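/- Let $k\ge 2$ and $m\ge 1$ be integers. **The series.** For a partition $\alpha\vdash n$ with $l(\alpha)$ parts let $\mathcal C_\alpha\subset\mathfrak S_n$ be the class of permutations of cycle type $\alpha$, and let $c_k(\alpha)$ be the number of minimal transitive ordered factorisations of a fixed $\pi\in\mathcal C_\alpha$ into $k$-cycles, i.e. of tuples $(\sigma_1,\dots,\sigma_j)$ of $k$-cycles with $\sigma_1\cdots\sigma_j=\pi$ which generate a transitive subgroup of $\mathfrak S_n$, with $j$ the least possible. Put $\mu_k(\alpha)=\frac{n+l(\alpha)-2}{k-1}$ and $$F^{(m)}=\sum_{n\ge1,\ k-1\mid n+m-2}\ \sum_{\alpha\vdash n,\ l(\alpha)=m}c_k(\alpha)\,|\mathcal C_\alpha|\,p_\alpha\frac{u^{\mu_k(\alpha)}}{\mu_k(\alpha)!}\frac{z^n}{n!},\qquad P^{(m)}(x_1,\dots,x_m)=\psi_m(F^{(m)}),$$ where $p_\alpha=p_{\alpha_1}p_{\alpha_2}\cdots$ and $\psi_m$ is the linear operator with $\psi_m(p_\alpha u^iz^j)=\sum_{\sigma\in\mathfrak S_m}x_1^{\alpha_{\sigma(1)}}\cdots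 x_m^{\alpha_{\sigma(m)}}$ for $l(\alpha)=m$. All series are formal power series over $\mathbb Q$. **The trees.** A plane two-coloured tree is a finite tree with a proper colouring of its vertices by black and white and a cyclic order on the edges at each vertex. Let $\widehat{\mathfrak t}$ range over the isomorphism classes of such trees in which every white vertex has degree at least $2$; the tree consisting of an isolated black vertex is included. Let $\mathrm{aut}(\widehat{\mathfrak t})$ be the automorphism group (preserving colours, incidence and cyclic orders), with the convention $|\mathrm{aut}(\widehat{\mathfrak t})|=k$ if $\widehat{\mathfrak t}$ is an isolated black vertex. Let $\mathcal V_b$, $\mathcal V_w$ be the sets of black and white vertices, $d(v)$ the degree of $v$, and $D(w)$ the set of neighbours of $w$. **Notation.** Let $z_1,\dots,z_m$ be markers for the variables $x_1,\dots,x_m$. For $S\subseteq\{1,\dots,m\}$ let $x_S$ be the list of the $x_i$ with $i\in S$, and put $$\Psi(t)=\sum_{S\subseteq\{1,\dots,m\}}\Bigl(\prod_{i\in S}z_i\Bigr)\,t\frac{\partial}{\partial t}P^{(|S|+1)}(t,x_S).$$ For a non-empty $N\subseteq\{1,\dots,m\}$ let $H^+(t;x_N)=1+\sum_{j\ge1}h^+_j(x_N)t^j$,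 where $h_j^+(x_N)$ is the sum of all monomials of degree $j$ in which exactly the variables $x_i$, $i\in N$, occur. For $a=\sum_j a_jt^j$ and $b=\sum_j b_jt^j$ let $a\circ b=\sum_{j\ge0}a_jb_j$. Finally let $B_0(\psi)=(y\psi)^k$, and $B_d(\psi)=\bigl(\frac{y}{1-y\psi}\bigr)^d$ for $d\ge1$. **Theorem.** One has $$\bigl[y^k z_1\cdots z_m\bigr]\sum_{\widehat{\mathfrak t}}\frac{1}{|\mathrm{aut}(\widehat{\mathfrak t})|}\sum_{\lambda}\ \prod_{v\in\mathcal V_b}z_{\lambda(v)}\,B_{d(v)}\bigl(\Psi(x_{\lambda(v)})\bigr)\prod_{w\in\mathcal V_w}\Psi(t)\circ H^+\bigl(t;x_{\lambda(D(w))}\bigr)=\frac1{k-1}\Bigl(\sum_{i=1}^m x_i\frac{\partial}{\partial x_i}+m-2\Bigr)P^{(m)},$$ where $\lambda$ ranges over the injective maps $\mathcal V_b\to\{1,\dots,m\}$; only finitely many trees $\widehat{\mathfrak t}$ contribute to the coefficient. Moreover, for $m\ge2$ this equation is a recursion: given $P^{(1)},\dots,P^{(m-1)}$, the series $P^{(m)}$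 is the only formal power series in $x_1,\dots,x_m$ with zero constant term that satisfies it (in place of $P^{(m)}$), whatever series are put for the $P^{(j)}$ with $j>m$. -/

import Mathlib

open Finset
open scoped BigOperators Nat

noncomputable section

namespace KCycle

/-! ### Minimal transitive ordered factorisations into `k`-cycles -/

/-- The list `σ = (σ₁, …, σⱼ)` of `k`-cycles is a transitive ordered factorisation of `π`. -/
def IsTransFact (k : ℕ) {n : ℕ} (π : Equiv.Perm (Fin n)) (σ : List (Equiv.Perm (Fin n))) : Prop :=
  (∀ s ∈ σ, s.IsCycle ∧ s.support.card = k) ∧ σ.prod = π ∧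
    MulAction.IsPretransitive (Subgroup.closure {s | s ∈ σ}) (Fin n)

/-- A transitive ordered factorisation of `π` into `k`-cycles is minimal if its number of factors
is the least possible. -/
def IsMinTransFact (k : ℕ) {n : ℕ} (π : Equiv.Perm (Fin n)) (σ : List (Equiv.Perm (Fin n))) :
    Prop :=
  IsTransFact k π σ ∧ ∀ τ, IsTransFact k π τ → σ.length ≤ τ.length

/-- The conjugacy class `𝒞_α` of permutations of cycle type `α` (fixed points are counted as
parts equal to `1`). -/
def conjClass {n : ℕ} (α : Nat.Partition n) : Set (Equiv.Perm (Fin n)) :=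
  {π | π.partition.parts = α.parts}

/-- `c_k(α)`: the number of minimal transitive ordered factorisations into `k`-cycles of an
arbitrary but fixed permutation of cycle type `α`. -/
def c (k : ℕ) {n : ℕ} (α : Nat.Partition n) : ℕ :=
  Nat.card {σ : List (Equiv.Perm (Fin n)) //
    IsMinTransFact k (Classical.epsilon fun π => π ∈ conjClass α) σ}

/-- `μ_k(α) = (n + l(α) - 2) / (k - 1)`; it is only used when the division is exact and
`n, l(α) ≥ 1`. -/
def mu (k : ℕ) {n : ℕ} (α : Nat.Partition n) : ℕ :=
  (n + α.parts.card - 2) / (k - 1)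

/-! ### The generating series -/

/-- The indeterminates `u`, `z`, `p_1, p_2, …`. -/
inductive Ind
  | u : Ind
  | z : Ind
  | p : ℕ → Ind

/-- The exponent of the monomial `p_α u^i z^j`. -/
def expo {n : ℕ} (α : Nat.Partition n) (i j : ℕ) : Ind →₀ ℕ :=
  (α.parts.map fun a => Finsupp.single (Ind.p a) 1).sum
    + Finsupp.single Ind.u i + Finsupp.single Ind.z j

open Classical in
/-- `F_k^{(m)} = ∑_{n ≥ 1, k-1 ∣ n+m-2} ∑_{α ⊢ n, l(α) = m}
c_k(α) |𝒞_α| p_α u^{μ_k(α)} / μ_k(α)! z^n / n!`, given by its coefficients. -/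
def F (k m : ℕ) : MvPowerSeries Ind ℚ := fun d =>
  ∑ α : Nat.Partition (d Ind.z),
    if 1 ≤ d Ind.z ∧ (k - 1) ∣ (d Ind.z + m - 2) ∧ α.parts.card = m ∧
        d = expo α (mu k α) (d Ind.z) then
      ((c k α : ℚ) * (Nat.card (conjClass α) : ℚ)) / (((mu k α)! : ℚ) * ((d Ind.z)! : ℚ))
    else 0

/-- The parts `α_1 ≥ α_2 ≥ …` of a partition (indexed from `0`). -/
def part {n : ℕ} (α : Nat.Partition n) (i : ℕ) : ℕ :=
  (α.parts.sort (· ≥ ·)).getD i 0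

open Classical in
/-- The symmetrisation operator: the linear extension of
`ψ_m(p_α u^i z^j) = ∑_{σ ∈ 𝔖_m} x_1^{α_σ(1)} ⋯ x_m^{α_σ(m)}`, for partitions `α` with `m` parts.
Only partitions of `|β|` contribute to the coefficient of `x^β`. -/
def psi (m : ℕ) (f : MvPowerSeries Ind ℚ) : MvPowerSeries (Fin m) ℚ := fun β =>
  ∑ α : Nat.Partition β.degree,
    if α.parts.card = m then
      (∑ᶠ ij : ℕ × ℕ, MvPowerSeries.coeff (expo α ij.1 ij.2) f) *
        (Nat.card {σ : Equiv.Perm (Fin m) // ∀ i, part α (σ i) = β i} : ℚ)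
    else 0

/-- `P_k^{(m)}(x_1, …, x_m) = ψ_m(F_k^{(m)})`. -/
def P (k m : ℕ) : MvPowerSeries (Fin m) ℚ := psi m (F k m)

/-- The operator `x_i ∂/∂x_i`. -/
def xD {m : ℕ} (i : Fin m) (f : MvPowerSeries (Fin m) ℚ) : MvPowerSeries (Fin m) ℚ :=
  MvPowerSeries.X i * MvPowerSeries.pderiv ℚ i f

/-! ### Plane two-coloured trees -/

/-- A plane two-coloured (black, white) tree: a two-coloured tree together with a cyclic order on
the edges around each vertex, given by the permutation sending an edge to the next edge around its
black (resp. white) end. -/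
structure PlaneTree where
  nB : ℕ
  nW : ℕ
  nE : ℕ
  /-- the black end of an edge -/
  black : Fin nE → Fin nB
  /-- the white end of an edge -/
  white : Fin nE → Fin nW
  rotB : Equiv.Perm (Fin nE)
  rotW : Equiv.Perm (Fin nE)
  rotB_sameCycle : ∀ e f, rotB.SameCycle e f ↔ black e = black f
  rotW_sameCycle : ∀ e f, rotW.SameCycle e f ↔ white e = white f
  simple : Function.Injective fun e => (black e, white e)
  isTree : (SimpleGraph.fromRel fun a b : Fin nB ⊕ Fin nW =>
    ∃ e, a = Sum.inl (black e) ∧ b = Sum.inr (white e)).IsTree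

namespace PlaneTree

/-- The degree of a black vertex. -/
def degB (T : PlaneTree) (v : Fin T.nB) : ℕ := (univ.filter fun e => T.black e = v).card

/-- The degree of a white vertex. -/
def degW (T : PlaneTree) (w : Fin T.nW) : ℕ := (univ.filter fun e => T.white e = w).card

/-- The neighbours of a white vertex. -/
def nbrs (T : PlaneTree) (w : Fin T.nW) : Finset (Fin T.nB) :=
  (univ.filter fun e => T.white e = w).image T.black

/-- Isomorphisms of plane two-coloured trees: they preserve colours, incidence and cyclic orders. -/
structure Iso (T T' : PlaneTree) where
  onB : Fin T.nB ≃ Fin T'.nB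
  onW : Fin T.nW ≃ Fin T'.nW
  onE : Fin T.nE ≃ Fin T'.nE
  black_comm : ∀ e, T'.black (onE e) = onB (T.black e)
  white_comm : ∀ e, T'.white (onE e) = onW (T.white e)
  rotB_comm : ∀ e, T'.rotB (onE e) = onE (T.rotB e)
  rotW_comm : ∀ e, T'.rotW (onE e) = onE (T.rotW e)

/-- A reduced tree: one without white vertices of degree one. (The tree consisting of an isolated
white vertex is not obtained by deleting monovalent white vertices from a tree with edges, and is
excluded as well.) -/
def IsReduced (T : PlaneTree) : Prop := ∀ w, 2 ≤ T.degW w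

end PlaneTree

/-- Isomorphism of reduced plane two-coloured trees. -/
instance treeSetoid : Setoid {T : PlaneTree // T.IsReduced} where
  r T T' := Nonempty (PlaneTree.Iso T.1 T'.1)
  iseqv :=
    { refl := fun _ => ⟨⟨Equiv.refl _, Equiv.refl _, Equiv.refl _,
        fun _ => rfl, fun _ => rfl, fun _ => rfl, fun _ => rfl⟩⟩
      symm := fun ⟨f⟩ => ⟨⟨f.onB.symm, f.onW.symm, f.onE.symm,
        fun e => by
          rw [Equiv.eq_symm_apply, ← f.black_comm, Equiv.apply_symm_apply],
        fun e => by
          rw [Equiv.eq_symm_apply, ← f.white_comm, Equiv.apply_symm_apply],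
        fun e => by
          rw [Equiv.eq_symm_apply, ← f.rotB_comm, Equiv.apply_symm_apply],
        fun e => by
          rw [Equiv.eq_symm_apply, ← f.rotW_comm, Equiv.apply_symm_apply]⟩⟩
      trans := fun ⟨f⟩ ⟨g⟩ => ⟨⟨f.onB.trans g.onB, f.onW.trans g.onW, f.onE.trans g.onE,
        fun e => by simp [g.black_comm, f.black_comm],
        fun e => by simp [g.white_comm, f.white_comm],
        fun e => by simp [g.rotB_comm, f.rotB_comm],
        fun e => by simp [g.rotW_comm, f.rotW_comm]⟩⟩ }

/-- The set of reduced plane two-coloured trees (up to isomorphism). -/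
abbrev ReducedTree := Quotient treeSetoid

/-- `|aut(t̂)|`, with the convention that for an isolated black vertex it is the order of the
cyclic group on `k` symbols. -/
def autCard (k : ℕ) (T : PlaneTree) : ℕ :=
  if T.nE = 0 then k else Nat.card (PlaneTree.Iso T T)

/-! ### The series `Ψ`, umbral composition and the tree sum

A product of series `Ψ` is to be read with the convention that the arguments other than the first
one of the various series `P^{(i)}` in it are pairwise disjoint sets of variables, which are also
disjoint from the set of the variables assigned to the black vertices, and the result is then
symmetrised. To express this, `z` is replaced by a marker `z_i` for each of the variables `x_i`, and
the coefficient of `z^m` by that of `z_1 ⋯ z_m`. -/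

/-- Formal power series in `x_1, …, x_m` and the markers `z_1, …, z_m`. -/
abbrev A (m : ℕ) := MvPowerSeries (Fin m ⊕ Fin m) ℚ

/-- The variable `x_i`. -/
def xv {m : ℕ} (i : Fin m) : A m := MvPowerSeries.X (Sum.inl i)

/-- The marker `z_i`. -/
def zv {m : ℕ} (i : Fin m) : A m := MvPowerSeries.X (Sum.inr i)

/-- The coefficient of `t^j` in `f(t, x_1, …, x_n)`. -/
def coeffFst {n : ℕ} (j : ℕ) (f : MvPowerSeries (Fin (n + 1)) ℚ) : MvPowerSeries (Fin n) ℚ :=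
  fun γ => MvPowerSeries.coeff (Finsupp.cons j γ) f

/-- `Ψ(z, t;) = ∑_S (∏_{i ∈ S} z_i) t ∂/∂t Q^{(|S|+1)}(t, x_S)`, a power series in `t`, where `S`
ranges over the sets of indices and `x_S` is the list of the variables with index in `S`. -/
def Psi {m : ℕ} (Q : ∀ j, MvPowerSeries (Fin j) ℚ) : PowerSeries (A m) :=
  PowerSeries.mk fun j => ∑ S : Finset (Fin m), (∏ i ∈ S, zv i) *
    MvPowerSeries.rename (fun a : Fin S.card => (Sum.inl (S.orderEmbOfFin rfl a) : Fin m ⊕ Fin m))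
      (coeffFst j (xD 0 (Q (S.card + 1))))

/-- The umbral composition `a ∘ b = ∑_{j ≥ 0} a_j b_j` of `a = ∑ a_j t^j` and `b = ∑ b_j t^j`,
where the sum of power series is taken coefficientwise. -/
def umbral {m : ℕ} (a b : PowerSeries (A m)) : A m := fun d =>
  ∑ᶠ j : ℕ, MvPowerSeries.coeff d (PowerSeries.coeff j a * PowerSeries.coeff j b)

/-- `h⁺_j(x_N)`: the sum of the monomials of degree `j` in which exactly the variables with index
in `N` occur if `j ≥ 1`, and `h⁺_0 = 1`. -/
def hplus {m : ℕ} (N : Finset (Fin m)) (j : ℕ) : A m :=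
  if j = 0 then 1 else
    ∑ f ∈ (N.piAntidiag j).filter (fun f => ∀ i ∈ N, 1 ≤ f i), ∏ i ∈ N, xv i ^ f i

/-- `H⁺(t; x_N) = ∑_{j ≥ 0} h⁺_j(x_N) t^j`. -/
def Hplus {m : ℕ} (N : Finset (Fin m)) : PowerSeries (A m) := PowerSeries.mk (hplus N)

/-- `Ψ(z, x_i;)`, the value of `Ψ(z, t;)` at `t = x_i`. -/
def PsiAt {m : ℕ} (Q : ∀ j, MvPowerSeries (Fin j) ℚ) (i : Fin m) : A m :=
  umbral (Psi Q) (PowerSeries.mk fun j => xv i ^ j)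

/-- The factor attached to a black vertex of degree `d`, as a power series in `y`. It is
`(y / (1 - y Ψ))^d` if `d ≥ 1`. An isolated black vertex accounts for the tree with `k` edges which
consists of a black vertex joined to `k` white vertices, with factor `(y Ψ)^k`. -/
def blackFactor {m : ℕ} (k d : ℕ) (Ψ : A m) : PowerSeries (A m) :=
  if d = 0 then (PowerSeries.X * PowerSeries.C Ψ) ^ k
  else (PowerSeries.X * PowerSeries.mk fun r => Ψ ^ r) ^ d

/-- The coefficient of `z_1 ⋯ z_m`. -/
def markerCoeff {m : ℕ} (f : A m) : MvPowerSeries (Fin m) ℚ := fun β =>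
  MvPowerSeries.coeff (Finsupp.sumElim β (Finsupp.equivFunOnFinite.symm fun _ => 1)) f

/-- The product over the vertices of `T` when the variables `x_{lam v}` are assigned to the black
vertices `v`. -/
def treeProd (k : ℕ) {m : ℕ} (Q : ∀ j, MvPowerSeries (Fin j) ℚ) (T : PlaneTree)
    (lam : Fin T.nB ↪ Fin m) : PowerSeries (A m) :=
  (∏ v, PowerSeries.C (zv (lam v)) * blackFactor k (T.degB v) (PsiAt Q (lam v))) *
    ∏ w, PowerSeries.C (umbral (Psi Q) (Hplus ((T.nbrs w).map lam)))

/-- The contribution of a reduced tree to the left side of the equation: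
`[y^k z_1 ⋯ z_m]` of the sum, over all assignments of distinct variables to the black vertices, of
the products over the vertices, divided by `|aut(t̂)|`. -/
def treeTerm (k m : ℕ) (Q : ∀ j, MvPowerSeries (Fin j) ℚ) (t : ReducedTree) :
    MvPowerSeries (Fin m) ℚ :=
  (1 / (autCard k t.out.1 : ℚ)) •
    markerCoeff (PowerSeries.coeff k (∑ lam : Fin t.out.1.nB ↪ Fin m, treeProd k Q t.out.1 lam))

/-- The left side of the equation, for the family `Q` in place of the family `P^{(j)}`. -/
def lhs (k m : ℕ) (Q : ∀ j, MvPowerSeries (Fin j) ℚ) : MvPowerSeries (Fin m) ℚ :=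
  ∑ᶠ t : ReducedTree, treeTerm k m Q t

/-- The right side of the equation: `(1/(k-1)) (∑ x_i ∂/∂x_i + m - 2) Q^{(m)}`. -/
def rhs (k m : ℕ) (Q : ∀ j, MvPowerSeries (Fin j) ℚ) : MvPowerSeries (Fin m) ℚ :=
  (1 / ((k : ℚ) - 1)) • ((∑ i, xD i (Q m)) + ((m : ℚ) - 2) • Q m)

end KCycle

end

/-!
The proof counts the minimal transitive factorisations of a permutation `π` of a set `X` by their
first factor.

By the genus inequality (`genus_bound`), `N` cycles of length `k` with product `π` can generate a
transitive group only if `N (k - 1) ≥ |X| + l - 2`, where `l` is the number of cycles of `π`.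
Equality can be attained whenever `k - 1` divides the right-hand side and `X` has one point or at
least `k` points (`wt_pos`), so the minimal factorisations are those of genus zero
(`card_isMinTransFact`). Let `wt k π` be their number divided by `N!`. Up to normalisation, the
coefficient of `x ^ β` in `P k m` is `wt k π` for a permutation `π` with cycles of lengths `β i`
(`coeff_P`), and the factor `(∑ β i + m - 2) / (k - 1)` on the right of the equation is the number
`N` of factors.

Let `s` be the first factor and `Y` its support. Then `s` is determined by `Y` and the permutation
`b = s⁻¹ * retPerm π Y` of `Y`, where `retPerm π Y` is the first return map of `π` to `Y`. These
data are a plane two-coloured graph with `k` edges, the points of `Y`: the cycles of `π` that meet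
`Y` are its black vertices, and the cycles of `b` on `Y` its white ones. The genus inequality,
applied to `s` and to the other factors, shows that the graph is a tree (`IsTreeCut`) and that the
other factors fall into transitive factorisations of genus zero, one for each white vertex
(`card_white_of_trans`). The cycles of `s⁻¹ * π` at a white vertex are one cycle whose length is the
sum of the arcs of `π` that start at its edges, and some cycles of `π` that do not meet `Y`; the
distribution of the latter over the white vertices is arbitrary, and so is the order in which the
factors of different white vertices are interleaved. This is the recursion `wt_recursion`, a sum
over all cuts `(Y, b)`.

On the left of the equation, the coefficient of `x ^ β z₁ ⋯ z_m` in the product of a tree expands as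
a sum over the ways to draw the tree, with further white leaves, on the cycles of `π`
(`coeff_treeProd`, `sum_coeff_treeProd`). A white vertex of degree at least two contributes the sum
of the arcs that start at its edges to the exponent of `t` in `Ψ t`; the factor `y / (1 - y Ψ(x))`
of an edge at a black vertex stands for any number of leaves that follow the edge on its cycle
(`sum_arc_subdivisions`). The permutation `b` forgets the leaves, as they are its fixed points in
`Y`; it determines the reduced tree, and the drawings of that tree with given `b` are a torsor under
the automorphism group (`card_drawings`), which cancels the weight `1 / |aut|` (`sum_drawings`). If
`b = 1`, then the tree is a star with `k` white leaves. It is represented by the isolated black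
vertex, and marking one of its edges gives the factor `1 / k` (`sum_cutCoeff_one`). If some `β i` is
zero, both sides vanish.

A tree contributes to the coefficient of `y ^ k` only if it has at most `k` edges, so finitely many
trees contribute. For the uniqueness, the equation is solved by induction on the degree
(`coeff_lhs_congr`): a tree with an edge has a white vertex of degree at least two, hence at least
two black vertices, and the factors of its product involve only the series `P^(j)` with `j < m`; in
the product of `k ≥ 2` factors for a star, a coefficient of `P^(m)` only occurs in a lower degree.
-/

noncomputable section

namespace KCycle

open Equiv Equiv.Perm

set_option linter.unusedSectionVars false
set_option linter.unusedDecidableInType false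
set_option linter.unusedFintypeInType false


/-! ### Orbits and the genus inequality -/

section Genus

variable {X : Type} [Fintype X] [DecidableEq X]

/-- The space of rational functions on `X` that are invariant under every permutation in `S`. Its
dimension is the number of orbits of the group generated by `S`. -/
def invFun (S : Set (Perm X)) : Submodule ℚ (X → ℚ) where
  carrier := {f | ∀ σ ∈ S, ∀ x, f (σ x) = f x}
  add_mem' := fun hf hg σ hσ x => by simp [hf σ hσ x, hg σ hσ x]
  zero_mem' := fun _ _ _ => rfl
  smul_mem' := fun c f hf σ hσ x => by simp [hf σ hσ x]

/-- The number of cycles of a permutation, fixed points included. -/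
def cyc (σ : Perm X) : ℕ := Module.finrank ℚ (invFun {σ})

theorem mem_invFun {S : Set (Perm X)} {f : X → ℚ} :
    f ∈ invFun S ↔ ∀ σ ∈ S, ∀ x, f (σ x) = f x := Iff.rfl

theorem mem_invFun_singleton {σ : Perm X} {f : X → ℚ} :
    f ∈ invFun {σ} ↔ ∀ x, f (σ x) = f x := by simp [mem_invFun]

theorem invFun_sameCycle {σ : Perm X} {f : X → ℚ} (hf : f ∈ invFun {σ}) {x y : X}
    (h : σ.SameCycle x y) : f x = f y := by
  rw [mem_invFun_singleton] at hf
  obtain ⟨i, rfl⟩ := h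
  induction i with
  | zero => simp
  | succ n ih => rw [add_comm, zpow_add, zpow_one, Perm.mul_apply, hf, ih]
  | pred n ih =>
    rw [ih, ← hf ((σ ^ (-(n : ℤ) - 1)) x), ← Perm.mul_apply, ← zpow_one_add]
    ring_nf

/-- The number of cycles can be read off a labelling of the points by their cycles. -/
theorem cyc_eq_card_of_label {I : Type} [Fintype I] {σ : Perm X} (lab : X → I)
    (hs : Function.Surjective lab) (hl : ∀ x y, lab x = lab y ↔ σ.SameCycle x y) :
    cyc σ = Fintype.card I := by
  let L : (I → ℚ) →ₗ[ℚ] invFun {σ} :=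
    { toFun := fun f => ⟨f ∘ lab, mem_invFun_singleton.2 fun x =>
        congrArg f ((hl _ _).2 ⟨-1, by simp⟩)⟩
      map_add' := fun _ _ => rfl
      map_smul' := fun _ _ => rfl }
  have hL : Function.Bijective L := by
    refine ⟨fun f g h => hs.injective_comp_right (Subtype.ext_iff.1 h), ?_⟩
    rintro ⟨f, hf⟩
    refine ⟨f ∘ Function.surjInv hs, Subtype.ext (funext fun x => ?_)⟩
    exact invFun_sameCycle hf ((hl _ _).1 (Function.surjInv_eq hs (lab x)))
  let e := LinearEquiv.ofBijective L hL
  rw [cyc, ← e.finrank_eq, Module.finrank_fintype_fun_eq_card]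

theorem cyc_one : cyc (1 : Perm X) = Fintype.card X :=
  cyc_eq_card_of_label id Function.surjective_id fun x y => by simp

/-- Multiplying by the transposition of two points on different cycles joins the two cycles. -/
theorem sameCycle_swap_mul [Finite X] {ρ : Perm X} {x y : X} (h : ¬ ρ.SameCycle x y) :
    (swap x y * ρ).SameCycle x y := by
  classical
  have hn : ∃ n, 0 < n ∧ (ρ ^ n) x = x :=
    ⟨orderOf ρ, orderOf_pos ρ, by simp [pow_orderOf_eq_one]⟩
  obtain ⟨hn0, hnx⟩ := Nat.find_spec hn
  have key : ∀ i < Nat.find hn, ((swap x y * ρ) ^ i) x = (ρ ^ i) x := by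
    intro i hi
    induction i with
    | zero => rfl
    | succ i ih =>
      rw [pow_succ', Perm.mul_apply, ih (by omega), Perm.mul_apply, ← Perm.mul_apply ρ,
        ← pow_succ']
      refine swap_apply_of_ne_of_ne (fun h' => Nat.find_min hn hi ⟨i.succ_pos, h'⟩) fun h' => ?_
      exact h ⟨(i + 1 : ℕ), by exact_mod_cast h'⟩
  refine ⟨(Nat.find hn : ℕ), ?_⟩
  obtain ⟨i, hi⟩ : ∃ i, Nat.find hn = i + 1 := ⟨_, (Nat.succ_pred_eq_of_pos hn0).symm⟩
  rw [zpow_natCast, hi, pow_succ', Perm.mul_apply, key i (by omega), Perm.mul_apply,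
    ← Perm.mul_apply ρ, ← pow_succ', ← hi, hnx, swap_apply_left]

/-- The difference of the values at two points. -/
def pointDiff (x y : X) : (X → ℚ) →ₗ[ℚ] ℚ where
  toFun f := f x - f y
  map_add' f g := by simp only [Pi.add_apply]; ring
  map_smul' c f := by simp only [Pi.smul_apply, smul_eq_mul, RingHom.id_apply]; ring

/-- The functions on `X` that take the same value at `x` and at `y`. -/
def eqAt (x y : X) : Submodule ℚ (X → ℚ) :=
  LinearMap.ker (pointDiff x y)

theorem mem_eqAt {x y : X} {f : X → ℚ} : f ∈ eqAt x y ↔ f x = f y := by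
  simp [eqAt, pointDiff, sub_eq_zero]

/-- Joining two points lowers the number of orbits by at most one. -/
theorem finrank_le_inf_eqAt (V : Submodule ℚ (X → ℚ)) (x y : X) :
    Module.finrank ℚ V ≤ Module.finrank ℚ (V ⊓ eqAt x y : Submodule ℚ (X → ℚ)) + 1 := by
  let D : V →ₗ[ℚ] ℚ := (pointDiff x y).comp V.subtype
  have h1 := LinearMap.finrank_range_add_finrank_ker D
  have h2 : Module.finrank ℚ (LinearMap.range D) ≤ 1 := by
    simpa using Submodule.finrank_le (LinearMap.range D)
  have h3 : Module.finrank ℚ (LinearMap.ker D) =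
      Module.finrank ℚ (V ⊓ eqAt x y : Submodule ℚ (X → ℚ)) := by
    have : (LinearMap.ker D).map V.subtype = V ⊓ eqAt x y := by
      ext f
      simp [D, eqAt, Submodule.mem_map, LinearMap.mem_ker, and_comm]
    rw [← this, (Submodule.equivMapOfInjective _ V.injective_subtype _).finrank_eq]
  omega

/-- Once `x` and `y` are joined, it makes no difference whether the transposition is there. -/
theorem invFun_swap_mul_inf (ρ : Perm X) (x y : X) :
    invFun {swap x y * ρ} ⊓ eqAt x y ≤ invFun {ρ} ⊓ eqAt x y := by
  rintro f ⟨h1, h2⟩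
  refine ⟨mem_invFun_singleton.2 fun z => ?_, h2⟩
  have h3 := mem_invFun_singleton.1 h1 z
  have h2' := mem_eqAt.1 h2
  rw [← h3, Perm.mul_apply]
  rcases eq_or_ne (ρ z) x with h | h
  · rw [h, swap_apply_left, h2']
  rcases eq_or_ne (ρ z) y with h' | h'
  · rw [h', swap_apply_right, h2']
  · rw [swap_apply_of_ne_of_ne h h']

theorem cyc_swap_mul_le (ρ : Perm X) (x y : X) : cyc (swap x y * ρ) ≤ cyc ρ + 1 :=
  (finrank_le_inf_eqAt _ x y).trans (Nat.add_le_add_right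
    ((Submodule.finrank_mono (invFun_swap_mul_inf ρ x y)).trans
      (Submodule.finrank_mono inf_le_left)) 1)

/-- A transposition of points on different cycles joins these cycles. That the cycles differ is
expressed by an invariant function `f` that separates the points. -/
theorem cyc_swap_mul_lt {ρ : Perm X} {x y : X} {f : X → ℚ} (hf : f ∈ invFun {ρ})
    (hxy : f x ≠ f y) : cyc (swap x y * ρ) < cyc ρ := by
  have h1 : ¬ ρ.SameCycle x y := fun h => hxy (invFun_sameCycle hf h)
  have h2 : invFun {swap x y * ρ} ≤ invFun {ρ} ⊓ eqAt x y := fun g hg =>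
    invFun_swap_mul_inf ρ x y ⟨hg, mem_eqAt.2 (invFun_sameCycle hg (sameCycle_swap_mul h1))⟩
  refine (Submodule.finrank_mono h2).trans_lt (Submodule.finrank_lt_finrank_of_lt ?_)
  exact lt_of_le_of_ne inf_le_left fun h => hxy (mem_eqAt.1 ((h.symm.le hf).2))

/-- Functions invariant under the factors are invariant under the product. -/
theorem invFun_le_prod {S : Set (Perm X)} {l : List (Perm X)} (h : ∀ σ ∈ l, invFun S ≤ invFun {σ}) :
    invFun S ≤ invFun {l.prod} := by
  induction l with
  | nil => exact fun f _ => mem_invFun_singleton.2 fun x => rfl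
  | cons a l ih =>
    intro f hf
    refine mem_invFun_singleton.2 fun x => ?_
    rw [List.prod_cons, Perm.mul_apply,
      mem_invFun_singleton.1 (h a (by simp) hf),
      mem_invFun_singleton.1 (ih (fun σ hσ => h σ (by simp [hσ])) hf)]

theorem invFun_le_of_mem {S : Set (Perm X)} {σ : Perm X} (h : σ ∈ S) : invFun S ≤ invFun {σ} :=
  fun _ hf => mem_invFun_singleton.2 (hf σ h)

/-- The genus inequality for transpositions. Each further factor either joins two orbits, and then
it joins two cycles of the product, or it leaves the orbits as they are. -/
theorem genus_bound_swaps (l : List (Perm X)) (hl : ∀ τ ∈ l, τ.IsSwap) :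
    Fintype.card X + cyc l.prod ≤ l.length + 2 * Module.finrank ℚ (invFun {σ | σ ∈ l}) := by
  induction l with
  | nil =>
    have h1 : invFun {σ : Perm X | σ ∈ ([] : List (Perm X))} = ⊤ := by
      ext; simp [mem_invFun]
    rw [h1, finrank_top, Module.finrank_fintype_fun_eq_card]
    simp only [List.prod_nil, cyc_one, List.length_nil]
    omega
  | cons τ l ih =>
    have ih := ih fun τ' h => hl τ' (by simp [h])
    obtain ⟨x, y, -, rfl⟩ := hl τ (by simp)
    -- the further factor joins the orbits of `x` and `y`
    have hS : invFun {σ | σ ∈ swap x y :: l} = invFun {σ | σ ∈ l} ⊓ eqAt x y := by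
      ext f
      rw [Submodule.mem_inf, mem_eqAt]
      constructor
      · intro h
        refine ⟨fun σ hσ => h σ (by simp_all), ?_⟩
        have := h (swap x y) (by simp) y
        rwa [swap_apply_right] at this
      · rintro ⟨h1, h2⟩ σ hσ z
        rcases List.mem_cons.1 hσ with rfl | hσ
        · rcases eq_or_ne z x with rfl | h
          · rw [swap_apply_left, h2]
          rcases eq_or_ne z y with rfl | h'
          · rw [swap_apply_right, h2]
          · rw [swap_apply_of_ne_of_ne h h']
        · exact h1 σ hσ z
    have hle : invFun {σ | σ ∈ l} ≤ invFun {l.prod} :=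
      invFun_le_prod fun σ hσ => invFun_le_of_mem hσ
    rw [List.prod_cons, List.length_cons, hS]
    -- whether `x` and `y` are on the same orbit already
    by_cases h : invFun {σ | σ ∈ l} ≤ eqAt x y
    · have := cyc_swap_mul_le l.prod x y
      rw [inf_eq_left.2 h]
      omega
    · obtain ⟨f, hf, hxy⟩ := SetLike.not_le_iff_exists.1 h
      have h1 := cyc_swap_mul_lt (hle hf) (fun h => hxy (mem_eqAt.2 h))
      have h2 := finrank_le_inf_eqAt (invFun {σ | σ ∈ l}) x y
      omega

/-- A permutation is a product of `n - cyc σ` transpositions. -/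
theorem exists_swap_list (σ : Perm X) : ∃ l : List (Perm X), (∀ τ ∈ l, τ.IsSwap) ∧ l.prod = σ ∧
    l.length + cyc σ ≤ Fintype.card X := by
  induction hn : #σ.support using Nat.strong_induction_on generalizing σ with
  | _ n ih =>
  by_cases h1 : σ = 1
  · exact ⟨[], by simp, by simp [h1], by simp [h1, cyc_one]⟩
  obtain ⟨x, hx⟩ : ∃ x, σ x ≠ x := by
    by_contra! h; exact h1 (Equiv.ext h)
  obtain ⟨l, hl, hp, hc⟩ := ih _ (hn ▸ card_support_swap_mul hx) (swap x (σ x) * σ) rfl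
  have hρ : (swap x (σ x) * σ) x = x := by simp
  refine ⟨swap x (σ x) :: l, ?_, by simp [hp], ?_⟩
  · intro τ hτ
    rcases List.mem_cons.1 hτ with rfl | h
    · exact ⟨x, σ x, hx.symm, rfl⟩
    · exact hl τ h
  · -- `x` is a fixed point of `swap x (σ x) * σ`
    have hf : (fun z => if z = x then (1 : ℚ) else 0) ∈ invFun {swap x (σ x) * σ} := by
      refine mem_invFun_singleton.2 fun z => ?_
      rcases eq_or_ne z x with rfl | h
      · rw [hρ]
      · have : (swap x (σ x) * σ) z ≠ x := fun h' => h ((Equiv.injective _) (h'.trans hρ.symm))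
        simp only [if_neg h, if_neg this]
    have := cyc_swap_mul_lt (x := x) (y := σ x) hf (by simp [hx])
    rw [swap_mul_self_mul] at this
    simp only [List.length_cons]
    omega

/-- **Genus inequality.** For permutations `σ₁, …, σⱼ` whose group has `r` orbits,
`n + cyc (σ₁ ⋯ σⱼ) ≤ ∑ (n - cyc σᵢ) + 2 r`. -/
theorem genus_bound (l : List (Perm X)) :
    Fintype.card X + cyc l.prod ≤
      (l.map fun σ => Fintype.card X - cyc σ).sum + 2 * Module.finrank ℚ (invFun {σ | σ ∈ l}) := by
  choose L hL1 hL2 hL3 using exists_swap_list (X := X)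
  -- Replace each factor by a minimal product of transpositions.
  have h := genus_bound_swaps (l.flatMap L) (by
    intro τ hτ
    obtain ⟨σ, -, h⟩ := List.mem_flatMap.1 hτ
    exact hL1 σ τ h)
  have hp : ∀ l : List (Perm X), (l.flatMap L).prod = l.prod := by
    intro l
    induction l with
    | nil => rfl
    | cons a l ih => rw [List.flatMap_cons, List.prod_append, hL2, ih, List.prod_cons]
  have hlen : (l.flatMap L).length ≤ (l.map fun σ => Fintype.card X - cyc σ).sum := by
    rw [List.length_flatMap]
    exact List.sum_le_sum fun σ _ => by have := hL3 σ; omega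
  have hr : invFun {σ | σ ∈ l.flatMap L} ≤ invFun {σ | σ ∈ l} := by
    intro f hf σ hσ
    have : invFun {σ | σ ∈ l.flatMap L} ≤ invFun {(L σ).prod} :=
      invFun_le_prod fun τ hτ => invFun_le_of_mem (List.mem_flatMap.2 ⟨σ, hσ, hτ⟩)
    rw [hL2] at this
    exact mem_invFun_singleton.1 (this hf)
  have := Submodule.finrank_mono hr
  rw [hp] at h
  omega

end Genus

/-! ### Labelling points by cycles -/

section White

variable {X : Type} [Fintype X] [DecidableEq X]

/-- An index set for the cycles of `b` on a set `Y` that contains its support: the non-trivial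
cycles and the fixed points in `Y`. -/
abbrev White (Y : Finset X) (b : Perm X) : Type :=
  {c // c ∈ b.cycleFactorsFinset} ⊕ {y // y ∈ Y \ b.support}

/-- The cycle of `b` that contains the given point of `Y`. -/
def white (Y : Finset X) (b : Perm X) (y : {y // y ∈ Y}) : White Y b :=
  if h : b y.1 ≠ y.1 then
    Sum.inl ⟨b.cycleOf y.1, cycleOf_mem_cycleFactorsFinset_iff.2 (mem_support.2 h)⟩
  else Sum.inr ⟨y.1, mem_sdiff.2 ⟨y.2, fun h' => h (mem_support.1 h')⟩⟩

theorem white_eq_inl {Y : Finset X} {b : Perm X} {y : {y // y ∈ Y}}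
    {c : {c // c ∈ b.cycleFactorsFinset}} :
    white Y b y = Sum.inl c ↔ y.1 ∈ c.1.support := by
  rw [white]
  split_ifs with h
  · rw [Sum.inl.injEq, ← Subtype.coe_inj]
    constructor
    · intro h'
      rw [← h', mem_support_cycleOf_iff]
      exact ⟨SameCycle.refl _ _, mem_support.2 h⟩
    · intro h'
      exact (cycle_is_cycleOf h' c.2).symm
  · simp only [false_iff]
    intro h'
    exact h (mem_support.1 (mem_cycleFactorsFinset_support_le c.2 h'))

theorem white_eq_inr {Y : Finset X} {b : Perm X} {y : {y // y ∈ Y}} {z : {y // y ∈ Y \ b.support}} :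
    white Y b y = Sum.inr z ↔ y.1 = z.1 := by
  have hz := (mem_sdiff.1 z.2).2
  rw [white]
  split_ifs with h
  · simp only [false_iff]
    intro h'
    exact hz (h' ▸ mem_support.2 h)
  · rw [Sum.inr.injEq, ← Subtype.coe_inj]

theorem white_eq_iff {Y : Finset X} {b : Perm X} {y z : {y // y ∈ Y}} :
    white Y b y = white Y b z ↔ b.SameCycle y.1 z.1 := by
  rcases hz : white Y b z with c | w
  · rw [white_eq_inl]
    rw [white_eq_inl] at hz
    rw [cycle_is_cycleOf hz c.2, mem_support_cycleOf_iff]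
    refine ⟨fun h => h.1.symm, fun h => ⟨h.symm, ?_⟩⟩
    exact mem_cycleFactorsFinset_support_le c.2 hz
  · rw [white_eq_inr]
    rw [white_eq_inr] at hz
    have hw : b w.1 = w.1 := notMem_support.1 (mem_sdiff.1 w.2).2
    rw [hz]
    exact ⟨fun h => h ▸ SameCycle.refl _ _, fun h => (h.symm.eq_of_left hw).symm⟩

theorem white_surjective {Y : Finset X} {b : Perm X} (hb : b.support ⊆ Y) :
    Function.Surjective (white Y b) := by
  rintro (c | w)
  · obtain ⟨x, hx⟩ := (mem_cycleFactorsFinset_iff.1 c.2).1.nonempty_support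
    exact ⟨⟨x, hb (mem_cycleFactorsFinset_support_le c.2 hx)⟩, white_eq_inl.2 hx⟩
  · exact ⟨⟨w.1, (mem_sdiff.1 w.2).1⟩, white_eq_inr.2 rfl⟩

theorem card_white {Y : Finset X} {b : Perm X} (hb : b.support ⊆ Y) :
    Fintype.card (White Y b) + #b.support = b.cycleType.card + #Y := by
  have h1 := card_sdiff_add_card_eq_card hb
  rw [Fintype.card_sum, Fintype.card_coe, Fintype.card_coe, cycleType_def, Multiset.card_map,
    Finset.card_val]
  omega

/-- The labelling of all the points by their cycles. -/
def label (σ : Perm X) (x : X) : White univ σ := white univ σ ⟨x, mem_univ x⟩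

theorem label_surjective (σ : Perm X) : Function.Surjective (label σ) := fun w =>
  let ⟨y, hy⟩ := white_surjective (subset_univ σ.support) w
  ⟨y.1, hy⟩

theorem label_eq_iff (σ : Perm X) (x y : X) : label σ x = label σ y ↔ σ.SameCycle x y :=
  white_eq_iff

theorem cyc_add_card_support (σ : Perm X) :
    cyc σ + #σ.support = σ.cycleType.card + Fintype.card X := by
  rw [cyc_eq_card_of_label _ (label_surjective σ) (label_eq_iff σ),
    card_white (subset_univ _), card_univ]

/-- Two labellings of the points by the cycles agree up to renaming the labels. -/
theorem exists_equiv_of_ker_eq {A B C : Type} {f : A → B} {g : A → C}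
    (hf : Function.Surjective f) (hg : Function.Surjective g)
    (h : ∀ x y, f x = f y ↔ g x = g y) : ∃ e : B ≃ C, ∀ x, e (f x) = g x := by
  refine ⟨Equiv.ofBijective (g ∘ Function.surjInv hf) ⟨fun a b hab => ?_, fun c => ?_⟩, fun x => ?_⟩
  · rw [← Function.surjInv_eq hf a, ← Function.surjInv_eq hf b]
    exact (h _ _).2 hab
  · obtain ⟨x, rfl⟩ := hg c
    exact ⟨f x, (h _ _).1 (Function.surjInv_eq hf _)⟩
  · exact (h _ _).1 (Function.surjInv_eq hf _)

theorem parts_partition_eq_label (σ : Perm X) :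
    σ.partition.parts = univ.val.map fun w => #{x | label σ x = w} := by
  have h1 : (univ : Finset (White univ σ)).val.map (fun w => #{x | label σ x = w}) =
      (univ.val.map fun c : {c // c ∈ σ.cycleFactorsFinset} => #c.1.support) +
      univ.val.map fun y : {y // y ∈ univ \ σ.support} => 1 := by
    rw [← univ_disjSum_univ, val_disjSum, Multiset.disjSum, Multiset.map_add, Multiset.map_map,
      Multiset.map_map]
    refine congrArg₂ (· + ·) ?_ ?_
    · refine Multiset.map_congr (by congr!) fun c _ => ?_
      rw [Function.comp_apply]
      congr 1
      ext x
      simp [label, white_eq_inl]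
    · refine Multiset.map_congr (by congr!) fun c _ => ?_
      rw [Function.comp_apply, card_eq_one]
      exact ⟨c.1, by ext x; simp [label, white_eq_inr]⟩
  rw [h1, parts_partition, cycleType_def]
  refine congrArg₂ (· + ·) ?_ ?_
  · rw [univ_eq_attach, attach_val]
    conv_lhs => rw [← Multiset.attach_map_val σ.cycleFactorsFinset.val, Multiset.map_map]
    rfl
  · have h2 := Fintype.card_coe (univ \ σ.support)
    rw [← compl_eq_univ_sdiff, card_compl, ← Nat.card_eq_fintype_card] at h2
    rw [Multiset.map_const', card_val, ← h2, Nat.card_eq_fintype_card, ← card_univ]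
    congr!

/-- The parts of the partition of a permutation are the sizes of the fibres of a labelling of the
points by their cycles. -/
theorem parts_partition_eq {I : Type} [Fintype I] [DecidableEq I] {σ : Perm X} {lab : X → I}
    (hs : Function.Surjective lab) (hl : ∀ x y, lab x = lab y ↔ σ.SameCycle x y) :
    σ.partition.parts = univ.val.map fun i => #{x | lab x = i} := by
  obtain ⟨e, he⟩ := exists_equiv_of_ker_eq (label_surjective σ) hs
    fun x y => (label_eq_iff σ x y).trans (hl x y).symm
  rw [parts_partition_eq_label]
  have h2 : (univ : Finset I) = univ.map e.toEmbedding := by simp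
  conv_rhs => rw [h2, map_val, Multiset.map_map]
  refine Multiset.map_congr rfl fun w _ => ?_
  congr 1
  ext x
  simp [← he]

theorem card_parts_partition (σ : Perm X) : σ.partition.parts.card = cyc σ := by
  have h := σ.support.card_le_univ
  have h' := cyc_add_card_support σ
  rw [parts_partition, Multiset.card_add, Multiset.card_replicate]
  omega

theorem cyc_of_cycleType {k : ℕ} {σ : Perm X} (h : σ.cycleType = {k}) :
    cyc σ + k = 1 + Fintype.card X ∧ #σ.support = k := by
  have h1 := cyc_add_card_support σ
  have h2 := sum_cycleType σ
  rw [h, Multiset.sum_singleton] at h2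
  rw [h, Multiset.card_singleton, ← h2] at h1
  exact ⟨h1, h2.symm⟩

end White

/-! ### Counting transitive factorisations -/

section Count

/-- The group generated by the permutations `σ t` is transitive: it leaves no predicate invariant
but the constant ones. -/
def Trans {X T : Type} (σ : T → Perm X) : Prop :=
  ∀ F : X → Prop, (∀ t x, F (σ t x) ↔ F x) → ∀ x y, F x → F y

/-- The transitive ordered factorisations of `π` into `N` cycles of length `k`. -/
def factSet (k : ℕ) {X : Type} [Fintype X] [DecidableEq X] (π : Perm X) (N : ℕ) :
    Set (Fin N → Perm X) :=
  {σ | (∀ t, (σ t).cycleType = {k}) ∧ (List.ofFn σ).prod = π ∧ Trans σ}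

/-- The number of transitive ordered factorisations of `π` into `N` cycles of length `k`. -/
def cntF (k : ℕ) {X : Type} [Fintype X] [DecidableEq X] (π : Perm X) (N : ℕ) : ℕ :=
  Nat.card (factSet k π N)

variable {X X' : Type} [Fintype X] [DecidableEq X] [Fintype X'] [DecidableEq X']

theorem cycleType_permCongr (e : X ≃ X') (σ : Perm X) :
    (e.permCongr σ).cycleType = σ.cycleType := by
  have := cycleType_extendDomain (p := fun _ : X' => True) (g := σ)
    (e.trans (Equiv.Set.univ X').symm)
  rw [← this]
  congr 1

theorem mem_factSet_permCongr (k : ℕ) (e : X ≃ X') (π : Perm X) {N : ℕ} {σ : Fin N → Perm X}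
    (h : σ ∈ factSet k π N) : (fun t => e.permCongr (σ t)) ∈ factSet k (e.permCongr π) N := by
  obtain ⟨h1, h2, h3⟩ := h
  refine ⟨fun t => by rw [cycleType_permCongr, h1], ?_, ?_⟩
  · rw [← h2]
    have := map_list_prod e.permCongrHom (List.ofFn σ)
    rw [List.map_ofFn] at this
    exact this.symm
  · intro F hF x y hx
    have := h3 (fun x => F (e x)) (fun t x => by simpa using hF t (e x)) (e.symm x) (e.symm y)
    simpa using this (by simpa using hx)

theorem cntF_permCongr (k : ℕ) (e : X ≃ X') (π : Perm X) (N : ℕ) :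
    cntF k (e.permCongr π) N = cntF k π N := by
  refine (Nat.card_congr (Equiv.subtypeEquiv (Equiv.piCongrRight fun _ => e.permCongr) fun σ =>
    ⟨mem_factSet_permCongr k e π, fun h => ?_⟩)).symm
  have h1 := mem_factSet_permCongr k e.symm _ h
  have h2 : e.symm.permCongr (e.permCongr π) = π := by ext x; simp
  have h3 : (fun t => e.symm.permCongr (Equiv.piCongrRight (fun _ => e.permCongr) σ t)) = σ := by
    funext t; ext x; simp
  rwa [h2, h3] at h1

/-- The number of factorisations depends on the cycle type only. -/
theorem cntF_congr (k : ℕ) {π : Perm X} {π' : Perm X'}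
    (h : π.partition.parts = π'.partition.parts) (N : ℕ) : cntF k π N = cntF k π' N := by
  have hc : Fintype.card X = Fintype.card X' := by
    rw [← π.partition.parts_sum, h, π'.partition.parts_sum]
  obtain ⟨e⟩ := Fintype.card_eq.1 hc
  have ht : π'.cycleType = (e.permCongr π).cycleType := by
    rw [cycleType_permCongr, ← filter_parts_partition_eq_cycleType, ← h,
      filter_parts_partition_eq_cycleType]
  obtain ⟨g, hg⟩ := isConj_iff.1 (isConj_of_cycleType_eq ht)
  rw [← cntF_permCongr k e π, ← hg, ← cntF_permCongr k g π']
  rfl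

/-- The number of factorisations of genus zero, divided by the factorial of the number of factors.
By the genus inequality the group generated by `N` cycles of length `k` is transitive only if
`N (k - 1) ≥ n + l - 2`, and genus zero stands for equality. -/
def wt (k : ℕ) (π : Perm X) : ℚ :=
  if (k - 1) ∣ (Fintype.card X + cyc π - 2) then
    (cntF k π ((Fintype.card X + cyc π - 2) / (k - 1)) : ℚ) /
      ((Fintype.card X + cyc π - 2) / (k - 1))! else 0

theorem wt_nonneg (k : ℕ) (π : Perm X) : 0 ≤ wt k π := by
  unfold wt; split_ifs <;> positivity

theorem wt_eq {k N : ℕ} (hk : 2 ≤ k) {π : Perm X}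
    (h : N * (k - 1) + 2 = Fintype.card X + cyc π) : wt k π = cntF k π N / N ! := by
  have h1 : Fintype.card X + cyc π - 2 = N * (k - 1) := by omega
  have h2 : Fintype.card X + cyc π - 2 = (k - 1) * N := by rw [h1, mul_comm]
  rw [wt, if_pos ⟨N, h2⟩, h1, Nat.mul_div_cancel _ (by omega)]

theorem finrank_invFun_le_one {T : Type} {σ : T → Perm X} (h : Trans σ) :
    Module.finrank ℚ (invFun (Set.range σ)) ≤ 1 := by
  rcases isEmpty_or_nonempty X with hX | ⟨⟨x0⟩⟩
  · exact (Submodule.finrank_le _).trans (by simp)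
  -- an invariant function is constant: the points where it has the value at `x0` are everything
  refine finrank_le_one ⟨fun _ => 1, fun _ _ _ => rfl⟩ fun f =>
    ⟨f.1 x0, Subtype.ext (funext fun x => ?_)⟩
  have := h (fun x => f.1 x = f.1 x0) (fun t x => by
    rw [mem_invFun.1 f.2 (σ t) ⟨t, rfl⟩]) x0 x rfl
  simp [this]

/-- The genus inequality for a factorisation into cycles of length `k`. -/
theorem genus_bound_kCycles {k : ℕ} {N : ℕ} {σ : Fin N → Perm X}
    (hσ : ∀ t, (σ t).cycleType = {k}) :
    Fintype.card X + cyc (List.ofFn σ).prod ≤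
      N * (k - 1) + 2 * Module.finrank ℚ (invFun (Set.range σ)) := by
  have h := genus_bound (List.ofFn σ)
  have h1 : ((List.ofFn σ).map fun σ => Fintype.card X - cyc σ).sum = N * (k - 1) := by
    rw [List.map_ofFn, List.sum_ofFn]
    rw [sum_congr rfl fun t _ => show _ = k - 1 from ?_]
    · simp
    · have := cyc_of_cycleType (hσ t)
      have h2 := (σ t).support.card_le_univ
      simp only [Function.comp_apply]
      omega
  have h2 : {s | s ∈ List.ofFn σ} = Set.range σ := by
    ext s; simp [List.mem_ofFn]
  rwa [h1, h2] at h

/-- A transitive factorisation has genus at least zero. -/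
theorem le_of_mem_factSet {k N : ℕ} {π : Perm X} {σ : Fin N → Perm X} (h : σ ∈ factSet k π N) :
    Fintype.card X + cyc π ≤ N * (k - 1) + 2 := by
  have h1 := genus_bound_kCycles h.1
  have h2 := finrank_invFun_le_one h.2.2
  rw [h.2.1] at h1
  omega

theorem le_of_cntF_ne_zero {k N : ℕ} {π : Perm X} (h : cntF k π N ≠ 0) :
    Fintype.card X + cyc π ≤ N * (k - 1) + 2 := by
  have : Nonempty (factSet k π N) := by
    by_contra h'
    rw [not_nonempty_iff] at h'
    exact h Nat.card_of_isEmpty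
  obtain ⟨σ, hσ⟩ := this
  exact le_of_mem_factSet hσ

end Count

/-! ### The first return to a set of points -/

section Return

variable {X : Type} [Fintype X] [DecidableEq X] (π : Perm X) (Y : Finset X)

open Classical in
/-- The number of steps after which `x` first returns to `Y` (`0` if the cycle of `x` misses
`Y`). -/
def gap (x : X) : ℕ := if h : ∃ j, (π ^ (j + 1)) x ∈ Y then Nat.find h + 1 else 0

/-- The first return of `x` to `Y`. -/
def ret (x : X) : X := (π ^ gap π Y x) x

variable {π Y}

theorem exists_return {x y : X} (hy : y ∈ Y) (h : π.SameCycle x y) :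
    ∃ j, (π ^ (j + 1)) x ∈ Y := by
  obtain ⟨i, h0, -, hi⟩ := h.exists_pow_eq''
  exact ⟨i - 1, by rw [Nat.sub_add_cancel h0, hi]; exact hy⟩

theorem gap_pos {x : X} (h : ∃ j, (π ^ (j + 1)) x ∈ Y) : 0 < gap π Y x := by
  rw [gap, dif_pos h]; omega

theorem gap_pos_of_mem {x : X} (h : x ∈ Y) : 0 < gap π Y x :=
  gap_pos (exists_return h (SameCycle.refl _ _))

theorem ret_mem {x : X} (h : ∃ j, (π ^ (j + 1)) x ∈ Y) : ret π Y x ∈ Y := by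
  classical
  rw [ret, gap, dif_pos h]
  exact Nat.find_spec h

theorem ret_mem_of_mem {x : X} (h : x ∈ Y) : ret π Y x ∈ Y :=
  ret_mem (exists_return h (SameCycle.refl _ _))

theorem notMem_of_lt_gap {x : X} {j : ℕ} (h0 : 0 < j) (hj : j < gap π Y x) :
    (π ^ j) x ∉ Y := by
  classical
  intro h
  have h' : ∃ j, (π ^ (j + 1)) x ∈ Y := ⟨j - 1, by rwa [Nat.sub_add_cancel h0]⟩
  rw [gap, dif_pos h'] at hj
  exact Nat.find_min h' (m := j - 1) (by omega) (by rwa [Nat.sub_add_cancel h0])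

theorem gap_eq {x : X} {g : ℕ} (h0 : 0 < g) (hg : (π ^ g) x ∈ Y)
    (hlt : ∀ j, 0 < j → j < g → (π ^ j) x ∉ Y) : gap π Y x = g := by
  have h' : ∃ j, (π ^ (j + 1)) x ∈ Y := ⟨g - 1, by rwa [Nat.sub_add_cancel h0]⟩
  rcases lt_trichotomy (gap π Y x) g with h | h | h
  · exact absurd (ret_mem h') (hlt _ (gap_pos h') h)
  · exact h
  · exact absurd hg (notMem_of_lt_gap h0 h)

/-- An arc from `z` that ends before the first return cannot pass through a second point of `Y`. -/
theorem arc_unique_aux {y z : X} {i j : ℕ} (hy : y ∈ Y) (hj : j < gap π Y z)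
    (h : (π ^ i) y = (π ^ j) z) (hij : i ≤ j) : i = j ∧ y = z := by
  have h1 : (π ^ (j - i)) z = y := by
    apply (π ^ i).injective
    rw [h, ← Perm.mul_apply, ← pow_add, Nat.add_sub_cancel' hij]
  rcases Nat.eq_zero_or_pos (j - i) with h0 | h0
  · exact ⟨by omega, by rw [← h1, h0]; rfl⟩
  · exact absurd (h1 ▸ hy) (notMem_of_lt_gap h0 (by omega))

/-- The arcs `y, π y, …` that end before the first return to `Y` are disjoint. -/
theorem arc_unique {y z : X} {i j : ℕ} (hy : y ∈ Y) (hz : z ∈ Y) (hi : i < gap π Y y)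
    (hj : j < gap π Y z) (h : (π ^ i) y = (π ^ j) z) : i = j ∧ y = z := by
  rcases le_total i j with hij | hij
  · exact arc_unique_aux hy hj h hij
  · have := arc_unique_aux hz hi h.symm hij
    exact ⟨this.1.symm, this.2.symm⟩

theorem ret_injOn : Set.InjOn (ret π Y) Y := by
  intro y hy z hz h
  have hy' := gap_pos_of_mem (π := π) hy
  have hz' := gap_pos_of_mem (π := π) hz
  refine (arc_unique (i := gap π Y y - 1) (j := gap π Y z - 1) (π := π) hy hz
    (by omega) (by omega) ?_).2
  apply π.injective
  rw [← Perm.mul_apply, ← Perm.mul_apply, ← pow_succ', ← pow_succ', Nat.sub_add_cancel hy',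
    Nat.sub_add_cancel hz']
  exact h

variable (π Y)

/-- The permutation that sends a point of `Y` to its first return to `Y` and fixes the other
points. -/
def retPerm : Perm X := Equiv.ofBijective (fun x => if x ∈ Y then ret π Y x else x) <| by
  refine Finite.injective_iff_bijective.1 fun x y h => ?_
  split_ifs at h with h1 h2 h2
  · exact ret_injOn h1 h2 h
  · exact absurd (h ▸ ret_mem_of_mem h1) h2
  · exact absurd (h ▸ ret_mem_of_mem h2) h1
  · exact h

open Classical in
/-- The last point of `Y` at or before `x` on the cycle of `x` (`x` itself if that cycle misses
`Y`). -/
def base (x : X) : X := if h : ∃ y ∈ Y, ∃ j < gap π Y y, (π ^ j) y = x then h.choose else x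

variable {π Y}

theorem retPerm_of_mem {x : X} (h : x ∈ Y) : retPerm π Y x = ret π Y x := by
  simp [retPerm, h]

theorem retPerm_of_notMem {x : X} (h : x ∉ Y) : retPerm π Y x = x := by
  simp [retPerm, h]

theorem retPerm_mem_iff {x : X} : retPerm π Y x ∈ Y ↔ x ∈ Y := by
  by_cases h : x ∈ Y
  · simp [retPerm_of_mem h, ret_mem_of_mem h, h]
  · simp [retPerm_of_notMem h, h]

theorem base_pow {y : X} (hy : y ∈ Y) {j : ℕ} (hj : j < gap π Y y) : base π Y ((π ^ j) y) = y := by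
  have h : ∃ z ∈ Y, ∃ i < gap π Y z, (π ^ i) z = (π ^ j) y := ⟨y, hy, j, hj, rfl⟩
  rw [base, dif_pos h]
  obtain ⟨i, hi, h2⟩ := h.choose_spec.2
  exact (arc_unique h.choose_spec.1 hy hi hj h2).2

theorem base_of_mem {y : X} (hy : y ∈ Y) : base π Y y = y :=
  base_pow (j := 0) hy (gap_pos_of_mem hy)

/-- A cycle that meets `Y` is covered by the arcs from the points of `Y`. -/
theorem exists_arc {x y : X} (hy : y ∈ Y) (h : π.SameCycle x y) :
    ∃ z ∈ Y, ∃ j < gap π Y z, (π ^ j) z = x := by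
  classical
  -- go back from `x` to the nearest point of `Y`
  have hex : ∃ j, ∃ z ∈ Y, (π ^ j) z = x := by
    obtain ⟨i, -, hi⟩ := h.symm.exists_pow_eq'
    exact ⟨i, y, hy, hi⟩
  obtain ⟨z, hz, hzx⟩ := Nat.find_spec hex
  refine ⟨z, hz, Nat.find hex, ?_, hzx⟩
  by_contra hlt
  have hg := gap_pos_of_mem (π := π) hz
  refine Nat.find_min hex (m := Nat.find hex - gap π Y z)
    (by omega) ⟨ret π Y z, ret_mem_of_mem hz, ?_⟩
  rw [ret, ← Perm.mul_apply, ← pow_add, Nat.sub_add_cancel (by omega), hzx]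

theorem card_base_eq {y : X} (hy : y ∈ Y) : #{x | base π Y x = y} = gap π Y y := by
  rw [← card_range (gap π Y y)]
  symm
  refine card_bij (fun j _ => (π ^ j) y) (fun j hj => ?_) (fun i hi j hj h => ?_) fun x hx => ?_
  · simpa using base_pow hy (mem_range.1 hj)
  · exact (arc_unique hy hy (mem_range.1 hi) (mem_range.1 hj) h).1
  · rw [mem_filter_univ] at hx
    by_cases h : ∃ z ∈ Y, ∃ j < gap π Y z, (π ^ j) z = x
    · obtain ⟨z, hz, j, hj, rfl⟩ := h
      rw [base_pow hz hj] at hx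
      subst hx
      exact ⟨j, mem_range.2 hj, rfl⟩
    · rw [base, dif_neg h] at hx
      subst hx
      exact absurd ⟨x, hy, 0, gap_pos_of_mem hy, rfl⟩ h

end Return

section Labels

variable {X I : Type} [Fintype X] [DecidableEq X] [DecidableEq I]
  {π : Perm X} {Y : Finset X} {lab : X → I}

theorem lab_pow (hl : ∀ x y, lab x = lab y ↔ π.SameCycle x y) (j : ℕ) (x : X) :
    lab ((π ^ j) x) = lab x := ((hl _ _).2 ⟨j, by simp⟩).symm

theorem lab_apply (hl : ∀ x y, lab x = lab y ↔ π.SameCycle x y) (x : X) :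
    lab (π x) = lab x := lab_pow hl 1 x

theorem lab_ret (hl : ∀ x y, lab x = lab y ↔ π.SameCycle x y) (x : X) :
    lab (ret π Y x) = lab x := lab_pow hl _ x

theorem lab_retPerm (hl : ∀ x y, lab x = lab y ↔ π.SameCycle x y) (x : X) :
    lab (retPerm π Y x) = lab x := by
  by_cases h : x ∈ Y
  · rw [retPerm_of_mem h, lab_ret hl]
  · rw [retPerm_of_notMem h]

theorem exists_arc_of_lab (hl : ∀ x y, lab x = lab y ↔ π.SameCycle x y) {x : X}
    (h : lab x ∈ Y.image lab) : ∃ z ∈ Y, ∃ j < gap π Y z, (π ^ j) z = x := by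
  obtain ⟨y, hy, hyx⟩ := mem_image.1 h
  exact exists_arc hy ((hl _ _).1 hyx.symm)

theorem lab_base (hl : ∀ x y, lab x = lab y ↔ π.SameCycle x y) (x : X) :
    lab (base π Y x) = lab x := by
  by_cases h : ∃ y ∈ Y, ∃ j < gap π Y y, (π ^ j) y = x
  · obtain ⟨z, hz, j, hj, rfl⟩ := h
    rw [base_pow hz hj, lab_pow hl]
  · rw [base, dif_neg h]

theorem base_mem_iff (hl : ∀ x y, lab x = lab y ↔ π.SameCycle x y) {x : X} :
    base π Y x ∈ Y ↔ lab x ∈ Y.image lab := by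
  refine ⟨fun h => ?_, fun h => ?_⟩
  · rw [← lab_base hl (Y := Y)]
    exact mem_image_of_mem _ h
  · obtain ⟨z, hz, j, hj, rfl⟩ := exists_arc_of_lab hl h
    rwa [base_pow hz hj]

/-- The gaps at the points of `Y` on a cycle add up to the length of the cycle. -/
theorem sum_gap (hl : ∀ x y, lab x = lab y ↔ π.SameCycle x y) {i : I} (hi : i ∈ Y.image lab) :
    ∑ y ∈ Y with lab y = i, gap π Y y = #{x | lab x = i} := by
  rw [card_eq_sum_card_fiberwise (f := base π Y) (t := Y.filter (lab · = i))]
  · refine sum_congr rfl fun y hy => ?_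
    rw [mem_filter] at hy
    rw [← card_base_eq hy.1, filter_filter]
    congr 1
    ext x
    simp only [mem_filter_univ]
    exact ⟨fun h => ⟨by rw [← lab_base hl (Y := Y), h, hy.2], h⟩, fun h => h.2⟩
  · intro x hx
    simp only [coe_filter, mem_univ, true_and, Set.mem_ofPred_eq] at hx ⊢
    exact ⟨(base_mem_iff hl).2 (hx ▸ hi), by rw [lab_base hl, hx]⟩

/-- Two points of `Y` are on the same cycle of `π` if and only if they are on the same cycle of the
first return permutation. -/
theorem retPerm_sameCycle (hl : ∀ x y, lab x = lab y ↔ π.SameCycle x y) {y z : X} (hy : y ∈ Y)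
    (hz : z ∈ Y) : (retPerm π Y).SameCycle y z ↔ lab y = lab z := by
  refine ⟨fun h => ?_, fun h => ?_⟩
  · obtain ⟨i, -, rfl⟩ := h.exists_pow_eq'
    clear h hz
    induction i with
    | zero => rfl
    | succ i ih => rw [pow_succ', Perm.mul_apply, lab_retPerm hl, ih]
  · obtain ⟨i, -, hi⟩ := ((hl _ _).1 h).exists_pow_eq'
    clear h
    induction i using Nat.strong_induction_on generalizing y with
    | _ i ih =>
    rcases Nat.eq_zero_or_pos i with rfl | h0
    · rw [← hi]; exact SameCycle.refl _ _
    have hg : gap π Y y ≤ i := by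
      by_contra h
      exact notMem_of_lt_gap h0 (not_le.1 h) (hi ▸ hz)
    have := ih (i - gap π Y y) (by have := gap_pos_of_mem (π := π) hy; omega)
      (ret_mem_of_mem hy) (by
        rw [ret, ← Perm.mul_apply, ← pow_add, Nat.sub_add_cancel hg, hi])
    rw [← retPerm_of_mem hy] at this
    exact (sameCycle_apply_left.1 this)

/-- Points placed on the cycles so that consecutive ones are at given distances, which add up to
the lengths of the cycles, are distinct, and the distances are the gaps. -/
theorem injective_and_gap_of_sum {E : Type} [Fintype E]
    (hl : ∀ x y, lab x = lab y ↔ π.SameCycle x y) {ι : E → X} {rot : E → E} {len : E → ℕ}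
    (h0 : ∀ e, 0 < len e) (hrot : ∀ e, ι (rot e) = (π ^ len e) (ι e))
    (hsum : ∑ e, len e = #{x | ∃ e, lab x = lab (ι e)}) :
    Function.Injective ι ∧ ∀ e, gap π (univ.image ι) (ι e) = len e := by
  -- The arcs of length `len e` from the points `ι e` cover the cycles on which there are points; as
  -- their lengths add up to the number of points on these cycles, they are disjoint.
  let T := {x // ∃ e, lab x = lab (ι e)}
  let A : (Σ e, Fin (len e)) → T := fun p => ⟨(π ^ (p.2 : ℕ)) (ι p.1), p.1, lab_pow hl _ _⟩
  have hsurj : Function.Surjective A := by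
    rintro ⟨x, e, hx⟩
    obtain ⟨i, -, rfl⟩ := ((hl _ _).1 hx.symm).exists_pow_eq'
    have : ∃ p : Σ e, Fin (len e), (π ^ (p.2 : ℕ)) (ι p.1) = (π ^ i) (ι e) := by
      clear hx
      induction i with
      | zero => exact ⟨⟨e, 0, h0 e⟩, rfl⟩
      | succ i ih =>
        obtain ⟨⟨e', j, hj⟩, hp⟩ := ih
        rw [pow_succ', Perm.mul_apply, ← hp]
        dsimp only
        rcases Nat.lt_or_ge (j + 1) (len e') with h | h
        · exact ⟨⟨e', j + 1, h⟩, by dsimp only; rw [pow_succ', Perm.mul_apply]⟩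
        · refine ⟨⟨rot e', 0, h0 _⟩, ?_⟩
          dsimp only
          have : len e' = j + 1 := by omega
          rw [hrot, this, pow_succ', Perm.mul_apply]
          rfl
    obtain ⟨p, hp⟩ := this
    exact ⟨p, Subtype.ext hp⟩
  have hbij : Function.Bijective A := by
    refine (Fintype.bijective_iff_surjective_and_card A).2 ⟨hsurj, ?_⟩
    rw [Fintype.card_sigma, Fintype.card_subtype]
    simpa using hsum
  have key : ∀ e e' i j, i < len e → j < len e' →
      (π ^ i) (ι e) = (π ^ j) (ι e') → e = e' ∧ i = j := by
    intro e e' i j hi hj h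
    have := @hbij.1 ⟨e, i, hi⟩ ⟨e', j, hj⟩ (Subtype.ext h)
    obtain ⟨rfl, h2⟩ := Sigma.mk.inj_iff.1 this
    exact ⟨rfl, congrArg Fin.val (eq_of_heq h2)⟩
  refine ⟨fun e e' h => (key e e' 0 0 (h0 _) (h0 _) h).1, fun e => ?_⟩
  refine gap_eq (h0 e) (by rw [← hrot]; exact mem_image_of_mem _ (mem_univ _)) fun j hj hj' h => ?_
  obtain ⟨e', -, he'⟩ := mem_image.1 h
  have := (key e' e 0 j (h0 _) hj' he').2
  omega

end Labels

/-! ### Splitting off a factor -/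

theorem eq_of_sameCycle {X B : Type} [Finite X] {σ : Perm X} {f : X → B} (hf : ∀ x, f (σ x) = f x)
    {x y : X} (h : σ.SameCycle x y) : f x = f y := by
  obtain ⟨i, -, rfl⟩ := h.exists_pow_eq'
  clear h
  induction i with
  | zero => rfl
  | succ i ih => rw [pow_succ', Perm.mul_apply, hf, ih]

theorem card_cycleType_le {X : Type} [Fintype X] [DecidableEq X] (σ : Perm X) :
    σ.cycleType.card ≤ #σ.support := by
  have := Multiset.card_nsmul_le_sum fun a ha => (one_lt_of_mem_cycleType (σ := σ) (n := a) ha).le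
  rwa [sum_cycleType, smul_eq_mul, mul_one] at this

theorem cyc_le_card {X : Type} [Fintype X] [DecidableEq X] (σ : Perm X) :
    cyc σ ≤ Fintype.card X := by
  have := card_cycleType_le σ
  have := cyc_add_card_support σ
  omega

section Cut

variable {X : Type} [Fintype X] [DecidableEq X]

/-- If the first factor of a factorisation of `π` is `s`, then `Y = s.support` and
`b = s⁻¹ * retPerm π Y` determine `s`. -/
def firstFactor (π : Perm X) (Y : Finset X) (b : Perm X) : Perm X := retPerm π Y * b⁻¹

/-- What is left of `π` after removing the factor `firstFactor π Y b`. The first return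
permutation of `rest π Y b` to `Y` is `b`. -/
def rest (π : Perm X) (Y : Finset X) (b : Perm X) : Perm X := b * (retPerm π Y)⁻¹ * π

theorem firstFactor_mul_rest (π : Perm X) (Y : Finset X) (b : Perm X) :
    firstFactor π Y b * rest π Y b = π := by
  simp [firstFactor, rest, mul_assoc]

variable {I : Type} [Fintype I] [DecidableEq I] {π : Perm X} {lab : X → I} {Y : Finset X}
  {b : Perm X}

theorem map_mem_of_support_subset (hb : b.support ⊆ Y) {y : X} (hy : y ∈ Y) : b y ∈ Y := by
  by_cases h : b y = y
  · rwa [h]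
  · exact hb (apply_mem_support.2 (mem_support.2 h))

/-- `rest π Y b` goes along the arcs of `π` between points of `Y`. -/
theorem rest_of_lt (hb : b.support ⊆ Y) {y : X} {j : ℕ} (hj : j + 1 < gap π Y y) :
    rest π Y b ((π ^ j) y) = (π ^ (j + 1)) y := by
  have h := notMem_of_lt_gap (Nat.succ_pos j) hj
  rw [rest, Perm.mul_apply, Perm.mul_apply, ← Perm.mul_apply π, ← pow_succ',
    Perm.inv_eq_iff_eq.2 (retPerm_of_notMem h).symm]
  exact notMem_support.1 fun h' => h (hb h')

/-- From the end of the arc that starts at `y`, `rest π Y b` goes to `b y`. -/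
theorem rest_last {y : X} (hy : y ∈ Y) :
    rest π Y b ((π ^ (gap π Y y - 1)) y) = b y := by
  rw [rest, Perm.mul_apply, Perm.mul_apply, ← Perm.mul_apply π, ← pow_succ',
    Nat.sub_add_cancel (gap_pos_of_mem hy)]
  congr 1
  rw [Perm.inv_eq_iff_eq, retPerm_of_mem hy, ret]

/-- `rest π Y b` agrees with `π` on the cycles of `π` that miss `Y`. -/
theorem rest_of_lab (hl : ∀ x y, lab x = lab y ↔ π.SameCycle x y) (hb : b.support ⊆ Y) {x : X}
    (h : lab x ∉ Y.image lab) : rest π Y b x = π x := by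
  have h : π x ∉ Y := fun h' => h (by rw [← lab_apply hl]; exact mem_image_of_mem _ h')
  rw [rest, Perm.mul_apply, Perm.mul_apply, Perm.inv_eq_iff_eq.2 (retPerm_of_notMem h).symm]
  exact notMem_support.1 fun h' => h (hb h')

theorem rest_sameCycle_arc (hb : b.support ⊆ Y) {y : X} {j : ℕ} (hj : j < gap π Y y) :
    (rest π Y b).SameCycle y ((π ^ j) y) := by
  induction j with
  | zero => exact SameCycle.refl _ _
  | succ j ih =>
    rw [← rest_of_lt hb hj]
    exact sameCycle_apply_right.2 (ih (by omega))

theorem rest_sameCycle_apply (hb : b.support ⊆ Y) {y : X} (hy : y ∈ Y) :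
    (rest π Y b).SameCycle y (b y) := by
  rw [← rest_last (π := π) hy, sameCycle_apply_right]
  exact rest_sameCycle_arc hb (Nat.sub_lt (gap_pos_of_mem hy) one_pos)

theorem rest_sameCycle_of_sameCycle (hb : b.support ⊆ Y) {y z : X} (hy : y ∈ Y)
    (h : b.SameCycle y z) : (rest π Y b).SameCycle y z := by
  obtain ⟨i, -, rfl⟩ := h.exists_pow_eq'
  clear h
  have : (b ^ i) y ∈ Y ∧ (rest π Y b).SameCycle y ((b ^ i) y) := by
    induction i with
    | zero => exact ⟨hy, SameCycle.refl _ _⟩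
    | succ i ih =>
      rw [pow_succ', Perm.mul_apply]
      exact ⟨map_mem_of_support_subset hb ih.1, ih.2.trans (rest_sameCycle_apply hb ih.1)⟩
  exact this.2

section Labels

variable {W : Type} [Fintype W] [DecidableEq W] {wh : X → W}

theorem white_base_rest (hb : b.support ⊆ Y)
    (hw : ∀ y ∈ Y, ∀ z ∈ Y, wh y = wh z ↔ b.SameCycle y z) {x : X}
    (h : ∃ z ∈ Y, ∃ j < gap π Y z, (π ^ j) z = x) :
    wh (base π Y (rest π Y b x)) = wh (base π Y x) := by
  obtain ⟨z, hz, j, hj, rfl⟩ := h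
  rw [base_pow hz hj]
  rcases Nat.lt_or_ge (j + 1) (gap π Y z) with h | h
  · rw [rest_of_lt hb h, base_pow hz h]
  · have hj' : j = gap π Y z - 1 := by omega
    have hbz := map_mem_of_support_subset hb hz
    rw [hj', rest_last hz, base_of_mem hbz, hw _ hbz _ hz]
    exact sameCycle_apply_left.2 (SameCycle.refl _ _)

/-- The labelling of the points by the cycles of `rest π Y b`: these are the cycles that meet `Y`,
labelled by `W`, and the cycles of `π` that miss `Y`. -/
def restLabel (π : Perm X) (lab : X → I) (Y : Finset X) (wh : X → W) (x : X) :
    W ⊕ {i // i ∉ Y.image lab} :=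
  if h : lab x ∈ Y.image lab then Sum.inl (wh (base π Y x)) else Sum.inr ⟨lab x, h⟩

theorem lab_rest (hl : ∀ x y, lab x = lab y ↔ π.SameCycle x y) (hb : b.support ⊆ Y) (x : X) :
    lab (rest π Y b x) ∈ Y.image lab ↔ lab x ∈ Y.image lab := by
  by_cases h : lab x ∈ Y.image lab
  · obtain ⟨z, hz, j, hj, rfl⟩ := exists_arc_of_lab hl h
    refine iff_of_true ?_ h
    rcases Nat.lt_or_ge (j + 1) (gap π Y z) with h | h
    · rw [rest_of_lt hb h, lab_pow hl]
      exact mem_image_of_mem _ hz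
    · have hj' : j = gap π Y z - 1 := by omega
      rw [hj', rest_last hz]
      exact mem_image_of_mem _ (map_mem_of_support_subset hb hz)
  · rw [rest_of_lab hl hb h, lab_apply hl]

/-- The cycles of `rest π Y b` that meet `Y` are obtained from the cycles of `b` on `Y` by inserting
the arcs of `π`; the others are the cycles of `π` that miss `Y`. -/
theorem restLabel_eq_iff (hl : ∀ x y, lab x = lab y ↔ π.SameCycle x y) (hb : b.support ⊆ Y)
    (hw : ∀ y ∈ Y, ∀ z ∈ Y, wh y = wh z ↔ b.SameCycle y z) (x y : X) :
    restLabel π lab Y wh x = restLabel π lab Y wh y ↔ (rest π Y b).SameCycle x y := by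
  refine ⟨fun h => ?_, fun h => eq_of_sameCycle (fun x => ?_) h⟩
  · by_cases hx : lab x ∈ Y.image lab <;> by_cases hy : lab y ∈ Y.image lab
    · rw [restLabel, dif_pos hx, restLabel, dif_pos hy, Sum.inl.injEq] at h
      obtain ⟨u, hu, i, hi, rfl⟩ := exists_arc_of_lab hl hx
      obtain ⟨v, hv, j, hj, rfl⟩ := exists_arc_of_lab hl hy
      rw [base_pow hu hi, base_pow hv hj, hw _ hu _ hv] at h
      exact (rest_sameCycle_arc hb hi).symm.trans
        ((rest_sameCycle_of_sameCycle hb hu h).trans (rest_sameCycle_arc hb hj))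
    · simp [restLabel, hx, hy] at h
    · simp [restLabel, hx, hy] at h
    · rw [restLabel, dif_neg hx, restLabel, dif_neg hy, Sum.inr.injEq, Subtype.mk.injEq, hl] at h
      obtain ⟨i, -, rfl⟩ := h.exists_pow_eq'
      refine ⟨i, ?_⟩
      clear h hy
      rw [zpow_natCast]
      induction i with
      | zero => rfl
      | succ i ih =>
        rw [pow_succ', Perm.mul_apply, ih, rest_of_lab hl hb (by rwa [lab_pow hl]), pow_succ',
          Perm.mul_apply]
  · have h1 := lab_rest hl hb x
    by_cases hx : lab x ∈ Y.image lab
    · rw [restLabel, dif_pos (h1.2 hx), restLabel, dif_pos hx,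
        white_base_rest hb hw (exists_arc_of_lab hl hx)]
    · have h2 := rest_of_lab hl hb hx
      rw [restLabel, dif_neg (fun h => hx (h1.1 h)), restLabel, dif_neg hx]
      simp only [h2, lab_apply hl x]

theorem restLabel_surjective (hls : Function.Surjective lab) (hws : ∀ w, ∃ y ∈ Y, wh y = w) :
    Function.Surjective (restLabel π lab Y wh) := by
  rintro (w | ⟨i, hi⟩)
  · obtain ⟨y, hy, rfl⟩ := hws w
    exact ⟨y, by rw [restLabel, dif_pos (mem_image_of_mem _ hy), base_of_mem hy]⟩
  · obtain ⟨x, rfl⟩ := hls i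
    exact ⟨x, by rw [restLabel, dif_neg hi]⟩

theorem cyc_rest (hl : ∀ x y, lab x = lab y ↔ π.SameCycle x y) (hls : Function.Surjective lab)
    (hb : b.support ⊆ Y) (hw : ∀ y ∈ Y, ∀ z ∈ Y, wh y = wh z ↔ b.SameCycle y z)
    (hws : ∀ w, ∃ y ∈ Y, wh y = w) :
    cyc (rest π Y b) + #(Y.image lab) = Fintype.card I + Fintype.card W := by
  rw [cyc_eq_card_of_label _ (restLabel_surjective hls hws) (restLabel_eq_iff hl hb hw),
    Fintype.card_sum, Fintype.card_subtype_compl, Fintype.card_coe]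
  have := card_le_univ (Y.image lab)
  omega

end Labels

/-- The labelling of `Y` by the cycles of `b`, extended to a map on all points. -/
theorem exists_white (hY : Y.Nonempty) (hb : b.support ⊆ Y) :
    ∃ wh : X → White Y b, (∀ y (hy : y ∈ Y), wh y = white Y b ⟨y, hy⟩) ∧
      (∀ y ∈ Y, ∀ z ∈ Y, wh y = wh z ↔ b.SameCycle y z) ∧ ∀ w, ∃ y ∈ Y, wh y = w := by
  obtain ⟨y0, hy0⟩ := hY
  obtain ⟨wh, h⟩ : ∃ wh : X → White Y b, ∀ y (hy : y ∈ Y), wh y = white Y b ⟨y, hy⟩ :=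
    ⟨fun x => if h : x ∈ Y then white Y b ⟨x, h⟩ else white Y b ⟨y0, hy0⟩, fun y hy => dif_pos hy⟩
  refine ⟨wh, h, fun y hy z hz => by rw [h y hy, h z hz, white_eq_iff], fun w => ?_⟩
  obtain ⟨y, hy⟩ := white_surjective hb w
  exact ⟨y.1, y.2, by rw [h y.1 y.2, hy]⟩

variable (lab Y b) in
/-- The two-coloured graph with edge set `Y`, whose black vertices are the cycles of `π` that meet
`Y` and whose white vertices are the cycles of `b` on `Y`, is a tree. It is connected, and the
number of its vertices exceeds the number of its edges by one; fixed points of `b` are left out on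
both sides of the latter equation. -/
structure IsTreeCut : Prop where
  support_subset : b.support ⊆ Y
  conn : ∀ F : X → Prop, (∀ y ∈ Y, F (b y) ↔ F y) →
    (∀ y ∈ Y, ∀ z ∈ Y, lab y = lab z → F y → F z) → ∀ y ∈ Y, ∀ z ∈ Y, F y → F z
  card_eq : #(Y.image lab) + b.cycleType.card = #b.support + 1

/-- If the graph of `Y` and `b` is connected, then the group generated by the first factor and the
rest has at most one orbit on the cycles of `π` that meet `Y`, besides the cycles that miss `Y`. -/
theorem finrank_invFun_cut (hl : ∀ x y, lab x = lab y ↔ π.SameCycle x y)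
    (hls : Function.Surjective lab) (hb : b.support ⊆ Y) (hY : Y.Nonempty)
    (hconn : ∀ F : X → Prop, (∀ y ∈ Y, F (b y) ↔ F y) →
      (∀ y ∈ Y, ∀ z ∈ Y, lab y = lab z → F y → F z) → ∀ y ∈ Y, ∀ z ∈ Y, F y → F z) :
    Module.finrank ℚ (invFun {σ | σ ∈ [firstFactor π Y b, rest π Y b]}) + #(Y.image lab) ≤
      1 + Fintype.card I := by
  obtain ⟨y0, hy0⟩ := hY
  set V := invFun {σ | σ ∈ [firstFactor π Y b, rest π Y b]} with hV
  have hπ : ∀ f ∈ V, ∀ x y, lab x = lab y → f x = f y := by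
    intro f hf x y hxy
    refine eq_of_sameCycle (fun x => ?_) ((hl x y).1 hxy)
    rw [← firstFactor_mul_rest π Y b, Perm.mul_apply, mem_invFun.1 hf _ (by simp),
      mem_invFun.1 hf _ (by simp)]
  have hYc : ∀ f ∈ V, ∀ y ∈ Y, f y = f y0 := by
    intro f hf y hy
    refine hconn (fun z => f z = f y0) (fun z hz => ?_) (fun z hz w hw h h' => ?_) y0 hy0 y hy rfl
    · have h2 : f z = f (b z) := eq_of_sameCycle (fun x => mem_invFun.1 hf _ (by simp) x)
        (rest_sameCycle_apply (π := π) hb hz)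
      rw [h2]
    · rw [← hπ f hf z w h, h']
  -- an invariant function is determined by its value on `Y` and by its values on the cycles that
  -- miss `Y`
  let L : V →ₗ[ℚ] (Unit ⊕ {i // i ∉ Y.image lab} → ℚ) :=
    { toFun := fun f => Sum.elim (fun _ => f.1 y0) fun i => f.1 (Function.surjInv hls i.1)
      map_add' := fun f g => by ext (_ | _) <;> rfl
      map_smul' := fun c f => by ext (_ | _) <;> rfl }
  have hL : Function.Injective L := by
    rw [← LinearMap.ker_eq_bot, LinearMap.ker_eq_bot']
    intro f hf
    have h1 : f.1 y0 = 0 := congrFun hf (Sum.inl ())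
    refine Subtype.ext (funext fun x => ?_)
    by_cases hx : lab x ∈ Y.image lab
    · obtain ⟨y, hy, hyx⟩ := mem_image.1 hx
      rw [hπ f.1 f.2 x y hyx.symm, hYc f.1 f.2 y hy, h1]
      rfl
    · rw [hπ f.1 f.2 x (Function.surjInv hls (lab x)) (Function.surjInv_eq hls _).symm]
      exact congrFun hf (Sum.inr ⟨lab x, hx⟩)
  have := LinearMap.finrank_le_finrank_of_injective hL
  rw [Module.finrank_fintype_fun_eq_card, Fintype.card_sum, Fintype.card_subtype_compl,
    Fintype.card_coe, Fintype.card_unit] at this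
  have := card_le_univ (Y.image lab)
  omega

theorem firstFactor_support_subset (hb : b.support ⊆ Y) : (firstFactor π Y b).support ⊆ Y := by
  intro x hx
  by_contra h
  refine mem_support.1 hx ?_
  rw [firstFactor, Perm.mul_apply, Perm.inv_eq_iff_eq.2 (notMem_support.1 fun h' => h (hb h')).symm,
    retPerm_of_notMem h]

/-- The factor that is encoded by a tree is a cycle. -/
theorem IsTreeCut.cycleType (hl : ∀ x y, lab x = lab y ↔ π.SameCycle x y)
    (hls : Function.Surjective lab) {k : ℕ} (hk : 2 ≤ k) (hY : #Y = k)
    (h : IsTreeCut lab Y b) :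
    (firstFactor π Y b).cycleType = {k} ∧ (firstFactor π Y b).support = Y := by
  have hne : Y.Nonempty := card_pos.1 (by omega)
  obtain ⟨wh, -, hw, hws⟩ := exists_white hne h.support_subset
  have h1 := cyc_rest hl hls h.support_subset hw hws
  have h2 := finrank_invFun_cut hl hls h.support_subset hne h.conn
  have h3 := card_white h.support_subset
  have h4 := genus_bound [firstFactor π Y b, rest π Y b]
  have h5 := h.card_eq
  have h6 := cyc_eq_card_of_label lab hls hl
  have h7 := card_le_univ (firstFactor π Y b).support
  have h8 := cyc_add_card_support (firstFactor π Y b)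
  have h9 := card_le_card (firstFactor_support_subset (π := π) h.support_subset)
  have h10 := cyc_add_card_support (rest π Y b)
  have h11 := card_le_univ (Y.image lab)
  simp only [List.prod_cons, List.prod_nil, mul_one, firstFactor_mul_rest, List.map_cons,
    List.map_nil, List.sum_cons, List.sum_nil, add_zero] at h4
  have h13 := cyc_le_card (rest π Y b)
  have h14 := card_cycleType_le (firstFactor π Y b)
  -- The genus inequality forces `firstFactor π Y b` to move all points of `Y`, in one cycle.
  have h15 : (firstFactor π Y b).cycleType.card = 1 := by
    have : (firstFactor π Y b).cycleType.card ≠ 0 := by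
      intro h0
      rw [card_cycleType_eq_zero] at h0
      have : #(firstFactor π Y b).support = 0 := by rw [h0]; simp
      have : (firstFactor π Y b).cycleType.card = 0 := by rw [h0]; simp
      omega
    omega
  have h16 : #(firstFactor π Y b).support = k := by omega
  refine ⟨?_, eq_of_subset_of_card_le (firstFactor_support_subset h.support_subset) (by omega)⟩
  rw [(card_cycleType_eq_one.1 h15).cycleType, h16]

/-- A cycle `s` is encoded by its support and by `s⁻¹ * retPerm π s.support`. -/
theorem firstFactor_eq (s : Perm X) :
    firstFactor π s.support (s⁻¹ * retPerm π s.support) = s := by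
  simp [firstFactor]

theorem rest_eq (s : Perm X) :
    rest π s.support (s⁻¹ * retPerm π s.support) = s⁻¹ * π := by
  simp [rest]

theorem support_inv_mul_retPerm (s : Perm X) :
    (s⁻¹ * retPerm π s.support).support ⊆ s.support := by
  intro x hx
  by_contra h
  refine mem_support.1 hx ?_
  rw [Perm.mul_apply, retPerm_of_notMem h, Perm.inv_eq_iff_eq]
  exact (notMem_support.1 h).symm

/-- The graph that encodes a cycle `s` is connected: each step of `s⁻¹` on `Y` can be made along a
cycle of `π` and a cycle of `b`. -/
theorem conn_of_cycle {s : Perm X} (hs : s.IsCycle) (hl : ∀ x y, lab x = lab y ↔ π.SameCycle x y)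
    (F : X → Prop) (h1 : ∀ y ∈ s.support, F ((s⁻¹ * retPerm π s.support) y) ↔ F y)
    (h2 : ∀ y ∈ s.support, ∀ z ∈ s.support, lab y = lab z → F y → F z) :
    ∀ y ∈ s.support, ∀ z ∈ s.support, F y → F z := by
  have key : ∀ y ∈ s.support, F (s⁻¹ y) ↔ F y := by
    intro y hy
    obtain ⟨x, rfl⟩ := (retPerm π s.support).surjective y
    have hx := retPerm_mem_iff.1 hy
    have h3 := h1 x hx
    rw [Perm.mul_apply] at h3
    rw [h3]
    exact ⟨h2 _ hx _ hy (lab_retPerm hl x).symm, h2 _ hy _ hx (lab_retPerm hl x)⟩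
  intro y hy z hz
  obtain ⟨i, -, rfl⟩ := ((hs.sameCycle (mem_support.1 hy) (mem_support.1 hz))).exists_pow_eq'
  clear hz
  intro hF
  induction i with
  | zero => exact hF
  | succ i ih =>
    rw [pow_succ', Perm.mul_apply, ← key _ (by rwa [apply_mem_support, pow_apply_mem_support])]
    simpa using ih

end Cut

/-! ### The orbits of the remaining factors -/

section Components

variable {X : Type} [Fintype X] [DecidableEq X] {I : Type} [Fintype I] [DecidableEq I]
  {W : Type} [Fintype W] [DecidableEq W]

/-- The factorisations of `ρ` into `N` cycles of length `k` whose group has the fibres of `f` as its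
orbits. -/
def fibSet (k : ℕ) (f : X → W) (ρ : Perm X) (N : ℕ) : Set (Fin N → Perm X) :=
  {τ | (∀ t, (τ t).cycleType = {k}) ∧ (List.ofFn τ).prod = ρ ∧ (∀ t x, f (τ t x) = f x) ∧
    ∀ F : X → Prop, (∀ t x, F (τ t x) ↔ F x) → ∀ x y, f x = f y → F x → F y}

/-- The map to the components: each cycle that meets `Y` gives a component, and `A` distributes the
other cycles to these. -/
def cutMap (π : Perm X) (lab : X → I) (Y : Finset X) (wh : X → W) (A : I → Option W) (x : X) : W :=
  (A (lab x)).getD (wh (base π Y x))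

variable {π : Perm X} {lab : X → I} {Y : Finset X} {b : Perm X} {wh : X → W}

theorem apply_mem_of_support_eq {s : Perm X} (h : s.support = Y) {x : X} (hx : x ∈ Y) : s x ∈ Y := by
  subst h; exact apply_mem_support.2 hx

/-- The genus inequality for `firstFactor π Y b` and `rest π Y b`. For a cycle of length `k` it says
that the connected graph with `k` edges that encodes it has at most `k + 1` vertices. -/
theorem genus_bound_cut (hl : ∀ x y, lab x = lab y ↔ π.SameCycle x y)
    (hls : Function.Surjective lab) (hb : b.support ⊆ Y) (hY : Y.Nonempty)
    (hw : ∀ y ∈ Y, ∀ z ∈ Y, wh y = wh z ↔ b.SameCycle y z) (hws : ∀ w, ∃ y ∈ Y, wh y = w)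
    (hconn : ∀ F : X → Prop, (∀ y ∈ Y, F (b y) ↔ F y) →
      (∀ y ∈ Y, ∀ z ∈ Y, lab y = lab z → F y → F z) → ∀ y ∈ Y, ∀ z ∈ Y, F y → F z) :
    #(Y.image lab) + Fintype.card W + cyc (firstFactor π Y b) ≤ Fintype.card X + 2 := by
  have h1 := cyc_rest hl hls hb hw hws
  have h2 := finrank_invFun_cut hl hls hb hY hconn
  have h4 := genus_bound [firstFactor π Y b, rest π Y b]
  have h6 := cyc_eq_card_of_label lab hls hl
  have h8 := cyc_le_card (firstFactor π Y b)
  have h10 := cyc_le_card (rest π Y b)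
  simp only [List.prod_cons, List.prod_nil, mul_one, firstFactor_mul_rest, List.map_cons,
    List.map_nil, List.sum_cons, List.sum_nil, add_zero] at h4
  omega

/-- A function invariant under the remaining factors is determined by its values at one point `r w`
of `Y` for each cycle of `b`: the points of `Y` are reached from these by `rest π Y b`, and all
other points are reached from `Y` by the remaining factors, since the first factor moves points of
`Y` only. -/
theorem invFun_eq_zero (hb : b.support ⊆ Y) (hw : ∀ y ∈ Y, ∀ z ∈ Y, wh y = wh z ↔ b.SameCycle y z)
    (hs : (firstFactor π Y b).support = Y) {N : ℕ}
    {τ : Fin N → Perm X} (hp : (List.ofFn τ).prod = rest π Y b)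
    (htr : Trans (Fin.cons (firstFactor π Y b) τ : Fin (N + 1) → Perm X)) (hY : Y.Nonempty)
    {f : X → ℚ} (hf : f ∈ invFun (Set.range τ)) {r : W → X} (hr : ∀ w, r w ∈ Y ∧ wh (r w) = w)
    (h0 : ∀ w, f (r w) = 0) : f = 0 := by
  have hfr : f ∈ invFun {rest π Y b} := by
    rw [← hp]
    refine invFun_le_prod (fun σ hσ => invFun_le_of_mem ?_) hf
    simpa [List.mem_ofFn] using hσ
  have hY0 : ∀ y ∈ Y, f y = 0 := by
    intro y hy
    rw [← h0 (wh y)]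
    exact invFun_sameCycle hfr (rest_sameCycle_of_sameCycle hb hy
      ((hw y hy _ (hr _).1).1 (hr _).2.symm))
  obtain ⟨y0, hy0⟩ := hY
  funext x
  refine htr (fun x => f x = 0) (fun t x => ?_) y0 x (hY0 y0 hy0)
  refine Fin.cases ?_ (fun t => ?_) t
  · rw [Fin.cons_zero]
    by_cases hx : x ∈ Y
    · exact iff_of_true (hY0 _ (apply_mem_of_support_eq hs hx)) (hY0 _ hx)
    · rw [notMem_support.1 (hs.symm ▸ hx : x ∉ (firstFactor π Y b).support)]
  · rw [Fin.cons_succ, hf (τ t) ⟨t, rfl⟩]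

/-- Genus zero forces the graph that encodes the first factor to be a tree, and the other factors to
have as many orbits as there are white vertices: both numbers are bounded on one side by
connectedness, and the genus inequalities bound their sum from the other side. -/
theorem card_white_of_trans (hl : ∀ x y, lab x = lab y ↔ π.SameCycle x y)
    (hls : Function.Surjective lab) (hb : b.support ⊆ Y)
    (hw : ∀ y ∈ Y, ∀ z ∈ Y, wh y = wh z ↔ b.SameCycle y z) {r : W → X}
    (hr : ∀ w, r w ∈ Y ∧ wh (r w) = w) {k N : ℕ} (hk : 2 ≤ k)
    (hs : (firstFactor π Y b).cycleType = {k}) (hsY : (firstFactor π Y b).support = Y)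
    (hconn : ∀ F : X → Prop, (∀ y ∈ Y, F (b y) ↔ F y) →
      (∀ y ∈ Y, ∀ z ∈ Y, lab y = lab z → F y → F z) → ∀ y ∈ Y, ∀ z ∈ Y, F y → F z)
    {τ : Fin N → Perm X} (hτ : ∀ t, (τ t).cycleType = {k}) (hp : (List.ofFn τ).prod = rest π Y b)
    (htr : Trans (Fin.cons (firstFactor π Y b) τ : Fin (N + 1) → Perm X))
    (hN : (N + 1) * (k - 1) + 2 = Fintype.card X + Fintype.card I) :
    #(Y.image lab) + Fintype.card W = k + 1 ∧
      Module.finrank ℚ (invFun (Set.range τ)) = Fintype.card W := by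
  have hsc := cyc_of_cycleType hs
  have hY : Y.Nonempty := by
    rw [← card_pos, ← hsY]; omega
  have h1 := cyc_rest hl hls hb hw fun w => ⟨r w, hr w⟩
  have h2 := genus_bound_cut hl hls hb hY hw (fun w => ⟨r w, hr w⟩) hconn
  have h3 := genus_bound_kCycles hτ
  -- every orbit of the remaining factors meets `Y`
  have h4 : Module.finrank ℚ (invFun (Set.range τ)) ≤ Fintype.card W := by
    let L : invFun (Set.range τ) →ₗ[ℚ] (W → ℚ) :=
      { toFun := fun f w => f.1 (r w)
        map_add' := fun _ _ => rfl
        map_smul' := fun _ _ => rfl }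
    have hL : Function.Injective L := by
      rw [← LinearMap.ker_eq_bot, LinearMap.ker_eq_bot']
      exact fun f hf => Subtype.ext (invFun_eq_zero hb hw hsY hp htr hY f.2 hr (congrFun hf))
    have := LinearMap.finrank_le_finrank_of_injective hL
    rwa [Module.finrank_fintype_fun_eq_card] at this
  rw [hp] at h3
  have h5 : (N + 1) * (k - 1) = N * (k - 1) + (k - 1) := by ring
  omega

theorem cutMap_of_mem {A : I → Option W} (hA : ∀ i, A i = none ↔ i ∈ Y.image lab) {y : X}
    (hy : y ∈ Y) : cutMap π lab Y wh A y = wh y := by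
  rw [cutMap, (hA _).2 (mem_image_of_mem _ hy), base_of_mem hy]
  rfl

/-- In a transitive factorisation of genus zero, the remaining factors generate a group with
exactly one orbit for each cycle of `rest π Y b` that meets `Y`. -/
theorem exists_mem_fibSet (hl : ∀ x y, lab x = lab y ↔ π.SameCycle x y)
    (hls : Function.Surjective lab) (hb : b.support ⊆ Y)
    (hw : ∀ y ∈ Y, ∀ z ∈ Y, wh y = wh z ↔ b.SameCycle y z) {r : W → X}
    (hr : ∀ w, r w ∈ Y ∧ wh (r w) = w) {k N : ℕ}
    (hsY : (firstFactor π Y b).support = Y) (hY : Y.Nonempty)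
    {τ : Fin N → Perm X} (hτ : ∀ t, (τ t).cycleType = {k}) (hp : (List.ofFn τ).prod = rest π Y b)
    (htr : Trans (Fin.cons (firstFactor π Y b) τ : Fin (N + 1) → Perm X))
    (hrk : Module.finrank ℚ (invFun (Set.range τ)) = Fintype.card W) :
    ∃ A : I → Option W, (∀ i, A i = none ↔ i ∈ Y.image lab) ∧
      τ ∈ fibSet k (cutMap π lab Y wh A) (rest π Y b) N := by
  let L : invFun (Set.range τ) →ₗ[ℚ] (W → ℚ) :=
    { toFun := fun f w => f.1 (r w)
      map_add' := fun _ _ => rfl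
      map_smul' := fun _ _ => rfl }
  have hL : Function.Injective L := by
    rw [← LinearMap.ker_eq_bot, LinearMap.ker_eq_bot']
    exact fun f hf => Subtype.ext (invFun_eq_zero hb hw hsY hp htr hY f.2 hr (congrFun hf))
  have hLs : Function.Surjective L :=
    (LinearMap.injective_iff_surjective_of_finrank_eq_finrank
      (by rw [hrk, Module.finrank_fintype_fun_eq_card])).1 hL
  -- By the rank condition, some invariant function `g` takes pairwise different values at the
  -- points `r w`. Its values are those at the points `r w` only, so its level map `f` to `W` is
  -- invariant and agrees with `wh` on `Y`.
  let num : W → ℚ := fun w => ((Fintype.equivFin W w : ℕ) : ℚ)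
  have hnum : Function.Injective num := fun a c h =>
    (Fintype.equivFin W).injective (Fin.ext (by simpa [num] using h))
  obtain ⟨⟨g, hg⟩, hgr⟩ := hLs num
  have hgr : ∀ w, g (r w) = num w := congrFun hgr
  have hrest : ∀ {f : X → ℚ}, f ∈ invFun (Set.range τ) → f ∈ invFun {rest π Y b} := by
    intro f hf
    rw [← hp]
    refine invFun_le_prod (fun σ hσ => invFun_le_of_mem ?_) hf
    simpa [List.mem_ofFn] using hσ
  have hgY : ∀ y ∈ Y, g y = num (wh y) := by
    intro y hy
    rw [← hgr]
    exact invFun_sameCycle (hrest hg) (rest_sameCycle_of_sameCycle hb hy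
      ((hw y hy _ (hr _).1).1 (hr _).2.symm))
  have hex : ∀ x, ∃ w, g x = num w := by
    obtain ⟨y0, hy0⟩ := hY
    intro x
    refine htr (fun x => ∃ w, g x = num w) (fun t x => ?_) y0 x ⟨_, hgY y0 hy0⟩
    refine Fin.cases ?_ (fun t => ?_) t
    · rw [Fin.cons_zero]
      by_cases hx : x ∈ Y
      · exact iff_of_true ⟨_, hgY _ (apply_mem_of_support_eq hsY hx)⟩ ⟨_, hgY _ hx⟩
      · rw [notMem_support.1 (hsY.symm ▸ hx : x ∉ (firstFactor π Y b).support)]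
    · rw [Fin.cons_succ, hg (τ t) ⟨t, rfl⟩]
  choose f hf using hex
  have hfτ : ∀ t x, f (τ t x) = f x := fun t x =>
    hnum (by rw [← hf, ← hf, hg (τ t) ⟨t, rfl⟩])
  have hfr : ∀ {x y}, (rest π Y b).SameCycle x y → f x = f y := fun h =>
    hnum (by rw [← hf, ← hf, invFun_sameCycle (hrest hg) h])
  have hfY : ∀ y ∈ Y, f y = wh y := fun y hy => hnum (by rw [← hf, hgY y hy])
  refine ⟨fun i => if i ∈ Y.image lab then none else some (f (Function.surjInv hls i)),
    fun i => by simp, ?_⟩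
  -- `f` is constant on the cycles of `rest π Y b`, hence it has the form `cutMap`.
  have hcut : cutMap π lab Y wh (fun i => if i ∈ Y.image lab then none else
      some (f (Function.surjInv hls i))) = f := by
    funext x
    by_cases hx : lab x ∈ Y.image lab
    · obtain ⟨y, hy, j, hj, rfl⟩ := exists_arc_of_lab hl hx
      rw [cutMap, if_pos hx, Option.getD_none, base_pow hy hj,
        ← hfr (rest_sameCycle_arc hb hj), hfY y hy]
    · rw [cutMap, if_neg hx, Option.getD_some]
      refine hfr ((restLabel_eq_iff (lab := lab) hl hb hw _ _).1 ?_)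
      have h1 : lab (Function.surjInv hls (lab x)) = lab x := Function.surjInv_eq hls _
      rw [restLabel, dif_neg (by rwa [h1]), restLabel, dif_neg hx]
      simp only [h1]
  rw [hcut]
  refine ⟨hτ, hp, hfτ, fun F hF x y hxy hFx => ?_⟩
  classical
  -- The indicator functions of `F ∧ f = w` and of `f = w` are proportional: both are invariant, and
  -- an invariant function is determined by its values at the points `r w`.
  let c : ℚ := if F (r (f x)) then 1 else 0
  let g1 : invFun (Set.range τ) := ⟨fun z => if F z ∧ f z = f x then 1 else 0, by
    rintro _ ⟨t, rfl⟩ z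
    simp only [hF, hfτ]⟩
  let g2 : invFun (Set.range τ) := ⟨fun z => if f z = f x then c else 0, by
    rintro _ ⟨t, rfl⟩ z
    simp only [hfτ]⟩
  have hg12 : g1 = g2 := by
    refine hL (funext fun w => ?_)
    have hfw : f (r w) = w := by rw [hfY _ (hr w).1, (hr w).2]
    show (if F (r w) ∧ f (r w) = f x then (1 : ℚ) else 0) = if f (r w) = f x then c else 0
    by_cases h : w = f x
    · subst h; simp [hfw, c]
    · simp [hfw, h]
  have h1 : (if F x ∧ f x = f x then (1 : ℚ) else 0) = if f x = f x then c else 0 :=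
    congrFun (Subtype.ext_iff.1 hg12) x
  have h2 : (if F y ∧ f y = f x then (1 : ℚ) else 0) = if f y = f x then c else 0 :=
    congrFun (Subtype.ext_iff.1 hg12) y
  rw [if_pos ⟨hFx, rfl⟩, if_pos rfl] at h1
  rw [if_pos hxy.symm, ← h1] at h2
  by_contra hFy
  simp [hFy] at h2

/-- The first factor is a cycle through points of every fibre of `cutMap`, so it joins the orbits of
the other factors. -/
theorem trans_of_mem_fibSet {k N : ℕ} {A : I → Option W}
    (hA : ∀ i, A i = none ↔ i ∈ Y.image lab) {r : W → X}
    (hr : ∀ w, r w ∈ Y ∧ wh (r w) = w) (hs : (firstFactor π Y b).cycleType = {k})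
    (hsY : (firstFactor π Y b).support = Y) {τ : Fin N → Perm X}
    (h : τ ∈ fibSet k (cutMap π lab Y wh A) (rest π Y b) N) :
    Trans (Fin.cons (firstFactor π Y b) τ : Fin (N + 1) → Perm X) := by
  obtain ⟨-, -, -, h4⟩ := h
  intro F hF x y hx
  have hs1 : (firstFactor π Y b).IsCycle := by
    rw [← card_cycleType_eq_one, hs, Multiset.card_singleton]
  have hFs : ∀ x, F (firstFactor π Y b x) ↔ F x := fun x => by simpa using hF 0 x
  have hFτ : ∀ t x, F (τ t x) ↔ F x := fun t x => by simpa using hF t.succ x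
  have hfr : ∀ w, cutMap π lab Y wh A (r w) = w := fun w => by
    rw [cutMap_of_mem hA (hr w).1, (hr w).2]
  have h5 := h4 F hFτ x (r (cutMap π lab Y wh A x)) (hfr _).symm hx
  refine h4 F hFτ (r (cutMap π lab Y wh A y)) y (hfr _) ?_
  have hmem : ∀ w, firstFactor π Y b (r w) ≠ r w := fun w => by
    rw [← mem_support, hsY]; exact (hr w).1
  have h6 := eq_of_sameCycle (f := F) (fun x => propext (hFs x))
    (hs1.sameCycle (hmem (cutMap π lab Y wh A x)) (hmem (cutMap π lab Y wh A y)))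
  rwa [← h6]

/-- The orbits of the remaining factors determine `A`, as each of them is named by the points of `Y`
in it. -/
theorem cutMap_unique {k N : ℕ} {A A' : I → Option W} {r : W → X}
    (hls : Function.Surjective lab)
    (hA : ∀ i, A i = none ↔ i ∈ Y.image lab) (hA' : ∀ i, A' i = none ↔ i ∈ Y.image lab)
    (hr : ∀ w, r w ∈ Y ∧ wh (r w) = w) {τ : Fin N → Perm X}
    (h : τ ∈ fibSet k (cutMap π lab Y wh A) (rest π Y b) N)
    (h' : τ ∈ fibSet k (cutMap π lab Y wh A') (rest π Y b) N) : A = A' := by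
  have key : ∀ x, cutMap π lab Y wh A x = cutMap π lab Y wh A' x := by
    intro x
    have h1 : cutMap π lab Y wh A (r (cutMap π lab Y wh A x)) = cutMap π lab Y wh A x := by
      rw [cutMap_of_mem hA (hr _).1, (hr _).2]
    have h2 := h.2.2.2 (fun z => cutMap π lab Y wh A' z = cutMap π lab Y wh A' x)
      (fun t z => by rw [h'.2.2.1]) x _ h1.symm rfl
    rw [← h2, cutMap_of_mem hA' (hr _).1, (hr _).2]
  funext i
  obtain ⟨x, rfl⟩ := hls i
  by_cases hx : lab x ∈ Y.image lab
  · rw [(hA _).2 hx, (hA' _).2 hx]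
  · obtain ⟨a, ha⟩ := Option.ne_none_iff_exists'.1 (fun h => hx ((hA _).1 h))
    obtain ⟨a', ha'⟩ := Option.ne_none_iff_exists'.1 (fun h => hx ((hA' _).1 h))
    have := key x
    rw [cutMap, cutMap, ha, ha'] at this
    rw [ha, ha']
    exact congrArg some this

/-- The factorisations with a given first factor, sorted by the orbits of the other factors. -/
theorem card_trans_cons (hl : ∀ x y, lab x = lab y ↔ π.SameCycle x y)
    (hls : Function.Surjective lab) (hb : b.support ⊆ Y)
    (hw : ∀ y ∈ Y, ∀ z ∈ Y, wh y = wh z ↔ b.SameCycle y z) (hws : ∀ w, ∃ y ∈ Y, wh y = w)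
    {k N : ℕ} (hk : 2 ≤ k)
    (hs : (firstFactor π Y b).cycleType = {k}) (hsY : (firstFactor π Y b).support = Y)
    (hconn : ∀ F : X → Prop, (∀ y ∈ Y, F (b y) ↔ F y) →
      (∀ y ∈ Y, ∀ z ∈ Y, lab y = lab z → F y → F z) → ∀ y ∈ Y, ∀ z ∈ Y, F y → F z)
    (hN : (N + 1) * (k - 1) + 2 = Fintype.card X + Fintype.card I) :
    Nat.card {τ : Fin N → Perm X // (∀ t, (τ t).cycleType = {k}) ∧
      (List.ofFn τ).prod = rest π Y b ∧
      Trans (Fin.cons (firstFactor π Y b) τ : Fin (N + 1) → Perm X)} =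
    ∑ A : {A : I → Option W // ∀ i, A i = none ↔ i ∈ Y.image lab},
      Nat.card (fibSet k (cutMap π lab Y wh A.1) (rest π Y b) N) := by
  choose r hr using hws
  have hY : Y.Nonempty := by
    rw [← card_pos, ← hsY, (cyc_of_cycleType hs).2]; omega
  rw [← Nat.card_sigma]
  refine (Nat.card_congr (Equiv.ofBijective
    (fun p => ⟨p.2.1, p.2.2.1, p.2.2.2.1, trans_of_mem_fibSet p.1.2 hr hs hsY p.2.2⟩)
    ⟨?_, ?_⟩)).symm
  · rintro ⟨A, τ, hτ⟩ ⟨A', τ', hτ'⟩ h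
    obtain rfl : τ = τ' := congrArg Subtype.val h
    obtain rfl : A = A' := Subtype.ext (cutMap_unique hls A.2 A'.2 hr hτ hτ')
    rfl
  · rintro ⟨τ, h1, h2, h3⟩
    have h4 := card_white_of_trans hl hls hb hw hr hk hs hsY hconn h1 h2 h3 hN
    obtain ⟨A, hA, hAτ⟩ := exists_mem_fibSet hl hls hb hw hr hsY hY h1 h2 h3 h4.2
    exact ⟨⟨⟨A, hA⟩, τ, hAτ⟩, rfl⟩

end Components

/-! ### Shuffles of factorisations -/

section Shuffle

/-- Factors equal to `1` can be left out of a product. -/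
theorem prod_ofFn_eq_of_eq_one {M : Type} [Monoid M] {N : ℕ} (J : Finset (Fin N)) (g : Fin N → M)
    (h : ∀ t ∉ J, g t = 1) :
    (List.ofFn g).prod = (List.ofFn fun i => g (J.orderEmbOfFin rfl i)).prod := by
  have h1 : ∀ l : List (Fin N), (l.map g).prod = ((l.filter (· ∈ J)).map g).prod := by
    intro l
    induction l with
    | nil => rfl
    | cons a l ih =>
      by_cases ha : a ∈ J
      · simp [ha, ih]
      · simp [ha, ih, h a ha]
  have h2 : (List.finRange N).filter (· ∈ J) = List.ofFn (J.orderEmbOfFin rfl) := by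
    refine List.SortedLT.eq_of_mem_iff ?_ ?_ fun a => ?_
    · rw [List.sortedLT_iff_pairwise]
      exact (List.sortedLT_iff_pairwise.1 (List.sortedLT_finRange N)).filter _
    · rw [List.sortedLT_ofFn_iff]
      exact (J.orderEmbOfFin rfl).strictMono
    · rw [List.mem_ofFn]
      simp only [List.mem_filter, List.mem_finRange, true_and, decide_eq_true_eq]
      exact (Set.ext_iff.1 (range_orderEmbOfFin J rfl) a).symm
  have h3 := h1 (List.finRange N)
  rw [h2, List.map_ofFn] at h3
  rw [List.ofFn_eq_map, h3]
  rfl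

/-- The number of maps with fibres of given sizes is a multinomial coefficient. -/
theorem card_fibres_mul {W : Type} [Fintype W] [DecidableEq W] {N : ℕ} (μ : W → ℕ)
    (hμ : ∑ w, μ w = N) :
    #{κ : Fin N → W | ∀ w, #{t | κ t = w} = μ w} * ∏ w, (μ w)! = N ! := by
  -- Compare coefficients in the expansion of `(∑ w, X w) ^ N`.
  have h1 := Finset.sum_pow' (univ : Finset W) (fun w => (MvPolynomial.X w : MvPolynomial W ℕ)) N
  rw [sum_pow_eq_sum_piAntidiag] at h1
  have hX : ∀ k : W → ℕ, (∏ w, (MvPolynomial.X w : MvPolynomial W ℕ) ^ k w) =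
      MvPolynomial.monomial (Finsupp.equivFunOnFinite.symm k) 1 := by
    intro k
    rw [MvPolynomial.monomial_eq, Finsupp.prod_fintype _ _ fun _ => by simp]
    simp
  have h2 := congrArg (MvPolynomial.coeff (Finsupp.equivFunOnFinite.symm μ)) h1
  have hp : ∀ p : Fin N → W, (∏ i, (MvPolynomial.X (p i) : MvPolynomial W ℕ)) =
      MvPolynomial.monomial (Finsupp.equivFunOnFinite.symm fun w => #{t | p t = w}) 1 := by
    intro p
    rw [← hX, ← prod_fiberwise_of_maps_to (g := p) (t := univ) fun _ _ => mem_univ _]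
    refine prod_congr rfl fun w _ => ?_
    rw [prod_congr rfl fun i hi => by rw [(mem_filter.1 hi).2], prod_const]
  simp only [hX, hp, MvPolynomial.coeff_sum, MvPolynomial.coeff_monomial, Fintype.piFinset_univ,
    EmbeddingLike.apply_eq_iff_eq] at h2
  have h3 : ∀ k : W → ℕ, MvPolynomial.coeff (Finsupp.equivFunOnFinite.symm μ)
      ((Nat.multinomial univ k : MvPolynomial W ℕ) *
        MvPolynomial.monomial (Finsupp.equivFunOnFinite.symm k) 1) =
      if k = μ then Nat.multinomial univ k else 0 := by
    intro k
    rw [← map_natCast (MvPolynomial.C (σ := W) (R := ℕ)), MvPolynomial.coeff_C_mul,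
      MvPolynomial.coeff_monomial]
    simp
  simp only [h3] at h2
  rw [sum_ite_eq', if_pos (by simp [hμ])] at h2
  have h4 := Nat.multinomial_spec univ μ
  rw [hμ] at h4
  rw [← h4, h2, mul_comm, sum_boole]
  rw [Nat.cast_id]
  congr 1
  exact card_bij (fun κ _ => κ) (fun κ hκ => by simpa [funext_iff] using hκ) (fun _ _ _ _ h => h)
    fun κ hκ => ⟨κ, by simpa [funext_iff] using hκ, rfl⟩

section Insert

variable {Z : Type} [Fintype Z] [DecidableEq Z]

/-- The factorisations of `π` with factors `1` outside of `J`. -/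
def factSetOn (k : ℕ) (π : Perm Z) {N : ℕ} (J : Finset (Fin N)) : Set (Fin N → Perm Z) :=
  {θ | (∀ t, if t ∈ J then (θ t).cycleType = {k} else θ t = 1) ∧ (List.ofFn θ).prod = π ∧ Trans θ}

/-- Inserting factors `1` at the positions outside of `J`. -/
theorem card_factSetOn (k : ℕ) (π : Perm Z) {N : ℕ} (J : Finset (Fin N)) :
    Nat.card (factSetOn k π J) = cntF k π #J := by
  have hmem : ∀ i, J.orderEmbOfFin rfl i ∈ J := orderEmbOfFin_mem J rfl
  have hex : ∀ t ∈ J, ∃ i, J.orderEmbOfFin rfl i = t := fun t ht => by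
    have : t ∈ Set.range (J.orderEmbOfFin rfl) := by rw [range_orderEmbOfFin]; exact ht
    exact this
  refine Nat.card_congr (Equiv.ofBijective
    (fun θ => ⟨fun i => θ.1 (J.orderEmbOfFin rfl i), fun i => ?_, ?_, ?_⟩) ⟨?_, ?_⟩)
  · have := θ.2.1 (J.orderEmbOfFin rfl i)
    rwa [if_pos (hmem i)] at this
  · rw [← prod_ofFn_eq_of_eq_one J, θ.2.2.1]
    intro t ht
    have := θ.2.1 t
    rwa [if_neg ht] at this
  · intro F hF
    refine θ.2.2.2 F fun t x => ?_
    by_cases ht : t ∈ J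
    · obtain ⟨i, rfl⟩ := hex t ht
      exact hF i x
    · have := θ.2.1 t
      rw [if_neg ht] at this
      rw [this, Perm.one_apply]
  · rintro ⟨θ, hθ⟩ ⟨θ', hθ'⟩ h
    refine Subtype.ext (funext fun t => ?_)
    by_cases ht : t ∈ J
    · obtain ⟨i, rfl⟩ := hex t ht
      exact congrFun (Subtype.ext_iff.1 h) i
    · have h1 := hθ.1 t
      have h2 := hθ'.1 t
      rw [if_neg ht] at h1 h2
      simp only [h1, h2]
  · rintro ⟨σ, h1, h2, h3⟩
    let θ : Fin N → Perm Z := fun t =>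
      if ht : t ∈ J then σ ((J.orderIsoOfFin rfl).symm ⟨t, ht⟩) else 1
    have hθ : ∀ i, θ (J.orderEmbOfFin rfl i) = σ i := by
      intro i
      simp only [θ, dif_pos (hmem i)]
      congr 1
      rw [OrderIso.symm_apply_eq]
      exact Subtype.ext (coe_orderIsoOfFin_apply _ _ _).symm
    refine ⟨⟨θ, fun t => ?_, ?_, ?_⟩, Subtype.ext (funext hθ)⟩
    · split_ifs with ht
      · obtain ⟨i, rfl⟩ := hex t ht
        rw [hθ, h1]
      · simp [θ, ht]
    · rw [prod_ofFn_eq_of_eq_one J, ← h2]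
      · simp only [hθ]
      · intro t ht
        simp [θ, ht]
    · intro F hF
      exact h3 F fun i x => by rw [← hθ]; exact hF _ x

end Insert

section Fibres

variable {X : Type} [Fintype X] [DecidableEq X] {W : Type} [Fintype W] [DecidableEq W]

/-- The restriction of `ρ` to a fibre of a map that it leaves invariant. -/
def fibPerm (f : X → W) (ρ : Perm X) (h : ∀ x, f (ρ x) = f x) (w : W) : Perm {x // f x = w} :=
  ρ.subtypePerm fun x => by rw [h]

/-- Permutations of the fibres of a map, put together. -/
def assemble (f : X → W) : (∀ w, Perm {x // f x = w}) →* Perm X :=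
  ((sigmaFiberEquiv f).permCongrHom : _ →* Perm X).comp (sigmaCongrRightHom _)

theorem assemble_apply (f : X → W) (θ : ∀ w, Perm {x // f x = w}) (x : X) :
    assemble f θ x = (θ (f x) ⟨x, rfl⟩).1 := rfl

theorem assemble_apply' (f : X → W) (θ : ∀ w, Perm {x // f x = w}) {w : W} {x : X} (h : f x = w) :
    assemble f θ x = (θ w ⟨x, h⟩).1 := by subst h; rfl

theorem assemble_inv (f : X → W) (θ : ∀ w, Perm {x // f x = w}) (x : X) :
    f (assemble f θ x) = f x := (θ (f x) ⟨x, rfl⟩).2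

theorem assemble_injective (f : X → W) : Function.Injective (assemble f) := by
  intro θ θ' h
  funext w
  ext ⟨x, hx⟩
  rw [← assemble_apply' f θ hx, ← assemble_apply' f θ' hx, h]

theorem assemble_fibPerm (f : X → W) (ρ : Perm X) (h : ∀ x, f (ρ x) = f x) :
    assemble f (fibPerm f ρ h) = ρ := by
  ext x; rfl

theorem cycleType_assemble (f : X → W) (θ : ∀ w, Perm {x // f x = w}) {w0 : W}
    (h : ∀ w ≠ w0, θ w = 1) : (assemble f θ).cycleType = (θ w0).cycleType := by
  rw [← cycleType_ofSubtype]
  congr 1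
  ext x
  by_cases hx : f x = w0
  · rw [assemble_apply' f θ hx, ofSubtype_apply_of_mem (θ w0) hx]
  · rw [assemble_apply, h _ hx, ofSubtype_apply_of_not_mem (θ w0) hx]
    rfl

theorem prod_ofFn_assemble (f : X → W) {N : ℕ} (θ : Fin N → ∀ w, Perm {x // f x = w}) :
    (List.ofFn fun t => assemble f (θ t)).prod =
      assemble f fun w => (List.ofFn fun t => θ t w).prod := by
  have h1 : (fun w => (List.ofFn fun t => θ t w).prod) = (List.ofFn θ).prod := by
    funext w
    have := map_list_prod (Pi.evalMonoidHom (fun w => Perm {x // f x = w}) w) (List.ofFn θ)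
    rw [List.map_ofFn] at this
    exact this.symm
  rw [h1, map_list_prod, List.map_ofFn]
  rfl

/-- Transitive factorisations on the fibres, at complementary sets of positions, form a
factorisation. -/
theorem assemble_mem_fibSet (k : ℕ) (f : X → W) (ρ : Perm X) (h : ∀ x, f (ρ x) = f x) {N : ℕ}
    (κ : Fin N → W)
    (θ : ∀ w, factSetOn k (fibPerm f ρ h w) (univ.filter fun t => κ t = w)) :
    (fun t => assemble f fun w => (θ w).1 t) ∈ fibSet k f ρ N := by
  refine ⟨fun t => ?_, ?_, fun t x => assemble_inv _ _ _, ?_⟩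
  · rw [cycleType_assemble f _ (w0 := κ t)]
    · have := (θ (κ t)).2.1 t
      rwa [if_pos (by simp)] at this
    · intro w hw
      have := (θ w).2.1 t
      rwa [if_neg (by simpa using hw.symm)] at this
  · rw [prod_ofFn_assemble]
    conv_rhs => rw [← assemble_fibPerm f ρ h]
    congr 1
    funext w
    exact (θ w).2.2.1
  · intro F hF x y hxy hx
    have := (θ (f y)).2.2.2 (fun z => F z.1) (fun t z => by
      have := hF t z.1
      rwa [assemble_apply' f _ z.2] at this) ⟨x, hxy⟩ ⟨y, rfl⟩ hx
    exact this

/-- A factorisation whose orbits are the fibres of `f` is a shuffle of transitive factorisations on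
the fibres. -/
theorem card_fibSet (k : ℕ) (f : X → W) (ρ : Perm X) (h : ∀ x, f (ρ x) = f x) (N : ℕ) :
    Nat.card (fibSet k f ρ N) =
      ∑ κ : Fin N → W, ∏ w, cntF k (fibPerm f ρ h w) #{t | κ t = w} := by
  have h0 : ∀ κ : Fin N → W, ∏ w, cntF k (fibPerm f ρ h w) #{t | κ t = w} =
      Nat.card (∀ w, factSetOn k (fibPerm f ρ h w) (univ.filter fun t => κ t = w)) := by
    intro κ
    rw [Nat.card_pi]
    exact prod_congr rfl fun w _ => (card_factSetOn _ _ _).symm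
  rw [sum_congr rfl fun κ _ => h0 κ, ← Nat.card_sigma]
  refine (Nat.card_congr (Equiv.ofBijective
    (fun p => ⟨_, assemble_mem_fibSet k f ρ h p.1 p.2⟩) ⟨?_, ?_⟩)).symm
  · rintro ⟨κ, θ⟩ ⟨κ', θ'⟩ hθ
    have hθ : ∀ t, (assemble f fun w => (θ w).1 t) = assemble f fun w => (θ' w).1 t :=
      congrFun (Subtype.ext_iff.1 hθ)
    have hθ : ∀ t w, (θ w).1 t = (θ' w).1 t := fun t => congrFun (assemble_injective f (hθ t))
    obtain rfl : κ = κ' := by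
      funext t
      by_contra hne
      have h1 := (θ (κ t)).2.1 t
      have h2 := (θ' (κ t)).2.1 t
      rw [if_pos (by simp)] at h1
      rw [if_neg (by simpa using fun h => hne h.symm), ← hθ] at h2
      rw [h2, cycleType_one] at h1
      exact absurd h1 (by simp)
    congr 1
    funext w
    exact Subtype.ext (funext fun t => hθ t w)
  · rintro ⟨τ, h1, h2, h3, h4⟩
    have hcyc : ∀ t, (τ t).IsCycle := fun t => by
      rw [← card_cycleType_eq_one, h1, Multiset.card_singleton]
    -- a cycle that leaves `f` invariant moves points of one fibre only
    choose x0 hx0 using fun t => (hcyc t).nonempty_support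
    have hone : ∀ t w, f (x0 t) ≠ w → fibPerm f (τ t) (h3 t) w = 1 := by
      intro t w hw
      ext ⟨x, hx⟩
      by_contra hne
      refine hw (hx ▸ ?_)
      exact eq_of_sameCycle (f := f) (h3 t) ((hcyc t).sameCycle (mem_support.1 (hx0 t)) hne)
    refine ⟨⟨fun t => f (x0 t), fun w => ⟨fun t => fibPerm f (τ t) (h3 t) w, fun t => ?_, ?_, ?_⟩⟩,
      ?_⟩
    · split_ifs with ht
      · have ht : f (x0 t) = w := by simpa using ht
        rw [← h1 t]
        subst ht
        conv_rhs => rw [← assemble_fibPerm f (τ t) (h3 t)]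
        exact (cycleType_assemble f _ fun w hw => hone t w hw.symm).symm
      · exact hone t w (by simpa using ht)
    · have h5 : assemble f (fun w => (List.ofFn fun t => fibPerm f (τ t) (h3 t) w).prod) =
          assemble f (fibPerm f ρ h) := by
        rw [← prod_ofFn_assemble f fun t w => fibPerm f (τ t) (h3 t) w, assemble_fibPerm, ← h2]
        rfl
      exact congrFun (assemble_injective f h5) w
    · intro F hF x y hx
      have := h4 (fun z => ∃ h : f z = w, F ⟨z, h⟩) (fun t z => ?_) x.1 y.1
        (by rw [x.2, y.2]) ⟨x.2, hx⟩
      · exact this.2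
      · refine ⟨fun ⟨h5, h6⟩ => ?_, fun ⟨h5, h6⟩ => ?_⟩
        · have h7 : f z = w := by rw [← h3 t, h5]
          exact ⟨h7, (hF t ⟨z, h7⟩).1 h6⟩
        · exact ⟨by rw [h3 t, h5], (hF t ⟨z, h5⟩).2 h6⟩
    · exact Subtype.ext (funext fun t => assemble_fibPerm f (τ t) (h3 t))

theorem cyc_eq_sum_fibPerm (f : X → W) (ρ : Perm X) (h : ∀ x, f (ρ x) = f x) :
    cyc ρ = ∑ w, cyc (fibPerm f ρ h w) := by
  let L : (∀ w, invFun {fibPerm f ρ h w}) →ₗ[ℚ] invFun {ρ} :=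
    { toFun := fun g => ⟨fun x => (g (f x)).1 ⟨x, rfl⟩, mem_invFun_singleton.2 fun x => by
        have h1 := mem_invFun_singleton.1 (g (f x)).2 ⟨x, rfl⟩
        rw [← h1]
        have : ∀ (w : W) (hw : f (ρ x) = w), (g (f (ρ x))).1 ⟨ρ x, rfl⟩ = (g w).1 ⟨ρ x, hw⟩ := by
          rintro w rfl; rfl
        exact this _ (h x)⟩
      map_add' := fun _ _ => rfl
      map_smul' := fun _ _ => rfl }
  have hL : Function.Bijective L := by
    constructor
    · intro g g' hg
      funext w
      ext ⟨x, hx⟩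
      subst hx
      exact congrFun (Subtype.ext_iff.1 hg) x
    · rintro ⟨g, hg⟩
      refine ⟨fun w => ⟨fun x => g x.1, mem_invFun_singleton.2 fun x => ?_⟩, rfl⟩
      exact mem_invFun_singleton.1 hg x.1
  rw [cyc, ← (LinearEquiv.ofBijective L hL).finrank_eq, Module.finrank_pi_fintype]
  rfl

theorem cyc_pos [Nonempty X] (ρ : Perm X) : 0 < cyc ρ := by
  rw [cyc_eq_card_of_label _ (label_surjective ρ) (label_eq_iff ρ), Fintype.card_pos_iff]
  exact ⟨label ρ (Classical.arbitrary X)⟩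

theorem exists_of_wt_ne_zero {k : ℕ} [Nonempty X] {ρ : Perm X} (h : wt k ρ ≠ 0) :
    ∃ a, a * (k - 1) + 2 = Fintype.card X + cyc ρ := by
  have h2 := cyc_pos ρ
  have h3 : 0 < Fintype.card X := Fintype.card_pos
  rw [wt] at h
  split_ifs at h with hd
  · obtain ⟨a, ha⟩ := hd
    refine ⟨a, ?_⟩
    rw [mul_comm]
    omega
  · exact absurd rfl h

/-- If the orbits are the fibres of `f` and the number of factors is as small as the genus inequality
permits, then it is so on each fibre. -/
theorem card_fibSet_eq {k : ℕ} (hk : 2 ≤ k) {f : X → W} (hf : Function.Surjective f) {ρ : Perm X}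
    (h : ∀ x, f (ρ x) = f x) {N : ℕ}
    (hN : N * (k - 1) + 2 * Fintype.card W = Fintype.card X + cyc ρ) :
    (Nat.card (fibSet k f ρ N) : ℚ) = N ! * ∏ w, wt k (fibPerm f ρ h w) := by
  have hX : Fintype.card X = ∑ w, Fintype.card {x // f x = w} := by
    rw [← Fintype.card_sigma, Fintype.card_congr (sigmaFiberEquiv f)]
  have hk0 : 0 < k - 1 := by omega
  -- a distribution of the factors with non-zero count is balanced on every fibre
  have hbal : ∀ κ : Fin N → W, ∏ w, cntF k (fibPerm f ρ h w) #{t | κ t = w} ≠ 0 →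
      ∀ w, #{t | κ t = w} * (k - 1) + 2 =
        Fintype.card {x // f x = w} + cyc (fibPerm f ρ h w) := by
    intro κ hκ w
    have h1 : ∀ w ∈ univ, Fintype.card {x // f x = w} + cyc (fibPerm f ρ h w) ≤
        #{t | κ t = w} * (k - 1) + 2 := fun w hw =>
      le_of_cntF_ne_zero (prod_ne_zero_iff.1 hκ w hw)
    have h2 : ∑ w, (Fintype.card {x // f x = w} + cyc (fibPerm f ρ h w)) =
        ∑ w, (#{t | κ t = w} * (k - 1) + 2) := by
      rw [sum_add_distrib, ← hX, ← cyc_eq_sum_fibPerm, ← hN, sum_add_distrib, ← sum_mul,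
        ← card_eq_sum_card_fiberwise fun _ _ => mem_univ _]
      simp [mul_comm]
    exact ((sum_eq_sum_iff_of_le h1).1 h2 w (mem_univ w)).symm
  rw [card_fibSet k f ρ h]
  -- `μ w` is the number of factors that genus zero requires on the fibre of `w`
  by_cases hex : ∃ μ : W → ℕ, ∀ w, μ w * (k - 1) + 2 =
      Fintype.card {x // f x = w} + cyc (fibPerm f ρ h w)
  · obtain ⟨μ, hμ⟩ := hex
    have hsum : ∑ w, μ w = N := by
      have : (∑ w, μ w) * (k - 1) = N * (k - 1) := by
        have : ∑ w, (μ w * (k - 1) + 2) = N * (k - 1) + 2 * Fintype.card W := by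
          rw [hN, sum_congr rfl fun w _ => hμ w, sum_add_distrib, ← hX, ← cyc_eq_sum_fibPerm]
        rw [sum_add_distrib, ← sum_mul] at this
        simp only [sum_const, card_univ, smul_eq_mul] at this
        omega
      exact Nat.eq_of_mul_eq_mul_right hk0 this
    have h1 : ∑ κ : Fin N → W, ∏ w, cntF k (fibPerm f ρ h w) #{t | κ t = w} =
        #{κ : Fin N → W | ∀ w, #{t | κ t = w} = μ w} * ∏ w, cntF k (fibPerm f ρ h w) (μ w) := by
      rw [← sum_filter_add_sum_filter_not univ fun κ : Fin N → W => ∀ w, #{t | κ t = w} = μ w,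
        sum_congr rfl fun κ hκ => prod_congr rfl fun w _ => by rw [(mem_filter.1 hκ).2 w],
        sum_const, smul_eq_mul, sum_eq_zero, add_zero]
      intro κ hκ
      by_contra hne
      refine (mem_filter.1 hκ).2 fun w => ?_
      have := hbal κ hne w
      rw [← hμ w] at this
      exact Nat.eq_of_mul_eq_mul_right hk0 (by omega)
    rw [h1, ← card_fibres_mul μ hsum]
    push_cast
    rw [mul_assoc, ← prod_mul_distrib]
    congr 1
    refine prod_congr rfl fun w _ => ?_
    rw [wt_eq hk (hμ w)]
    field_simp
  · push Not at hex
    rw [sum_eq_zero]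
    · obtain ⟨w, hw⟩ : ∃ w, wt k (fibPerm f ρ h w) = 0 := by
        by_contra! hne
        have : ∀ w, ∃ a, a * (k - 1) + 2 =
            Fintype.card {x // f x = w} + cyc (fibPerm f ρ h w) := by
          intro w
          obtain ⟨x, hx⟩ := hf w
          have : Nonempty {x // f x = w} := ⟨⟨x, hx⟩⟩
          exact exists_of_wt_ne_zero (hne w)
        choose μ hμ using this
        obtain ⟨w, hw⟩ := hex μ
        exact hw (hμ w)
      rw [prod_eq_zero (mem_univ w) hw]
      simp
    · intro κ _
      by_contra hne
      obtain ⟨w, hw⟩ := hex fun w => #{t | κ t = w}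
      exact hw (hbal κ hne w)

end Fibres

end Shuffle

/-! ### The recursion -/

section Recursion

/-- The value of `wt k` at the permutations with the given multiset of cycle lengths. -/
def wtM (k : ℕ) (M : Multiset ℕ) : ℚ :=
  open Classical in
  if h : ∃ p : Σ n, Perm (Fin n), p.2.partition.parts = M then wt k h.choose.2 else 0

theorem wtM_nonneg (k : ℕ) (M : Multiset ℕ) : 0 ≤ wtM k M := by
  rw [wtM]; split_ifs
  · exact wt_nonneg _ _
  · exact le_rfl

variable {X : Type} [Fintype X] [DecidableEq X]

theorem wt_congr {X' : Type} [Fintype X'] [DecidableEq X'] (k : ℕ) {π : Perm X} {π' : Perm X'}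
    (h : π.partition.parts = π'.partition.parts) : wt k π = wt k π' := by
  have h1 : Fintype.card X = Fintype.card X' := by
    rw [← π.partition.parts_sum, h, π'.partition.parts_sum]
  have h2 : cyc π = cyc π' := by rw [← card_parts_partition, h, card_parts_partition]
  rw [wt, wt, h1, h2, cntF_congr k h]

theorem wt_eq_wtM (k : ℕ) (π : Perm X) : wt k π = wtM k π.partition.parts := by
  have h : ∃ p : Σ n, Perm (Fin n), p.2.partition.parts = π.partition.parts := by
    let e := Fintype.equivFin X
    refine ⟨⟨_, e.permCongr π⟩, ?_⟩
    rw [parts_partition, parts_partition, cycleType_permCongr, Fintype.card_fin, ← sum_cycleType,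
      cycleType_permCongr, sum_cycleType]
  rw [wtM, dif_pos h]
  exact wt_congr k h.choose_spec.symm

variable {I : Type} [Fintype I] [DecidableEq I] {π : Perm X} {lab : X → I} {Y : Finset X}
  {b : Perm X}

section Fibre

variable {W : Type} [Fintype W] [DecidableEq W] {wh : X → W} {A : I → Option W}

/-- `cutMap` depends only on the cycle of `rest π Y b` on which a point lies. -/
theorem cutMap_eq_restLabel (hA : ∀ i, A i = none ↔ i ∈ Y.image lab) (x : X) :
    some (cutMap π lab Y wh A x) =
      (restLabel π lab Y wh x).elim (fun w => some w) fun i => A i.1 := by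
  by_cases hx : lab x ∈ Y.image lab
  · rw [cutMap, restLabel, dif_pos hx, (hA _).2 hx]; rfl
  · obtain ⟨a, ha⟩ := Option.ne_none_iff_exists'.1 fun h => hx ((hA _).1 h)
    rw [restLabel, dif_neg hx, cutMap, ha]
    simp [ha]

theorem cutMap_rest (hl : ∀ x y, lab x = lab y ↔ π.SameCycle x y) (hb : b.support ⊆ Y)
    (hw : ∀ y ∈ Y, ∀ z ∈ Y, wh y = wh z ↔ b.SameCycle y z)
    (hA : ∀ i, A i = none ↔ i ∈ Y.image lab) (x : X) :
    cutMap π lab Y wh A (rest π Y b x) = cutMap π lab Y wh A x := by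
  refine Option.some_injective _ ?_
  rw [cutMap_eq_restLabel hA, cutMap_eq_restLabel hA, (restLabel_eq_iff hl hb hw _ _).2]
  exact sameCycle_apply_left.2 (SameCycle.refl _ _)

/-- The cycle lengths on a component: the cycle that meets `Y`, and the cycles of `π` that are
assigned to the component. -/
theorem parts_fibPerm_cutMap (hl : ∀ x y, lab x = lab y ↔ π.SameCycle x y)
    (hls : Function.Surjective lab) (hb : b.support ⊆ Y)
    (hw : ∀ y ∈ Y, ∀ z ∈ Y, wh y = wh z ↔ b.SameCycle y z) (hws : ∀ w, ∃ y ∈ Y, wh y = w)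
    (hA : ∀ i, A i = none ↔ i ∈ Y.image lab) (w : W) :
    (fibPerm (cutMap π lab Y wh A) (rest π Y b) (cutMap_rest hl hb hw hA) w).partition.parts =
      (∑ y ∈ Y with wh y = w, gap π Y y) ::ₘ
        (univ.filter fun i => A i = some w).val.map fun i => #{x | lab x = i} := by
  set f := cutMap π lab Y wh A with hf
  -- Label the cycles on the component: `none` for the cycle that meets `Y`, and `some j` for the
  -- cycles of `π` that are assigned to the component.
  let J := {i // i ∈ univ.filter fun i => A i = some w}
  have hJ : ∀ x : {x // f x = w}, lab x.1 ∉ Y.image lab →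
      lab x.1 ∈ univ.filter fun i => A i = some w := by
    rintro ⟨x, hx⟩ h
    have := cutMap_eq_restLabel (π := π) (wh := wh) hA x
    rw [restLabel, dif_neg h, ← hf, hx] at this
    simpa using this.symm
  let labJ : {x // f x = w} → Option J := fun x =>
    if h : lab x.1 ∈ Y.image lab then none else some ⟨lab x.1, hJ x h⟩
  have hnone : ∀ x, labJ x = none ↔ lab x.1 ∈ Y.image lab := by
    intro x
    simp only [labJ]
    split_ifs with h <;> simp [h]
  have hsome : ∀ x j, labJ x = some j ↔ lab x.1 = j.1 := by
    intro x j
    have hj : j.1 ∉ Y.image lab := fun h => by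
      have h1 := (hA j.1).2 h
      have h2 := (mem_filter.1 j.2).2
      rw [h1] at h2
      exact absurd h2 (by simp)
    simp only [labJ]
    split_ifs with h
    · simp only [false_iff]
      exact fun h' => hj (h' ▸ h)
    · rw [Option.some.injEq, ← Subtype.coe_inj]
  have hfl : ∀ x, lab x ∈ Y.image lab → f x = wh (base π Y x) := by
    intro x hx
    rw [hf, cutMap, (hA _).2 hx]; rfl
  have hfn : ∀ x w, A (lab x) = some w → f x = w := by
    intro x w hx
    rw [hf, cutMap, hx]; rfl
  have hker : ∀ x y, labJ x = labJ y ↔ (fibPerm f (rest π Y b)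
      (cutMap_rest hl hb hw hA) w).SameCycle x y := by
    intro x y
    rw [fibPerm, sameCycle_subtypePerm, ← restLabel_eq_iff hl hb hw]
    rcases hy : labJ y with _ | j
    · rw [hnone]
      rw [hnone] at hy
      constructor
      · intro hx
        rw [restLabel, dif_pos hx, restLabel, dif_pos hy, ← hfl _ hx, ← hfl _ hy, x.2, y.2]
      · intro h
        by_contra hx
        rw [restLabel, dif_neg hx, restLabel, dif_pos hy] at h
        exact absurd h (by simp)
    · rw [hsome]
      rw [hsome] at hy
      have hy' : lab y.1 ∉ Y.image lab := fun h => by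
        have h1 := (hnone y).2 h
        rw [(hsome y j).2 hy] at h1
        exact absurd h1 (by simp)
      rw [← hy]
      constructor
      · intro h
        have hx' : lab x.1 ∉ Y.image lab := h ▸ hy'
        rw [restLabel, dif_neg hx', restLabel, dif_neg hy']
        simp only [h]
      · intro h
        by_cases hx : lab x.1 ∈ Y.image lab
        · rw [restLabel, dif_pos hx, restLabel, dif_neg hy'] at h
          exact absurd h (by simp)
        · rw [restLabel, dif_neg hx, restLabel, dif_neg hy'] at h
          simpa using h
  have hsurj : Function.Surjective labJ := by
    rintro (_ | j)
    · obtain ⟨y, hy, hyw⟩ := hws w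
      have h1 := mem_image_of_mem lab hy
      exact ⟨⟨y, by rw [hfl _ h1, base_of_mem hy, hyw]⟩, (hnone _).2 h1⟩
    · obtain ⟨x, hx⟩ := hls j.1
      exact ⟨⟨x, hfn x w (by rw [hx]; exact (mem_filter.1 j.2).2)⟩, (hsome _ _).2 hx⟩
  rw [parts_partition_eq hsurj hker]
  have hcn : #{x | labJ x = none} = ∑ y ∈ Y with wh y = w, gap π Y y := by
    rw [sum_congr rfl fun y hy => (card_base_eq (mem_filter.1 hy).1).symm, ← card_biUnion]
    · refine card_bij (fun x _ => x.1) (fun x hx => ?_) (fun _ _ _ _ h => Subtype.ext h)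
        fun x hx => ?_
      · have hx := (hnone x).1 (mem_filter.1 hx).2
        refine mem_biUnion.2 ⟨base π Y x, mem_filter.2 ⟨(base_mem_iff hl).2 hx, ?_⟩, by simp⟩
        rw [← hfl _ hx, x.2]
      · obtain ⟨y, hy, hyx⟩ := mem_biUnion.1 hx
        rw [mem_filter] at hy hyx
        have h1 : lab x ∈ Y.image lab := (base_mem_iff hl).1 (hyx.2 ▸ hy.1)
        exact ⟨⟨x, by rw [hfl _ h1, hyx.2, hy.2]⟩,
          mem_filter.2 ⟨mem_univ _, (hnone _).2 h1⟩, rfl⟩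
    · intro y _ z _ hyz
      refine disjoint_left.2 fun x hx hx' => hyz ?_
      rw [← (mem_filter.1 hx).2, ← (mem_filter.1 hx').2]
  have hcs : ∀ j : J, #{x | labJ x = some j} = #{x | lab x = j.1} := by
    intro j
    refine card_bij (fun x _ => x.1) (fun x hx => ?_) (fun _ _ _ _ h => Subtype.ext h)
      fun x hx => ?_
    · exact mem_filter.2 ⟨mem_univ _, (hsome _ _).1 (mem_filter.1 hx).2⟩
    · have hx := (mem_filter.1 hx).2
      exact ⟨⟨x, hfn x w (by rw [hx]; exact (mem_filter.1 j.2).2)⟩,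
        mem_filter.2 ⟨mem_univ _, (hsome _ _).2 hx⟩, rfl⟩
  rw [univ_option, insertNone]
  simp only [OrderEmbedding.coe_ofMapLEIff, cons_val, Multiset.map_cons, map_val, Multiset.map_map]
  rw [hcn]
  congr 1
  have h5 : (univ : Finset J).val.map (fun j => #{x | lab x = j.1}) =
      ((univ.filter fun i => A i = some w).val).map fun i => #{x | lab x = i} := by
    conv_rhs => rw [← Multiset.attach_map_val (univ.filter fun i => A i = some w).val,
      Multiset.map_map]
    exact Multiset.map_congr
      (by rw [← attach_val, ← univ_eq_attach]; congr!) fun _ _ => rfl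
  rw [← h5]
  exact Multiset.map_congr rfl fun j _ => hcs j

end Fibre

variable (π Y b) in
/-- The length of a cycle of `rest π Y b` that meets `Y`. -/
def whiteLen (w : White Y b) : ℕ := ∑ y : {y // y ∈ Y} with white Y b y = w, gap π Y y.1

variable (π lab Y b) in
open Classical in
/-- The contribution of a factor to the recursion: the sum over all the distributions of the cycles
of `π` that miss `Y`. -/
def cutWeight (k : ℕ) : ℚ :=
  ∑ A : I → Option (White Y b) with ∀ i, A i = none ↔ i ∈ Y.image lab,
    ∏ w, wtM k (whiteLen π Y b w ::ₘ
      (univ.filter fun i => A i = some w).val.map fun i => #{x | lab x = i})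

/-- The contribution of a factor counts factorisations of `rest π Y b` on the components. -/
theorem cutWeight_eq (hl : ∀ x y, lab x = lab y ↔ π.SameCycle x y)
    (hls : Function.Surjective lab) (hb : b.support ⊆ Y) {wh : X → White Y b}
    (hwh : ∀ y (hy : y ∈ Y), wh y = white Y b ⟨y, hy⟩)
    (hw : ∀ y ∈ Y, ∀ z ∈ Y, wh y = wh z ↔ b.SameCycle y z) (hws : ∀ w, ∃ y ∈ Y, wh y = w) (k : ℕ) :
    cutWeight π lab Y b k = ∑ A : {A : I → Option (White Y b) // ∀ i, A i = none ↔ i ∈ Y.image lab},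
      ∏ w, wt k (fibPerm (cutMap π lab Y wh A.1) (rest π Y b) (cutMap_rest hl hb hw A.2) w) := by
  rw [cutWeight, ← sum_subtype_eq_sum_filter]
  have hlen : ∀ w, whiteLen π Y b w = ∑ y ∈ Y with wh y = w, gap π Y y := by
    intro w
    rw [whiteLen, ← sum_subtype_of_mem (fun y => gap π Y y) (p := fun y => y ∈ Y)
      fun y hy => (mem_filter.1 hy).1]
    refine sum_congr ?_ fun _ _ => rfl
    ext y
    simp [← hwh y.1 y.2]
  refine sum_congr (by ext A; simp) fun A _ => prod_congr rfl fun w _ => ?_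
  rw [wt_eq_wtM, parts_fibPerm_cutMap hl hls hb hw hws A.2, hlen]

/-- The encodings of the possible first factors of a factorisation of genus zero. -/
def cuts (lab : X → I) (k : ℕ) : Finset (Finset X × Perm X) :=
  @Finset.filter _ (fun p => #p.1 = k ∧ IsTreeCut lab p.1 p.2) (Classical.decPred _) univ

theorem mem_cuts {k : ℕ} {p : Finset X × Perm X} :
    p ∈ cuts lab k ↔ #p.1 = k ∧ IsTreeCut lab p.1 p.2 := by
  rw [cuts, @mem_filter _ _ (Classical.decPred _)]
  exact and_iff_right (mem_univ _)

/-- **The recursion for the number of factorisations of genus zero**, obtained by splitting off the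
first factor. -/
theorem wt_recursion (hl : ∀ x y, lab x = lab y ↔ π.SameCycle x y)
    (hls : Function.Surjective lab) {k : ℕ} (hk : 2 ≤ k) [Nonempty X] :
    ((Fintype.card X + Fintype.card I - 2 : ℚ) / (k - 1)) * wt k π =
      ∑ p ∈ cuts lab k, cutWeight π lab p.1 p.2 k := by
  have hI : cyc π = Fintype.card I := cyc_eq_card_of_label lab hls hl
  have hX0 : 0 < Fintype.card X := Fintype.card_pos
  have hI0 := hI ▸ cyc_pos π
  have hk1 : ((k : ℚ) - 1) = ((k - 1 : ℕ) : ℚ) := by push_cast [show 1 ≤ k by omega]; rfl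
  have hk0 : ((k - 1 : ℕ) : ℚ) ≠ 0 := by exact_mod_cast (by omega : k - 1 ≠ 0)
  by_cases hN : ∃ N, (N + 1) * (k - 1) + 2 = Fintype.card X + Fintype.card I
  · obtain ⟨N, hN⟩ := hN
    -- Sort the factorisations into `N + 1` factors by the code of the first factor.
    have h1 : cntF k π (N + 1) = ∑ p : {p // p ∈ cuts lab k},
        Nat.card {τ : Fin N → Perm X // (∀ t, (τ t).cycleType = {k}) ∧
          (List.ofFn τ).prod = rest π p.1.1 p.1.2 ∧
          Trans (Fin.cons (firstFactor π p.1.1 p.1.2) τ : Fin (N + 1) → Perm X)} := by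
      rw [← Nat.card_sigma, cntF]
      have hcyc : ∀ p : {p // p ∈ cuts lab k}, (firstFactor π p.1.1 p.1.2).cycleType = {k} ∧
          (firstFactor π p.1.1 p.1.2).support = p.1.1 := fun p =>
        (mem_cuts.1 p.2).2.cycleType hl hls hk (mem_cuts.1 p.2).1
      refine (Nat.card_congr (Equiv.ofBijective (fun q => ⟨Fin.cons (firstFactor π q.1.1.1 q.1.1.2)
        q.2.1, Fin.cases (hcyc q.1).1 q.2.2.1, by
          rw [List.ofFn_cons, List.prod_cons, q.2.2.2.1, firstFactor_mul_rest], q.2.2.2.2⟩)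
        ⟨?_, ?_⟩)).symm
      · rintro ⟨⟨⟨Y, b⟩, hp⟩, τ, hτ⟩ ⟨⟨⟨Y', b'⟩, hp'⟩, τ', hτ'⟩ h
        have h : (Fin.cons (firstFactor π Y b) τ : Fin (N + 1) → Perm X) =
          Fin.cons (firstFactor π Y' b') τ' := Subtype.ext_iff.1 h
        have h := Fin.cons_inj.1 h
        obtain rfl : τ = τ' := h.2
        have h2 := (hcyc ⟨_, hp⟩).2
        have h3 := (hcyc ⟨_, hp'⟩).2
        obtain rfl : Y = Y' := by
          have h1 : (firstFactor π Y b).support = (firstFactor π Y' b').support := by rw [h.1]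
          exact (h2.symm.trans h1).trans h3
        obtain rfl : b = b' := by
          have := h.1
          simpa [firstFactor] using this
        rfl
      · rintro ⟨σ, h1, h2, h3⟩
        set s := σ 0 with hs
        set τ : Fin N → Perm X := fun t => σ t.succ with hτ
        have hσ : σ = Fin.cons s τ := (Fin.cons_self_tail σ).symm
        have hs1 : s.IsCycle := by
          rw [← card_cycleType_eq_one, h1, Multiset.card_singleton]
        have hsc := cyc_of_cycleType (h1 0)
        have hne : s.support.Nonempty := hs1.nonempty_support
        have hsub := support_inv_mul_retPerm (π := π) s
        obtain ⟨wh, -, hw, hws⟩ := exists_white hne hsub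
        choose r hr using hws
        have hp : (List.ofFn τ).prod = rest π s.support (s⁻¹ * retPerm π s.support) := by
          rw [rest_eq, eq_inv_mul_iff_mul_eq, ← h2, hσ, List.ofFn_cons, List.prod_cons]
        have htr : Trans (Fin.cons (firstFactor π s.support (s⁻¹ * retPerm π s.support)) τ :
            Fin (N + 1) → Perm X) := by
          rw [firstFactor_eq, ← hσ]; exact h3
        have h4 := (card_white_of_trans hl hls hsub hw hr hk
          (by rw [firstFactor_eq]; exact h1 0) (by rw [firstFactor_eq])
          (conn_of_cycle hs1 hl) (fun t => h1 t.succ) hp htr hN).1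
        have h5 := card_white hsub
        refine ⟨⟨⟨⟨s.support, s⁻¹ * retPerm π s.support⟩, mem_cuts.2 ⟨hsc.2,
          hsub, conn_of_cycle hs1 hl, ?_⟩⟩, τ, fun t => h1 t.succ, hp, htr⟩, ?_⟩
        · have : #s.support = k := hsc.2
          show #(s.support.image lab) + (s⁻¹ * retPerm π s.support).cycleType.card =
            #(s⁻¹ * retPerm π s.support).support + 1
          omega
        · refine Subtype.ext ?_
          dsimp only
          rw [firstFactor_eq, ← hσ]
    -- The remaining `N` factors are a shuffle of transitive factorisations of genus zero on the
    -- components.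
    have h2 : ∀ p : {p // p ∈ cuts lab k},
        (Nat.card {τ : Fin N → Perm X // (∀ t, (τ t).cycleType = {k}) ∧
          (List.ofFn τ).prod = rest π p.1.1 p.1.2 ∧
          Trans (Fin.cons (firstFactor π p.1.1 p.1.2) τ : Fin (N + 1) → Perm X)} : ℚ) =
        N ! * cutWeight π lab p.1.1 p.1.2 k := by
      intro p
      have hp := mem_cuts.1 p.2
      have hb := hp.2.support_subset
      have hne : p.1.1.Nonempty := card_pos.1 (by omega)
      obtain ⟨wh, hwh, hw, hws⟩ := exists_white hne hb
      have hcyc := hp.2.cycleType hl hls hk hp.1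
      rw [card_trans_cons hl hls hb hw hws hk hcyc.1 hcyc.2 hp.2.conn hN,
        cutWeight_eq hl hls hb hwh hw hws, mul_sum]
      push_cast
      refine sum_congr rfl fun A _ => ?_
      refine card_fibSet_eq hk (fun w => ?_) (cutMap_rest hl hb hw A.2) ?_
      · obtain ⟨y, hy, rfl⟩ := hws w
        exact ⟨y, cutMap_of_mem A.2 hy⟩
      · have h3 := cyc_rest hl hls hb hw hws
        have h4 := card_white hb
        have h5 := hp.2.card_eq
        have h6 : (N + 1) * (k - 1) = N * (k - 1) + (k - 1) := by ring
        omega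
    have h3 : wt k π = cntF k π (N + 1) / (N + 1)! := wt_eq hk (by rw [hN, hI])
    have h4 : (Fintype.card X + Fintype.card I - 2 : ℚ) = (N + 1) * (k - 1 : ℕ) := by
      have : ((N + 1) * (k - 1 : ℕ) + 2 : ℚ) = Fintype.card X + Fintype.card I := by
        exact_mod_cast hN
      linarith
    rw [h3, h4, h1, hk1, mul_div_assoc, div_self hk0, mul_one, Nat.cast_sum,
      sum_congr rfl fun p _ => h2 p, ← mul_sum, Nat.factorial_succ,
      ← sum_coe_sort (cuts lab k) fun p => cutWeight π lab p.1 p.2 k]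
    have : (N ! : ℚ) ≠ 0 := by exact_mod_cast N.factorial_ne_zero
    have h5 : (N + 1 : ℚ) ≠ 0 := by positivity
    push_cast
    field_simp
  · -- Genus zero is not possible with a positive number of factors: on the left, either the number
    -- of factors is `0` or `wt k π = 0`; on the right, the contribution of each code vanishes,
    -- since genus zero on all components gives genus zero on the whole.
    rw [sum_eq_zero]
    · by_contra hne
      obtain ⟨a, ha⟩ := exists_of_wt_ne_zero (right_ne_zero_of_mul hne)
      rcases a with _ | a
      · refine left_ne_zero_of_mul hne ?_
        have : (Fintype.card X + Fintype.card I : ℚ) = 2 := by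
          rw [hI] at ha
          exact_mod_cast (by omega : Fintype.card X + Fintype.card I = 2)
        rw [this]; simp
      · exact hN ⟨a, by rw [ha, hI]⟩
    · intro p hp
      have hp := mem_cuts.1 hp
      have hb := hp.2.support_subset
      have hne : p.1.Nonempty := card_pos.1 (by omega)
      obtain ⟨wh, hwh, hw, hws⟩ := exists_white hne hb
      rw [cutWeight_eq hl hls hb hwh hw hws]
      refine sum_eq_zero fun A _ => ?_
      by_contra hne
      have hinv := cutMap_rest hl hb hw A.2
      have h1 : ∀ w, ∃ a, a * (k - 1) + 2 =
          Fintype.card {x // cutMap π lab p.1 wh A.1 x = w} +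
          cyc (fibPerm (cutMap π lab p.1 wh A.1) (rest π p.1 p.2) hinv w) := by
        intro w
        obtain ⟨y, hy, rfl⟩ := hws w
        have : Nonempty {x // cutMap π lab p.1 wh A.1 x = wh y} := ⟨⟨y, cutMap_of_mem A.2 hy⟩⟩
        exact exists_of_wt_ne_zero (prod_ne_zero_iff.1 hne _ (mem_univ _))
      choose μ hμ using h1
      have h2 : ∑ w, (μ w * (k - 1) + 2) = Fintype.card X + cyc (rest π p.1 p.2) := by
        rw [sum_congr rfl fun w _ => hμ w, sum_add_distrib, ← cyc_eq_sum_fibPerm,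
          ← Fintype.card_sigma, Fintype.card_congr (sigmaFiberEquiv _)]
      rw [sum_add_distrib, ← sum_mul] at h2
      simp only [sum_const, card_univ, smul_eq_mul] at h2
      have h3 := cyc_rest hl hls hb hw hws
      have h4 := card_white hb
      have h5 := hp.2.card_eq
      refine hN ⟨∑ w, μ w, ?_⟩
      have h6 : (∑ w, μ w + 1) * (k - 1) = (∑ w, μ w) * (k - 1) + (k - 1) := by ring
      omega

end Recursion

/-! ### Existence of factorisations of genus zero -/

section Existence

/-- On a single point, the empty factorisation is the only one. -/
theorem wt_of_card_eq_one {X : Type} [Fintype X] [DecidableEq X] {k : ℕ} (hk : 2 ≤ k) {π : Perm X}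
    (hX : Fintype.card X = 1) : wt k π = 1 := by
  have := Fintype.card_le_one_iff_subsingleton.1 hX.le
  have hne : Nonempty X := Fintype.card_pos_iff.1 (by omega)
  have h1 := cyc_pos π
  have h2 := cyc_le_card π
  rw [wt_eq (N := 0) hk (by omega), cntF]
  have : Nat.card (factSet k π 0) = 1 := by
    rw [Nat.card_eq_one_iff_unique]
    refine ⟨⟨fun a b => Subtype.ext (Subsingleton.elim _ _)⟩, ⟨⟨Fin.elim0, fun t => t.elim0,
      Subsingleton.elim _ _, fun F _ x y h => Subsingleton.elim x y ▸ h⟩⟩⟩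
  rw [this]; simp

variable {X : Type} [Fintype X] [DecidableEq X]

/-- A set that contains at most `t` points, where `t` is at most the number of points in the
cycles it meets, is enlarged to a set of `t` points by adding points that directly precede points
of the set. -/
theorem exists_backward_extension {I : Type} [Fintype I] [DecidableEq I] {π : Perm X} {lab : X → I}
    (hl : ∀ x y, lab x = lab y ↔ π.SameCycle x y) (Y₀ : Finset X) {t : ℕ} (h0 : #Y₀ ≤ t)
    (ht : t ≤ #{x | lab x ∈ Y₀.image lab}) :
    ∃ Y : Finset X, Y₀ ⊆ Y ∧ #Y = t ∧ Y.image lab = Y₀.image lab ∧ ∀ y ∈ Y, y ∉ Y₀ → π y ∈ Y := by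
  induction t, h0 using Nat.le_induction with
  | base => exact ⟨Y₀, Subset.rfl, rfl, rfl, fun y h h' => absurd h h'⟩
  | succ t h0 ih =>
    obtain ⟨Y, h1, h2, h3, h4⟩ := ih (by omega)
    -- otherwise `Y` is all of the cycles that it meets
    obtain ⟨y, hy, hy'⟩ : ∃ y ∉ Y, π y ∈ Y := by
      by_contra! hcon
      have hinv : ∀ x, lab x ∈ Y₀.image lab → x ∈ Y := by
        intro x hx
        rw [← h3] at hx
        obtain ⟨z, hz, hzx⟩ := mem_image.1 hx
        obtain ⟨i, -, rfl⟩ := ((hl _ _).1 hzx.symm).exists_pow_eq'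
        by_contra hxY
        have : ∀ j, (π ^ j) x ∉ Y := by
          intro j
          induction j with
          | zero => exact hxY
          | succ j ih => rw [pow_succ', Perm.mul_apply]; exact hcon _ ih
        exact this i hz
      have : #{x | lab x ∈ Y₀.image lab} ≤ #Y := card_le_card fun x hx =>
        hinv x (mem_filter.1 hx).2
      omega
    refine ⟨insert y Y, h1.trans (subset_insert _ _), by rw [card_insert_of_notMem hy, h2], ?_, ?_⟩
    · rw [image_insert, h3, insert_eq_self, ← h3, ← lab_apply hl]
      exact mem_image_of_mem _ hy'
    · intro z hz hz'
      rcases mem_insert.1 hz with rfl | hz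
      · exact mem_insert_of_mem hy'
      · exact mem_insert_of_mem (h4 z hz hz')

theorem gap_eq_one {π : Perm X} {Y : Finset X} {y : X} (h : π y ∈ Y) : gap π Y y = 1 :=
  gap_eq one_pos h fun j _ _ => by omega

/-- Minimal transitive factorisations into `k`-cycles have genus zero. The induction splits off a
factor whose tree has at most one white vertex of degree at least two. -/
theorem wt_pos {k : ℕ} (hk : 2 ≤ k) (μ : ℕ) {X : Type} [Fintype X] [DecidableEq X] {π : Perm X}
    (hμ : μ * (k - 1) + 2 = Fintype.card X + cyc π)
    (hX : Fintype.card X = 1 ∨ k ≤ Fintype.card X) : 0 < wt k π := by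
  induction μ using Nat.strong_induction_on generalizing X with
  | _ μ ih =>
  rcases hX with hX | hX
  · rw [wt_of_card_eq_one hk hX]; exact one_pos
  classical
  have hne : Nonempty X := Fintype.card_pos_iff.1 (by omega)
  let I := Quotient (SameCycle.setoid π)
  let lab : X → I := Quotient.mk _
  have hl : ∀ x y, lab x = lab y ↔ π.SameCycle x y := fun x y => Quotient.eq
  have hls : Function.Surjective lab := Quotient.mk_surjective
  have hI : cyc π = Fintype.card I := cyc_eq_card_of_label lab hls hl
  have hI0 := hI ▸ cyc_pos π
  rw [hI] at hμ
  obtain ⟨μ, rfl⟩ : ∃ ν, μ = ν + 1 := ⟨μ - 1, by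
    rcases μ with _ | μ
    · omega
    · rfl⟩
  have hμ' : (μ + 1) * (k - 1) = μ * (k - 1) + (k - 1) := by ring
  -- the representatives of the cycles joined by the white vertex of high degree
  obtain ⟨B, hB⟩ : ∃ B : Finset I, #B = min (Fintype.card I) k := by
    obtain ⟨B, -, hB⟩ := exists_subset_card_eq (s := (univ : Finset I))
      (n := min (Fintype.card I) k) (by simp)
    exact ⟨B, hB⟩
  set sec : I → X := Function.surjInv hls with hsec
  have hsl : ∀ i, lab (sec i) = i := Function.surjInv_eq hls
  set Y₀ := B.image sec with hY₀
  have hinj : Function.Injective sec := Function.injective_surjInv hls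
  have hY₀c : #Y₀ = min (Fintype.card I) k := by rw [hY₀, card_image_of_injective _ hinj, hB]
  have hY₀l : Y₀.image lab = B := by
    rw [hY₀, image_image, show lab ∘ sec = id from funext hsl, image_id]
  have hY₀pos : 0 < #Y₀ := by rw [hY₀c]; omega
  have hBk : k ≤ #{x | lab x ∈ Y₀.image lab} := by
    rw [hY₀l]
    rcases le_total (Fintype.card I) k with h | h
    · have : B = univ := by rw [← card_eq_iff_eq_univ, hB, min_eq_left h]
      rw [this]; simpa using hX
    · calc k = #Y₀ := by rw [hY₀c, min_eq_right h]
        _ ≤ _ := card_le_card fun x hx => by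
          rw [mem_filter_univ, ← hY₀l]; exact mem_image_of_mem _ hx
  obtain ⟨Y, hYs, hYc, hYl, hYπ⟩ := exists_backward_extension hl Y₀ (t := k)
    (by rw [hY₀c]; exact min_le_right _ _) hBk
  rw [hY₀l] at hYl
  -- a permutation that is a cycle on the representatives
  obtain ⟨b, hbs, hbt, hbc⟩ : ∃ b : Perm X, b.support ⊆ Y₀ ∧
      #Y₀ + b.cycleType.card = #b.support + 1 ∧ ∀ y ∈ Y₀, ∀ z ∈ Y₀, b.SameCycle y z := by
    rcases Nat.lt_or_ge 1 #Y₀ with h1 | h1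
    · obtain ⟨b, hb, hbs⟩ := Finset.exists_cycleOn Y₀
      have hsub : Y₀ ⊆ b.support := fun y hy => mem_support.2
        (hb.apply_ne (by exact_mod_cast one_lt_card_iff_nontrivial.1 h1) hy)
      have hsupp : b.support = Y₀ := Subset.antisymm hbs hsub
      refine ⟨b, hbs, ?_, fun y hy z hz => hb.2 hy hz⟩
      have hcyc : b.IsCycle := by
        obtain ⟨y, hy⟩ := card_pos.1 hY₀pos
        refine ⟨y, mem_support.1 (hsub hy), fun z hz => hb.2 hy (hbs (mem_support.2 hz))⟩
      rw [hsupp, hcyc.cycleType, Multiset.card_singleton]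
    · refine ⟨1, by simp, ?_, fun y hy z hz => ?_⟩
      · simp; omega
      · rw [card_le_one.1 h1 y hy z hz]
  have hbY := hbs.trans hYs
  have hcut : IsTreeCut lab Y b := by
    refine ⟨hbY, fun F hF1 hF2 y hy z hz h => ?_, ?_⟩
    · have hrep : ∀ y ∈ Y, ∃ x ∈ Y₀, lab x = lab y := by
        intro y hy
        have := mem_image_of_mem lab hy
        rw [hYl, ← hY₀l] at this
        exact mem_image.1 this
      obtain ⟨y', hy', hyy⟩ := hrep y hy
      obtain ⟨z', hz', hzz⟩ := hrep z hz
      have h1 := hF2 y hy y' (hYs hy') hyy.symm h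
      obtain ⟨i, -, hi⟩ := (hbc y' hy' z' hz').exists_pow_eq'
      have h2 : ∀ i, (b ^ i) y' ∈ Y ∧ F ((b ^ i) y') := by
        intro i
        induction i with
        | zero => exact ⟨hYs hy', h1⟩
        | succ i ih =>
          rw [pow_succ', Perm.mul_apply]
          exact ⟨map_mem_of_support_subset hbY ih.1, (hF1 _ ih.1).2 ih.2⟩
      have h3 := (h2 i).2
      rw [hi] at h3
      exact hF2 z' (hYs hz') z hz hzz h3
    · rw [hYl, ← hbt, ← hY₀l, card_image_of_injOn]
      rw [hY₀]
      intro x hx y hy hxy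
      obtain ⟨i, -, rfl⟩ := mem_image.1 (mem_coe.1 hx)
      obtain ⟨j, -, rfl⟩ := mem_image.1 (mem_coe.1 hy)
      rw [hsl, hsl] at hxy
      rw [hxy]
  obtain ⟨wh, hwh, hw, hws⟩ := exists_white (card_pos.1 (by omega : 0 < #Y)) hbY
  obtain ⟨y₀, hy₀⟩ := card_pos.1 hY₀pos
  -- All cycles that miss `Y` are assigned to the white vertex of high degree. The component of
  -- any other white vertex is a single point, because a leaf directly precedes a point of `Y`.
  set A : I → Option (White Y b) := fun i => if i ∈ Y.image lab then none else some (wh y₀)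
  have hA : ∀ i, A i = none ↔ i ∈ Y.image lab := by
    intro i
    simp only [A]
    split_ifs with h <;> simp only [h]
  have hwt : 0 < cutWeight π lab Y b k := by
    rw [cutWeight_eq hl hls hbY hwh hw hws]
    refine sum_pos' (fun _ _ => prod_nonneg fun _ _ => wt_nonneg _ _)
      ⟨⟨A, hA⟩, mem_univ _, prod_pos fun w _ => ?_⟩
    -- sizes and numbers of cycles of the components
    have hparts := parts_fibPerm_cutMap hl hls hbY hw hws hA w
    have hcard : Fintype.card {x // cutMap π lab Y wh A x = w} = _ :=
      (Perm.partition _).parts_sum.symm.trans (congrArg Multiset.sum hparts)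
    have hcyc := (card_parts_partition _).symm.trans (congrArg Multiset.card hparts)
    by_cases hw0 : w = wh y₀
    · subst hw0
      have hfil : (Y.filter fun y => wh y = wh y₀) = Y₀ := by
        ext y
        rw [mem_filter]
        constructor
        · rintro ⟨hy, hyw⟩
          by_contra hy'
          have h1 : b y = y := notMem_support.1 fun h => hy' (hbs h)
          exact hy' ((((hw _ hy _ (hYs hy₀)).1 hyw).eq_of_left h1) ▸ hy₀)
        · exact fun hy => ⟨hYs hy, (hw _ (hYs hy) _ (hYs hy₀)).2 (hbc _ hy _ hy₀)⟩
      have hfA : (univ.filter fun i => A i = some (wh y₀)) = univ \ B := by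
        ext i
        simp only [A, hYl]
        by_cases h : i ∈ B <;> simp [h]
      have hg : ∑ y ∈ Y₀, gap π Y y + (k - #Y₀) = #{x | lab x ∈ B} := by
        have h1 : ∑ y ∈ Y \ Y₀, gap π Y y = k - #Y₀ := by
          rw [sum_congr rfl fun y hy => gap_eq_one (hYπ y (mem_sdiff.1 hy).1 (mem_sdiff.1 hy).2),
            sum_const, smul_eq_mul, mul_one, card_sdiff_of_subset hYs, hYc]
        rw [← h1, add_comm, sum_sdiff hYs, ← sum_fiberwise_of_maps_to (t := B) (g := lab)
          fun y hy => hYl ▸ mem_image_of_mem _ hy,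
          card_eq_sum_card_fiberwise (s := univ.filter fun x => lab x ∈ B) (f := lab) (t := B)
            fun x hx => (mem_filter.1 hx).2]
        refine sum_congr rfl fun i hi => ?_
        rw [sum_gap hl (by rw [hYl]; exact hi)]
        congr 1
        ext x
        simp only [mem_filter, mem_univ, true_and]
        exact ⟨fun h => ⟨h ▸ hi, h⟩, fun h => h.2⟩
      have hcomp : (((univ \ B).val.map fun i => #{x | lab x = i}).sum) + #{x | lab x ∈ B} =
          Fintype.card X := by
        change ∑ i ∈ univ \ B, #{x | lab x = i} + _ = _
        rw [card_eq_sum_card_fiberwise (s := univ.filter fun x => lab x ∈ B) (f := lab) (t := B)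
          fun x hx => (mem_filter.1 hx).2, ← card_univ,
          card_eq_sum_card_fiberwise (s := (univ : Finset X)) (f := lab) (t := univ)
          fun x hx => mem_coe.2 (mem_univ _), ← sum_sdiff (subset_univ B)]
        congr 1
        refine sum_congr rfl fun i hi => ?_
        congr 1
        ext x
        simp only [mem_filter, mem_univ, true_and]
        exact ⟨fun h => h.2, fun h => ⟨h ▸ hi, h⟩⟩
      rw [hfil, hfA, Multiset.sum_cons] at hcard
      rw [hfA, Multiset.card_cons, Multiset.card_map, card_val,
      card_sdiff_of_subset (subset_univ B),
        card_univ, hB] at hcyc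
      have hmn := hI ▸ cyc_le_card π
      rw [hY₀c] at hg
      refine ih μ (by omega) ?_ ?_
      · rw [hcyc, hcard]
        omega
      · rw [hcard]
        rcases μ with _ | μ
        · left
          omega
        · right
          have : (μ + 1) * (k - 1) = μ * (k - 1) + (k - 1) := by ring
          omega
    · have hsing : ∃ y, (Y.filter fun y => wh y = w) = {y} ∧ π y ∈ Y := by
        obtain ⟨y, hy, rfl⟩ := hws w
        have hy' : y ∉ Y₀ := fun h => hw0 ((hw _ hy _ (hYs hy₀)).2 (hbc _ h _ hy₀))
        have h1 : b y = y := notMem_support.1 fun h => hy' (hbs h)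
        refine ⟨y, ?_, hYπ y hy hy'⟩
        ext z
        rw [mem_filter, mem_singleton]
        constructor
        · rintro ⟨hz, hzw⟩
          exact (((hw _ hz _ hy).1 hzw).symm.eq_of_left h1).symm
        · rintro rfl
          exact ⟨hy, rfl⟩
      obtain ⟨y, hfil, hy⟩ := hsing
      have hfA : (univ.filter fun i => A i = some w) = ∅ := by
        ext i
        simp only [A, hYl]
        by_cases h : i ∈ B <;> simp [Ne.symm hw0]
      rw [hfil, hfA, sum_singleton, gap_eq_one hy] at hcard
      rw [wt_of_card_eq_one hk (by simpa using hcard)]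
      exact one_pos
  have hrec := wt_recursion hl hls hk (π := π)
  have h1 : 0 < ∑ p ∈ cuts lab k, cutWeight π lab p.1 p.2 k := by
    refine sum_pos' (fun p hp => ?_) ⟨(Y, b), mem_cuts.2 ⟨hYc, hcut⟩, hwt⟩
    refine sum_nonneg fun A _ => prod_nonneg fun w _ => wtM_nonneg _ _
  rw [← hrec] at h1
  exact (wt_nonneg _ _).lt_of_ne fun h => by rw [← h, mul_zero] at h1; exact h1.false

end Existence

/-! ### The coefficients of the generating series -/

section Coefficients

theorem cycleType_eq_singleton_iff {X : Type} [Fintype X] [DecidableEq X] {k : ℕ} {s : Perm X} :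
    s.cycleType = {k} ↔ s.IsCycle ∧ s.support.card = k := by
  constructor
  · intro h
    refine ⟨?_, (cyc_of_cycleType h).2⟩
    rw [← card_cycleType_eq_one, h, Multiset.card_singleton]
  · rintro ⟨h, rfl⟩
    exact h.cycleType

theorem isPretransitive_closure_iff {X T : Type} (σ : T → Perm X) :
    MulAction.IsPretransitive (Subgroup.closure (Set.range σ)) X ↔ Trans σ := by
  constructor
  · intro h F hF x y hx
    obtain ⟨⟨g, hg⟩, rfl⟩ := h.exists_smul_eq x y
    have : ∀ z, F (g z) ↔ F z := by
      induction hg using Subgroup.closure_induction with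
      | mem g hg => obtain ⟨t, rfl⟩ := hg; exact hF t
      | one => exact fun z => Iff.rfl
      | mul a b _ _ ha hb => exact fun z => (ha _).trans (hb z)
      | inv a _ ha => exact fun z => by rw [← ha (a⁻¹ z), ← Perm.mul_apply, mul_inv_cancel]; rfl
    exact (this x).2 hx
  · intro h
    refine ⟨fun x y => h (fun z => ∃ g : Subgroup.closure (Set.range σ), g • x = z) ?_ x y
      ⟨1, one_smul _ _⟩⟩
    intro t z
    have ht : σ t ∈ Subgroup.closure (Set.range σ) := Subgroup.subset_closure ⟨t, rfl⟩
    constructor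
    · rintro ⟨g, hg⟩
      refine ⟨⟨σ t, ht⟩⁻¹ * g, ?_⟩
      rw [mul_smul, hg]
      exact (σ t).symm_apply_apply z
    · rintro ⟨g, hg⟩
      refine ⟨⟨σ t, ht⟩ * g, ?_⟩
      rw [mul_smul, hg]
      rfl

theorem isTransFact_ofFn {k n N : ℕ} {π : Perm (Fin n)} {σ : Fin N → Perm (Fin n)} :
    IsTransFact k π (List.ofFn σ) ↔ σ ∈ factSet k π N := by
  have h1 : {s | s ∈ List.ofFn σ} = Set.range σ := by
    ext s; simp
  rw [IsTransFact, h1, isPretransitive_closure_iff]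
  refine and_congr ?_ Iff.rfl
  simp only [List.mem_ofFn, cycleType_eq_singleton_iff]
  exact ⟨fun h t => h _ ⟨t, rfl⟩, by rintro h s ⟨t, rfl⟩; exact h t⟩

theorem isTransFact_iff {k n : ℕ} {π : Perm (Fin n)} {l : List (Perm (Fin n))} :
    IsTransFact k π l ↔ l.get ∈ factSet k π l.length := by
  rw [← isTransFact_ofFn, List.ofFn_get]

theorem cntF_pos_iff {k N : ℕ} {X : Type} [Fintype X] [DecidableEq X] {π : Perm X} :
    0 < cntF k π N ↔ (factSet k π N).Nonempty := by
  rw [cntF, Nat.card_pos_iff, and_iff_left (Subtype.finite), Set.nonempty_coe_sort]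

/-- The minimal transitive factorisations are those of genus zero. -/
theorem card_isMinTransFact {k n : ℕ} (hk : 2 ≤ k) (hn : 1 ≤ n) {π : Perm (Fin n)} {μ : ℕ}
    (hμ : μ * (k - 1) + 2 = n + cyc π) :
    Nat.card {l : List (Perm (Fin n)) // IsMinTransFact k π l} = cntF k π μ := by
  have hle : ∀ l : List (Perm (Fin n)), IsTransFact k π l → μ ≤ l.length := by
    intro l hl
    have h := le_of_mem_factSet (isTransFact_iff.1 hl)
    rw [Fintype.card_fin, ← hμ] at h
    exact Nat.le_of_mul_le_mul_right (by omega : μ * (k - 1) ≤ _ * (k - 1)) (by omega)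
  by_cases hnk : n = 1 ∨ k ≤ n
  · have hpos : 0 < wt k π := wt_pos hk μ (by rw [Fintype.card_fin, hμ])
      (by rwa [Fintype.card_fin])
    rw [wt_eq (N := μ) hk (by rw [Fintype.card_fin, hμ])] at hpos
    have hc : 0 < cntF k π μ := by
      rw [Nat.pos_iff_ne_zero]
      intro h
      rw [h] at hpos
      simp at hpos
    obtain ⟨τ, hτ⟩ := cntF_pos_iff.1 hc
    rw [cntF]
    have hmin : ∀ σ : factSet k π μ, IsMinTransFact k π (List.ofFn σ.1) := fun σ =>
      ⟨isTransFact_ofFn.2 σ.2, fun l hl => by rw [List.length_ofFn]; exact hle l hl⟩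
    refine (Nat.card_congr (Equiv.ofBijective (fun σ => ⟨List.ofFn σ.1, hmin σ⟩) ⟨?_, ?_⟩)).symm
    · intro a b h
      exact Subtype.ext (List.ofFn_injective (Subtype.ext_iff.1 h))
    · rintro ⟨l, h1, h2⟩
      have h3 := h2 _ (isTransFact_ofFn.2 hτ)
      rw [List.length_ofFn] at h3
      obtain rfl : μ = l.length := le_antisymm (hle l h1) h3
      exact ⟨⟨l.get, isTransFact_iff.1 h1⟩, Subtype.ext (List.ofFn_get l)⟩
  · -- for `1 < n < k` there are no cycles of length `k`, and no transitive factorisations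
    push Not at hnk
    have hno : ∀ N, ¬ (factSet k π N).Nonempty := by
      rintro N ⟨σ, h1, -, h3⟩
      rcases N with _ | N
      · have h01 := h3 (fun x => x.1 = 0) (fun t => t.elim0) ⟨0, by omega⟩ ⟨1, by omega⟩ rfl
        simp at h01
      · have h := (cyc_of_cycleType (h1 0)).2
        have := card_le_univ (σ 0).support
        rw [Fintype.card_fin] at this
        omega
    have h1 : cntF k π μ = 0 := by
      have := mt cntF_pos_iff.1 (hno μ)
      omega
    rw [h1, Nat.card_eq_zero]
    left
    exact ⟨fun l => hno _ ⟨_, isTransFact_iff.1 l.2.1⟩⟩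

/-- `conjClass` in terms of the cycle type, which leaves out the fixed points. -/
theorem mem_conjClass_iff {n : ℕ} {α : Nat.Partition n} {π : Perm (Fin n)} :
    π ∈ conjClass α ↔ π.cycleType = α.parts.filter (2 ≤ ·) := by
  rw [conjClass, Set.mem_ofPred_eq]
  constructor
  · intro h
    rw [← h, filter_parts_partition_eq_cycleType]
  · intro h
    have h2 : α.parts = α.parts.filter (2 ≤ ·) + Multiset.replicate (α.parts.count 1) 1 := by
      conv_lhs => rw [← Multiset.filter_add_not (2 ≤ ·) α.parts]
      congr 1
      rw [← Multiset.filter_eq']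
      refine Multiset.filter_congr fun a ha => ?_
      have := α.parts_pos ha
      omega
    have h3 := congrArg Multiset.sum h2
    rw [α.parts_sum, Multiset.sum_add, ← h, sum_cycleType, Multiset.sum_replicate, smul_eq_mul,
      mul_one] at h3
    rw [parts_partition, h2, h, Fintype.card_fin]
    congr 2
    omega

theorem conjClass_nonempty {n : ℕ} (α : Nat.Partition n) : ∃ π, π ∈ conjClass α := by
  obtain ⟨π, hπ⟩ := (exists_with_cycleType_iff (Fin n) (m := α.parts.filter (2 ≤ ·))).2 (by
    refine ⟨?_, fun a ha => (Multiset.mem_filter.1 ha).2⟩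
    rw [Fintype.card_fin]
    conv_rhs => rw [← α.parts_sum]
    conv_rhs => rw [← Multiset.filter_add_not (2 ≤ ·) α.parts, Multiset.sum_add]
    exact Nat.le_add_right _ _)
  exact ⟨π, mem_conjClass_iff.2 hπ⟩

/-- The order of the centraliser is `∏ a, a ^ (count a) * (count a)!`. -/
theorem card_conjClass_mul {n : ℕ} (α : Nat.Partition n) :
    Nat.card (conjClass α) * (α.parts.prod * ∏ a ∈ α.parts.toFinset, (α.parts.count a)!) = n ! := by
  classical
  obtain ⟨π, hπ⟩ := conjClass_nonempty α
  rw [mem_conjClass_iff] at hπ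
  have h := card_of_cycleType_mul_eq (Fin n) (α.parts.filter (2 ≤ ·))
  rw [if_pos ((exists_with_cycleType_iff (Fin n)).1 ⟨π, hπ⟩), Fintype.card_fin] at h
  rw [← h]
  have h2 : α.parts = α.parts.filter (2 ≤ ·) + Multiset.replicate (α.parts.count 1) 1 := by
    conv_lhs => rw [← Multiset.filter_add_not (2 ≤ ·) α.parts]
    congr 1
    rw [← Multiset.filter_eq']
    refine Multiset.filter_congr fun a ha => ?_
    have := α.parts_pos ha
    omega
  have h3 := congrArg Multiset.sum h2
  rw [α.parts_sum, Multiset.sum_add, Multiset.sum_replicate, smul_eq_mul, mul_one] at h3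
  have h4 : α.parts.prod = (α.parts.filter (2 ≤ ·)).prod := by
    conv_lhs => rw [h2]
    rw [Multiset.prod_add, Multiset.prod_replicate, one_pow, mul_one]
  have h5 : ∏ a ∈ α.parts.toFinset, (α.parts.count a)! =
      (α.parts.count 1)! * ∏ a ∈ (α.parts.filter (2 ≤ ·)).toFinset,
        ((α.parts.filter (2 ≤ ·)).count a)! := by
    have h6 : (1 : ℕ) ∉ (α.parts.filter (2 ≤ ·)).toFinset := by simp
    have h7 : ∏ a ∈ (α.parts.filter (2 ≤ ·)).toFinset, ((α.parts.filter (2 ≤ ·)).count a)! =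
        ∏ a ∈ (α.parts.filter (2 ≤ ·)).toFinset, (α.parts.count a)! := by
      refine prod_congr rfl fun a ha => ?_
      rw [Multiset.count_filter_of_pos (Multiset.mem_filter.1 (Multiset.mem_toFinset.1 ha)).2]
    rw [h7, ← prod_insert (f := fun a => (α.parts.count a)!) h6]
    refine prod_subset (fun a ha => ?_) fun a _ ha => ?_
    · rw [Multiset.mem_toFinset] at ha
      have := α.parts_pos ha
      rw [mem_insert, Multiset.mem_toFinset, Multiset.mem_filter]
      rcases Nat.lt_or_ge 1 a with h | h
      · exact Or.inr ⟨ha, h⟩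
      · left; omega
    · rw [Multiset.count_eq_zero_of_notMem fun h => ha (Multiset.mem_toFinset.2 h),
        Nat.factorial_zero]
  have h8 : Nat.card (conjClass α) =
      #(univ.filter fun g : Perm (Fin n) => g.cycleType = α.parts.filter (2 ≤ ·)) := by
    rw [Nat.card_eq_fintype_card, Fintype.card_subtype]
    congr 1
    ext g
    rw [mem_filter_univ, mem_filter_univ, mem_conjClass_iff]
  rw [h8, h5, ← h4, show n - (α.parts.filter (2 ≤ ·)).sum = α.parts.count 1 by omega]
  ring

section Expo

theorem sum_single_apply (M : Multiset ℕ) (v : Ind) :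
    ((M.map fun a => Finsupp.single (Ind.p a) 1).sum : Ind →₀ ℕ) v =
      match v with
      | Ind.p a => M.count a
      | _ => 0 := by
  induction M using Multiset.induction_on with
  | empty => cases v <;> simp
  | cons a M ih =>
    rw [Multiset.map_cons, Multiset.sum_cons, Finsupp.add_apply, ih]
    cases v with
    | u => simp
    | z => simp
    | p b =>
      by_cases h : b = a
      · subst h
        simp [add_comm]
      · simp [h, Finsupp.single_eq_of_ne]

variable {n i j : ℕ} (α : Nat.Partition n)

theorem expo_z : expo α i j Ind.z = j := by
  simp [expo, sum_single_apply]

theorem expo_u : expo α i j Ind.u = i := by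
  simp [expo, sum_single_apply]

theorem expo_p (a : ℕ) : expo α i j (Ind.p a) = α.parts.count a := by
  simp [expo, sum_single_apply]

theorem parts_eq_of_expo_eq {n' i' j' : ℕ} {α' : Nat.Partition n'}
    (h : expo α i j = expo α' i' j') : α.parts = α'.parts := by
  ext a
  rw [← expo_p α (i := i) (j := j), h, expo_p]

/-- The monomial of `F` determines the partition and the exponents of `u` and `z`. -/
theorem F_expo (k m : ℕ) : MvPowerSeries.coeff (expo α i j) (F k m) =
    if i = mu k α ∧ j = n ∧ 1 ≤ n ∧ (k - 1) ∣ (n + m - 2) ∧ α.parts.card = m then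
      ((c k α : ℚ) * (Nat.card (conjClass α) : ℚ)) / (((mu k α)! : ℚ) * (n ! : ℚ)) else 0 := by
  classical
  change F k m (expo α i j) = _
  generalize hd : expo α i j = d
  have hz : d Ind.z = j := by rw [← hd, expo_z]
  have hu : d Ind.u = i := by rw [← hd, expo_u]
  -- a partition with the same monomial is the given one
  have key : ∀ α' : Nat.Partition (d Ind.z), d = expo α' (mu k α') (d Ind.z) →
      ∃ h : d Ind.z = n, h ▸ α' = α := by
    intro α' h
    have hp := parts_eq_of_expo_eq α (hd.trans h)
    have hn : d Ind.z = n := by rw [← α'.parts_sum, ← hp, α.parts_sum]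
    refine ⟨hn, Nat.Partition.ext ?_⟩
    subst hn
    exact hp.symm
  unfold F
  by_cases hn : d Ind.z = n
  · subst hn
    rw [sum_eq_single α]
    · congr 1
      rw [eq_iff_iff]
      constructor
      · rintro ⟨h1, h2, h3, h4⟩
        refine ⟨?_, hz.symm, h1, h2, h3⟩
        rw [← hu]
        exact (DFunLike.congr_fun h4 Ind.u).trans (expo_u α)
      · rintro ⟨rfl, h1, h2, h3, h4⟩
        refine ⟨h2, h3, h4, ?_⟩
        exact hd.symm.trans (congrArg (expo α (mu k α)) hz.symm)
    · intro α' _ hne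
      rw [if_neg]
      rintro ⟨-, -, -, h4⟩
      obtain ⟨_, h⟩ := key α' h4
      exact hne h
    · exact fun h => absurd (mem_univ _) h
  · rw [if_neg fun h => hn (hz.trans h.2.1)]
    refine sum_eq_zero fun α' _ => if_neg ?_
    rintro ⟨-, -, -, h4⟩
    exact hn (key α' h4).1

end Expo

theorem exists_perm_of_map_eq {m : ℕ} {f g : Fin m → ℕ} (h : univ.val.map f = univ.val.map g) :
    ∃ τ : Perm (Fin m), ∀ i, g (τ i) = f i := by
  have hc : ∀ a, Nonempty ({i // f i = a} ≃ {i // g i = a}) := by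
    intro a
    rw [← Fintype.card_eq, Fintype.card_subtype, Fintype.card_subtype]
    have := congrArg (Multiset.count a) h
    rw [Multiset.count_map, Multiset.count_map] at this
    simpa only [eq_comm, ← filter_val, card_val] using this
  exact ⟨Equiv.ofFiberEquiv fun a => (hc a).some, fun i => Equiv.ofFiberEquiv_map _ i⟩

/-- The parts of `α` as a family indexed by `Fin m`. -/
theorem map_part {n m : ℕ} (α : Nat.Partition n) (hα : α.parts.card = m) :
    (univ : Finset (Fin m)).val.map (fun i : Fin m => part α i) = α.parts := by
  rw [Fin.univ_val_map]
  conv_rhs => rw [← Multiset.sort_eq α.parts (· ≥ ·)]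
  congr 1
  have hlen : (α.parts.sort (· ≥ ·)).length = m := by rw [Multiset.length_sort, hα]
  refine List.ext_getElem (by simp [hlen]) fun i h1 h2 => ?_
  rw [List.getElem_ofFn, part, List.getD_eq_getElem _ _ h2]

/-- The rearrangements of the parts that give the exponents `β` form a coset of the stabiliser of
the parts. -/
theorem card_rearrangements {n m : ℕ} (α : Nat.Partition n) {β : Fin m → ℕ}
    (hα : univ.val.map β = α.parts) :
    Nat.card {σ : Perm (Fin m) // ∀ i, part α (σ i) = β i} =
      ∏ a ∈ α.parts.toFinset, (α.parts.count a)! := by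
  classical
  have hc : α.parts.card = m := by rw [← hα]; simp
  have hp := map_part α hc
  set f : Fin m → ℕ := fun i => part α i with hf
  obtain ⟨τ, hτ⟩ := exists_perm_of_map_eq (hα.trans hp.symm)
  have h1 : Nat.card {σ : Perm (Fin m) // ∀ i, part α (σ i) = β i} =
      Nat.card {g : Perm (Fin m) // f ∘ g = f} := by
    refine Nat.card_congr (Equiv.subtypeEquiv (Equiv.mulRight τ⁻¹) fun σ => ?_)
    rw [Equiv.coe_mulRight, funext_iff]
    constructor
    · intro h i
      obtain ⟨i, rfl⟩ := τ.surjective i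
      rw [hτ, ← h i]
      simp [hf]
    · intro h i
      rw [← hτ, ← h]
      simp [hf]
  rw [h1, Nat.card_eq_fintype_card, DomMulAct.stabilizer_card']
  have h2 : univ.image f = α.parts.toFinset := by
    ext a
    rw [Multiset.mem_toFinset, ← hp]
    simp
  rw [h2]
  refine prod_congr rfl fun a _ => ?_
  rw [Fintype.card_subtype, ← hp, Multiset.count_map]
  congr 1
  rw [← filter_val, card_val]
  congr 1
  ext i
  simp [eq_comm]

/-- All the variables occur in every monomial of `P k m`, as parts are positive. -/
theorem coeff_P_eq_zero (k : ℕ) {m : ℕ} {β : Fin m →₀ ℕ} {i : Fin m} (hi : β i = 0) :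
    MvPowerSeries.coeff β (P k m) = 0 := by
  classical
  change psi m (F k m) β = 0
  refine sum_eq_zero fun α _ => ?_
  split_ifs with hα
  · have : IsEmpty {σ : Perm (Fin m) // ∀ i, part α (σ i) = β i} := by
      refine ⟨fun σ => ?_⟩
      have h1 := σ.2 i
      rw [hi] at h1
      have h2 : part α (σ.1 i) ∈ α.parts := by
        rw [← map_part α hα]
        exact Multiset.mem_map_of_mem (fun i : Fin m => part α i) (mem_univ (σ.1 i))
      have := α.parts_pos h2
      omega
    rw [Nat.card_of_isEmpty, Nat.cast_zero, mul_zero]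
  · rfl

/-- The coefficients of `P k m` count the factorisations of genus zero: the number of rearrangements
cancels against the multiplicities in the order of the centraliser, which leaves the product of the
parts in the denominator. -/
theorem coeff_P {k : ℕ} (hk : 2 ≤ k) {m : ℕ} (hm : 1 ≤ m) {β : Fin m →₀ ℕ} (hβ : ∀ i, β i ≠ 0) :
    MvPowerSeries.coeff β (P k m) = wtM k (univ.val.map β) / ∏ i, (β i : ℚ) := by
  classical
  have hdeg : β.degree = ∑ i, β i := Finsupp.degree_eq_sum β
  let α : Nat.Partition β.degree :=
    { parts := univ.val.map β
      parts_pos := by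
        intro a ha
        obtain ⟨i, -, rfl⟩ := Multiset.mem_map.1 ha
        exact Nat.pos_of_ne_zero (hβ i)
      parts_sum := hdeg.symm }
  have hα : univ.val.map β = α.parts := rfl
  have hc : α.parts.card = m := by rw [← hα]; simp
  have hn : m ≤ β.degree := by
    rw [hdeg]
    calc m = ∑ _i : Fin m, 1 := by simp
      _ ≤ _ := sum_le_sum fun i _ => Nat.pos_of_ne_zero (hβ i)
  change psi m (F k m) β = _
  rw [psi, sum_eq_single α]
  · rw [if_pos hc, finsum_eq_single _ (mu k α, β.degree), F_expo, card_rearrangements α hα]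
    · set π : Perm (Fin β.degree) := Classical.epsilon fun π => π ∈ conjClass α with hπ
      have hπα : π.partition.parts = α.parts := Classical.epsilon_spec (conjClass_nonempty α)
      have hcyc : cyc π = m := by rw [← card_parts_partition, hπα, hc]
      rw [show wtM k (univ.val.map β) = wt k π by rw [wt_eq_wtM, hπα]]
      have hsz := card_conjClass_mul α
      have hprod : (α.parts.prod : ℚ) = ∏ i, (β i : ℚ) := by
        rw [← hα]; exact Nat.cast_prod _ _
      have hprod0 : (∏ i, (β i : ℚ)) ≠ 0 :=
        prod_ne_zero_iff.2 fun i _ => Nat.cast_ne_zero.2 (hβ i)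
      by_cases hdvd : (k - 1) ∣ (β.degree + m - 2)
      · obtain ⟨N, hN⟩ := hdvd
        have hmu : mu k α = N := by
          rw [mu, hc, hN, Nat.mul_div_cancel_left _ (by omega)]
        have hN' : N * (k - 1) + 2 = β.degree + cyc π := by
          rw [hcyc, mul_comm]; omega
        rw [if_pos ⟨rfl, rfl, by omega, ⟨N, hN⟩, hc⟩, hmu, wt_eq hk (by rwa [Fintype.card_fin])]
        have hcc : c k α = cntF k π N := card_isMinTransFact hk (by omega) hN'
        rw [hcc, ← hprod]
        rw [← hprod] at hprod0
        have h1 : (N ! : ℚ) ≠ 0 := Nat.cast_ne_zero.2 N.factorial_ne_zero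
        have h2 : (β.degree ! : ℚ) ≠ 0 := Nat.cast_ne_zero.2 (Nat.factorial_ne_zero _)
        have h3 : (Nat.card (conjClass α) : ℚ) *
            (α.parts.prod * (∏ a ∈ α.parts.toFinset, (α.parts.count a)! : ℕ)) = β.degree ! := by
          exact_mod_cast hsz
        field_simp
        linear_combination (cntF k π N : ℚ) * h3
      · rw [if_neg fun h => hdvd h.2.2.2.1, wt, if_neg (by rwa [Fintype.card_fin, hcyc])]
        simp
    · rintro ⟨i, j⟩ hij
      rw [F_expo, if_neg]
      rintro ⟨h1, h2, -⟩
      exact hij (Prod.ext h1 h2)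
  · intro α' _ hne
    split_ifs with hα'
    · have : IsEmpty {σ : Perm (Fin m) // ∀ i, part α' (σ i) = β i} := by
        refine ⟨fun σ => hne (Nat.Partition.ext ?_)⟩
        rw [← hα, ← map_part α' hα']
        conv_lhs => rw [← Multiset.map_univ_val_equiv σ.1, Multiset.map_map]
        exact Multiset.map_congr rfl fun i _ => σ.2 i
      rw [Nat.card_of_isEmpty, Nat.cast_zero, mul_zero]
    · rfl
  · exact fun h => absurd (mem_univ _) h

end Coefficients

/-! ### Subdividing arcs -/

section Chain

variable {R : Type*} [CommRing R]

/-- The sum, over the compositions `q = j₁ + ⋯ + jᵣ`, of `u j₁ ⋯ u jᵣ`. -/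
def chain (u : ℕ → R) : ℕ → R
  | 0 => 1
  | q + 1 => ∑ j : Fin (q + 1), u (j.1 + 1) * chain u (q - j.1)
termination_by q => q
decreasing_by omega

theorem chain_zero (u : ℕ → R) : chain u 0 = 1 := by rw [chain]

theorem chain_of_pos (u : ℕ → R) {q : ℕ} (hq : 0 < q) :
    chain u q = ∑ j ∈ Icc 1 q, u j * chain u (q - j) := by
  obtain ⟨q, rfl⟩ : ∃ p, q = p + 1 := ⟨q - 1, by omega⟩
  rw [chain, Fin.sum_univ_eq_sum_range fun j => u (j + 1) * chain u (q - j)]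
  refine sum_bij (fun j _ => j + 1) (fun j hj => ?_) (fun _ _ _ _ h => by omega)
    (fun j hj => ?_) fun j _ => ?_
  · rw [mem_range] at hj
    rw [mem_Icc]
    omega
  · rw [mem_Icc] at hj
    exact ⟨j - 1, by rw [mem_range]; omega, by omega⟩
  · rw [Nat.add_sub_add_right]

/-- The least element of `K` that is greater than `j`, and `n` if there is none. -/
def nxt (K : Finset ℕ) (n j : ℕ) : ℕ := sInf {p | j < p ∧ (p ∈ K ∨ p = n)}

variable {K : Finset ℕ} {n j : ℕ}

theorem nxt_spec (hj : j < n) : j < nxt K n j ∧ (nxt K n j ∈ K ∨ nxt K n j = n) :=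
  Nat.sInf_mem (s := {p | j < p ∧ (p ∈ K ∨ p = n)}) ⟨n, hj, Or.inr rfl⟩

theorem nxt_le {p : ℕ} (hj : j < p) (hp : p ∈ K ∨ p = n) : nxt K n j ≤ p :=
  Nat.sInf_le (s := {p | j < p ∧ (p ∈ K ∨ p = n)}) ⟨hj, hp⟩

theorem nxt_eq {p : ℕ} (hj : j < p) (hpn : p ≤ n) (hp : p ∈ K ∨ p = n)
    (h : ∀ i, j < i → i < p → i ∉ K) : nxt K n j = p := by
  refine le_antisymm (nxt_le hj hp) (le_of_not_gt fun hlt => ?_)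
  obtain ⟨h1, h2 | h2⟩ := nxt_spec (K := K) (n := n) (j := j) (by omega)
  · exact h _ h1 hlt h2
  · omega

theorem nxt_insert {f : ℕ} (hf : f ≤ j) (hj : j < n) : nxt (insert f K) n j = nxt K n j := by
  obtain ⟨h1, h2⟩ := nxt_spec (K := K) hj
  refine nxt_eq h1 (nxt_le hj (Or.inr rfl)) (h2.imp_left (mem_insert_of_mem ·)) fun i hi hi' h => ?_
  rcases mem_insert.1 h with rfl | h
  · omega
  · exact absurd (nxt_le hi (Or.inl h) : nxt K n j ≤ i) (by omega)

/-- Subdivide the interval from `s` to `n` in such a way that the first part ends at `f`, and weight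
all parts but the first one. -/
theorem sum_subdivisions (u : ℕ → R) (n s f : ℕ) (hs : s < f) (hf : f ≤ n) :
    ∑ K ∈ (Ioo s n).powerset with nxt K n s = f, ∏ j ∈ K, u (nxt K n j - j) = chain u (n - f) := by
  induction hd : n - f using Nat.strong_induction_on generalizing s f with
  | _ d ih =>
  subst hd
  rcases hf.eq_or_lt with rfl | hf
  · have : ((Ioo s f).powerset.filter fun K => nxt K f s = f) = {∅} := by
      ext K
      rw [mem_filter, mem_powerset, mem_singleton]
      constructor
      · rintro ⟨h1, h2⟩
        refine eq_empty_of_forall_notMem fun i hi => ?_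
        have h3 := mem_Ioo.1 (h1 hi)
        have := nxt_le (n := f) h3.1 (Or.inl hi)
        omega
      · rintro rfl
        exact ⟨empty_subset _, nxt_eq hs le_rfl (Or.inr rfl) fun _ _ _ => notMem_empty _⟩
    rw [this, sum_singleton, prod_empty, Nat.sub_self, chain_zero]
  · -- split off the first division point `f`
    have h1 : ∑ K ∈ (Ioo s n).powerset with nxt K n s = f, ∏ j ∈ K, u (nxt K n j - j) =
        ∑ K ∈ (Ioo f n).powerset, u (nxt K n f - f) * ∏ j ∈ K, u (nxt K n j - j) := by
      symm
      refine sum_bij (fun K _ => insert f K) (fun K hK => ?_) (fun K hK K' hK' h => ?_)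
        (fun K hK => ?_) fun K hK => ?_
      · rw [mem_powerset] at hK
        refine mem_filter.2 ⟨mem_powerset.2 (insert_subset (mem_Ioo.2 ⟨hs, hf⟩) (hK.trans ?_)), ?_⟩
        · exact Ioo_subset_Ioo_left hs.le
        · refine nxt_eq hs hf.le (Or.inl (mem_insert_self _ _)) fun i hi hi' h => ?_
          rcases mem_insert.1 h with rfl | h
          · omega
          · have := mem_Ioo.1 (hK h)
            omega
      · have hn : ∀ K ∈ (Ioo f n).powerset, f ∉ K := fun K hK h =>
          (mem_Ioo.1 (mem_powerset.1 hK h)).1.false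
        rw [← erase_insert (hn K hK), h, erase_insert (hn K' hK')]
      · obtain ⟨h1, h2⟩ := mem_filter.1 hK
        rw [mem_powerset] at h1
        have hfK : f ∈ K := by
          have := (nxt_spec (K := K) (n := n) (j := s) (by omega)).2
          rw [h2] at this
          exact this.resolve_right hf.ne
        refine ⟨K.erase f, mem_powerset.2 fun i hi => ?_, insert_erase hfK⟩
        obtain ⟨hi1, hi2⟩ := mem_erase.1 hi
        have h3 := mem_Ioo.1 (h1 hi2)
        have := nxt_le (n := n) h3.1 (Or.inl hi2)
        exact mem_Ioo.2 ⟨by omega, h3.2⟩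
      · rw [mem_powerset] at hK
        have hn : f ∉ K := fun h => (mem_Ioo.1 (hK h)).1.false
        rw [prod_insert hn, nxt_insert le_rfl hf]
        congr 1
        refine prod_congr rfl fun j hj => ?_
        have := mem_Ioo.1 (hK hj)
        rw [nxt_insert this.1.le this.2]
    rw [h1, ← sum_fiberwise_of_maps_to (t := Ioc f n) (g := fun K => nxt K n f) fun K _ =>
      mem_Ioc.2 ⟨(nxt_spec hf).1, nxt_le hf (Or.inr rfl)⟩]
    rw [chain_of_pos u (by omega : 0 < n - f)]
    refine sum_bij (fun g _ => g - f) (fun g hg => ?_) (fun g hg g' hg' h => ?_) (fun j hj => ?_)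
      fun g hg => ?_
    · rw [mem_Ioc] at hg
      rw [mem_Icc]
      omega
    · rw [mem_Ioc] at hg hg'
      omega
    · rw [mem_Icc] at hj
      exact ⟨f + j, mem_Ioc.2 (by omega), by omega⟩
    · rw [mem_Ioc] at hg
      rw [sum_congr rfl fun K hK => by rw [(mem_filter.1 hK).2], ← mul_sum,
        ih (n - g) (by omega) f g hg.1 hg.2 rfl, show n - f - (g - f) = n - g by omega]

end Chain

section Arcs

variable {X : Type} [Fintype X] [DecidableEq X] {I : Type} [Fintype I] [DecidableEq I]
  {π : Perm X} {lab : X → I} {E : Type} [Fintype E] [DecidableEq E] {ι : E → X}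

/-- The points at the positions `K e` in the arcs that start at the points `ι e`. -/
def arcPoints (π : Perm X) (ι : E → X) (K : E → Finset ℕ) : Finset X :=
  univ.biUnion fun e => (K e).image fun j => (π ^ j) (ι e)

theorem mem_arcPoints {K : E → Finset ℕ} {x : X} :
    x ∈ arcPoints π ι K ↔ ∃ e, ∃ j ∈ K e, (π ^ j) (ι e) = x := by
  simp [arcPoints]

theorem pow_mem_arcPoints_iff (hι : Function.Injective ι) {K : E → Finset ℕ}
    (hK : ∀ e, K e ⊆ Ioo 0 (gap π (univ.image ι) (ι e))) {e : E} {j : ℕ}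
    (hj : j < gap π (univ.image ι) (ι e)) : (π ^ j) (ι e) ∈ arcPoints π ι K ↔ j ∈ K e := by
  rw [mem_arcPoints]
  refine ⟨fun ⟨e', j', hj', h⟩ => ?_, fun h => ⟨e, j, h, rfl⟩⟩
  obtain ⟨rfl, h2⟩ := arc_unique (mem_image_of_mem ι (mem_univ e'))
    (mem_image_of_mem ι (mem_univ e)) (mem_Ioo.1 (hK e' hj')).2 hj h
  rwa [← hι h2]

/-- The gap at a point of an arc leads to the next division point. -/
theorem gap_union_arcPoints (hι : Function.Injective ι) {K : E → Finset ℕ}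
    (hK : ∀ e, K e ⊆ Ioo 0 (gap π (univ.image ι) (ι e))) {e : E} {j : ℕ}
    (hj : j < gap π (univ.image ι) (ι e)) :
    gap π (univ.image ι ∪ arcPoints π ι K) ((π ^ j) (ι e)) =
      nxt (K e) (gap π (univ.image ι) (ι e)) j - j := by
  set n := gap π (univ.image ι) (ι e) with hn
  obtain ⟨h1, h2⟩ := nxt_spec (K := K e) hj
  have h3 : nxt (K e) n j ≤ n := nxt_le hj (Or.inr rfl)
  refine gap_eq (by omega) ?_ fun i hi0 hi h => ?_
  · rw [← Perm.mul_apply, ← pow_add, Nat.sub_add_cancel h1.le, mem_union]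
    rcases h2 with h2 | h2
    · exact Or.inr (mem_arcPoints.2 ⟨e, _, h2, rfl⟩)
    · left
      rw [h2, hn]
      exact ret_mem_of_mem (mem_image_of_mem ι (mem_univ e))
  · rw [← Perm.mul_apply, ← pow_add, mem_union] at h
    rcases h with h | h
    · exact notMem_of_lt_gap (by omega) (by omega) h
    · rw [pow_mem_arcPoints_iff hι hK (by omega)] at h
      have := nxt_le (n := n) (by omega : j < i + j) (Or.inl h)
      omega

/-- Enlarge the set of the points `ι e` by points on the cycles that it meets. The new points are
weighted by their gaps, and `f e` is the new gap at `ι e`. -/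
theorem sum_arc_subdivisions {R : Type*} [CommRing R]
    (hl : ∀ x y, lab x = lab y ↔ π.SameCycle x y) (hι : Function.Injective ι)
    (Φ : (E → ℕ) → R) (u : ℕ → R) :
    ∑ L ∈ (univ.filter fun x => lab x ∈ (univ.image ι).image lab ∧ x ∉ univ.image ι).powerset,
      Φ (fun e => gap π (univ.image ι ∪ L) (ι e)) * ∏ l ∈ L, u (gap π (univ.image ι ∪ L) l) =
    ∑ f ∈ Fintype.piFinset fun e => Icc 1 (gap π (univ.image ι) (ι e)),
      Φ f * ∏ e, chain u (gap π (univ.image ι) (ι e) - f e) := by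
  set len : E → ℕ := fun e => gap π (univ.image ι) (ι e) with hlen
  have hι' : ∀ e, ι e ∈ univ.image ι := fun e => mem_image_of_mem ι (mem_univ e)
  have hlen0 : ∀ e, 0 < len e := fun e => gap_pos_of_mem (hι' e)
  -- each arc is subdivided independently
  have h1 : ∑ L ∈ (univ.filter fun x => lab x ∈ (univ.image ι).image lab ∧
        x ∉ univ.image ι).powerset,
      Φ (fun e => gap π (univ.image ι ∪ L) (ι e)) * ∏ l ∈ L, u (gap π (univ.image ι ∪ L) l) =
      ∑ K ∈ Fintype.piFinset fun e => (Ioo 0 (len e)).powerset,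
        Φ (fun e => nxt (K e) (len e) 0) * ∏ e, ∏ j ∈ K e, u (nxt (K e) (len e) j - j) := by
    symm
    have hKs : ∀ K ∈ Fintype.piFinset fun e => (Ioo 0 (len e)).powerset,
        ∀ e, K e ⊆ Ioo 0 (gap π (univ.image ι) (ι e)) := fun K hK e =>
      mem_powerset.1 (Fintype.mem_piFinset.1 hK e)
    refine sum_bij (fun K _ => arcPoints π ι K) (fun K hK => ?_) (fun K hK K' hK' h => ?_)
      (fun L hL => ?_) fun K hK => ?_
    · refine mem_powerset.2 fun x hx => mem_filter.2 ⟨mem_univ _, ?_⟩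
      obtain ⟨e, j, hj, rfl⟩ := mem_arcPoints.1 hx
      have hj' := mem_Ioo.1 (hKs K hK e hj)
      rw [lab_pow hl]
      exact ⟨mem_image_of_mem _ (hι' e), notMem_of_lt_gap hj'.1 hj'.2⟩
    · funext e
      ext j
      by_cases hj : j < len e
      · rw [← pow_mem_arcPoints_iff hι (hKs K hK) hj, ← pow_mem_arcPoints_iff hι (hKs K' hK') hj]
        exact iff_of_eq (congrArg ((π ^ j) (ι e) ∈ ·) h)
      · exact iff_of_false (fun h => hj (mem_Ioo.1 (hKs K hK e h)).2)
          fun h => hj (mem_Ioo.1 (hKs K' hK' e h)).2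
    · refine ⟨fun e => (Ioo 0 (len e)).filter fun j => (π ^ j) (ι e) ∈ L, Fintype.mem_piFinset.2
        fun e => mem_powerset.2 (filter_subset _ _), ?_⟩
      ext x
      rw [mem_arcPoints]
      constructor
      · rintro ⟨e, j, hj, rfl⟩
        exact (mem_filter.1 hj).2
      · intro hx
        obtain ⟨hx1, hx2⟩ := (mem_filter.1 (mem_powerset.1 hL hx)).2
        obtain ⟨z, hz, j, hj, rfl⟩ := exists_arc_of_lab hl hx1
        obtain ⟨e, -, rfl⟩ := mem_image.1 hz
        refine ⟨e, j, mem_filter.2 ⟨mem_Ioo.2 ⟨Nat.pos_of_ne_zero ?_, hj⟩, hx⟩, rfl⟩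
        rintro rfl
        exact hx2 hz
    · congr 1
      · congr 1
        funext e
        exact (gap_union_arcPoints hι (hKs K hK) (j := 0) (hlen0 e)).symm
      · rw [arcPoints, prod_biUnion]
        · refine prod_congr rfl fun e _ => ?_
          rw [prod_image]
          · refine prod_congr rfl fun j hj => ?_
            exact congrArg u (gap_union_arcPoints hι (hKs K hK)
              (mem_Ioo.1 (hKs K hK e hj)).2).symm
          · intro j hj j' hj' h
            exact (arc_unique (hι' e) (hι' e) (mem_Ioo.1 (hKs K hK e hj)).2
              (mem_Ioo.1 (hKs K hK e hj')).2 h).1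
        · intro e _ e' _ hne
          refine disjoint_left.2 fun x hx hx' => hne ?_
          obtain ⟨j, hj, rfl⟩ := mem_image.1 hx
          obtain ⟨j', hj', h⟩ := mem_image.1 hx'
          exact (hι (arc_unique (hι' e') (hι' e) (mem_Ioo.1 (hKs K hK e' hj')).2
            (mem_Ioo.1 (hKs K hK e hj)).2 h).2).symm
  rw [h1, ← sum_fiberwise_of_maps_to (t := Fintype.piFinset fun e => Icc 1 (len e))
    (g := fun K e => nxt (K e) (len e) 0) fun K _ => Fintype.mem_piFinset.2 fun e =>
      mem_Icc.2 ⟨(nxt_spec (hlen0 e)).1, nxt_le (hlen0 e) (Or.inr rfl)⟩]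
  refine sum_congr rfl fun f hf => ?_
  rw [sum_congr rfl fun K hK => by rw [(mem_filter.1 hK).2], ← mul_sum]
  congr 1
  have hf' := fun e => mem_Icc.1 (Fintype.mem_piFinset.1 hf e)
  rw [prod_congr rfl fun e _ => (sum_subdivisions u (len e) 0 (f e) (hf' e).1 (hf' e).2).symm,
    prod_univ_sum]
  refine sum_congr ?_ fun _ _ => rfl
  ext K
  simp only [mem_filter, Fintype.mem_piFinset, funext_iff]
  exact ⟨fun h e => ⟨h.1 e, h.2 e⟩, fun h => ⟨fun e => (h e).1, fun e => (h e).2⟩⟩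

end Arcs

/-! ### Extracting coefficients -/

section Ideals

variable {σ : Type}

/-- The power series whose coefficients at the exponents in a lower set vanish. -/
def lowIdeal (D : Set (σ →₀ ℕ)) (hD : IsLowerSet D) : Ideal (MvPowerSeries σ ℚ) where
  carrier := {f | ∀ d ∈ D, MvPowerSeries.coeff d f = 0}
  zero_mem' := fun d _ => map_zero _
  add_mem' := fun {f g} hf hg d hd => by rw [map_add, hf d hd, hg d hd, add_zero]
  smul_mem' := fun c f hf d hd => by
    classical
    rw [smul_eq_mul, MvPowerSeries.coeff_mul]
    refine sum_eq_zero fun p hp => ?_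
    rw [hf p.2 (hD (mem_antidiagonal.1 hp ▸ le_add_self) hd), mul_zero]

theorem mem_lowIdeal {D : Set (σ →₀ ℕ)} {hD : IsLowerSet D} {f : MvPowerSeries σ ℚ} :
    f ∈ lowIdeal D hD ↔ ∀ d ∈ D, MvPowerSeries.coeff d f = 0 := Iff.rfl

theorem coeff_eq_of_mk_eq {D : Set (σ →₀ ℕ)} {hD : IsLowerSet D} {f g : MvPowerSeries σ ℚ}
    (h : Ideal.Quotient.mk (lowIdeal D hD) f = Ideal.Quotient.mk (lowIdeal D hD) g)
    {d : σ →₀ ℕ} (hd : d ∈ D) : MvPowerSeries.coeff d f = MvPowerSeries.coeff d g := by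
  have := mem_lowIdeal.1 (Ideal.Quotient.eq.1 h) d hd
  rwa [map_sub, sub_eq_zero] at this

theorem mk_eq_of_coeff_eq {D : Set (σ →₀ ℕ)} {hD : IsLowerSet D} {f g : MvPowerSeries σ ℚ}
    (h : ∀ d ∈ D, MvPowerSeries.coeff d f = MvPowerSeries.coeff d g) :
    Ideal.Quotient.mk (lowIdeal D hD) f = Ideal.Quotient.mk (lowIdeal D hD) g :=
  Ideal.Quotient.eq.2 fun d hd => by rw [map_sub, h d hd, sub_self]

/-- The power series in all of whose monomials `s` occurs only together with `t`. -/
def occ (s t : σ) : Subring (MvPowerSeries σ ℚ) where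
  carrier := {f | ∀ d, MvPowerSeries.coeff d f ≠ 0 → d s ≠ 0 → d t ≠ 0}
  zero_mem' := fun d h => absurd (map_zero _) h
  one_mem' := fun d h hs => by
    classical
    rw [MvPowerSeries.coeff_one] at h
    split_ifs at h with hd
    · rw [hd] at hs
      exact absurd rfl hs
    · exact absurd rfl h
  add_mem' := fun {f g} hf hg d h hs => by
    rw [map_add] at h
    by_cases hfd : MvPowerSeries.coeff d f = 0
    · rw [hfd, zero_add] at h
      exact hg d h hs
    · exact hf d hfd hs
  neg_mem' := fun {f} hf d h hs => hf d (by rwa [map_neg, neg_ne_zero] at h) hs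
  mul_mem' := fun {f g} hf hg d h hs => by
    classical
    rw [MvPowerSeries.coeff_mul] at h
    obtain ⟨p, hp, hne⟩ := exists_ne_zero_of_sum_ne_zero h
    have hpd := mem_antidiagonal.1 hp
    have hs' : p.1 s + p.2 s = d s := by rw [← hpd]; rfl
    have ht' : p.1 t + p.2 t = d t := by rw [← hpd]; rfl
    by_cases h1 : p.1 s = 0
    · have := hg p.2 (right_ne_zero_of_mul hne) (by omega)
      omega
    · have := hf p.1 (left_ne_zero_of_mul hne) h1
      omega

theorem mem_occ {s t : σ} {f : MvPowerSeries σ ℚ} :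
    f ∈ occ s t ↔ ∀ d, MvPowerSeries.coeff d f ≠ 0 → d s ≠ 0 → d t ≠ 0 := Iff.rfl

/-- The power series with coefficients in a subring. -/
def coeffSubring {R : Type*} [CommRing R] (S : Subring R) : Subring (PowerSeries R) where
  carrier := {f | ∀ n, PowerSeries.coeff n f ∈ S}
  zero_mem' := fun n => by rw [map_zero]; exact S.zero_mem
  one_mem' := fun n => by
    rw [PowerSeries.coeff_one]
    split_ifs
    · exact S.one_mem
    · exact S.zero_mem
  add_mem' := fun {f g} hf hg n => by rw [map_add]; exact S.add_mem (hf n) (hg n)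
  neg_mem' := fun {f} hf n => by rw [map_neg]; exact S.neg_mem (hf n)
  mul_mem' := fun {f g} hf hg n => by
    rw [PowerSeries.coeff_mul]
    exact S.sum_mem fun p _ => S.mul_mem (hf _) (hg _)

theorem C_mem_coeffSubring {R : Type*} [CommRing R] {S : Subring R} {a : R} (ha : a ∈ S) :
    PowerSeries.C a ∈ coeffSubring S := by
  intro n
  rw [PowerSeries.coeff_C]
  split_ifs
  · exact ha
  · exact S.zero_mem

theorem X_mem_coeffSubring {R : Type*} [CommRing R] {S : Subring R} :
    (PowerSeries.X : PowerSeries R) ∈ coeffSubring S := by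
  intro n
  rw [PowerSeries.coeff_X]
  split_ifs
  · exact S.one_mem
  · exact S.zero_mem

theorem chain_mem {R : Type*} [CommRing R] {S : Subring R} {u : ℕ → R} (hu : ∀ j, u j ∈ S) (q : ℕ) :
    chain u q ∈ S := by
  induction q using Nat.strong_induction_on with
  | _ q ih =>
    rcases Nat.eq_zero_or_pos q with rfl | hq
    · rw [chain_zero]; exact S.one_mem
    · rw [chain_of_pos u hq]
      refine S.sum_mem fun j hj => S.mul_mem (hu j) (ih _ ?_)
      rw [mem_Icc] at hj
      omega

theorem map_chain {R S : Type*} [CommRing R] [CommRing S] (f : R →+* S) (u : ℕ → R) (q : ℕ) :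
    f (chain u q) = chain (fun j => f (u j)) q := by
  induction q using Nat.strong_induction_on with
  | _ q ih =>
    rcases Nat.eq_zero_or_pos q with rfl | hq
    · rw [chain_zero, chain_zero, map_one]
    · rw [chain_of_pos u hq, chain_of_pos _ hq, map_sum]
      refine sum_congr rfl fun j hj => ?_
      rw [mem_Icc] at hj
      rw [map_mul, ih _ (by omega)]

end Ideals

section Exponents

variable {m : ℕ}

/-- The exponent of the product of `x_i ^ β_i z_i` over `i ∈ S`. -/
def ex (β : Fin m → ℕ) (S : Finset (Fin m)) : Fin m ⊕ Fin m →₀ ℕ :=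
  Finsupp.equivFunOnFinite.symm
    (Sum.elim (fun i => if i ∈ S then β i else 0) fun i => if i ∈ S then 1 else 0)

@[simp] theorem ex_inl (β : Fin m → ℕ) (S : Finset (Fin m)) (i : Fin m) :
    ex β S (Sum.inl i) = if i ∈ S then β i else 0 := rfl

@[simp] theorem ex_inr (β : Fin m → ℕ) (S : Finset (Fin m)) (i : Fin m) :
    ex β S (Sum.inr i) = if i ∈ S then 1 else 0 := rfl

theorem markerCoeff_eq (f : A m) (β : Fin m →₀ ℕ) :
    MvPowerSeries.coeff β (markerCoeff f) = MvPowerSeries.coeff (ex β univ) f := by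
  change MvPowerSeries.coeff _ f = _
  congr 2
  ext (i | i) <;> simp

/-- In all monomials of the power series, `x_i` occurs only together with the marker `z_i`. -/
def bal (m : ℕ) : Subring (A m) := ⨅ i, occ (Sum.inl i) (Sum.inr i)

theorem mem_bal {f : A m} : f ∈ bal m ↔ ∀ d, MvPowerSeries.coeff d f ≠ 0 →
    ∀ i, d (Sum.inl i) ≠ 0 → d (Sum.inr i) ≠ 0 := by
  rw [bal, Subring.mem_iInf]
  exact ⟨fun h d hd i => h i d hd, fun h i d hd => h d hd i⟩

/-- Since every marker occurs once, each variable goes to exactly one of the factors. -/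
theorem coeff_ex_prod {W : Type} [Fintype W] [DecidableEq W] (β : Fin m → ℕ) (S : Finset (Fin m))
    {f : W → A m} (hf : ∀ w, f w ∈ bal m) :
    MvPowerSeries.coeff (ex β S) (∏ w, f w) =
      ∑ A : Fin m → Option W with ∀ i, A i = none ↔ i ∉ S,
        ∏ w, MvPowerSeries.coeff (ex β (univ.filter fun i => A i = some w)) (f w) := by
  classical
  rw [MvPowerSeries.coeff_prod]
  symm
  refine sum_of_injOn (fun A => Finsupp.equivFunOnFinite.symm fun w =>
    ex β (univ.filter fun i => A i = some w)) ?_ ?_ ?_ ?_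
  · intro A _ A' _ h
    have h1 : ∀ i w, A i = some w ↔ A' i = some w := by
      intro i w
      have := DFunLike.congr_fun (DFunLike.congr_fun h w) (Sum.inr i)
      simp only [Finsupp.equivFunOnFinite_symm_apply_apply, ex_inr, mem_filter, mem_univ,
        true_and] at this
      by_cases h1 : A i = some w <;> by_cases h2 : A' i = some w <;> simp_all
    funext i
    rcases h2 : A' i with _ | w
    · rcases h3 : A i with _ | w
      · rfl
      · rw [(h1 i w).1 h3] at h2
        exact absurd h2 (by simp)
    · exact (h1 i w).2 h2
  · intro A hA
    have hA := (mem_filter.1 (mem_coe.1 hA)).2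
    rw [mem_coe, mem_finsuppAntidiag]
    refine ⟨?_, subset_univ _⟩
    have key : ∀ (i : Fin m) (a : ℕ), (∑ w, if A i = some w then a else 0) =
        if i ∈ S then a else 0 := by
      intro i a
      rcases h : A i with _ | w
      · simp [(hA i).1 h]
      · have : i ∈ S := by
          by_contra h'
          rw [(hA i).2 h'] at h
          exact absurd h (by simp)
        simp [this]
    ext (i | i)
    · rw [Finsupp.finsetSum_apply, ex_inl, ← key i (β i)]
      simp
    · rw [Finsupp.finsetSum_apply, ex_inr, ← key i 1]
      simp
  · intro l hl hne
    rw [mem_finsuppAntidiag] at hl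
    by_contra h0
    refine hne ?_
    have h0 : ∀ w, MvPowerSeries.coeff (l w) (f w) ≠ 0 := fun w =>
      prod_ne_zero_iff.1 h0 w (mem_univ w)
    have hsum : ∀ s, ∑ w, l w s = ex β S s := by
      intro s
      rw [← hl.1, Finsupp.finsetSum_apply]
    have hbal : ∀ w i, l w (Sum.inr i) = 0 → l w (Sum.inl i) = 0 := by
      intro w i h
      by_contra h'
      exact mem_bal.1 (hf w) _ (h0 w) i h' h
    -- each marker goes to at most one factor, and by `hbal` it takes its variable along
    have huniq : ∀ i w w', l w (Sum.inr i) ≠ 0 → w' ≠ w → l w' (Sum.inr i) = 0 := by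
      intro i w w' h h'
      have h1 : ∑ w, l w (Sum.inr i) ≤ 1 := by
        rw [hsum, ex_inr]; split_ifs <;> omega
      have h2 : l w (Sum.inr i) + l w' (Sum.inr i) ≤ ∑ w, l w (Sum.inr i) := by
        rw [← sum_pair (f := fun w => l w (Sum.inr i)) h'.symm]
        exact sum_le_sum_of_subset (subset_univ _)
      omega
    let A : Fin m → Option W := fun i =>
      if h : ∃ w, l w (Sum.inr i) ≠ 0 then some h.choose else none
    have hA : ∀ i w, A i = some w ↔ l w (Sum.inr i) ≠ 0 := by
      intro i w
      simp only [A]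
      split_ifs with h
      · rw [Option.some.injEq]
        constructor
        · rintro rfl
          exact h.choose_spec
        · intro hw
          by_contra h'
          exact hw (huniq i _ w h.choose_spec (Ne.symm h'))
      · push Not at h
        simp [h w]
    have hAn : ∀ i, A i = none ↔ i ∉ S := by
      intro i
      have h1 : A i = none ↔ ∀ w, l w (Sum.inr i) = 0 := by
        simp only [A]
        split_ifs with h
        · obtain ⟨w, hw⟩ := h
          simp only [false_iff, not_forall]
          exact ⟨w, hw⟩
        · push Not at h
          simp [h]
      have h2 := hsum (Sum.inr i)
      rw [h1, ← not_iff_not, not_not]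
      rw [ex_inr] at h2
      split_ifs at h2 with hi
      · refine iff_of_true (fun h => ?_) hi
        rw [sum_eq_zero fun w _ => h w] at h2
        omega
      · exact iff_of_false (fun h => h fun w => (sum_eq_zero_iff.1 h2) w (mem_univ w)) hi
    refine ⟨A, mem_coe.2 (mem_filter.2 ⟨mem_univ _, hAn⟩), ?_⟩
    ext w s
    have hval : ∀ i, A i = some w → ∀ s, (s = Sum.inl i ∨ s = Sum.inr i) → l w s = ex β S s := by
      intro i hi s hs
      rw [← hsum, sum_eq_single w]
      · intro w' _ hw'
        have := huniq i w w' ((hA i w).1 hi) hw'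
        rcases hs with rfl | rfl
        · exact hbal _ _ this
        · exact this
      · exact fun h => absurd (mem_univ _) h
    have hnot : ∀ i, A i ≠ some w → l w (Sum.inr i) = 0 := fun i hi => by
      by_contra h
      exact hi ((hA i w).2 h)
    have hmemS : ∀ i, A i = some w → i ∈ S := fun i hi => by
      by_contra h
      rw [(hAn i).2 h] at hi
      exact absurd hi (by simp)
    rcases s with i | i
    · by_cases hi : A i = some w
      · rw [hval i hi _ (Or.inl rfl)]
        simp [hi, hmemS i hi]
      · rw [hbal _ _ (hnot i hi)]
        simp [hi]
    · by_cases hi : A i = some w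
      · rw [hval i hi _ (Or.inr rfl)]
        simp [hi, hmemS i hi]
      · rw [hnot i hi]
        simp [hi]
  · intro A _
    rfl

/-- The exponents of `x_B ^ d z_B` can be split off only if they agree with `β` on `B`. -/
theorem coeff_monomial_mul_bal (β : Fin m → ℕ) (B : Finset (Fin m)) {g : A m} (hg : g ∈ bal m)
    {d : Fin m ⊕ Fin m →₀ ℕ} (hr : ∀ i, d (Sum.inr i) = if i ∈ B then 1 else 0)
    (hd : ∀ i ∉ B, d (Sum.inl i) = 0) :
    MvPowerSeries.coeff (ex β univ) (MvPowerSeries.monomial d 1 * g) =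
      if ∀ i ∈ B, d (Sum.inl i) = β i then MvPowerSeries.coeff (ex β Bᶜ) g else 0 := by
  rw [MvPowerSeries.coeff_monomial_mul, one_mul]
  split_ifs with h1 h2 h2
  · congr 2
    ext (i | i)
    · rw [Finsupp.tsub_apply]
      by_cases hi : i ∈ B
      · simp [hi, h2 i hi]
      · simp [hi, hd i hi]
    · rw [Finsupp.tsub_apply, hr]
      by_cases hi : i ∈ B <;> simp [hi]
  · push Not at h2
    obtain ⟨i, hi, hne⟩ := h2
    by_contra h0
    have h3 := mem_bal.1 hg _ h0 i
    have h4 := h1 (Sum.inl i)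
    rw [Finsupp.tsub_apply, Finsupp.tsub_apply, hr] at h3
    simp only [ex_inl, ex_inr, mem_univ, if_true, hi, Nat.sub_self] at h3 h4
    exact h3 (by omega) rfl
  · refine absurd (fun s => ?_) h1
    rcases s with i | i
    · by_cases hi : i ∈ B
      · simp [h2 i hi]
      · simp [hd i hi]
    · rw [hr]
      by_cases hi : i ∈ B <;> simp [hi]
  · rfl

end Exponents

section PsiCoefficients

theorem coeff_xD {m : ℕ} (i : Fin m) (f : MvPowerSeries (Fin m) ℚ) (d : Fin m →₀ ℕ) :
    MvPowerSeries.coeff d (xD i f) = d i * MvPowerSeries.coeff d f := by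
  rw [xD, MvPowerSeries.X_def, MvPowerSeries.coeff_monomial_mul, one_mul,
    MvPowerSeries.coeff_pderiv]
  by_cases h : d i = 0
  · rw [if_neg, h, Nat.cast_zero, zero_mul]
    intro h'
    have := h' i
    rw [Finsupp.single_eq_same] at this
    omega
  · have hle : Finsupp.single i 1 ≤ d := by
      rw [Finsupp.single_le_iff]; omega
    rw [if_pos hle, tsub_add_cancel_of_le hle, Finsupp.tsub_apply, Finsupp.single_eq_same,
      Nat.cast_sub (by omega)]
    push_cast
    ring

/-- Coefficients after an injective renaming of the variables. -/
theorem coeff_rename_emb {n : ℕ} {σ : Type} (e : Fin n ↪ σ) (p : MvPowerSeries (Fin n) ℚ)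
    (x : σ →₀ ℕ) [Decidable (∀ s, x s ≠ 0 → s ∈ Set.range e)] :
    MvPowerSeries.coeff x (MvPowerSeries.rename e p) =
      if ∀ s, x s ≠ 0 → s ∈ Set.range e then
        MvPowerSeries.coeff (Finsupp.equivFunOnFinite.symm fun a => x (e a)) p else 0 := by
  split_ifs with h
  · have h1 : x = Finsupp.embDomain e (Finsupp.equivFunOnFinite.symm fun a => x (e a)) := by
      ext s
      by_cases hs : s ∈ Set.range e
      · obtain ⟨a, rfl⟩ := hs
        rw [Finsupp.embDomain_apply_self]
        rfl
      · rw [Finsupp.embDomain_of_notMem_range _ _ _ hs]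
        by_contra h'
        exact hs (h s h')
    conv_lhs => rw [h1]
    rw [MvPowerSeries.coeff_embDomain_rename]
  · refine MvPowerSeries.coeff_rename_eq_zero _ _ ?_
    rintro ⟨y, rfl⟩
    refine h fun s hs => ?_
    by_contra h'
    exact hs (Finsupp.mapDomain_of_notMem_range _ _ h')

variable {m : ℕ} (Q : ∀ j, MvPowerSeries (Fin j) ℚ)

/-- The exponents of the variables `x_i`, `i ∈ S`, as a family indexed by `Fin S.card`. -/
def restr (d : Fin m → ℕ) (S : Finset (Fin m)) : Fin S.card →₀ ℕ :=
  Finsupp.equivFunOnFinite.symm fun a => d (S.orderEmbOfFin rfl a)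

theorem prod_zv (S : Finset (Fin m)) :
    ∏ i ∈ S, (zv i : A m) = MvPowerSeries.monomial (ex (fun _ => 0) S) 1 := by
  classical
  induction S using Finset.induction_on with
  | empty =>
    rw [prod_empty, ← MvPowerSeries.monomial_zero_one]
    congr 1
    congr 1
    ext (i | i) <;> simp
  | insert a S ha ih =>
    rw [prod_insert ha, ih, zv, MvPowerSeries.X_def, MvPowerSeries.monomial_mul_monomial, one_mul]
    congr 1
    congr 1
    ext (i | i)
    · simp
    · by_cases h : i = a
      · subst h; simp [ha]
      · simp [h]

open Classical in
/-- The markers in a monomial of `Psi Q` tell from which of the series `Q (#S + 1)` it comes. -/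
theorem coeff_Psi (j : ℕ) (d : Fin m ⊕ Fin m →₀ ℕ) :
    MvPowerSeries.coeff d (PowerSeries.coeff j (Psi Q)) =
      if (∀ i, d (Sum.inr i) ≤ 1) ∧ ∀ i, d (Sum.inl i) ≠ 0 → d (Sum.inr i) ≠ 0 then
        j * MvPowerSeries.coeff (Finsupp.cons j
          (restr (fun i => d (Sum.inl i)) (univ.filter fun i => d (Sum.inr i) ≠ 0)))
          (Q (#{i | d (Sum.inr i) ≠ 0} + 1)) else 0 := by
  have hterm : ∀ S : Finset (Fin m), MvPowerSeries.coeff d ((∏ i ∈ S, zv i) *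
      MvPowerSeries.rename (fun a : Fin S.card => (Sum.inl (S.orderEmbOfFin rfl a) : Fin m ⊕ Fin m))
        (coeffFst j (xD 0 (Q (S.card + 1))))) =
      if (∀ i, d (Sum.inr i) = if i ∈ S then 1 else 0) ∧ ∀ i, d (Sum.inl i) ≠ 0 → i ∈ S then
        j * MvPowerSeries.coeff (Finsupp.cons j (restr (fun i => d (Sum.inl i)) S))
          (Q (S.card + 1)) else 0 := by
    intro S
    let e : Fin S.card ↪ Fin m ⊕ Fin m := (S.orderEmbOfFin rfl).toEmbedding.trans .inl
    have hr : Set.range e = {s | ∃ i ∈ S, s = Sum.inl i} := by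
      ext s
      constructor
      · rintro ⟨a, rfl⟩
        exact ⟨_, orderEmbOfFin_mem S rfl a, rfl⟩
      · rintro ⟨i, hi, rfl⟩
        have : i ∈ Set.range (S.orderEmbOfFin rfl) := by rwa [range_orderEmbOfFin]
        obtain ⟨a, rfl⟩ := this
        exact ⟨a, rfl⟩
    rw [prod_zv, MvPowerSeries.coeff_monomial_mul, one_mul]
    change (if _ then MvPowerSeries.coeff _ (MvPowerSeries.rename e _) else _) = _
    rw [coeff_rename_emb, ← ite_and]
    refine if_congr ?_ ?_ rfl
    · rw [hr]
      constructor
      · rintro ⟨h1, h2⟩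
        refine ⟨fun i => ?_, fun i hi => ?_⟩
        · have h3 := h1 (Sum.inr i)
          have h4 : (d - ex (fun _ => 0) S) (Sum.inr i) = 0 := by
            by_contra h
            obtain ⟨i, -, h⟩ := h2 _ h
            exact absurd h (by simp)
          rw [Finsupp.tsub_apply] at h4
          rw [ex_inr] at h3 h4
          omega
        · obtain ⟨i', hi', h⟩ := h2 (Sum.inl i) (by
            rw [Finsupp.tsub_apply, ex_inl]
            split_ifs <;> simpa using hi)
          rw [Sum.inl.inj h]
          exact hi'
      · rintro ⟨h1, h2⟩
        refine ⟨fun s => ?_, fun s hs => ?_⟩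
        · rcases s with i | i
          · rw [ex_inl]; split_ifs <;> exact Nat.zero_le _
          · rw [ex_inr, h1]
        · rcases s with i | i
          · rw [Finsupp.tsub_apply] at hs
            exact ⟨i, h2 i (by omega), rfl⟩
          · rw [Finsupp.tsub_apply, ex_inr, h1, Nat.sub_self] at hs
            exact absurd rfl hs
    · change MvPowerSeries.coeff (Finsupp.cons j _) (xD 0 _) = _
      rw [coeff_xD, Finsupp.cons_zero]
      congr 3
      congr 1
      ext a
      change (d - ex (fun _ => 0) S) (Sum.inl _) = d (Sum.inl _)
      rw [Finsupp.tsub_apply, ex_inl]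
      split_ifs <;> rfl
  rw [Psi, PowerSeries.coeff_mk, map_sum, sum_congr rfl fun S _ => hterm S]
  by_cases h : (∀ i, d (Sum.inr i) ≤ 1) ∧ ∀ i, d (Sum.inl i) ≠ 0 → d (Sum.inr i) ≠ 0
  · rw [if_pos h, sum_eq_single (univ.filter fun i => d (Sum.inr i) ≠ 0)]
    · rw [if_pos]
      refine ⟨fun i => ?_, fun i hi => mem_filter.2 ⟨mem_univ _, h.2 i hi⟩⟩
      have := h.1 i
      simp only [mem_filter, mem_univ, true_and]
      split_ifs <;> omega
    · intro S _ hS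
      rw [if_neg]
      rintro ⟨h1, -⟩
      refine hS ?_
      ext i
      rw [mem_filter_univ, h1]
      by_cases hi : i ∈ S <;> simp [hi]
    · exact fun h => absurd (mem_univ _) h
  · rw [if_neg h]
    refine sum_eq_zero fun S _ => if_neg ?_
    rintro ⟨h1, h2⟩
    refine h ⟨fun i => ?_, fun i hi => ?_⟩
    · rw [h1]; split_ifs <;> omega
    · rw [h1, if_pos (h2 i hi)]; exact one_ne_zero

theorem coeff_Psi_mem_bal (j : ℕ) : PowerSeries.coeff j (Psi (m := m) Q) ∈ bal m := by
  classical
  rw [mem_bal]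
  intro d hd
  rw [coeff_Psi] at hd
  exact (ite_ne_right_iff.1 hd).1.2

theorem coeff_Psi_zero : PowerSeries.coeff 0 (Psi (m := m) Q) = 0 := by
  classical
  ext d
  rw [coeff_Psi]
  simp

/-- The coefficient of `Psi Q` at `x_S ^ β z_S` is one of the series `Q (#S + 1)`. -/
theorem coeff_ex_Psi (j : ℕ) (β : Fin m → ℕ) (S : Finset (Fin m)) :
    MvPowerSeries.coeff (ex β S) (PowerSeries.coeff j (Psi Q)) =
      j * MvPowerSeries.coeff (Finsupp.cons j (restr β S)) (Q (#S + 1)) := by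
  classical
  have hS : (univ.filter fun i => ex β S (Sum.inr i) ≠ 0) = S := by
    ext i
    rw [mem_filter_univ, ex_inr]
    by_cases hi : i ∈ S <;> simp [hi]
  rw [coeff_Psi, if_pos]
  · have h1 : ∀ T, T = S → MvPowerSeries.coeff
        (Finsupp.cons j (restr (fun i => ex β S (Sum.inl i)) T)) (Q (#T + 1)) =
        MvPowerSeries.coeff (Finsupp.cons j (restr β S)) (Q (#S + 1)) := by
      rintro T rfl
      congr 3
      ext a
      exact if_pos (orderEmbOfFin_mem _ rfl a)
    rw [h1 _ hS]
  · refine ⟨fun i => ?_, fun i hi => ?_⟩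
    · rw [ex_inr]; split_ifs <;> omega
    · rw [ex_inl] at hi
      rw [ex_inr, if_pos (ite_ne_right_iff.1 hi).1]; exact one_ne_zero

end PsiCoefficients

/-! ### Expanding the product over the vertices of a tree -/

section Abstract

variable {R : Type*} [CommRing R]

/-- `∑ chain u q * x ^ q` is the inverse of `1 - ∑ u j * x ^ j`, for nilpotent `x`. -/
theorem sum_chain_mul (u : ℕ → R) (x : R) {N : ℕ} (hN : 0 < N) (hx : x ^ N = 0) :
    (∑ q ∈ range N, chain u q * x ^ q) * (1 - ∑ j ∈ Ico 1 N, u j * x ^ j) = 1 := by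
  have h1 : (∑ q ∈ range N, chain u q * x ^ q) * ∑ j ∈ Ico 1 N, u j * x ^ j =
      ∑ n ∈ Ico 1 N, chain u n * x ^ n := by
    rw [sum_mul_sum, ← sum_product', ← sum_filter_add_sum_filter_not _ fun p => p.1 + p.2 < N]
    have h2 : ∑ p ∈ range N ×ˢ Ico 1 N with ¬ p.1 + p.2 < N,
        chain u p.1 * x ^ p.1 * (u p.2 * x ^ p.2) = 0 := by
      refine sum_eq_zero fun p hp => ?_
      have h3 : x ^ (p.1 + p.2) = 0 := pow_eq_zero_of_le (not_lt.1 (mem_filter.1 hp).2) hx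
      rw [show chain u p.1 * x ^ p.1 * (u p.2 * x ^ p.2) =
        chain u p.1 * u p.2 * x ^ (p.1 + p.2) by ring, h3, mul_zero]
    rw [h2, add_zero, ← sum_fiberwise_of_maps_to (t := Ico 1 N) (g := fun p => p.1 + p.2)]
    · refine sum_congr rfl fun n hn => ?_
      rw [mem_Ico] at hn
      rw [chain_of_pos u (by omega), sum_mul]
      symm
      refine sum_bij (fun j _ => (n - j, j)) (fun j hj => ?_) (fun j _ j' _ h => ?_)
        (fun p hp => ?_) fun j hj => ?_
      · rw [mem_Icc] at hj
        simp only [mem_filter, mem_product, mem_range, mem_Ico]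
        omega
      · exact (Prod.ext_iff.1 h).2
      · simp only [mem_filter, mem_product, mem_range, mem_Ico] at hp
        refine ⟨p.2, mem_Icc.2 (by omega), Prod.ext ?_ rfl⟩
        change n - p.2 = p.1
        omega
      · rw [mem_Icc] at hj
        have : x ^ n = x ^ (n - j) * x ^ j := by rw [← pow_add]; congr 1; omega
        rw [this]
        ring
    · intro p hp
      simp only [mem_filter, mem_product, mem_range, mem_Ico] at hp
      exact mem_Ico.2 (by omega)
  rw [mul_sub, mul_one, h1, range_eq_Ico, sum_eq_sum_Ico_succ_bot hN, chain_zero]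
  simp

theorem mk_pow_mul (a : R) :
    (PowerSeries.mk fun r => a ^ r) * (1 - PowerSeries.X * PowerSeries.C a) = 1 := by
  ext n
  rw [mul_sub, mul_one, map_sub, ← mul_assoc, PowerSeries.coeff_mul_C, PowerSeries.coeff_mk]
  rcases n with _ | n
  · simp
  · rw [PowerSeries.coeff_succ_mul_X, PowerSeries.coeff_mk, ← pow_succ, sub_self,
      PowerSeries.coeff_one, if_neg (by omega)]

theorem prod_monomial_one {σ ι : Type} (s : Finset ι) (d : ι → σ →₀ ℕ) :
    ∏ i ∈ s, (MvPowerSeries.monomial (d i) 1 : MvPowerSeries σ ℚ) =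
      MvPowerSeries.monomial (∑ i ∈ s, d i) 1 := by
  classical
  induction s using Finset.induction_on with
  | empty => simp
  | insert a s ha ih =>
    rw [prod_insert ha, sum_insert ha, ih, MvPowerSeries.monomial_mul_monomial, one_mul]

/-- A product of sums over functions supported on the fibres of `g` is a sum over all functions. -/
theorem prod_sum_fibres {E W : Type} [Fintype E] [DecidableEq E] [Fintype W] [DecidableEq W]
    (g : E → W) (s : Finset ℕ) (a : W → (E → ℕ) → R) :
    ∏ w, ∑ f ∈ Fintype.piFinset fun e => if g e = w then s else {0}, a w f =
      ∑ f ∈ Fintype.piFinset fun _ : E => s, ∏ w, a w fun e => if g e = w then f e else 0 := by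
  rw [prod_univ_sum]
  symm
  refine sum_bij (fun f _ w e => if g e = w then f e else 0) (fun f hf => ?_)
    (fun f _ f' _ h => ?_) (fun F hF => ?_) fun f _ => rfl
  · rw [Fintype.mem_piFinset] at hf ⊢
    intro w
    rw [Fintype.mem_piFinset]
    intro e
    split_ifs
    · exact hf e
    · exact mem_singleton_self 0
  · funext e
    have := congrFun (congrFun h (g e)) e
    simpa using this
  · have hF : ∀ w e, F w e ∈ if g e = w then s else {0} := fun w e =>
      Fintype.mem_piFinset.1 (Fintype.mem_piFinset.1 hF w) e
    refine ⟨fun e => F (g e) e, Fintype.mem_piFinset.2 fun e => by simpa using hF (g e) e, ?_⟩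
    funext w e
    have h := hF w e
    split_ifs at h ⊢ with hw
    · change F (g e) e = F w e
      rw [hw]
    · exact (mem_singleton.1 h).symm

end Abstract

section Box

variable {m : ℕ} {β : Fin m → ℕ}

/-- The ideal of the power series without monomials that divide the monomial with exponent
`ex β univ`. -/
def boxIdeal (β : Fin m → ℕ) : Ideal (A m) := lowIdeal (Set.Iic (ex β univ)) (isLowerSet_Iic _)

theorem xv_pow_mem {i : Fin m} {n : ℕ} (h : β i < n) : xv i ^ n ∈ boxIdeal β := by
  classical
  intro d hd
  rw [xv, MvPowerSeries.coeff_X_pow, if_neg]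
  rintro rfl
  have := hd (Sum.inl i)
  rw [Finsupp.single_eq_same, ex_inl, if_pos (mem_univ i)] at this
  omega

theorem hplus_mem {S : Finset (Fin m)} {j : ℕ} (h : ∑ i, β i < j) : hplus S j ∈ boxIdeal β := by
  rw [hplus, if_neg (by omega)]
  refine Ideal.sum_mem _ fun f hf => ?_
  have hf := (mem_piAntidiag.1 (mem_filter.1 hf).1).1
  obtain ⟨i, hi, hlt⟩ : ∃ i ∈ S, β i < f i := by
    by_contra! hcon
    have h1 : S.sum f ≤ ∑ i ∈ S, β i := sum_le_sum hcon
    have h2 := sum_le_sum_of_subset (f := β) (subset_univ S)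
    omega
  exact Ideal.mem_of_dvd _ (dvd_prod_of_mem _ hi) (xv_pow_mem hlt)

/-- Modulo the ideal, the operation `umbral` is a finite sum. -/
theorem mk_umbral (a b : PowerSeries (A m)) {N : ℕ}
    (hb : ∀ j, N ≤ j → PowerSeries.coeff j b ∈ boxIdeal β) :
    Ideal.Quotient.mk (boxIdeal β) (umbral a b) =
      ∑ j ∈ range N, Ideal.Quotient.mk (boxIdeal β) (PowerSeries.coeff j a) *
        Ideal.Quotient.mk (boxIdeal β) (PowerSeries.coeff j b) := by
  simp only [← map_mul, ← map_sum]
  refine mk_eq_of_coeff_eq fun d hd => ?_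
  rw [map_sum]
  change ∑ᶠ j : ℕ, _ = _
  refine finsum_eq_sum_of_support_subset _ fun j hj => ?_
  by_contra h
  rw [mem_coe, mem_range, not_lt] at h
  exact hj (Ideal.mul_mem_left _ _ (hb j h) d hd)

variable (Q : ∀ j, MvPowerSeries (Fin j) ℚ)

/-- The factor of a white vertex of degree one, as a function of its label. -/
def leafFactor (m : ℕ) (j : ℕ) : PowerSeries (A m) :=
  PowerSeries.X * PowerSeries.C (PowerSeries.coeff j (Psi Q))

theorem mk_PsiAt {N : ℕ} (hN : ∑ i, β i < N) (i : Fin m) :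
    Ideal.Quotient.mk (boxIdeal β) (PsiAt Q i) =
      ∑ j ∈ Ico 1 N, Ideal.Quotient.mk (boxIdeal β) (PowerSeries.coeff j (Psi Q)) *
        Ideal.Quotient.mk (boxIdeal β) (xv i) ^ j := by
  have hi : β i < N := (single_le_sum (fun _ _ => Nat.zero_le _) (mem_univ i)).trans_lt hN
  rw [PsiAt, mk_umbral _ _ (N := N), range_eq_Ico, sum_eq_sum_Ico_succ_bot (by omega),
    coeff_Psi_zero, map_zero, zero_mul, zero_add]
  · refine sum_congr rfl fun j _ => ?_
    rw [PowerSeries.coeff_mk, map_pow]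
  · intro j hj
    rw [PowerSeries.coeff_mk]
    exact xv_pow_mem (by omega)

/-- The factor of an edge at a black vertex stands for a sequence of leaves. -/
theorem map_geometric {N : ℕ} (hN : ∑ i, β i < N) (i : Fin m) :
    PowerSeries.map (Ideal.Quotient.mk (boxIdeal β)) (PowerSeries.mk fun r => PsiAt Q i ^ r) =
      PowerSeries.map (Ideal.Quotient.mk (boxIdeal β))
        (∑ q ∈ range N, chain (leafFactor Q m) q * PowerSeries.C (xv i) ^ q) := by
  have hi : β i < N := (single_le_sum (fun _ _ => Nat.zero_le _) (mem_univ i)).trans_lt hN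
  set f := PowerSeries.map (Ideal.Quotient.mk (boxIdeal β)) with hf
  have hx : f (PowerSeries.C (xv i)) ^ N = 0 := by
    rw [← map_pow, ← map_pow, hf, PowerSeries.map_C, Ideal.Quotient.eq_zero_iff_mem.2
      (xv_pow_mem hi), map_zero]
  have h1 := congrArg f (mk_pow_mul (PsiAt Q i))
  rw [map_mul, map_sub, map_mul, map_one] at h1
  have h2 : f PowerSeries.X * f (PowerSeries.C (PsiAt Q i)) =
      ∑ j ∈ Ico 1 N, f (leafFactor Q m j) * f (PowerSeries.C (xv i)) ^ j := by
    rw [hf, PowerSeries.map_C, mk_PsiAt Q hN, map_sum, mul_sum]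
    refine sum_congr rfl fun j _ => ?_
    simp only [leafFactor, map_mul, map_pow, PowerSeries.map_C]
    ring
  have h3 := sum_chain_mul (fun j => f (leafFactor Q m j)) _ (by omega : 0 < N) hx
  rw [h2] at h1
  rw [map_sum]
  simp only [map_mul, map_pow, map_chain]
  exact left_inv_eq_right_inv h1 ((mul_comm _ _).trans h3)

variable {T : PlaneTree} (lam : Fin T.nB ↪ Fin m)

/-- The factor of a white vertex, expanded over the labels of its edges. -/
theorem mk_white {N : ℕ} (hN : N = ∑ i, β i + 1) (w : Fin T.nW) :
    Ideal.Quotient.mk (boxIdeal β) (umbral (Psi Q) (Hplus ((T.nbrs w).map lam))) =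
      Ideal.Quotient.mk (boxIdeal β)
        (∑ f ∈ Fintype.piFinset fun e => if T.white e = w then Ico 1 N else {0},
          PowerSeries.coeff (∑ e, f e) (Psi Q) * ∏ e, xv (lam (T.black e)) ^ f e) := by
  set S := (T.nbrs w).map lam with hS
  set Ew := univ.filter fun e => T.white e = w with hEw
  have hSi : S = Ew.image fun e => lam (T.black e) := by
    rw [hS, PlaneTree.nbrs, map_eq_image, image_image]
    rfl
  have hinj : Set.InjOn (fun e => lam (T.black e)) (Ew : Set (Fin T.nE)) := by
    intro e he e' he' h
    have h1 := (mem_filter.1 (mem_coe.1 he)).2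
    have h2 := (mem_filter.1 (mem_coe.1 he')).2
    exact T.simple (Prod.ext (lam.injective h) (h1.trans h2.symm))
  have hfE : ∀ f ∈ Fintype.piFinset (fun e => if T.white e = w then Ico 1 N else {0}),
      ∀ e, (T.white e = w → 1 ≤ f e ∧ f e < N) ∧ (T.white e ≠ w → f e = 0) := by
    intro f hf e
    have := Fintype.mem_piFinset.1 hf e
    split_ifs at this with h
    · exact ⟨fun _ => mem_Ico.1 this, fun h' => absurd h h'⟩
    · exact ⟨fun h' => absurd h' h, fun _ => mem_singleton.1 this⟩
  rw [mk_umbral _ _ (N := N), map_sum]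
  swap
  · intro j hj
    rw [Hplus, PowerSeries.coeff_mk]
    exact hplus_mem (by omega)
  rw [← sum_filter_add_sum_filter_not (Fintype.piFinset _) fun f => ∑ e, f e < N]
  -- a family of exponents with a large sum exceeds `β` somewhere
  have hbig : ∑ f ∈ (Fintype.piFinset fun e => if T.white e = w then Ico 1 N else {0}) with
      ¬ ∑ e, f e < N, Ideal.Quotient.mk (boxIdeal β) (PowerSeries.coeff (∑ e, f e) (Psi Q) *
        ∏ e, xv (lam (T.black e)) ^ f e) = 0 := by
    refine sum_eq_zero fun f hf => ?_
    obtain ⟨hf1, hf2⟩ := mem_filter.1 hf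
    rw [Ideal.Quotient.eq_zero_iff_mem]
    refine Ideal.mul_mem_left _ _ ?_
    obtain ⟨e, -, he⟩ : ∃ e ∈ Ew, β (lam (T.black e)) < f e := by
      by_contra! hcon
      have h1 := sum_le_sum hcon
      have h2 : ∑ e ∈ Ew, β (lam (T.black e)) = ∑ i ∈ S, β i := by
        rw [hSi, sum_image hinj]
      have h3 : ∑ e ∈ Ew, f e = ∑ e, f e := sum_subset (subset_univ _) fun e _ he =>
        (hfE f hf1 e).2 fun h => he (mem_filter.2 ⟨mem_univ _, h⟩)
      have := sum_le_sum_of_subset (f := β) (subset_univ S)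
      omega
    exact Ideal.mem_of_dvd _ (dvd_prod_of_mem _ (mem_univ e)) (xv_pow_mem he)
  rw [hbig, add_zero, ← sum_fiberwise_of_maps_to (t := range N) (g := fun f => ∑ e, f e)
    (s := (Fintype.piFinset fun e => if T.white e = w then Ico 1 N else {0}).filter
      fun f => ∑ e, f e < N) fun f hf => mem_range.2 (mem_filter.1 hf).2]
  refine sum_congr rfl fun j hj => ?_
  rw [mem_range] at hj
  rcases Nat.eq_zero_or_pos j with rfl | hj0
  · rw [coeff_Psi_zero, map_zero, zero_mul]
    refine (sum_eq_zero fun f hf => ?_).symm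
    rw [(mem_filter.1 hf).2, coeff_Psi_zero, zero_mul, map_zero]
  · rw [sum_congr rfl fun f hf => by rw [(mem_filter.1 hf).2, map_mul], ← mul_sum, Hplus,
      PowerSeries.coeff_mk, hplus, if_neg (by omega), map_sum]
    congr 1
    have hmemS : ∀ e, T.white e = w → lam (T.black e) ∈ S := fun e he => by
      rw [hSi]
      exact mem_image_of_mem _ (mem_filter.2 ⟨mem_univ _, he⟩)
    -- the edges at `w` correspond to its neighbours
    refine sum_bij (fun g _ e => if T.white e = w then g (lam (T.black e)) else 0) (fun g hg => ?_)
      (fun g hg g' hg' h => ?_) (fun f hf => ?_) fun g hg => ?_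
    · obtain ⟨hg1, hg2⟩ := mem_filter.1 hg
      rw [mem_piAntidiag] at hg1
      have hsum : ∑ e, (if T.white e = w then g (lam (T.black e)) else 0) = j := by
        rw [← sum_filter, ← hg1.1, hSi, sum_image hinj]
      rw [mem_filter, mem_filter, Fintype.mem_piFinset]
      refine ⟨⟨fun e => ?_, by rw [hsum]; exact hj⟩, hsum⟩
      split_ifs with he
      · refine mem_Ico.2 ⟨hg2 _ (hmemS e he), lt_of_le_of_lt ?_ hj⟩
        rw [← hg1.1]
        exact single_le_sum (fun _ _ => Nat.zero_le _) (hmemS e he)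
      · exact mem_singleton_self 0
    · have hz : ∀ g ∈ (S.piAntidiag j).filter (fun f => ∀ i ∈ S, 1 ≤ f i), ∀ i ∉ S, g i = 0 := by
        intro g hg i hi
        by_contra h
        exact hi ((mem_piAntidiag.1 (mem_filter.1 hg).1).2 i h)
      funext i
      by_cases hi : i ∈ S
      · obtain ⟨e, he, rfl⟩ := mem_image.1 (hSi ▸ hi)
        have := congrFun h e
        simpa only [if_pos (mem_filter.1 he).2] using this
      · rw [hz g hg i hi, hz g' hg' i hi]
    · obtain ⟨hf1, hf2⟩ := mem_filter.1 hf
      have hf3 := hfE f (mem_filter.1 hf1).1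
      let g : Fin m → ℕ := fun i => ∑ e ∈ Ew with lam (T.black e) = i, f e
      have hg : ∀ e, T.white e = w → g (lam (T.black e)) = f e := by
        intro e he
        have heE : e ∈ Ew := mem_filter.2 ⟨mem_univ _, he⟩
        have : (Ew.filter fun e' => lam (T.black e') = lam (T.black e)) = {e} := by
          ext e'
          rw [mem_filter, mem_singleton]
          exact ⟨fun h => hinj (mem_coe.2 h.1) (mem_coe.2 heE) h.2, by rintro rfl; exact ⟨heE, rfl⟩⟩
        simp only [g]
        rw [this, sum_singleton]
      have hgS : ∀ i, g i ≠ 0 → i ∈ S := by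
        intro i hi
        obtain ⟨e, he, -⟩ := exists_ne_zero_of_sum_ne_zero hi
        rw [mem_filter] at he
        rw [← he.2]
        exact hmemS e (mem_filter.1 he.1).2
      refine ⟨g, mem_filter.2 ⟨mem_piAntidiag.2 ⟨?_, hgS⟩, fun i hi => ?_⟩, ?_⟩
      · rw [hSi, sum_image hinj, sum_congr rfl fun e he => hg e (mem_filter.1 he).2, ← hf2]
        exact sum_subset (subset_univ _) fun e _ he =>
          (hf3 e).2 fun h => he (mem_filter.2 ⟨mem_univ _, h⟩)
      · obtain ⟨e, he, rfl⟩ := mem_image.1 (hSi ▸ hi)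
        rw [hg e (mem_filter.1 he).2]
        exact ((hf3 e).1 (mem_filter.1 he).2).1
      · funext e
        split_ifs with he
        · exact hg e he
        · exact ((hf3 e).2 he).symm
    · congr 1
      rw [hSi, prod_image hinj, hEw, prod_filter]
      refine prod_congr rfl fun e _ => ?_
      by_cases he : T.white e = w
      · simp only [if_pos he]
      · simp only [if_neg he, pow_zero]

/-- The factor of a black vertex, distributed over the edges at the vertex. -/
theorem treeProd_eq (k : ℕ) (hdeg : ∀ v, T.degB v ≠ 0) :
    treeProd k Q T lam = PowerSeries.C (∏ v, zv (lam v)) *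
      (PowerSeries.X ^ T.nE * ∏ e, PowerSeries.mk fun r => PsiAt Q (lam (T.black e)) ^ r) *
      ∏ w, PowerSeries.C (umbral (Psi Q) (Hplus ((T.nbrs w).map lam))) := by
  have h1 : ∀ v, blackFactor k (T.degB v) (PsiAt Q (lam v)) =
      ∏ e with T.black e = v, (PowerSeries.X * PowerSeries.mk fun r =>
        PsiAt Q (lam (T.black e)) ^ r : PowerSeries (A m)) := by
    intro v
    rw [blackFactor, if_neg (hdeg v), PlaneTree.degB, prod_congr rfl fun e he => by
      rw [(mem_filter.1 he).2], prod_const]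
  rw [treeProd, prod_mul_distrib, map_prod, prod_congr rfl fun v _ => h1 v, prod_fiberwise,
    prod_mul_distrib, prod_const, card_univ, Fintype.card_fin]

theorem prod_zv_mul_prod_xv (n : Fin T.nE → ℕ) :
    (∏ v, zv (lam v)) * ∏ e, xv (lam (T.black e)) ^ n e =
      (MvPowerSeries.monomial (ex (fun i => ∑ e with lam (T.black e) = i, n e) (univ.map lam)) 1 :
        A m) := by
  have h1 : ∏ v, (zv (lam v) : A m) = ∏ i ∈ univ.map lam, zv i := by rw [prod_map]
  simp only [h1, prod_zv, xv, MvPowerSeries.X_pow_eq, prod_monomial_one,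
    MvPowerSeries.monomial_mul_monomial, one_mul]
  congr 1
  congr 1
  ext (i | i)
  · rw [Finsupp.add_apply, Finsupp.finsetSum_apply, ex_inl, ex_inl, ite_self, zero_add]
    simp only [Finsupp.single_apply, Sum.inl.injEq]
    rw [← sum_filter]
    split_ifs with h
    · rfl
    · rw [filter_false_of_mem, sum_empty]
      rintro e - rfl
      exact h (mem_map_of_mem lam (mem_univ _))
  · rw [Finsupp.add_apply, Finsupp.finsetSum_apply, ex_inr, ex_inr]
    simp

theorem leafFactor_mem (j : ℕ) : leafFactor Q m j ∈ coeffSubring (bal m) :=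
  Subring.mul_mem _ X_mem_coeffSubring (C_mem_coeffSubring (coeff_Psi_mem_bal Q j))

theorem coeff_coeff_eq {F G : PowerSeries (A m)}
    (h : PowerSeries.map (Ideal.Quotient.mk (boxIdeal β)) F =
      PowerSeries.map (Ideal.Quotient.mk (boxIdeal β)) G) (k : ℕ) :
    MvPowerSeries.coeff (ex β univ) (PowerSeries.coeff k F) =
      MvPowerSeries.coeff (ex β univ) (PowerSeries.coeff k G) := by
  have h1 := congrArg (PowerSeries.coeff k) h
  rw [PowerSeries.coeff_map, PowerSeries.coeff_map] at h1
  exact coeff_eq_of_mk_eq h1 (Set.mem_Iic.2 le_rfl)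

/-- The contribution of the tree consisting of an isolated black vertex. -/
theorem coeff_star (β : Fin m → ℕ) (i : Fin m) (k : ℕ) :
    MvPowerSeries.coeff (ex β univ) (zv i * PsiAt Q i ^ k) =
      MvPowerSeries.coeff (ex β {i}ᶜ) (PowerSeries.coeff k (chain (leafFactor Q m) (β i))) := by
  set N := ∑ i, β i + 1 with hN
  have hi : β i < N := Nat.lt_succ_of_le (single_le_sum (fun _ _ => Nat.zero_le _) (mem_univ i))
  have h1 : (zv i * PsiAt Q i ^ k : A m) = PowerSeries.coeff k
      (PowerSeries.C (zv i) * PowerSeries.mk fun r => PsiAt Q i ^ r) := by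
    rw [PowerSeries.coeff_C_mul, PowerSeries.coeff_mk]
  have h2 : PowerSeries.map (Ideal.Quotient.mk (boxIdeal β))
      (PowerSeries.C (zv i) * PowerSeries.mk fun r => PsiAt Q i ^ r) =
      PowerSeries.map (Ideal.Quotient.mk (boxIdeal β))
      (∑ q ∈ range N, PowerSeries.C (zv i * xv i ^ q) * chain (leafFactor Q m) q) := by
    rw [map_mul, map_geometric Q (by omega : ∑ i, β i < N), ← map_mul, mul_sum]
    refine congrArg _ (sum_congr rfl fun q _ => ?_)
    rw [map_mul, map_pow, mul_comm (chain _ _), mul_assoc]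
  have hm : ∀ q, (zv i * xv i ^ q : A m) = MvPowerSeries.monomial (ex (fun _ => q) {i}) 1 := by
    intro q
    rw [zv, xv, MvPowerSeries.X_pow_eq, MvPowerSeries.X_def, MvPowerSeries.monomial_mul_monomial,
      one_mul]
    congr 1
    congr 1
    ext (j | j)
    · by_cases h : j = i
      · subst h; simp
      · simp [h]
    · by_cases h : j = i
      · subst h; simp
      · simp [h]
  have hterm : ∀ q, MvPowerSeries.coeff (ex β univ) (PowerSeries.coeff k
      (PowerSeries.C (zv i * xv i ^ q) * chain (leafFactor Q m) q)) =
      if β i = q then MvPowerSeries.coeff (ex β {i}ᶜ)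
        (PowerSeries.coeff k (chain (leafFactor Q m) q)) else 0 := by
    intro q
    rw [PowerSeries.coeff_C_mul, hm, coeff_monomial_mul_bal β {i}
      (chain_mem (leafFactor_mem Q) q k)]
    · refine if_congr ?_ rfl rfl
      simp [eq_comm]
    · intro j
      rw [ex_inr]
    · intro j hj
      rw [ex_inl, if_neg hj]
  rw [h1, coeff_coeff_eq h2, map_sum, map_sum, sum_congr rfl fun q _ => hterm q, sum_ite_eq,
    if_pos (mem_range.2 hi)]

end Box

section TreeCoefficient

variable {m : ℕ} {β : Fin m → ℕ} (Q : ∀ j, MvPowerSeries (Fin j) ℚ) {T : PlaneTree}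
  (lam : Fin T.nB ↪ Fin m)

/-- The product over the white vertices when an edge `e` contributes `f e` to the label of its white
end, multiplied by the factor `y` of every edge. -/
def whiteProd (T : PlaneTree) (f : Fin T.nE → ℕ) : PowerSeries (A m) :=
  PowerSeries.X ^ T.nE *
    ∏ w, PowerSeries.C (PowerSeries.coeff (∑ e with T.white e = w, f e) (Psi Q))

/-- The product over the vertices, expanded over the edges: at each edge `e`, the leaves that follow
it take up length `q e`, and the share of its white end is `f e`. -/
theorem map_treeProd {N : ℕ} (hN : N = ∑ i, β i + 1) (k : ℕ) (hdeg : ∀ v, T.degB v ≠ 0) :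
    PowerSeries.map (Ideal.Quotient.mk (boxIdeal β)) (treeProd k Q T lam) =
      PowerSeries.map (Ideal.Quotient.mk (boxIdeal β))
        (∑ q ∈ Fintype.piFinset fun _ : Fin T.nE => range N,
          ∑ f ∈ Fintype.piFinset fun _ : Fin T.nE => Ico 1 N,
            PowerSeries.C (MvPowerSeries.monomial
              (ex (fun i => ∑ e with lam (T.black e) = i, (q e + f e)) (univ.map lam)) 1) *
            (whiteProd Q T f * ∏ e, chain (leafFactor Q m) (q e))) := by
  have h1 : PowerSeries.map (Ideal.Quotient.mk (boxIdeal β)) (treeProd k Q T lam) =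
      PowerSeries.map (Ideal.Quotient.mk (boxIdeal β)) (PowerSeries.C (∏ v, zv (lam v)) *
        (PowerSeries.X ^ T.nE * ∏ e, ∑ q ∈ range N,
          chain (leafFactor Q m) q * PowerSeries.C (xv (lam (T.black e))) ^ q) *
        ∏ w, PowerSeries.C (∑ f ∈ Fintype.piFinset fun e => if T.white e = w then Ico 1 N else {0},
          PowerSeries.coeff (∑ e, f e) (Psi Q) * ∏ e, xv (lam (T.black e)) ^ f e)) := by
    rw [treeProd_eq Q lam k hdeg]
    simp only [map_mul (PowerSeries.map _), map_prod]
    congr 1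
    · congr 2
      exact prod_congr rfl fun e _ => map_geometric Q (by omega) _
    · refine prod_congr rfl fun w _ => ?_
      rw [PowerSeries.map_C, PowerSeries.map_C, mk_white Q lam hN]
  rw [h1]
  refine congrArg _ ?_
  simp only [map_sum PowerSeries.C]
  rw [prod_univ_sum, prod_sum_fibres T.white (Ico 1 N) fun w f =>
    PowerSeries.C (PowerSeries.coeff (∑ e, f e) (Psi Q) * ∏ e, xv (lam (T.black e)) ^ f e)]
  rw [mul_assoc, mul_assoc, sum_mul_sum, mul_sum, mul_sum]
  refine sum_congr rfl fun q _ => ?_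
  rw [mul_sum, mul_sum]
  refine sum_congr rfl fun f _ => ?_
  have h2 : ∏ w, PowerSeries.C (PowerSeries.coeff (∑ e, if T.white e = w then f e else 0) (Psi Q) *
      ∏ e, xv (lam (T.black e)) ^ (if T.white e = w then f e else 0)) =
      (∏ w, PowerSeries.C (PowerSeries.coeff (∑ e with T.white e = w, f e) (Psi (m := m) Q))) *
        PowerSeries.C (∏ e, xv (lam (T.black e)) ^ f e) := by
    rw [map_prod (PowerSeries.C) (fun e => xv (lam (T.black e)) ^ f e),
      ← prod_fiberwise univ T.white, ← prod_mul_distrib]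
    refine prod_congr rfl fun w _ => ?_
    rw [map_mul, sum_filter, prod_filter, map_prod]
    congr 1
    refine prod_congr rfl fun e _ => ?_
    split_ifs
    · rfl
    · rw [pow_zero, map_one]
  rw [h2, ← prod_zv_mul_prod_xv lam, prod_mul_distrib, whiteProd, map_mul]
  have h3 : (PowerSeries.C (∏ e, xv (lam (T.black e)) ^ (q e + f e)) : PowerSeries (A m)) =
      (∏ e, PowerSeries.C (xv (lam (T.black e))) ^ q e) *
        PowerSeries.C (∏ e, xv (lam (T.black e)) ^ f e) := by
    rw [map_prod, map_prod, ← prod_mul_distrib]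
    refine prod_congr rfl fun e _ => ?_
    rw [pow_add, map_mul, map_pow]
  rw [h3]
  generalize (∏ w, PowerSeries.C (PowerSeries.coeff (∑ e with T.white e = w, f e)
    (Psi (m := m) Q))) = a1
  generalize (∏ e, chain (leafFactor Q m) (q e)) = a2
  generalize (∏ e, PowerSeries.C (xv (lam (T.black e))) ^ q e) = a3
  generalize (PowerSeries.C (∏ e, xv (lam (T.black e)) ^ f e) : PowerSeries (A m)) = a4
  generalize (PowerSeries.C (∏ v, zv (lam v)) : PowerSeries (A m)) = a5
  generalize (PowerSeries.X ^ T.nE : PowerSeries (A m)) = a6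
  ring

/-- The arc lengths: positive integers at the edges whose sums around the black vertices are given
by `β`. -/
def arcLengths (T : PlaneTree) (lam : Fin T.nB ↪ Fin m) (β : Fin m → ℕ) :
    Finset (Fin T.nE → ℕ) :=
  (Fintype.piFinset fun _ => Ico 1 (∑ i, β i + 1)).filter fun len =>
    ∀ v, ∑ e with T.black e = v, len e = β (lam v)

theorem mem_arcLengths {len : Fin T.nE → ℕ} : len ∈ arcLengths T lam β ↔
    (∀ e, 1 ≤ len e) ∧ ∀ v, ∑ e with T.black e = v, len e = β (lam v) := by
  rw [arcLengths, mem_filter, Fintype.mem_piFinset]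
  refine and_congr_left fun h => forall_congr' fun e => ?_
  rw [mem_Ico, and_iff_left]
  have h1 : len e ≤ ∑ e' with T.black e' = T.black e, len e' :=
    single_le_sum (f := len) (fun _ _ => Nat.zero_le _) (mem_filter.2 ⟨mem_univ e, rfl⟩)
  have h2 : β (lam (T.black e)) ≤ ∑ i, β i := single_le_sum (fun _ _ => Nat.zero_le _) (mem_univ _)
  rw [h] at h1
  omega

/-- The sum over the ways to place leaves on arcs of lengths `len`. -/
def arcSum (T : PlaneTree) (len : Fin T.nE → ℕ) : PowerSeries (A m) :=
  ∑ f ∈ Fintype.piFinset fun e => Icc 1 (len e),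
    whiteProd Q T f * ∏ e, chain (leafFactor Q m) (len e - f e)

theorem whiteProd_mem (f : Fin T.nE → ℕ) : whiteProd Q T f ∈ coeffSubring (bal m) :=
  Subring.mul_mem _ (Subring.pow_mem _ X_mem_coeffSubring _)
    (Subring.prod_mem _ fun _ _ => C_mem_coeffSubring (coeff_Psi_mem_bal Q _))

/-- In the coefficient of `x ^ β z₁ ⋯ z_m`, the contributions of the edges at a black vertex add up
to the exponent of its variable, and the other variables go to the white vertices and the leaves. -/
theorem coeff_treeProd (β : Fin m → ℕ) (k : ℕ) (hdeg : ∀ v, T.degB v ≠ 0) :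
    MvPowerSeries.coeff (ex β univ) (PowerSeries.coeff k (treeProd k Q T lam)) =
      ∑ len ∈ arcLengths T lam β,
        MvPowerSeries.coeff (ex β (univ.map lam)ᶜ) (PowerSeries.coeff k (arcSum Q T len)) := by
  set N := ∑ i, β i + 1 with hN
  have hterm : ∀ q f : Fin T.nE → ℕ, MvPowerSeries.coeff (ex β univ) (PowerSeries.coeff k
      (PowerSeries.C (MvPowerSeries.monomial
        (ex (fun i => ∑ e with lam (T.black e) = i, (q e + f e)) (univ.map lam)) 1) *
        (whiteProd Q T f * ∏ e, chain (leafFactor Q m) (q e)))) =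
      if ∀ v, ∑ e with T.black e = v, (q e + f e) = β (lam v) then
        MvPowerSeries.coeff (ex β (univ.map lam)ᶜ) (PowerSeries.coeff k
          (whiteProd Q T f * ∏ e, chain (leafFactor Q m) (q e))) else 0 := by
    intro q f
    have hmem : whiteProd Q T f * ∏ e, chain (leafFactor Q m) (q e) ∈ coeffSubring (bal m) :=
      Subring.mul_mem _ (whiteProd_mem Q f)
        (Subring.prod_mem _ fun e _ => chain_mem (leafFactor_mem Q) _)
    rw [PowerSeries.coeff_C_mul, coeff_monomial_mul_bal β (univ.map lam) (hmem k)]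
    · refine if_congr ?_ rfl rfl
      have h1 : ∀ v, (univ.filter fun e => lam (T.black e) = lam v) =
          univ.filter fun e => T.black e = v := fun v =>
        filter_congr fun e _ => lam.injective.eq_iff
      constructor
      · intro h v
        have := h _ (mem_map_of_mem lam (mem_univ v))
        rwa [ex_inl, if_pos (mem_map_of_mem lam (mem_univ v)), h1] at this
      · intro h i hi
        obtain ⟨v, -, rfl⟩ := mem_map.1 hi
        rw [ex_inl, if_pos hi, h1, h]
    · intro i
      rw [ex_inr]
    · intro i hi
      rw [ex_inl, if_neg hi]
  rw [coeff_coeff_eq (map_treeProd Q lam hN k hdeg)]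
  simp only [map_sum, hterm, arcSum]
  rw [← sum_product', ← sum_filter, sum_sigma']
  have hlt : ∀ q f : Fin T.nE → ℕ, (∀ v, ∑ e with T.black e = v, (q e + f e) = β (lam v)) →
      ∀ e, q e + f e < N := by
    intro q f h e
    have h1 : q e + f e ≤ ∑ e' with T.black e' = T.black e, (q e' + f e') :=
      single_le_sum (f := fun e => q e + f e) (fun _ _ => Nat.zero_le _)
        (mem_filter.2 ⟨mem_univ e, rfl⟩)
    have h2 : β (lam (T.black e)) ≤ ∑ i, β i :=
      single_le_sum (fun _ _ => Nat.zero_le _) (mem_univ _)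
    rw [h] at h1
    omega
  refine sum_bij (fun p _ => ⟨fun e => p.1 e + p.2 e, p.2⟩) ?_ ?_ ?_ ?_
  · rintro ⟨q, f⟩ hp
    simp only [mem_filter, mem_product, Fintype.mem_piFinset, mem_range, mem_Ico] at hp
    rw [mem_sigma, mem_arcLengths, Fintype.mem_piFinset]
    refine ⟨⟨fun e => ?_, hp.2⟩, fun e => ?_⟩
    · have := hp.1.2 e
      change 1 ≤ q e + f e
      omega
    · have := hp.1.2 e
      change f e ∈ Icc 1 (q e + f e)
      rw [mem_Icc]
      omega
  · rintro ⟨q, f⟩ _ ⟨q', f'⟩ _ h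
    simp only [Sigma.mk.injEq, heq_eq_eq] at h
    obtain ⟨h1, rfl⟩ := h
    refine Prod.ext (funext fun e => ?_) rfl
    have := congrFun h1 e
    change q e = q' e
    omega
  · rintro ⟨len, f⟩ hp
    rw [mem_sigma, mem_arcLengths, Fintype.mem_piFinset] at hp
    obtain ⟨⟨h1, h2⟩, h3⟩ := hp
    have h4 : ∀ e, len e - f e + f e = len e := fun e => by
      have := mem_Icc.1 (h3 e)
      dsimp only at this
      omega
    have h5 : ∀ v, ∑ e with T.black e = v, (len e - f e + f e) = β (lam v) := fun v => by
      rw [sum_congr rfl fun e _ => h4 e]; exact h2 v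
    have h6 := hlt _ _ h5
    refine ⟨(fun e => len e - f e, f), ?_, ?_⟩
    · simp only [mem_filter, mem_product, Fintype.mem_piFinset, mem_range, mem_Ico]
      refine ⟨⟨fun e => ?_, fun e => ?_⟩, h5⟩
      · have := h6 e
        omega
      · have := h6 e
        have h7 := (mem_Icc.1 (h3 e)).1
        dsimp only at h7
        omega
    · simp only [h4]
  · rintro ⟨q, f⟩ _
    simp only [Nat.add_sub_cancel]

end TreeCoefficient

/-! ### The contribution of a first factor as a coefficient -/

section PCoefficients

variable {m k : ℕ} {β : Fin m → ℕ}

theorem map_cons_restr (j : ℕ) (β : Fin m → ℕ) (S : Finset (Fin m)) :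
    univ.val.map (Finsupp.cons j (restr β S)) = j ::ₘ S.val.map β := by
  have h1 : S.val.map β = univ.val.map fun a => β (S.orderEmbOfFin rfl a) := by
    conv_lhs => rw [← map_orderEmbOfFin_univ S rfl, map_val, Multiset.map_map]
    rfl
  rw [h1, Fin.univ_val_map, Fin.univ_val_map, List.ofFn_succ]
  rfl

/-- The derivative in `Psi` cancels the factor `1 / j` of the coefficient of `P`. -/
theorem coeff_ex_Psi_P (hk : 2 ≤ k) {j : ℕ} (hj : j ≠ 0) {S : Finset (Fin m)}
    (hβ : ∀ i ∈ S, β i ≠ 0) :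
    MvPowerSeries.coeff (ex β S) (PowerSeries.coeff j (Psi (P k))) =
      wtM k (j ::ₘ S.val.map β) / ∏ i ∈ S, (β i : ℚ) := by
  have h2 : ∀ a : Fin #S, restr β S a = β (S.orderEmbOfFin rfl a) := fun a => rfl
  rw [coeff_ex_Psi, coeff_P hk (by omega), map_cons_restr, Fin.prod_univ_succ, Finsupp.cons_zero]
  · have h1 : ∏ i ∈ S, (β i : ℚ) = ∏ a, (restr β S a : ℚ) := by
      conv_lhs => rw [← map_orderEmbOfFin_univ S rfl, prod_map]
      rfl
    have hj' : (j : ℚ) ≠ 0 := Nat.cast_ne_zero.2 hj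
    simp only [Finsupp.cons_succ]
    rw [h1, mul_div_assoc', mul_div_mul_left _ _ hj']
  · intro i
    refine Fin.cases ?_ (fun a => ?_) i
    · rwa [Finsupp.cons_zero]
    · rw [Finsupp.cons_succ, h2]
      exact hβ _ (orderEmbOfFin_mem S rfl a)

theorem coeff_ex_prod_Psi_P (hk : 2 ≤ k) {W : Type} [Fintype W] [DecidableEq W] {len : W → ℕ}
    (hlen : ∀ w, len w ≠ 0) {S : Finset (Fin m)} (hβ : ∀ i ∈ S, β i ≠ 0) :
    MvPowerSeries.coeff (ex β S) (∏ w, PowerSeries.coeff (len w) (Psi (P k))) =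
      (∑ A : Fin m → Option W with ∀ i, A i = none ↔ i ∉ S,
        ∏ w, wtM k (len w ::ₘ (univ.filter fun i => A i = some w).val.map β)) /
          ∏ i ∈ S, (β i : ℚ) := by
  rw [coeff_ex_prod β S fun w => coeff_Psi_mem_bal (P k) (len w), sum_div]
  refine sum_congr rfl fun A hA => ?_
  have hA := (mem_filter.1 hA).2
  have hmem : ∀ w i, A i = some w → i ∈ S := fun w i h => by
    by_contra h'
    rw [(hA i).2 h'] at h
    exact absurd h (by simp)
  rw [prod_congr rfl fun w _ => coeff_ex_Psi_P hk (hlen w) fun i hi =>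
    hβ i (hmem w i (mem_filter.1 hi).2), prod_div_distrib]
  congr 1
  rw [← prod_biUnion]
  · refine prod_congr ?_ fun _ _ => rfl
    ext i
    simp only [mem_biUnion, mem_filter, mem_univ, true_and]
    refine ⟨fun ⟨w, hw⟩ => hmem w i hw, fun hi => ?_⟩
    exact Option.ne_none_iff_exists'.1 fun h => (hA i).1 h hi
  · intro w _ w' _ hne
    refine disjoint_left.2 fun i hi hi' => hne ?_
    have h1 := (mem_filter.1 hi).2
    rw [(mem_filter.1 hi').2, Option.some.injEq] at h1
    exact h1.symm

end PCoefficients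

section Cuts

variable {X : Type} [Fintype X] [DecidableEq X] {π : Perm X} {Y : Finset X} {b : Perm X} {m : ℕ}

theorem sum_white_inl (hb : b.support ⊆ Y) (c : {c // c ∈ b.cycleFactorsFinset}) (g : X → ℕ) :
    ∑ y : {y // y ∈ Y} with white Y b y = Sum.inl c, g y.1 = ∑ y ∈ c.1.support, g y := by
  refine sum_bij (fun y _ => y.1) (fun y hy => white_eq_inl.1 (mem_filter.1 hy).2)
    (fun _ _ _ _ h => Subtype.ext h) (fun y hy => ?_) fun _ _ => rfl
  exact ⟨⟨y, hb (mem_cycleFactorsFinset_support_le c.2 hy)⟩,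
    mem_filter.2 ⟨mem_univ _, white_eq_inl.2 hy⟩, rfl⟩

theorem sum_white_inr (z : {y // y ∈ Y \ b.support}) (g : X → ℕ) :
    ∑ y : {y // y ∈ Y} with white Y b y = Sum.inr z, g y.1 = g z.1 := by
  rw [sum_eq_single_of_mem (⟨z.1, (mem_sdiff.1 z.2).1⟩ : {y // y ∈ Y})
    (mem_filter.2 ⟨mem_univ _, white_eq_inr.2 rfl⟩)]
  intro y hy hne
  exact absurd (Subtype.ext (white_eq_inr.1 (mem_filter.1 hy).2)) hne

theorem whiteLen_pos (hb : b.support ⊆ Y) (w : White Y b) : 0 < whiteLen π Y b w := by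
  obtain ⟨y, rfl⟩ := white_surjective hb w
  exact sum_pos (fun y _ => gap_pos_of_mem y.2) ⟨y, mem_filter.2 ⟨mem_univ _, rfl⟩⟩

variable (Q : ∀ j, MvPowerSeries (Fin j) ℚ)

/-- The product of the series of the white vertices of the tree of a first factor. -/
def cutProd (m : ℕ) (π : Perm X) (Y : Finset X) (b : Perm X) : A m :=
  ∏ w : White Y b, PowerSeries.coeff (whiteLen π Y b w) (Psi Q)

/-- The coefficient counts the factorisations with the given first factor. -/
theorem coeff_cutProd {k : ℕ} (hk : 2 ≤ k) {lab : X → Fin m} (hls : Function.Surjective lab)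
    (hb : b.support ⊆ Y) {β : Fin m → ℕ} (hβ : ∀ i, #{x | lab x = i} = β i) :
    MvPowerSeries.coeff (ex β (Y.image lab)ᶜ) (cutProd (P k) m π Y b) =
      cutWeight π lab Y b k / ∏ i ∈ (Y.image lab)ᶜ, (β i : ℚ) := by
  rw [cutProd, coeff_ex_prod_Psi_P hk fun w => (whiteLen_pos hb w).ne']
  · congr 1
    rw [cutWeight]
    refine sum_congr ?_ fun A _ => ?_
    · ext A
      simp
    · simp only [hβ]
  · intro i _
    rw [← hβ]
    obtain ⟨x, hx⟩ := hls i
    exact (card_pos.2 ⟨x, mem_filter.2 ⟨mem_univ _, hx⟩⟩).ne'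

/-- Additional leaves contribute the series at their gaps. -/
theorem cutProd_union {L : Finset X} (hb : b.support ⊆ Y) (hL : Disjoint Y L) :
    cutProd Q m π (Y ∪ L) b =
      (∏ w : White Y b, PowerSeries.coeff
        (∑ y : {y // y ∈ Y} with white Y b y = w, gap π (Y ∪ L) y.1) (Psi Q)) *
        ∏ l ∈ L, PowerSeries.coeff (gap π (Y ∪ L) l) (Psi Q) := by
  rw [cutProd, Fintype.prod_sum_type, Fintype.prod_sum_type, mul_assoc]
  have hb' : b.support ⊆ Y ∪ L := hb.trans subset_union_left
  congr 1
  · refine prod_congr rfl fun c _ => ?_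
    rw [whiteLen, sum_white_inl hb' c fun y => gap π (Y ∪ L) y,
      sum_white_inl hb c fun y => gap π (Y ∪ L) y]
  · simp only [whiteLen, sum_white_inr _ fun y => gap π (Y ∪ L) y]
    rw [prod_coe_sort ((Y ∪ L) \ b.support) fun y => PowerSeries.coeff (gap π (Y ∪ L) y)
        (Psi (m := m) Q),
      prod_coe_sort (Y \ b.support) fun y => PowerSeries.coeff (gap π (Y ∪ L) y) (Psi (m := m) Q),
      ← prod_union (disjoint_of_subset_left sdiff_subset hL)]
    congr 1
    ext y
    simp only [mem_sdiff, mem_union]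
    constructor
    · rintro ⟨h | h, h'⟩
      · exact Or.inl ⟨h, h'⟩
      · exact Or.inr h
    · rintro (h | h)
      · exact ⟨Or.inl h.1, h.2⟩
      · exact ⟨Or.inr h, fun h' => disjoint_left.1 hL (hb h') h⟩

/-- The first factors with a given core, summed up. The number `k` of their edges is the exponent
that is extracted, and the leaves are accounted for by `chain`. -/
theorem sum_cutProd {lab : X → Fin m} (hl : ∀ x y, lab x = lab y ↔ π.SameCycle x y) {E : Type}
    [Fintype E] [DecidableEq E] {ι : E → X} (hι : Function.Injective ι)
    (hb : b.support ⊆ univ.image ι) (k : ℕ) :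
    ∑ L ∈ (univ.filter fun x => lab x ∈ (univ.image ι).image lab ∧ x ∉ univ.image ι).powerset with
      Fintype.card E + #L = k, cutProd Q m π (univ.image ι ∪ L) b =
    PowerSeries.coeff k (∑ f ∈ Fintype.piFinset fun e => Icc 1 (gap π (univ.image ι) (ι e)),
      (PowerSeries.X ^ Fintype.card E * ∏ w : White (univ.image ι) b, PowerSeries.C
        (PowerSeries.coeff (∑ e with white (univ.image ι) b
          ⟨ι e, mem_image_of_mem ι (mem_univ e)⟩ = w, f e) (Psi Q))) *
        ∏ e, chain (leafFactor Q m) (gap π (univ.image ι) (ι e) - f e)) := by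
  rw [← sum_arc_subdivisions hl hι (fun f => PowerSeries.X ^ Fintype.card E *
    ∏ w : White (univ.image ι) b, PowerSeries.C
        (PowerSeries.coeff (∑ e with white (univ.image ι) b
          ⟨ι e, mem_image_of_mem ι (mem_univ e)⟩ = w, f e) (Psi Q))) (leafFactor Q m),
    map_sum, sum_filter]
  refine sum_congr rfl fun L hL => ?_
  have hdis : Disjoint (univ.image ι) L := disjoint_right.2 fun x hx =>
    (mem_filter.1 (mem_powerset.1 hL hx)).2.2
  have h1 : ∀ w, ∑ y : {y // y ∈ univ.image ι} with white (univ.image ι) b y = w,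
      gap π (univ.image ι ∪ L) y.1 = ∑ e with white (univ.image ι) b
          ⟨ι e, mem_image_of_mem ι (mem_univ e)⟩ = w, gap π (univ.image ι ∪ L) (ι e) := by
    intro w
    symm
    refine sum_bij (fun e _ => ⟨ι e, mem_image_of_mem ι (mem_univ e)⟩) (fun e he => ?_)
      (fun e _ e' _ h => hι (Subtype.ext_iff.1 h)) (fun y hy => ?_) fun _ _ => rfl
    · exact mem_filter.2 ⟨mem_univ _, (mem_filter.1 he).2⟩
    · obtain ⟨e, -, he⟩ := mem_image.1 y.2
      refine ⟨e, mem_filter.2 ⟨mem_univ _, ?_⟩, Subtype.ext he⟩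
      have := (mem_filter.1 hy).2
      rwa [show y = ⟨ι e, mem_image_of_mem ι (mem_univ e)⟩ from Subtype.ext he.symm] at this
  simp only [cutProd_union Q hb hdis, h1, leafFactor, prod_mul_distrib, prod_const, ← map_prod]
  rw [mul_mul_mul_comm, ← pow_add, ← map_mul, PowerSeries.coeff_mul_C, PowerSeries.coeff_X_pow]
  by_cases h : Fintype.card E + #L = k
  · rw [if_pos h, if_pos h.symm, one_mul]
  · rw [if_neg h, if_neg (Ne.symm h), zero_mul]

end Cuts

/-! ### Placing the edges of a tree on the cycles -/

section ArcMaps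

variable {E : Type} [Fintype E] [DecidableEq E] {τ : Perm E} {len : E → ℕ}

/-- The lengths along one period add up to `b`. -/
theorem sum_period {e : E} {b : ℕ} (h : ∑ e' with τ.SameCycle e e', len e' = b) :
    ∑ j ∈ range (Function.minimalPeriod τ e), len ((τ ^ j) e) = b := by
  classical
  rw [← h]
  have hp : 0 < Function.minimalPeriod τ e := Function.minimalPeriod_pos_of_mem_periodicPts
    (Function.Injective.mem_periodicPts τ.injective e)
  refine sum_bij (fun j _ => (τ ^ j) e) (fun j _ => ?_) (fun i hi j hj h => ?_) (fun e' he' => ?_)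
    fun _ _ => rfl
  · exact mem_filter.2 ⟨mem_univ _, ⟨j, by simp⟩⟩
  · rw [← iterate_eq_pow, ← iterate_eq_pow] at h
    exact Function.iterate_injOn_Iio_minimalPeriod (mem_range.1 hi) (mem_range.1 hj) h
  · obtain ⟨i, -, rfl⟩ := ((mem_filter.1 he').2).exists_pow_eq'
    refine ⟨i % Function.minimalPeriod τ e, mem_range.2 (Nat.mod_lt _ hp), ?_⟩
    rw [← iterate_eq_pow, ← iterate_eq_pow, Function.iterate_mod_minimalPeriod_eq]

theorem sum_range_mul_period {e : E} {b : ℕ} (h : ∑ e' with τ.SameCycle e e', len e' = b) (t : ℕ) :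
    ∑ j ∈ range (Function.minimalPeriod τ e * t), len ((τ ^ j) e) = b * t := by
  induction t with
  | zero => simp
  | succ t ih =>
    rw [Nat.mul_succ, sum_range_add, ih, Nat.mul_succ, ← sum_period h]
    congr 1
    refine sum_congr rfl fun j _ => ?_
    rw [← iterate_eq_pow, ← iterate_eq_pow, add_comm, Function.iterate_add_apply]
    have := Function.IsPeriodicPt.mul_const (Function.isPeriodicPt_minimalPeriod τ e) t
    rw [this.eq]

variable {X : Type} [Fintype X] [DecidableEq X] {π : Perm X}

/-- The point reached from `x` by going through the distances at `e`, `τ e`, … depends only on the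
edge that is reached. -/
theorem pow_sum_eq_of_le {e : E} {b : ℕ} (h : ∑ e' with τ.SameCycle e e', len e' = b) {x : X}
    (hx : (π ^ b) x = x) {i i' : ℕ} (hii : i ≤ i') (hi : (τ ^ i) e = (τ ^ i') e) :
    (π ^ ∑ j ∈ range i, len ((τ ^ j) e)) x = (π ^ ∑ j ∈ range i', len ((τ ^ j) e)) x := by
  obtain ⟨c, rfl⟩ := Nat.exists_eq_add_of_le hii
  have hc : (τ ^ c) ((τ ^ i) e) = (τ ^ i) e := by
    rw [← Perm.mul_apply, ← pow_add, add_comm, ← hi]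
  have h' : ∑ e' with τ.SameCycle ((τ ^ i) e) e', len e' = b := by
    rw [← h]
    refine sum_congr (filter_congr fun e' _ => ?_) fun _ _ => rfl
    exact sameCycle_pow_left
  have hd : Function.minimalPeriod τ ((τ ^ i) e) ∣ c := by
    refine Function.IsPeriodicPt.minimalPeriod_dvd ?_
    rw [Function.IsPeriodicPt, Function.IsFixedPt, iterate_eq_pow, hc]
  obtain ⟨t, rfl⟩ := hd
  have h2 := sum_range_mul_period h' t
  have h3 : (π ^ (b * t)) x = x := by
    rw [pow_mul]
    clear h2 hi hc hii
    induction t with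
    | zero => rfl
    | succ t ih => rw [pow_succ, Perm.mul_apply, hx, ih]
  rw [sum_range_add, pow_add, Perm.mul_apply, ← h2] at *
  rw [← h2] at h3
  have h4 : ∑ j ∈ range (Function.minimalPeriod τ ((τ ^ i) e) * t), len ((τ ^ (i + j)) e) =
      ∑ j ∈ range (Function.minimalPeriod τ ((τ ^ i) e) * t), len ((τ ^ j) ((τ ^ i) e)) := by
    refine sum_congr rfl fun j _ => ?_
    rw [← Perm.mul_apply, ← pow_add, add_comm]
  rw [h4, h3]

theorem pow_card_fibre {I : Type} [Fintype I] [DecidableEq I] {lab : X → I}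
    (hl : ∀ x y, lab x = lab y ↔ π.SameCycle x y) (x : X) :
    (π ^ #{y | lab y = lab x}) x = x := by
  have h1 := sum_gap (Y := {x}) hl (i := lab x) (by simp)
  have h2 : ∑ y ∈ ({x} : Finset X) with lab y = lab x, gap π {x} y = gap π {x} x := by
    rw [filter_singleton, if_pos rfl, sum_singleton]
  rw [← h1, h2]
  exact mem_singleton.1 (ret_mem_of_mem (mem_singleton_self x))

/-- The maps that place the edges at every black vertex on a given cycle, with given distances
between successive edges, are determined by the images of one edge for every black vertex. -/
theorem card_arcMaps {I V : Type} [Fintype I] [DecidableEq I] [Fintype V] [DecidableEq V]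
    {lab : X → I} (hl : ∀ x y, lab x = lab y ↔ π.SameCycle x y) {black : E → V}
    (hblack : Function.Surjective black) (hτ : ∀ e f, τ.SameCycle e f ↔ black e = black f)
    {g : V → I} (hlen : ∀ v, ∑ e with black e = v, len e = #{x | lab x = g v}) :
    Nat.card {ι : E → X // (∀ e, lab (ι e) = g (black e)) ∧ ∀ e, ι (τ e) = (π ^ len e) (ι e)} =
      ∏ v, #{x | lab x = g v} := by
  classical
  let r : V → E := Function.surjInv hblack
  have hr : ∀ v, black (r v) = v := Function.surjInv_eq hblack
  have hsum : ∀ v, ∑ e' with τ.SameCycle (r v) e', len e' = #{x | lab x = g v} := by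
    intro v
    rw [← hlen]
    refine sum_congr (filter_congr fun e _ => ?_) fun _ _ => rfl
    rw [hτ, hr, eq_comm]
  -- going around a black vertex once is going around the cycle of `π` once
  have hkey : ∀ v x, lab x = g v → ∀ i i', (τ ^ i) (r v) = (τ ^ i') (r v) →
      (π ^ ∑ j ∈ range i, len ((τ ^ j) (r v))) x = (π ^ ∑ j ∈ range i', len ((τ ^ j) (r v))) x := by
    intro v x hx i i' h
    have hx' : (π ^ #{x | lab x = g v}) x = x := by
      have := pow_card_fibre hl x
      rwa [hx] at this
    rcases le_total i i' with hii | hii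
    · exact pow_sum_eq_of_le (hsum v) hx' hii h
    · exact (pow_sum_eq_of_le (hsum v) hx' hii h.symm).symm
  have hpow : ∀ e, ∃ i, (τ ^ i) (r (black e)) = e := by
    intro e
    obtain ⟨i, -, hi⟩ := ((hτ (r (black e)) e).2 (hr _)).exists_pow_eq'
    exact ⟨i, hi⟩
  choose p hp using hpow
  have hiter : ∀ ι : E → X, (∀ e, ι (τ e) = (π ^ len e) (ι e)) → ∀ e i,
      ι ((τ ^ i) e) = (π ^ ∑ j ∈ range i, len ((τ ^ j) e)) (ι e) := by
    intro ι hι e i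
    induction i with
    | zero => rfl
    | succ i ih =>
      rw [pow_succ', Perm.mul_apply, hι, ih, sum_range_succ, add_comm, pow_add, Perm.mul_apply]
  have hcard : ∏ v, #{x | lab x = g v} = Nat.card (∀ v, {x // lab x = g v}) := by
    rw [Nat.card_eq_fintype_card, Fintype.card_pi]
    exact prod_congr rfl fun v _ => (Fintype.card_subtype _).symm
  rw [hcard]
  refine Nat.card_congr (Equiv.ofBijective (fun ι v => ⟨ι.1 (r v), by rw [ι.2.1, hr]⟩) ⟨?_, ?_⟩)
  · rintro ⟨ι, h1, h2⟩ ⟨ι', h1', h2'⟩ h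
    refine Subtype.ext (funext fun e => ?_)
    have h3 := Subtype.ext_iff.1 (congrFun h (black e))
    dsimp only at h3 ⊢
    rw [← hp e, hiter ι h2, hiter ι' h2', h3]
  · intro x
    let ι : E → X := fun e =>
      (π ^ ∑ j ∈ range (p e), len ((τ ^ j) (r (black e)))) (x (black e)).1
    have hι : ∀ v i, ι ((τ ^ i) (r v)) = (π ^ ∑ j ∈ range i, len ((τ ^ j) (r v))) (x v).1 := by
      intro v i
      have hb : black ((τ ^ i) (r v)) = v := by
        rw [← hr v, ← hτ, hr]
        exact sameCycle_pow_left.2 (SameCycle.refl _ _)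
      simp only [ι]
      have h2 := hp ((τ ^ i) (r v))
      rw [hb] at h2 ⊢
      exact hkey v _ (x v).2 _ _ h2
    refine ⟨⟨ι, fun e => ?_, fun e => ?_⟩, funext fun v => Subtype.ext ?_⟩
    · simp only [ι]
      rw [lab_pow hl, (x (black e)).2]
    · obtain ⟨v, i, rfl⟩ : ∃ v i, (τ ^ i) (r v) = e := ⟨_, _, hp e⟩
      rw [← Perm.mul_apply, ← pow_succ', hι, hι, sum_range_succ, add_comm, pow_add, Perm.mul_apply]
    · exact hι v 0

end ArcMaps

/-! ### Plane two-coloured trees -/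

section TreeGraph

variable {E B W : Type} [Fintype E] [Fintype B] [Fintype W]

/-- The graph with an edge joining `black e` to `white e` for every `e`. -/
abbrev incGraph (black : E → B) (white : E → W) : SimpleGraph (B ⊕ W) :=
  SimpleGraph.fromRel fun a b : B ⊕ W => ∃ e, a = Sum.inl (black e) ∧ b = Sum.inr (white e)

variable {black : E → B} {white : E → W}

theorem incGraph_adj (e : E) :
    (incGraph black white).Adj (Sum.inl (black e)) (Sum.inr (white e)) :=
  (SimpleGraph.fromRel_adj _ _ _).2 ⟨Sum.inl_ne_inr, Or.inl ⟨e, rfl, rfl⟩⟩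

/-- Connectedness as an induction principle along edges. -/
theorem incGraph_connected_iff : (incGraph black white).Connected ↔ Nonempty (B ⊕ W) ∧
    ∀ F : B ⊕ W → Prop, (∀ e, F (Sum.inl (black e)) ↔ F (Sum.inr (white e))) →
      ∀ a b, F a → F b := by
  constructor
  · intro h
    refine ⟨h.nonempty, fun F hF a b ha => ?_⟩
    obtain ⟨p⟩ := h.preconnected a b
    induction p with
    | nil => exact ha
    | cons hadj _ ih =>
      refine ih ?_
      rcases ((SimpleGraph.fromRel_adj _ _ _).1 hadj).2 with ⟨e, rfl, rfl⟩ | ⟨e, rfl, rfl⟩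
      · exact (hF e).1 ha
      · exact (hF e).2 ha
  · rintro ⟨hne, h⟩
    refine (SimpleGraph.connected_iff _).2 ⟨fun a b => ?_, hne⟩
    refine h (fun c => (incGraph black white).Reachable a c) (fun e => ?_) a b
      (SimpleGraph.Reachable.refl _)
    exact ⟨fun h' => h'.trans (incGraph_adj e).reachable,
      fun h' => h'.trans (incGraph_adj e).symm.reachable⟩

/-- The edge of the graph that belongs to an element of the index set of the edges. -/
def incEdge (black : E → B) (white : E → W) (e : E) : (incGraph black white).edgeSet :=
  ⟨s(Sum.inl (black e), Sum.inr (white e)), incGraph_adj e⟩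

theorem incEdge_surjective : Function.Surjective (incEdge black white) := by
  rintro ⟨s, hs⟩
  induction s using Sym2.ind with
  | _ a b =>
    rcases ((SimpleGraph.fromRel_adj _ _ _).1 ((SimpleGraph.mem_edgeSet _).1 hs)).2 with
      ⟨e, rfl, rfl⟩ | ⟨e, rfl, rfl⟩
    · exact ⟨e, rfl⟩
    · exact ⟨e, Subtype.ext Sym2.eq_swap⟩

theorem incEdge_injective_iff : Function.Injective (incEdge black white) ↔
    Function.Injective fun e => (black e, white e) := by
  have : ∀ e f, incEdge black white e = incEdge black white f ↔
      (black e, white e) = (black f, white f) := by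
    intro e f
    simp [incEdge, Subtype.ext_iff]
  simp only [Function.Injective, this]

theorem card_of_isTree (hs : Function.Injective fun e => (black e, white e))
    (h : (incGraph black white).IsTree) :
    Fintype.card B + Fintype.card W = Fintype.card E + 1 := by
  have h1 := (SimpleGraph.isTree_iff_connected_and_card.1 h).2
  rw [← Nat.card_eq_of_bijective _ ⟨incEdge_injective_iff.2 hs, incEdge_surjective⟩,
    Nat.card_eq_fintype_card, Nat.card_eq_fintype_card, Fintype.card_sum] at h1
  exact h1.symm

/-- A connected graph with one more vertex than edges is a tree, and no two of its edges join the
same vertices. -/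
theorem isTree_of_card (hc : (incGraph black white).Connected)
    (h : Fintype.card B + Fintype.card W = Fintype.card E + 1) :
    (Function.Injective fun e => (black e, white e)) ∧ (incGraph black white).IsTree := by
  have h1 := hc.card_vert_le_card_edgeSet_add_one
  have h2 := Nat.card_le_card_of_surjective _ (incEdge_surjective (black := black) (white := white))
  rw [Nat.card_eq_fintype_card, Fintype.card_sum] at h1
  rw [Nat.card_eq_fintype_card (α := E)] at h2
  have h3 : Fintype.card E = Nat.card (incGraph black white).edgeSet := by omega
  refine ⟨incEdge_injective_iff.1 ?_, ?_⟩
  · refine ((Nat.bijective_iff_surjective_and_card _).2 ⟨incEdge_surjective, ?_⟩).1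
    rw [Nat.card_eq_fintype_card, h3]
  · refine SimpleGraph.isTree_iff_connected_and_card.2 ⟨hc, ?_⟩
    rw [Nat.card_eq_fintype_card (α := B ⊕ W), Fintype.card_sum]
    omega

end TreeGraph

namespace PlaneTree

variable {T T' : PlaneTree}

theorem card_vertices (T : PlaneTree) : T.nB + T.nW = T.nE + 1 := by
  have := card_of_isTree T.simple T.isTree
  simpa using this

theorem connected (T : PlaneTree) {F : Fin T.nB ⊕ Fin T.nW → Prop}
    (hF : ∀ e, F (Sum.inl (T.black e)) ↔ F (Sum.inr (T.white e))) (a b) : F a → F b :=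
  (incGraph_connected_iff.1 T.isTree.1).2 F hF a b

theorem black_surjective (hE : T.nE ≠ 0) : Function.Surjective T.black := by
  intro v
  by_contra h
  push Not at h
  have := T.connected (F := fun a => a = Sum.inl v) (fun e => by simp [h e]) (Sum.inl v)
    (Sum.inr (T.white ⟨0, Nat.pos_of_ne_zero hE⟩)) rfl
  cases this

theorem white_surjective (hE : T.nE ≠ 0) : Function.Surjective T.white := by
  intro v
  by_contra h
  push Not at h
  have := T.connected (F := fun a => a = Sum.inr v) (fun e => by simp [h e]) (Sum.inr v)
    (Sum.inl (T.black ⟨0, Nat.pos_of_ne_zero hE⟩)) rfl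
  cases this

theorem degB_ne_zero (hE : T.nE ≠ 0) (v : Fin T.nB) : T.degB v ≠ 0 := by
  obtain ⟨e, rfl⟩ := black_surjective hE v
  have : 0 < T.degB (T.black e) := card_pos.2 ⟨e, mem_filter.2 ⟨mem_univ _, rfl⟩⟩
  exact this.ne'

theorem IsReduced.nW_eq_zero (hT : T.IsReduced) (hE : T.nE = 0) : T.nW = 0 := by
  by_contra h
  have h1 := hT ⟨0, Nat.pos_of_ne_zero h⟩
  have h2 : T.degW ⟨0, Nat.pos_of_ne_zero h⟩ ≤ T.nE := by
    have := card_filter_le univ fun e => T.white e = ⟨0, Nat.pos_of_ne_zero h⟩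
    rwa [card_univ, Fintype.card_fin] at this
  omega

theorem IsReduced.nB_eq_one (hT : T.IsReduced) (hE : T.nE = 0) : T.nB = 1 := by
  have h1 := hT.nW_eq_zero hE
  have h2 := T.card_vertices
  omega

/-- A white vertex of degree at least two has at least two neighbours. -/
theorem IsReduced.two_le_nB (hT : T.IsReduced) (hE : T.nE ≠ 0) : 2 ≤ T.nB := by
  obtain ⟨e, he, f, hf, hne⟩ := one_lt_card.1 (hT (T.white ⟨0, Nat.pos_of_ne_zero hE⟩))
  have h1 : T.black e ≠ T.black f := fun h => hne (T.simple (Prod.ext h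
    ((mem_filter.1 he).2.trans (mem_filter.1 hf).2.symm)))
  have h2 := Fintype.one_lt_card_iff.2 ⟨_, _, h1⟩
  rwa [Fintype.card_fin] at h2

theorem IsReduced.rotW_ne (hT : T.IsReduced) (e : Fin T.nE) : T.rotW e ≠ e := by
  intro h
  obtain ⟨f, hf, g, hg, hne⟩ := one_lt_card.1 (hT (T.white e))
  have h1 : ∀ f, f ∈ univ.filter (fun f => T.white f = T.white e) → e = f := fun f hf =>
    ((T.rotW_sameCycle e f).2 (mem_filter.1 hf).2.symm).eq_of_left h
  exact hne ((h1 f hf).symm.trans (h1 g hg))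

theorem finite_of_card_le (N : ℕ) : {T : PlaneTree | T.nE ≤ N}.Finite := by
  let S := Σ p : Fin (N + 2) × Fin (N + 2) × Fin (N + 1), (Fin p.2.2 → Fin p.1) ×
    (Fin p.2.2 → Fin p.2.1) × Perm (Fin p.2.2) × Perm (Fin p.2.2)
  let f : {T : PlaneTree | T.nE ≤ N} → S := fun T => ⟨(⟨T.1.nB, by
      have := T.1.card_vertices; have : T.1.nE ≤ N := T.2; omega⟩, ⟨T.1.nW, by
      have := T.1.card_vertices; have : T.1.nE ≤ N := T.2; omega⟩, ⟨T.1.nE, by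
      have : T.1.nE ≤ N := T.2; omega⟩), T.1.black, T.1.white, T.1.rotB, T.1.rotW⟩
  refine Set.finite_coe_iff.1 (Finite.of_injective f ?_)
  rintro ⟨⟨nB, nW, nE, a, b, c, d, _, _, _, _⟩, _⟩
    ⟨⟨nB', nW', nE', a', b', c', d', _, _, _, _⟩, _⟩ h
  obtain ⟨h1, h⟩ := Sigma.mk.inj_iff.1 h
  simp only [Prod.mk.injEq, Fin.mk.injEq] at h1
  obtain ⟨rfl, rfl, rfl⟩ := h1
  simp only [heq_eq_eq, Prod.mk.injEq] at h
  obtain ⟨rfl, rfl, rfl, rfl⟩ := h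
  rfl

/-- An isomorphism of trees with edges is determined by what it does to the edges. -/
theorem Iso.ext_onE (hE : T.nE ≠ 0) {f g : Iso T T'} (h : f.onE = g.onE) : f = g := by
  have h1 : f.onB = g.onB := Equiv.ext fun v => by
    obtain ⟨e, rfl⟩ := black_surjective hE v
    rw [← f.black_comm, ← g.black_comm, h]
  have h2 : f.onW = g.onW := Equiv.ext fun v => by
    obtain ⟨e, rfl⟩ := white_surjective hE v
    rw [← f.white_comm, ← g.white_comm, h]
  cases f
  cases g
  subst h h1 h2
  rfl

instance : Finite (Iso T T') := by
  refine Finite.of_injective (fun f => (f.onB, f.onW, f.onE)) fun f g h => ?_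
  cases f
  cases g
  simp only [Prod.mk.injEq] at h
  obtain ⟨rfl, rfl, rfl⟩ := h
  rfl

instance : Nonempty (Iso T T) :=
  ⟨⟨Equiv.refl _, Equiv.refl _, Equiv.refl _, fun _ => rfl, fun _ => rfl, fun _ => rfl,
    fun _ => rfl⟩⟩

/-- The tree consisting of an isolated black vertex. -/
def isolated : PlaneTree where
  nB := 1
  nW := 0
  nE := 0
  black := finZeroElim
  white := finZeroElim
  rotB := 1
  rotW := 1
  rotB_sameCycle := fun e => e.elim0
  rotW_sameCycle := fun e => e.elim0
  simple := fun e => e.elim0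
  isTree := (isTree_of_card (incGraph_connected_iff.2 ⟨⟨Sum.inl 0⟩, fun F _ a b h => by
    rcases a with a | a
    · rcases b with b | b
      · rwa [Subsingleton.elim b a]
      · exact b.elim0
    · exact a.elim0⟩) (by simp)).2

theorem isolated_isReduced : isolated.IsReduced := fun w => w.elim0

theorem nonempty_iso_isolated (hT : T.IsReduced) (hE : T.nE = 0) : Nonempty (Iso T isolated) := by
  have h1 := hT.nW_eq_zero hE
  have h2 := hT.nB_eq_one hE
  have : IsEmpty (Fin T.nE) := by rw [hE]; infer_instance
  exact ⟨⟨finCongr h2, finCongr h1, finCongr hE, fun e => isEmptyElim e, fun e => isEmptyElim e,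
    fun e => isEmptyElim e, fun e => isEmptyElim e⟩⟩

end PlaneTree

section Support

variable {m k : ℕ} (Q : ∀ j, MvPowerSeries (Fin j) ℚ)

/-- Every edge contributes a factor `y`. -/
theorem coeff_treeProd_eq_zero {T : PlaneTree} (lam : Fin T.nB ↪ Fin m) (h : k < T.nE) :
    PowerSeries.coeff k (treeProd k Q T lam) = 0 := by
  rw [treeProd_eq Q lam k (PlaneTree.degB_ne_zero (by omega)), mul_assoc, PowerSeries.coeff_C_mul,
    mul_assoc, PowerSeries.coeff_X_pow_mul', if_neg (by omega), mul_zero]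

theorem nE_le_of_treeTerm_ne_zero {t : ReducedTree} (h : treeTerm k m Q t ≠ 0) :
    t.out.1.nE ≤ k := by
  by_contra hlt
  refine h ?_
  rw [treeTerm, map_sum, sum_eq_zero fun lam _ => coeff_treeProd_eq_zero Q lam (not_le.1 hlt)]
  have : markerCoeff (0 : A m) = 0 := by
    ext β
    rw [markerCoeff_eq, map_zero, map_zero]
  rw [this, smul_zero]

theorem finite_nE_le (k : ℕ) : {t : ReducedTree | t.out.1.nE ≤ k}.Finite := by
  refine Set.Finite.of_finite_image (f := fun t : ReducedTree => t.out.1)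
    ((PlaneTree.finite_of_card_le k).subset ?_) ?_
  · rintro _ ⟨t, ht, rfl⟩
    exact ht
  · intro s _ t _ h
    have h' := Subtype.ext h
    rw [← Quotient.out_eq s, ← Quotient.out_eq t, h']

theorem finite_support_treeTerm : (Function.support (treeTerm k m Q)).Finite :=
  (finite_nE_le k).subset fun _ h => nE_le_of_treeTerm_ne_zero Q h

end Support

/-! ### Trees drawn on the cycles of a permutation -/

section Core

variable {X E : Type} [Fintype X] [DecidableEq X] [Fintype E] {ι : E → X} {τ : Perm E}

open Classical in
/-- The permutation of `X` that acts as `τ` on the points `ι e` and fixes the other points. The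
value is junk if `ι` is not injective. -/
def core (ι : E → X) (τ : Perm E) : Perm X :=
  if h : Function.Injective ι then τ.viaEmbedding ⟨ι, h⟩ else 1

theorem core_apply (hι : Function.Injective ι) (e : E) : core ι τ (ι e) = ι (τ e) := by
  rw [core, dif_pos hι]
  exact viaEmbedding_apply τ ⟨ι, hι⟩ e

theorem core_of_notMem (hι : Function.Injective ι) {x : X} (hx : x ∉ univ.image ι) :
    core ι τ x = x := by
  rw [core, dif_pos hι]
  refine viaEmbedding_apply_of_notMem τ ⟨ι, hι⟩ x fun ⟨e, he⟩ => hx ?_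
  exact mem_image.2 ⟨e, mem_univ _, he⟩

theorem eq_core (hι : Function.Injective ι) {b : Perm X} (h1 : ∀ e, b (ι e) = ι (τ e))
    (h2 : ∀ x ∉ univ.image ι, b x = x) : b = core ι τ := by
  ext x
  by_cases hx : x ∈ univ.image ι
  · obtain ⟨e, -, rfl⟩ := mem_image.1 hx
    rw [h1, core_apply hι]
  · rw [h2 x hx, core_of_notMem hι hx]

theorem support_core_subset (hι : Function.Injective ι) : (core ι τ).support ⊆ univ.image ι :=
  fun x hx => by
    by_contra h
    exact mem_support.1 hx (core_of_notMem hι h)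

theorem support_core (hι : Function.Injective ι) (hτ : ∀ e, τ e ≠ e) :
    (core ι τ).support = univ.image ι := by
  refine (support_core_subset hι).antisymm fun x hx => ?_
  obtain ⟨e, -, rfl⟩ := mem_image.1 hx
  rw [mem_support, core_apply hι]
  exact fun h => hτ e (hι h)

theorem core_pow_apply (hι : Function.Injective ι) (i : ℕ) (e : E) :
    (core ι τ ^ i) (ι e) = ι ((τ ^ i) e) := by
  induction i with
  | zero => rfl
  | succ i ih => rw [pow_succ', pow_succ', Perm.mul_apply, Perm.mul_apply, ih, core_apply hι]

theorem core_sameCycle (hι : Function.Injective ι) {e f : E} :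
    (core ι τ).SameCycle (ι e) (ι f) ↔ τ.SameCycle e f := by
  constructor
  · intro h
    obtain ⟨i, -, hi⟩ := h.exists_pow_eq'
    rw [core_pow_apply hι] at hi
    exact ⟨i, by rw [zpow_natCast]; exact hι hi⟩
  · rintro h
    obtain ⟨i, -, hi⟩ := h.exists_pow_eq'
    exact ⟨i, by rw [zpow_natCast, core_pow_apply hι, hi]⟩

end Core

section Drawing

variable {X I : Type} [Fintype X] [DecidableEq X] [DecidableEq I] {π : Perm X} {lab : X → I}
  {T T' : PlaneTree}

/-- The edges of `T` are drawn as points on the cycles of `π`, in such a way that the cyclic order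
of the edges at a black vertex is that of the points on a cycle. -/
def IsDrawing (T : PlaneTree) (π : Perm X) (ι : Fin T.nE → X) : Prop :=
  Function.Injective ι ∧ retPerm π (univ.image ι) = core ι T.rotB

theorem isDrawing_iff {ι : Fin T.nE → X} : IsDrawing T π ι ↔
    Function.Injective ι ∧ ∀ e, ret π (univ.image ι) (ι e) = ι (T.rotB e) := by
  refine and_congr_right fun hι => ⟨fun h e => ?_, fun h => ?_⟩
  · rw [← retPerm_of_mem (mem_image_of_mem ι (mem_univ e)), h, core_apply hι]
  · refine eq_core hι (fun e => ?_) fun x hx => retPerm_of_notMem hx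
    rw [retPerm_of_mem (mem_image_of_mem ι (mem_univ e)), h]

variable {ι : Fin T.nE → X} {ι' : Fin T'.nE → X}

theorem IsDrawing.lab_eq_iff (h : IsDrawing T π ι) (hl : ∀ x y, lab x = lab y ↔ π.SameCycle x y)
    (e f : Fin T.nE) : lab (ι e) = lab (ι f) ↔ T.black e = T.black f := by
  rw [← retPerm_sameCycle hl (mem_image_of_mem ι (mem_univ e)) (mem_image_of_mem ι (mem_univ f)),
    h.2, core_sameCycle h.1, T.rotB_sameCycle]

/-- A drawing places different black vertices on different cycles. -/
theorem IsDrawing.exists_lam (h : IsDrawing T π ι) (hl : ∀ x y, lab x = lab y ↔ π.SameCycle x y)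
    (hE : T.nE ≠ 0) : ∃ lam : Fin T.nB ↪ I, ∀ e, lab (ι e) = lam (T.black e) := by
  have hs := PlaneTree.black_surjective hE
  refine ⟨⟨fun v => lab (ι (Function.surjInv hs v)), fun v w hvw => ?_⟩, fun e => ?_⟩
  · rw [h.lab_eq_iff hl, Function.surjInv_eq hs, Function.surjInv_eq hs] at hvw
    exact hvw
  · exact (h.lab_eq_iff hl _ _).2 (Function.surjInv_eq hs _).symm

theorem image_lab_image {lam : Fin T.nB ↪ I} (hE : T.nE ≠ 0)
    (h : ∀ e, lab (ι e) = lam (T.black e)) : (univ.image ι).image lab = univ.map lam := by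
  ext i
  simp only [mem_image, mem_univ, true_and, mem_map, exists_exists_eq_and, h]
  constructor
  · rintro ⟨e, rfl⟩
    exact ⟨_, rfl⟩
  · rintro ⟨v, rfl⟩
    obtain ⟨e, rfl⟩ := PlaneTree.black_surjective hE v
    exact ⟨e, rfl⟩

/-- The white vertices are the cycles around them. -/
theorem exists_equiv_white (hι : Function.Injective ι) (hE : T.nE ≠ 0) :
    ∃ g : Fin T.nW ≃ White (univ.image ι) (core ι T.rotW), ∀ e, g (T.white e) =
      white (univ.image ι) (core ι T.rotW) ⟨ι e, mem_image_of_mem ι (mem_univ e)⟩ := by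
  refine exists_equiv_of_ker_eq (PlaneTree.white_surjective hE) (fun w => ?_) fun e f => ?_
  · obtain ⟨⟨y, hy⟩, rfl⟩ := KCycle.white_surjective (support_core_subset hι) w
    obtain ⟨e, -, rfl⟩ := mem_image.1 hy
    exact ⟨e, rfl⟩
  · rw [white_eq_iff, core_sameCycle hι, T.rotW_sameCycle]

/-- The graph of a drawing of a tree is a tree. -/
theorem IsDrawing.isTreeCut (h : IsDrawing T π ι)
    (hl : ∀ x y, lab x = lab y ↔ π.SameCycle x y) (hE : T.nE ≠ 0) :
    IsTreeCut lab (univ.image ι) (core ι T.rotW) := by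
  refine ⟨support_core_subset h.1, fun F hb hF y hy z hz hFy => ?_, ?_⟩
  · -- a property of the edges that only depends on the end of the edge, of either colour
    have hB : ∀ e f, T.black e = T.black f → F (ι e) → F (ι f) := fun e f hef =>
      hF _ (mem_image_of_mem ι (mem_univ e)) _ (mem_image_of_mem ι (mem_univ f))
        ((h.lab_eq_iff hl e f).2 hef)
    have hW : ∀ e f, T.white e = T.white f → F (ι e) → F (ι f) := by
      intro e f hef hFe
      obtain ⟨i, -, rfl⟩ := ((T.rotW_sameCycle e f).2 hef).exists_pow_eq'
      clear hef
      induction i with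
      | zero => exact hFe
      | succ i ih =>
        rw [pow_succ', Perm.mul_apply, ← core_apply h.1]
        exact (hb _ (mem_image_of_mem ι (mem_univ _))).2 ih
    obtain ⟨e, -, rfl⟩ := mem_image.1 hy
    obtain ⟨f, -, rfl⟩ := mem_image.1 hz
    have := T.connected (F := fun a => ∃ e, (a = Sum.inl (T.black e) ∨ a = Sum.inr (T.white e)) ∧
      F (ι e)) (fun e => ?_) (Sum.inl (T.black e)) (Sum.inl (T.black f)) ⟨e, Or.inl rfl, hFy⟩
    · obtain ⟨e', h1 | h1, h2⟩ := this
      · exact hB _ _ (Sum.inl_injective h1).symm h2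
      · cases h1
    · constructor
      · rintro ⟨e', h1 | h1, h2⟩
        · exact ⟨e, Or.inr rfl, hB _ _ (Sum.inl_injective h1).symm h2⟩
        · cases h1
      · rintro ⟨e', h1 | h1, h2⟩
        · cases h1
        · exact ⟨e, Or.inl rfl, hW _ _ (Sum.inr_injective h1).symm h2⟩
  · obtain ⟨lam, hlam⟩ := h.exists_lam hl hE
    obtain ⟨g, -⟩ := exists_equiv_white h.1 hE
    have h1 := card_white (support_core_subset (τ := T.rotW) h.1)
    rw [← Fintype.card_congr g, card_image_of_injective _ h.1, card_univ, Fintype.card_fin,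
      Fintype.card_fin] at h1
    rw [image_lab_image hE hlam, card_map, card_univ, Fintype.card_fin]
    have := T.card_vertices
    omega

/-- Isomorphisms act on drawings. -/
theorem IsDrawing.comp (h : IsDrawing T' π ι') (g : PlaneTree.Iso T T') :
    IsDrawing T π (ι' ∘ g.onE) ∧ core (ι' ∘ g.onE) T.rotW = core ι' T'.rotW := by
  have himg : univ.image (ι' ∘ g.onE) = univ.image ι' := by
    rw [← image_image, image_univ_equiv]
  have hinj := h.1.comp g.onE.injective
  refine ⟨isDrawing_iff.2 ⟨hinj, fun e => ?_⟩, (eq_core hinj (fun e => ?_) fun x hx => ?_).symm⟩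
  · rw [himg, Function.comp_apply, (isDrawing_iff.1 h).2, g.rotB_comm, Function.comp_apply]
  · rw [Function.comp_apply, core_apply h.1, g.rotW_comm, Function.comp_apply]
  · exact core_of_notMem h.1 (himg ▸ hx)

/-- A tree is determined by a drawing of its edges and by the permutation of the points around the
white vertices. -/
theorem IsDrawing.exists_iso (h : IsDrawing T π ι) (h' : IsDrawing T' π ι') (hT : T.IsReduced)
    (hT' : T'.IsReduced) (hE : T.nE ≠ 0) (hE' : T'.nE ≠ 0)
    (hc : core ι T.rotW = core ι' T'.rotW) :
    ∃ g : PlaneTree.Iso T T', ∀ e, ι' (g.onE e) = ι e := by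
  have himg : univ.image ι = univ.image ι' := by
    rw [← support_core h.1 hT.rotW_ne, hc, support_core h'.1 hT'.rotW_ne]
  have hex : ∀ e, ∃ e', ι' e' = ι e := fun e => by
    have := mem_image_of_mem ι (mem_univ e)
    rw [himg] at this
    obtain ⟨e', -, he⟩ := mem_image.1 this
    exact ⟨e', he⟩
  choose g hg using hex
  have hbij : Function.Bijective g := by
    refine ⟨fun e f hef => h.1 (by rw [← hg, ← hg, hef]), fun e' => ?_⟩
    have := mem_image_of_mem ι' (mem_univ e')
    rw [← himg] at this
    obtain ⟨e, -, he⟩ := mem_image.1 this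
    exact ⟨e, h'.1 (by rw [hg, he])⟩
  have hB : ∀ e, T'.rotB (g e) = g (T.rotB e) := fun e => h'.1 (by
    rw [hg, ← (isDrawing_iff.1 h).2, ← (isDrawing_iff.1 h').2, hg, himg])
  have hW : ∀ e, T'.rotW (g e) = g (T.rotW e) := fun e => h'.1 (by
    rw [hg, ← core_apply h.1, ← core_apply h'.1, hg, hc])
  have hpow : ∀ {σ : Perm (Fin T.nE)} {σ' : Perm (Fin T'.nE)}, (∀ e, σ' (g e) = g (σ e)) →
      ∀ e f, σ.SameCycle e f ↔ σ'.SameCycle (g e) (g f) := by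
    intro σ σ' hσ e f
    have hcore : core g σ = σ' := (eq_core hbij.1 hσ fun x hx => by
      obtain ⟨e, rfl⟩ := hbij.2 x
      exact absurd (mem_image_of_mem g (mem_univ e)) hx).symm
    rw [← hcore, core_sameCycle hbij.1]
  obtain ⟨gB, hgB⟩ := exists_equiv_of_ker_eq (g := fun e => T'.black (g e))
    (PlaneTree.black_surjective hE) ((PlaneTree.black_surjective hE').comp hbij.2) fun e f => by
      rw [← T.rotB_sameCycle, ← T'.rotB_sameCycle, hpow hB]
  obtain ⟨gW, hgW⟩ := exists_equiv_of_ker_eq (g := fun e => T'.white (g e))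
    (PlaneTree.white_surjective hE) ((PlaneTree.white_surjective hE').comp hbij.2) fun e f => by
      rw [← T.rotW_sameCycle, ← T'.rotW_sameCycle, hpow hW]
  exact ⟨⟨gB, gW, Equiv.ofBijective g hbij, fun e => (hgB e).symm, fun e => (hgW e).symm, hB, hW⟩,
    hg⟩

/-- Every tree given by points and a permutation of them is the drawing of a plane tree, whose edges
are the points moved by `b`. -/
theorem exists_drawing (hl : ∀ x y, lab x = lab y ↔ π.SameCycle x y) {b : Perm X} (hb : b ≠ 1)
    (hcut : IsTreeCut lab b.support b) : ∃ (T : PlaneTree) (ι : Fin T.nE → X), T.IsReduced ∧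
      T.nE ≠ 0 ∧ IsDrawing T π ι ∧ core ι T.rotW = b := by
  set Y := b.support with hY
  have hne : #Y ≠ 0 := by rwa [Ne, hY, card_support_eq_zero]
  let eE : Fin #Y ≃ {y // y ∈ Y} := Y.equivFin.symm
  let eB : {i // i ∈ Y.image lab} ≃ Fin #(Y.image lab) := (Y.image lab).equivFin
  let eW : White Y b ≃ Fin (Fintype.card (White Y b)) := Fintype.equivFin _
  let ι : Fin #Y → X := fun e => (eE e).1
  have hι : Function.Injective ι := fun e f h => eE.injective (Subtype.ext h)
  have hmem : ∀ e, ι e ∈ Y := fun e => (eE e).2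
  have himg : univ.image ι = Y := by
    ext y
    refine ⟨fun h => ?_, fun h => mem_image.2 ⟨eE.symm ⟨y, h⟩, mem_univ _, by simp [ι]⟩⟩
    obtain ⟨e, -, rfl⟩ := mem_image.1 h
    exact hmem e
  have hsub : ∀ (σ : Perm X), (∀ x, σ x ∈ Y ↔ x ∈ Y) →
      ∃ τ : Perm (Fin #Y), ∀ e, σ (ι e) = ι (τ e) := fun σ hσ =>
    ⟨eE.symm.permCongr (σ.subtypePerm hσ), fun e => by simp [ι, Equiv.permCongr_apply]⟩
  obtain ⟨τB, hτB⟩ := hsub (retPerm π Y) fun x => retPerm_mem_iff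
  obtain ⟨τW, hτW⟩ := hsub b fun x => by rw [hY]; exact apply_mem_support
  have hcB : retPerm π Y = core ι τB := eq_core hι hτB fun x hx => retPerm_of_notMem (himg ▸ hx)
  have hcW : b = core ι τW := eq_core hι hτW fun x hx =>
    notMem_support.1 fun h => hx (himg.symm ▸ h)
  let black : Fin #Y → Fin #(Y.image lab) := fun e => eB ⟨lab (ι e), mem_image_of_mem _ (hmem e)⟩
  let wh : Fin #Y → Fin (Fintype.card (White Y b)) := fun e => eW (white Y b (eE e))
  have hblack : ∀ e f, τB.SameCycle e f ↔ black e = black f := fun e f => by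
    rw [← core_sameCycle hι, ← hcB, retPerm_sameCycle hl (hmem e) (hmem f), eB.apply_eq_iff_eq,
      Subtype.mk.injEq]
  have hwh : ∀ e f, τW.SameCycle e f ↔ wh e = wh f := fun e f => by
    rw [← core_sameCycle hι, ← hcW, eW.apply_eq_iff_eq, white_eq_iff]
  have hbs : Function.Surjective black := fun v => by
    obtain ⟨⟨i, hi⟩, rfl⟩ := eB.surjective v
    obtain ⟨y, hy, rfl⟩ := mem_image.1 hi
    exact ⟨eE.symm ⟨y, hy⟩, by simp [black, ι]⟩
  have hws : Function.Surjective wh :=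
    eW.surjective.comp ((white_surjective subset_rfl).comp eE.surjective)
  have hconn : (incGraph black wh).Connected := by
    refine incGraph_connected_iff.2 ⟨⟨Sum.inl (black ⟨0, Nat.pos_of_ne_zero hne⟩)⟩, fun F hF => ?_⟩
    have key : ∀ e f, F (Sum.inl (black e)) → F (Sum.inl (black f)) := by
      intro e f
      have := hcut.conn (fun y => ∃ e, ι e = y ∧ F (Sum.inl (black e))) (fun y hy => ?_)
        (fun y hy z hz hyz => ?_) _ (hmem e) _ (hmem f)
      · intro he
        obtain ⟨f', hf, h⟩ := this ⟨e, rfl, he⟩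
        rwa [hι hf] at h
      · obtain ⟨e, rfl⟩ : ∃ e, ι e = y := ⟨eE.symm ⟨y, hy⟩, by simp [ι]⟩
        have h1 : wh (τW e) = wh e := (hwh _ _).1 (sameCycle_apply_left.2 (SameCycle.refl _ _))
        rw [hτW]
        constructor
        · rintro ⟨f, hf, h⟩
          rw [hι hf, hF, h1, ← hF] at h
          exact ⟨e, rfl, h⟩
        · rintro ⟨f, hf, h⟩
          rw [hι hf, hF, ← h1, ← hF] at h
          exact ⟨_, rfl, h⟩
      · rintro ⟨e, rfl, h⟩
        refine ⟨eE.symm ⟨z, hz⟩, by simp [ι], ?_⟩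
        have : black (eE.symm ⟨z, hz⟩) = black e := by
          simp only [black, ι, eB.apply_eq_iff_eq, Subtype.mk.injEq, Equiv.apply_symm_apply]
          exact hyz.symm
        rwa [this]
    -- every vertex is the end of an edge
    have key2 : ∀ a, ∃ e, F a ↔ F (Sum.inl (black e)) := by
      rintro (v | w)
      · obtain ⟨e, rfl⟩ := hbs v
        exact ⟨e, Iff.rfl⟩
      · obtain ⟨e, rfl⟩ := hws w
        exact ⟨e, (hF e).symm⟩
    intro a c ha
    obtain ⟨e, he⟩ := key2 a
    obtain ⟨f, hf⟩ := key2 c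
    exact hf.2 (key e f (he.1 ha))
  obtain ⟨hsimple, htree⟩ := isTree_of_card hconn (by
    have h1 := card_white (b := b) (Y := Y) subset_rfl
    have h2 := hcut.card_eq
    rw [Fintype.card_fin, Fintype.card_fin, Fintype.card_fin]
    omega)
  let T : PlaneTree := ⟨_, _, _, black, wh, τB, τW, hblack, hwh, hsimple, htree⟩
  refine ⟨T, ι, fun w => ?_, hne, ⟨hι, ?_⟩, hcW.symm⟩
  · obtain ⟨e, rfl⟩ := hws w
    refine one_lt_card.2 ⟨e, mem_filter.2 ⟨mem_univ _, rfl⟩, τW e, mem_filter.2 ⟨mem_univ _, ?_⟩,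
      fun h => ?_⟩
    · exact (hwh _ _).1 (sameCycle_apply_left.2 (SameCycle.refl _ _))
    · refine mem_support.1 (hmem e) ?_
      rw [hτW, ← h]
  · exact (congrArg (retPerm π) himg).trans hcB

open Classical in
/-- The drawings of a tree with a given permutation around the white vertices are a torsor under
the automorphism group of the tree. -/
theorem card_drawings (hT : T.IsReduced) (hE : T.nE ≠ 0) (h : IsDrawing T π ι) :
    #{ι' : Fin T.nE → X | IsDrawing T π ι' ∧ core ι' T.rotW = core ι T.rotW} =
      Nat.card (PlaneTree.Iso T T) := by
  have : Nat.card (PlaneTree.Iso T T) =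
      Nat.card {ι' : Fin T.nE → X // IsDrawing T π ι' ∧ core ι' T.rotW = core ι T.rotW} := by
    refine Nat.card_eq_of_bijective (fun g => ⟨ι ∘ g.onE, h.comp g⟩) ⟨fun f g hfg => ?_, ?_⟩
    · refine PlaneTree.Iso.ext_onE hE (Equiv.ext fun e => h.1 ?_)
      exact congrFun (Subtype.ext_iff.1 hfg) e
    · rintro ⟨ι', h', hc⟩
      obtain ⟨g, hg⟩ := h'.exists_iso h hT hT hE hE hc
      exact ⟨g, Subtype.ext (funext hg)⟩
  rw [this, Nat.card_eq_fintype_card, Fintype.card_subtype]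

end Drawing

/-! ### The contribution of a tree as a sum over its drawings -/

section TreeSum

variable {X : Type} [Fintype X] [DecidableEq X] {m : ℕ} {π : Perm X} {lab : X → Fin m}
  (Q : ∀ j, MvPowerSeries (Fin j) ℚ)

/-- The contribution of a first factor, as a coefficient. The cycles of `π` that the factor meets
are the black vertices of its tree, and the remaining cycles are distributed among the series at
the white vertices. -/
def cutCoeff (π : Perm X) (lab : X → Fin m) (Y : Finset X) (b : Perm X) : ℚ :=
  MvPowerSeries.coeff (ex (fun i => #{x | lab x = i}) (Y.image lab)ᶜ) (cutProd Q m π Y b) /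
    ∏ i ∈ Y.image lab, (#{x | lab x = i} : ℚ)

/-- The sets of `k` points that arise from `Z` by adding leaves at the black vertices. -/
def leafExtensions (lab : X → Fin m) (Z : Finset X) (k : ℕ) : Finset (Finset X) :=
  univ.filter fun Y => Z ⊆ Y ∧ Y.image lab = Z.image lab ∧ #Y = k

theorem mem_leafExtensions {Z Y : Finset X} {k : ℕ} :
    Y ∈ leafExtensions lab Z k ↔ Z ⊆ Y ∧ Y.image lab = Z.image lab ∧ #Y = k := by
  rw [leafExtensions, mem_filter, and_iff_right (mem_univ _)]

theorem sum_leafExtensions {M : Type*} [AddCommMonoid M] (Z : Finset X) (k : ℕ)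
    (g : Finset X → M) : ∑ Y ∈ leafExtensions lab Z k, g Y =
      ∑ L ∈ (univ.filter fun x => lab x ∈ Z.image lab ∧ x ∉ Z).powerset with #Z + #L = k,
        g (Z ∪ L) := by
  symm
  have hdis : ∀ L ∈ (univ.filter fun x => lab x ∈ Z.image lab ∧ x ∉ Z).powerset, Disjoint Z L :=
    fun L hL => disjoint_right.2 fun x hx => (mem_filter.1 (mem_powerset.1 hL hx)).2.2
  refine sum_bij (fun L _ => Z ∪ L) (fun L hL => ?_) (fun L hL L' hL' h => ?_) (fun Y hY => ?_)
    fun _ _ => rfl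
  · rw [mem_filter] at hL
    refine mem_leafExtensions.2 ⟨subset_union_left, ?_, ?_⟩
    · rw [image_union, union_eq_left]
      intro i hi
      obtain ⟨x, hx, rfl⟩ := mem_image.1 hi
      exact (mem_filter.1 (mem_powerset.1 hL.1 hx)).2.1
    · rw [card_union_of_disjoint (hdis L hL.1), hL.2]
  · have h1 := hdis L (mem_filter.1 hL).1
    have h2 := hdis L' (mem_filter.1 hL').1
    rw [← union_sdiff_cancel_left h1, h, union_sdiff_cancel_left h2]
  · obtain ⟨h1, h2, h3⟩ := mem_leafExtensions.1 hY
    refine ⟨Y \ Z, mem_filter.2 ⟨mem_powerset.2 fun x hx => ?_, ?_⟩, union_sdiff_of_subset h1⟩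
    · rw [mem_sdiff] at hx
      exact mem_filter.2 ⟨mem_univ _, h2 ▸ mem_image_of_mem _ hx.1, hx.2⟩
    · rw [add_comm, card_sdiff_add_card_eq_card h1, h3]

theorem sum_cutCoeff (hl : ∀ x y, lab x = lab y ↔ π.SameCycle x y) {E : Type} [Fintype E]
    [DecidableEq E] {ι : E → X} (hι : Function.Injective ι) {b : Perm X}
    (hb : b.support ⊆ univ.image ι) (k : ℕ) :
    ∑ Y ∈ leafExtensions lab (univ.image ι) k, cutCoeff Q π lab Y b =
      MvPowerSeries.coeff (ex (fun i => #{x | lab x = i}) ((univ.image ι).image lab)ᶜ)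
        (PowerSeries.coeff k (∑ f ∈ Fintype.piFinset fun e => Icc 1 (gap π (univ.image ι) (ι e)),
        (PowerSeries.X ^ Fintype.card E * ∏ w : White (univ.image ι) b, PowerSeries.C
          (PowerSeries.coeff (∑ e with white (univ.image ι) b
            ⟨ι e, mem_image_of_mem ι (mem_univ e)⟩ = w, f e) (Psi Q))) *
          ∏ e, chain (leafFactor Q m) (gap π (univ.image ι) (ι e) - f e))) /
      ∏ i ∈ (univ.image ι).image lab, (#{x | lab x = i} : ℚ) := by
  rw [← sum_cutProd Q hl hι hb k, map_sum, sum_div]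
  have h1 : Fintype.card E = #(univ.image ι) := by
    rw [card_image_of_injective _ hι, card_univ]
  rw [h1, ← sum_leafExtensions (univ.image ι) k fun Y => MvPowerSeries.coeff
    (ex (fun i => #{x | lab x = i}) ((univ.image ι).image lab)ᶜ) (cutProd Q m π Y b) /
      ∏ i ∈ (univ.image ι).image lab, (#{x | lab x = i} : ℚ)]
  refine sum_congr rfl fun Y hY => ?_
  rw [cutCoeff, (mem_leafExtensions.1 hY).2.1]

/-- The first factors that arise from a drawing by adding leaves. -/
theorem sum_cutCoeff_core (hl : ∀ x y, lab x = lab y ↔ π.SameCycle x y) {T : PlaneTree}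
    (hE : T.nE ≠ 0) {ι : Fin T.nE → X} (hι : Function.Injective ι) {lam : Fin T.nB ↪ Fin m}
    (hlam : ∀ e, lab (ι e) = lam (T.black e)) (k : ℕ) :
    ∑ Y ∈ leafExtensions lab (univ.image ι) k, cutCoeff Q π lab Y (core ι T.rotW) =
      MvPowerSeries.coeff (ex (fun i => #{x | lab x = i}) (univ.map lam)ᶜ)
        (PowerSeries.coeff k (arcSum Q T fun e => gap π (univ.image ι) (ι e))) /
      ∏ v, (#{x | lab x = lam v} : ℚ) := by
  rw [sum_cutCoeff Q hl hι (support_core_subset hι), image_lab_image hE hlam, prod_map]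
  congr 2
  rw [arcSum]
  refine congrArg _ (sum_congr rfl fun f _ => ?_)
  rw [whiteProd, Fintype.card_fin]
  obtain ⟨g, hg⟩ := exists_equiv_white hι hE
  rw [← Equiv.prod_comp g]
  simp only [← hg, g.apply_eq_iff_eq]

/-- The sum over the assignments of variables to the black vertices of a tree is a sum over the
drawings of the tree: a drawing is determined by the arcs between successive edges and by the
position of one edge at each black vertex. -/
theorem sum_coeff_treeProd (hl : ∀ x y, lab x = lab y ↔ π.SameCycle x y)
    (hls : Function.Surjective lab) {T : PlaneTree} (hE : T.nE ≠ 0) (k : ℕ) :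
    ∑ lam : Fin T.nB ↪ Fin m, MvPowerSeries.coeff (ex (fun i => #{x | lab x = i}) univ)
      (PowerSeries.coeff k (treeProd k Q T lam)) =
    ∑ ι ∈ @Finset.filter (Fin T.nE → X) (IsDrawing T π) (Classical.decPred _) univ,
      ∑ Y ∈ leafExtensions lab (univ.image ι) k, cutCoeff Q π lab Y (core ι T.rotW) := by
  classical
  set β : Fin m → ℕ := fun i => #{x | lab x = i} with hβ
  have hβ0 : ∀ i, (β i : ℚ) ≠ 0 := fun i => by
    obtain ⟨x, hx⟩ := hls i
    exact Nat.cast_ne_zero.2 (card_pos.2 ⟨x, mem_filter.2 ⟨mem_univ _, hx⟩⟩).ne'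
  have hbs := PlaneTree.black_surjective hE
  let R : (Fin T.nB ↪ Fin m) → (Fin T.nE → ℕ) → (Fin T.nE → X) → Prop := fun lam len ι =>
    (∀ e, lab (ι e) = lam (T.black e)) ∧ ∀ e, ι (T.rotB e) = (π ^ len e) (ι e)
  -- arc lengths and points that fit together come from a drawing
  have hR : ∀ lam, ∀ len ∈ arcLengths T lam β, ∀ ι, R lam len ι →
      IsDrawing T π ι ∧ ∀ e, gap π (univ.image ι) (ι e) = len e := by
    rintro lam len hlen ι ⟨h1, h2⟩
    obtain ⟨h3, h4⟩ := (mem_arcLengths lam).1 hlen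
    have hsum : ∑ e, len e = #{x | ∃ e, lab x = lab (ι e)} := by
      rw [← sum_fiberwise univ T.black len, sum_congr rfl fun v _ => h4 v, ← card_biUnion]
      · congr 1
        ext x
        simp only [mem_biUnion, mem_filter, mem_univ, true_and, h1]
        exact ⟨fun ⟨v, hv⟩ => by
          obtain ⟨e, rfl⟩ := hbs v
          exact ⟨e, hv⟩, fun ⟨e, he⟩ => ⟨_, he⟩⟩
      · intro v _ w _ hvw
        refine disjoint_left.2 fun x hx hx' => hvw (lam.injective ?_)
        rw [← (mem_filter.1 hx).2, ← (mem_filter.1 hx').2]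
    obtain ⟨h5, h6⟩ := injective_and_gap_of_sum hl h3 h2 (hsum.trans (by congr!))
    exact ⟨isDrawing_iff.2 ⟨h5, fun e => by rw [ret, h6, h2]⟩, h6⟩
  have hterm : ∀ lam, ∀ len ∈ arcLengths T lam β,
      MvPowerSeries.coeff (ex β (univ.map lam)ᶜ) (PowerSeries.coeff k (arcSum Q T len)) =
      ∑ ι with R lam len ι,
        ∑ Y ∈ leafExtensions lab (univ.image ι) k, cutCoeff Q π lab Y (core ι T.rotW) := by
    intro lam len hlen
    have h1 : ∀ ι ∈ univ.filter (R lam len),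
        ∑ Y ∈ leafExtensions lab (univ.image ι) k, cutCoeff Q π lab Y (core ι T.rotW) =
        MvPowerSeries.coeff (ex β (univ.map lam)ᶜ) (PowerSeries.coeff k (arcSum Q T len)) /
          ∏ v, (β (lam v) : ℚ) := by
      intro ι hι
      obtain ⟨h2, h3⟩ := hR lam len hlen ι (mem_filter.1 hι).2
      rw [sum_cutCoeff_core Q hl hE h2.1 (mem_filter.1 hι).2.1, funext h3]
    have h4 := card_arcMaps hl hbs T.rotB_sameCycle (g := lam) ((mem_arcLengths lam).1 hlen).2
    rw [Nat.card_eq_fintype_card, Fintype.card_subtype] at h4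
    have h5 : (#(univ.filter (R lam len)) : ℚ) = ∏ v, (β (lam v) : ℚ) := by
      rw [← Nat.cast_prod, ← h4]
    rw [sum_congr rfl h1, sum_const, nsmul_eq_mul, h5,
      mul_div_cancel₀ _ (prod_ne_zero_iff.2 fun v _ => hβ0 _)]
  rw [sum_congr rfl fun lam _ => (coeff_treeProd Q lam β k (PlaneTree.degB_ne_zero hE)).trans
    (sum_congr rfl (hterm lam)), sum_sigma', sum_sigma']
  refine sum_bij (fun p _ => p.2) ?_ ?_ ?_ fun _ _ => rfl
  · rintro ⟨⟨lam, len⟩, ι⟩ hp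
    simp only [mem_sigma, mem_univ, true_and, mem_filter] at hp
    exact mem_filter.2 ⟨mem_univ _, (hR lam len hp.1 ι hp.2).1⟩
  · rintro ⟨⟨lam, len⟩, ι⟩ hp ⟨⟨lam', len'⟩, ι'⟩ hp' h
    simp only [mem_sigma, mem_univ, true_and, mem_filter] at hp hp'
    dsimp only at h
    subst h
    have h1 := (hR lam len hp.1 ι hp.2).2
    have h2 := (hR lam' len' hp'.1 ι hp'.2).2
    have h3 : lam = lam' := by
      ext v
      obtain ⟨e, rfl⟩ := hbs v
      rw [← hp.2.1, ← hp'.2.1]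
    have h4 : len = len' := funext fun e => by rw [← h1, ← h2]
    rw [h3, h4]
  · intro ι hι
    have hd := (mem_filter.1 hι).2
    obtain ⟨lam, hlam⟩ := hd.exists_lam hl hE
    refine ⟨⟨⟨lam, fun e => gap π (univ.image ι) (ι e)⟩, ι⟩, ?_, rfl⟩
    simp only [mem_sigma, mem_univ, true_and, mem_filter, mem_arcLengths]
    refine ⟨⟨fun e => gap_pos_of_mem (mem_image_of_mem ι (mem_univ e)), fun v => ?_⟩, hlam,
      fun e => ((isDrawing_iff.1 hd).2 e).symm⟩
    have hv : lam v ∈ (univ.image ι).image lab := by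
      rw [image_lab_image hE hlam]
      exact mem_map_of_mem lam (mem_univ v)
    change _ = #{x | lab x = lam v}
    rw [← sum_gap hl hv]
    refine sum_bij (fun e _ => ι e) (fun e he => ?_) (fun _ _ _ _ h => hd.1 h) (fun y hy => ?_)
      fun _ _ => rfl
    · exact mem_filter.2 ⟨mem_image_of_mem ι (mem_univ e), by rw [hlam, (mem_filter.1 he).2]⟩
    · obtain ⟨hy, hy'⟩ := mem_filter.1 hy
      obtain ⟨e, -, rfl⟩ := mem_image.1 hy
      rw [hlam, lam.injective.eq_iff] at hy'
      exact ⟨e, mem_filter.2 ⟨mem_univ _, hy'⟩, rfl⟩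

end TreeSum

/-! ### The left side of the equation as a sum over first factors -/

section Classify

variable {X I : Type} [Fintype X] [DecidableEq X] [DecidableEq I] {π : Perm X} {lab : X → I}
  {Y : Finset X} {b : Perm X}

theorem isTreeCut_one_iff : IsTreeCut lab Y 1 ↔ #(Y.image lab) = 1 := by
  refine ⟨fun h => by simpa using h.card_eq, fun h => ⟨by simp, fun F _ hF y hy z hz => ?_,
    by simpa using h⟩⟩
  exact hF y hy z hz (card_le_one.1 h.le _ (mem_image_of_mem _ hy) _ (mem_image_of_mem _ hz))

/-- The edges of the tree of a first factor that do not lead to leaves also form a tree. -/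
theorem isTreeCut_iff (hb : b ≠ 1) : IsTreeCut lab Y b ↔
    IsTreeCut lab b.support b ∧ b.support ⊆ Y ∧ Y.image lab = b.support.image lab := by
  have hmem : ∀ {y}, b y ≠ y → y ∈ b.support ∧ b y ∈ b.support := fun h =>
    ⟨mem_support.2 h, apply_mem_support.2 (mem_support.2 h)⟩
  constructor
  · intro h
    obtain ⟨y0, hy0⟩ : b.support.Nonempty := by
      rwa [nonempty_iff_ne_empty, Ne, support_eq_empty_iff]
    have himg : Y.image lab = b.support.image lab := by
      refine subset_antisymm (fun i hi => ?_) (image_subset_image h.support_subset)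
      obtain ⟨z, hz, rfl⟩ := mem_image.1 hi
      refine h.conn (fun y => lab y ∈ b.support.image lab) (fun y _ => ?_)
        (fun y _ z _ hyz hy => hyz ▸ hy) y0 (h.support_subset hy0) z hz (mem_image_of_mem _ hy0)
      by_cases hfix : b y = y
      · rw [hfix]
      · exact iff_of_true (mem_image_of_mem _ (hmem hfix).2) (mem_image_of_mem _ (hmem hfix).1)
    refine ⟨⟨subset_rfl, fun F hbF hF y hy z hz hFy => ?_, himg ▸ h.card_eq⟩, h.support_subset,
      himg⟩
    -- a property of edges at black vertices extends to the edges that lead to leaves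
    have hF' : ∀ y ∈ b.support, (∃ z ∈ b.support, lab z = lab y ∧ F z) ↔ F y := fun y hy =>
      ⟨fun ⟨z, hz, hzy, hFz⟩ => hF z hz y hy hzy hFz, fun hFy => ⟨y, hy, rfl, hFy⟩⟩
    refine (hF' z hz).1 (h.conn (fun y => ∃ z ∈ b.support, lab z = lab y ∧ F z) (fun y _ => ?_)
      (fun y _ z _ hyz hy => hyz ▸ hy) y (h.support_subset hy) z (h.support_subset hz)
      ((hF' y hy).2 hFy))
    by_cases hfix : b y = y
    · rw [hfix]
    · rw [hF' _ (hmem hfix).1, hF' _ (hmem hfix).2, hbF y (hmem hfix).1]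
  · rintro ⟨h, hsub, himg⟩
    refine ⟨hsub, fun F hbF hF y hy z hz hFy => ?_, himg ▸ h.card_eq⟩
    have hex : ∀ y ∈ Y, ∃ y' ∈ b.support, lab y' = lab y := fun y hy => by
      have := mem_image_of_mem lab hy
      rw [himg] at this
      exact mem_image.1 this
    obtain ⟨y', hy', hyy⟩ := hex y hy
    obtain ⟨z', hz', hzz⟩ := hex z hz
    refine hF z' (hsub hz') z hz hzz (h.conn F (fun y hy => hbF y (hsub hy))
      (fun y hy z hz => hF y (hsub hy) z (hsub hz)) y' hy' z' hz' ?_)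
    exact hF y hy y' (hsub hy') hyy.symm hFy

/-- The permutations around the white vertices of degree at least two. -/
def cores (lab : X → I) : Finset (Perm X) :=
  @Finset.filter _ (fun b => b ≠ 1 ∧ IsTreeCut lab b.support b) (Classical.decPred _) univ

theorem mem_cores : b ∈ cores lab ↔ b ≠ 1 ∧ IsTreeCut lab b.support b := by
  rw [cores, @mem_filter _ _ (Classical.decPred _)]
  exact and_iff_right (mem_univ _)

end Classify

section Star

variable {X : Type} [Fintype X] [DecidableEq X] {m : ℕ} {π : Perm X} {lab : X → Fin m}
  (Q : ∀ j, MvPowerSeries (Fin j) ℚ)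

/-- The first factors whose tree is a star with a marked edge. -/
theorem sum_cutCoeff_point (hl : ∀ x y, lab x = lab y ↔ π.SameCycle x y) (y : X) (k : ℕ) :
    ∑ Y ∈ leafExtensions lab {y} k, cutCoeff Q π lab Y 1 =
      MvPowerSeries.coeff (ex (fun i => #{x | lab x = i}) {lab y}ᶜ)
        (PowerSeries.coeff k (chain (leafFactor Q m) #{x | lab x = lab y})) /
          (#{x | lab x = lab y} : ℚ) := by
  have hgap : gap π {y} y = #{x | lab x = lab y} := by
    rw [← sum_gap (Y := {y}) hl (by simp), sum_filter, sum_singleton, if_pos rfl]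
  have hpos : 0 < #{x | lab x = lab y} := card_pos.2 ⟨y, by simp⟩
  have h := sum_cutCoeff Q hl (ι := fun _ : Unit => y) (b := 1) (fun _ _ _ => rfl) (by simp) k
  have hW : Fintype.card (White (univ.image fun _ : Unit => y) 1) = 1 := by simp
  obtain ⟨w, hw⟩ := Fintype.card_eq_one_iff.1 hW
  have hprod : ∀ f : Unit → ℕ, ∏ w : White (univ.image fun _ : Unit => y) 1, PowerSeries.C
      (PowerSeries.coeff (∑ e with white (univ.image fun _ : Unit => y) 1
        ⟨y, mem_image_of_mem (fun _ : Unit => y) (mem_univ e)⟩ = w, f e) (Psi (m := m) Q)) =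
      PowerSeries.C (PowerSeries.coeff (f ()) (Psi Q)) := by
    intro f
    rw [Fintype.prod_eq_single w fun w' h => absurd (hw w') h, sum_filter,
      sum_congr rfl fun e _ => if_pos (hw _), Fintype.sum_unique]
  simp only [hprod] at h
  rw [image_const univ_nonempty] at h
  rw [h, hgap, image_singleton, prod_singleton, chain_of_pos _ hpos]
  congr 2
  refine congrArg _ ?_
  refine sum_bij (fun f _ => f ()) (fun f hf => Fintype.mem_piFinset.1 hf ())
    (fun f _ g _ hfg => funext fun _ => hfg)
    (fun j hj => ⟨fun _ => j, Fintype.mem_piFinset.2 fun _ => hj, rfl⟩) fun f _ => ?_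
  rw [Fintype.card_unit, pow_one, univ_unique, prod_singleton]
  rfl

/-- The first factors whose tree is a star. The tree has `k` edges, any of which can be used to
mark a point on the cycle of `π`. -/
theorem sum_cutCoeff_one (hl : ∀ x y, lab x = lab y ↔ π.SameCycle x y)
    (hls : Function.Surjective lab) (k : ℕ) :
    (k : ℚ) * ∑ Y : Finset X with #Y = k ∧ #(Y.image lab) = 1, cutCoeff Q π lab Y 1 =
      ∑ i, MvPowerSeries.coeff (ex (fun i => #{x | lab x = i}) {i}ᶜ)
        (PowerSeries.coeff k (chain (leafFactor Q m) #{x | lab x = i})) := by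
  set g : Fin m → ℚ := fun i => MvPowerSeries.coeff (ex (fun i => #{x | lab x = i}) {i}ᶜ)
        (PowerSeries.coeff k (chain (leafFactor Q m) #{x | lab x = i})) with hg
  have h1 : ∑ x, g (lab x) / (#{y | lab y = lab x} : ℚ) = ∑ i, g i := by
    refine (sum_fiberwise univ lab _).symm.trans (sum_congr rfl fun i _ => ?_)
    obtain ⟨x, hx⟩ := hls i
    have hne : (#{y | lab y = i} : ℚ) ≠ 0 :=
      Nat.cast_ne_zero.2 (card_pos.2 ⟨x, mem_filter.2 ⟨mem_univ _, hx⟩⟩).ne'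
    have h1 : ∀ x ∈ univ.filter (fun x => lab x = i),
        g (lab x) / (#{y | lab y = lab x} : ℚ) = g i / #{y | lab y = i} := fun x hx => by
      rw [(mem_filter.1 hx).2]
    rw [sum_congr rfl h1, sum_const, nsmul_eq_mul, mul_div_cancel₀ _ hne]
  rw [← h1, sum_congr rfl fun x _ => (sum_cutCoeff_point Q hl x k).symm, mul_sum]
  have h2 : ∀ Y ∈ univ.filter (fun Y : Finset X => #Y = k ∧ #(Y.image lab) = 1),
      (k : ℚ) * cutCoeff Q π lab Y 1 = ∑ x ∈ Y, cutCoeff Q π lab Y 1 := fun Y hY => by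
    rw [sum_const, nsmul_eq_mul, (mem_filter.1 hY).2.1]
  rw [sum_congr rfl h2]
  refine sum_comm' fun Y x => ?_
  rw [mem_filter, mem_leafExtensions, singleton_subset_iff, image_singleton,
    and_iff_right (mem_univ _),
    and_iff_left (mem_univ _)]
  constructor
  · rintro ⟨⟨h3, h4⟩, hx⟩
    refine ⟨hx, ?_, h3⟩
    obtain ⟨i, hi⟩ := card_eq_one.1 h4
    have h5 := mem_image_of_mem lab hx
    rw [hi, mem_singleton] at h5
    rw [hi, h5]
  · rintro ⟨hx, h3, h4⟩
    exact ⟨⟨h4, by rw [h3, card_singleton]⟩, hx⟩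

/-- The first factors, sorted by their trees without leaves: stars have `b = 1`, and for all others
the remaining edges are the points of the support of `b`. -/
theorem sum_cuts (k : ℕ) : ∑ p ∈ cuts lab k, cutCoeff Q π lab p.1 p.2 =
    ∑ Y : Finset X with #Y = k ∧ #(Y.image lab) = 1, cutCoeff Q π lab Y 1 +
      ∑ b ∈ cores lab, ∑ Y ∈ leafExtensions lab b.support k, cutCoeff Q π lab Y b := by
  rw [← sum_filter_add_sum_filter_not (cuts lab k) (fun p => p.2 = 1)]
  congr 1
  · refine sum_bij (fun p _ => p.1) ?_ ?_ ?_ ?_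
    · rintro ⟨Y, b⟩ hp
      obtain ⟨h1, h2⟩ := mem_filter.1 hp
      obtain ⟨h3, h4⟩ := mem_cuts.1 h1
      dsimp only at h2 h3 h4
      subst h2
      exact mem_filter.2 ⟨mem_univ _, h3, isTreeCut_one_iff.1 h4⟩
    · rintro ⟨Y, b⟩ hp ⟨Y', b'⟩ hp' h
      exact Prod.ext h ((mem_filter.1 hp).2.trans (mem_filter.1 hp').2.symm)
    · intro Y hY
      obtain ⟨-, h1, h2⟩ := mem_filter.1 hY
      exact ⟨(Y, 1), mem_filter.2 ⟨mem_cuts.2 ⟨h1, isTreeCut_one_iff.2 h2⟩, rfl⟩, rfl⟩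
    · rintro ⟨Y, b⟩ hp
      have h2 := (mem_filter.1 hp).2
      dsimp only at h2
      rw [h2]
  · rw [sum_sigma']
    refine sum_bij (fun p _ => ⟨p.2, p.1⟩) ?_ ?_ ?_ fun _ _ => rfl
    · rintro ⟨Y, b⟩ hp
      obtain ⟨h1, h2⟩ := mem_filter.1 hp
      obtain ⟨h3, h4⟩ := mem_cuts.1 h1
      obtain ⟨h5, h6, h7⟩ := (isTreeCut_iff h2).1 h4
      exact mem_sigma.2 ⟨mem_cores.2 ⟨h2, h5⟩, mem_leafExtensions.2 ⟨h6, h7, h3⟩⟩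
    · rintro ⟨Y, b⟩ _ ⟨Y', b'⟩ _ h
      simp only [Sigma.mk.injEq, heq_eq_eq] at h
      rw [h.1, h.2]
    · rintro ⟨b, Y⟩ hp
      obtain ⟨h1, h2⟩ := mem_sigma.1 hp
      obtain ⟨h3, h4⟩ := mem_cores.1 h1
      obtain ⟨h5, h6, h7⟩ := mem_leafExtensions.1 h2
      exact ⟨(Y, b), mem_filter.2 ⟨mem_cuts.2 ⟨h7, (isTreeCut_iff h3).2 ⟨h4, h5, h6⟩⟩, h3⟩, rfl⟩

end Star

section TreeClasses

variable {X : Type} [Fintype X] [DecidableEq X] {m : ℕ} {π : Perm X} {lab : X → Fin m}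

open Classical in
/-- A sum over the drawings of all trees, each tree counted with the inverse of the order of its
automorphism group, is a sum over the permutations that arise around the white vertices. -/
theorem sum_drawings (hl : ∀ x y, lab x = lab y ↔ π.SameCycle x y) (k : ℕ) (g : Perm X → ℚ)
    (hg : ∀ b, k < #b.support → g b = 0) :
    ∑ t ∈ (finite_nE_le k).toFinset with t.out.1.nE ≠ 0, (1 / (autCard k t.out.1 : ℚ)) *
      ∑ ι : Fin t.out.1.nE → X with IsDrawing t.out.1 π ι, g (core ι t.out.1.rotW) =
    ∑ b ∈ cores lab, g b := by
  -- the class of the tree that is drawn with the permutation `b` around its white vertices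
  have hcls : ∀ b, ∃ t : ReducedTree, b ∈ cores lab → t.out.1.nE ≠ 0 ∧
      ∃ ι, IsDrawing t.out.1 π ι ∧ core ι t.out.1.rotW = b := by
    intro b
    by_cases hb : b ∈ cores lab
    · obtain ⟨h1, h2⟩ := mem_cores.1 hb
      obtain ⟨T, ι, hT, hE, hι, rfl⟩ := exists_drawing hl h1 h2
      obtain ⟨f⟩ : Nonempty (PlaneTree.Iso (Quotient.mk treeSetoid ⟨T, hT⟩).out.1 T) :=
        Quotient.mk_out (s := treeSetoid) (⟨T, hT⟩ : {T : PlaneTree // T.IsReduced})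
      refine ⟨Quotient.mk treeSetoid ⟨T, hT⟩, fun _ => ⟨?_, ι ∘ f.onE, hι.comp f⟩⟩
      have := Fintype.card_congr f.onE
      rw [Fintype.card_fin, Fintype.card_fin] at this
      rwa [this]
    · exact ⟨Quotient.mk treeSetoid ⟨_, PlaneTree.isolated_isReduced⟩, fun h => absurd h hb⟩
  choose cls hcls using hcls
  have hsupp : ∀ b ∈ cores lab, #b.support = (cls b).out.1.nE := by
    intro b hb
    obtain ⟨-, ι, h1, h2⟩ := hcls b hb
    conv_lhs => rw [← h2]
    rw [support_core h1.1 (cls b).out.2.rotW_ne, card_image_of_injective _ h1.1, card_univ,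
      Fintype.card_fin]
  have hterm : ∀ t : ReducedTree, t.out.1.nE ≠ 0 → (1 / (autCard k t.out.1 : ℚ)) *
      ∑ ι : Fin t.out.1.nE → X with IsDrawing t.out.1 π ι, g (core ι t.out.1.rotW) =
      ∑ b ∈ cores lab with cls b = t, g b := by
    intro t ht
    have hmaps : ∀ ι ∈ univ.filter (fun ι : Fin t.out.1.nE → X => IsDrawing t.out.1 π ι),
        core ι t.out.1.rotW ∈ (cores lab).filter fun b => cls b = t := by
      intro ι hι
      have hd := (mem_filter.1 hι).2
      have hs := support_core hd.1 t.out.2.rotW_ne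
      have hc : core ι t.out.1.rotW ∈ cores lab := by
        refine mem_cores.2 ⟨fun h => ?_, hs ▸ hd.isTreeCut hl ht⟩
        rw [h, support_one] at hs
        have := mem_image_of_mem ι (mem_univ ⟨0, Nat.pos_of_ne_zero ht⟩)
        rw [← hs] at this
        exact absurd this (notMem_empty _)
      refine mem_filter.2 ⟨hc, ?_⟩
      obtain ⟨h1, ι', h2, h3⟩ := hcls _ hc
      obtain ⟨f, -⟩ := h2.exists_iso hd (cls _).out.2 t.out.2 h1 ht h3
      have h4 : Quotient.mk treeSetoid (cls (core ι t.out.1.rotW)).out =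
          Quotient.mk treeSetoid t.out := Quotient.sound ⟨f⟩
      rwa [Quotient.out_eq, Quotient.out_eq] at h4
    rw [← sum_fiberwise_of_maps_to hmaps, mul_sum]
    refine sum_congr rfl fun b hb => ?_
    obtain ⟨hb', rfl⟩ := mem_filter.1 hb
    obtain ⟨-, ι, h2, h3⟩ := hcls b hb'
    have hcard := card_drawings (cls b).out.2 ht h2
    rw [h3] at hcard
    rw [sum_congr rfl fun ι hι => by rw [(mem_filter.1 hι).2], sum_const, filter_filter, hcard,
      autCard, if_neg ht, nsmul_eq_mul, ← mul_assoc, one_div, inv_mul_cancel₀, one_mul]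
    exact Nat.cast_ne_zero.2 Nat.card_pos.ne'
  rw [sum_congr rfl fun t ht => hterm t (mem_filter.1 ht).2,
    ← sum_filter_add_sum_filter_not (cores lab) fun b => #b.support ≤ k]
  rw [sum_eq_zero (s := (cores lab).filter fun b => ¬ #b.support ≤ k) fun b hb =>
    hg b (not_le.1 (mem_filter.1 hb).2), add_zero, ← sum_fiberwise_of_maps_to
      (s := (cores lab).filter fun b => #b.support ≤ k) (g := cls)
      (t := (finite_nE_le k).toFinset.filter fun t => t.out.1.nE ≠ 0)]
  · refine sum_congr rfl fun t ht => ?_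
    rw [filter_filter]
    refine sum_congr ?_ fun _ _ => rfl
    ext b
    simp only [mem_filter]
    refine and_congr_right fun hb => ⟨fun h => ⟨?_, h⟩, fun h => h.2⟩
    subst h
    rw [hsupp b hb]
    exact (finite_nE_le k).mem_toFinset.1 (mem_filter.1 ht).1
  · intro b hb
    obtain ⟨hb, hk⟩ := mem_filter.1 hb
    rw [hsupp b hb] at hk
    exact mem_filter.2 ⟨(Set.Finite.mem_toFinset _).2 hk, (hcls b hb).1⟩

end TreeClasses

/-! ### Coefficients of the two sides of the equation -/

section Sides

variable {m k : ℕ} (Q : ∀ j, MvPowerSeries (Fin j) ℚ)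

theorem coeff_rhs (k : ℕ) (β : Fin m →₀ ℕ) : MvPowerSeries.coeff β (rhs k m Q) =
    (∑ i, (β i : ℚ) + m - 2) / (k - 1) * MvPowerSeries.coeff β (Q m) := by
  rw [rhs, map_smul, map_add, map_sum, map_smul, smul_eq_mul, smul_eq_mul,
    sum_congr rfl fun i _ => coeff_xD i (Q m) β, ← sum_mul]
  ring

/-- The coefficient of the contribution of the isolated black vertex, which stands for the stars
with `k` edges. -/
def starCoeff (k : ℕ) (β : Fin m → ℕ) : ℚ :=
  ∑ i, MvPowerSeries.coeff (ex β {i}ᶜ) (PowerSeries.coeff k (chain (leafFactor Q m) (β i)))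

theorem sum_coeff_treeProd_isolated {T : PlaneTree} (hB : T.nB = 1) (hW : T.nW = 0)
    (hE : T.nE = 0) (β : Fin m → ℕ) : ∑ lam : Fin T.nB ↪ Fin m,
      MvPowerSeries.coeff (ex β univ) (PowerSeries.coeff k (treeProd k Q T lam)) =
        starCoeff Q k β := by
  have : Unique (Fin T.nB) := by rw [hB]; infer_instance
  have hW' : IsEmpty (Fin T.nW) := by rw [hW]; infer_instance
  have hE' : IsEmpty (Fin T.nE) := by rw [hE]; infer_instance
  refine Fintype.sum_equiv (Equiv.uniqueEmbeddingEquivResult (α := Fin T.nB)) _ _ fun lam => ?_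
  have hd : T.degB default = 0 := by
    rw [PlaneTree.degB, univ_eq_empty, filter_empty, card_empty]
  rw [← coeff_star, treeProd, Fintype.prod_unique, univ_eq_empty (α := Fin T.nW), prod_empty,
    mul_one, hd, blackFactor, if_pos rfl, PowerSeries.coeff_C_mul, mul_pow, ← map_pow,
    PowerSeries.coeff_mul_C, PowerSeries.coeff_X_pow_self, one_mul]
  rfl

theorem filter_nE_eq_zero (k : ℕ) :
    ((finite_nE_le k).toFinset.filter fun t : ReducedTree => t.out.1.nE = 0) =
      {Quotient.mk treeSetoid ⟨_, PlaneTree.isolated_isReduced⟩} := by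
  ext t
  rw [mem_filter, mem_singleton, Set.Finite.mem_toFinset]
  constructor
  · rintro ⟨-, h⟩
    have h1 : Quotient.mk treeSetoid t.out =
        Quotient.mk treeSetoid ⟨_, PlaneTree.isolated_isReduced⟩ :=
      Quotient.sound (PlaneTree.nonempty_iso_isolated t.out.2 h)
    rwa [Quotient.out_eq] at h1
  · rintro rfl
    obtain ⟨f⟩ : Nonempty (PlaneTree.Iso (Quotient.mk treeSetoid
        ⟨_, PlaneTree.isolated_isReduced⟩).out.1 PlaneTree.isolated) :=
      Quotient.mk_out (s := treeSetoid)
        (⟨_, PlaneTree.isolated_isReduced⟩ : {T : PlaneTree // T.IsReduced})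
    have h : (Quotient.mk treeSetoid
        ⟨_, PlaneTree.isolated_isReduced⟩ : ReducedTree).out.1.nE = 0 := by
      have := Fintype.card_congr f.onE
      rwa [Fintype.card_fin, Fintype.card_fin] at this
    refine ⟨?_, h⟩
    rw [Set.mem_ofPred_eq, h]
    exact Nat.zero_le k

/-- The isolated black vertex has `k` automorphisms by convention; the trees with more than `k`
edges do not contribute. -/
theorem coeff_lhs (k : ℕ) (β : Fin m →₀ ℕ) : MvPowerSeries.coeff β (lhs k m Q) =
    1 / (k : ℚ) * starCoeff Q k β +
      ∑ t ∈ (finite_nE_le k).toFinset with t.out.1.nE ≠ 0, (1 / (autCard k t.out.1 : ℚ)) *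
        ∑ lam : Fin t.out.1.nB ↪ Fin m, MvPowerSeries.coeff (ex β univ)
          (PowerSeries.coeff k (treeProd k Q t.out.1 lam)) := by
  have hterm : ∀ t : ReducedTree, MvPowerSeries.coeff β (treeTerm k m Q t) =
      (1 / (autCard k t.out.1 : ℚ)) * ∑ lam : Fin t.out.1.nB ↪ Fin m,
        MvPowerSeries.coeff (ex β univ) (PowerSeries.coeff k (treeProd k Q t.out.1 lam)) := by
    intro t
    rw [treeTerm, map_smul, markerCoeff_eq, map_sum, map_sum, smul_eq_mul]
  have h0 : ∀ t ∈ (finite_nE_le k).toFinset.filter fun t : ReducedTree => t.out.1.nE = 0,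
      MvPowerSeries.coeff β (treeTerm k m Q t) = 1 / (k : ℚ) * starCoeff Q k β := by
    intro t ht
    have hE := (mem_filter.1 ht).2
    rw [hterm, sum_coeff_treeProd_isolated Q (t.out.2.nB_eq_one hE) (t.out.2.nW_eq_zero hE) hE,
      autCard, if_pos hE]
  rw [lhs, finsum_eq_sum_of_support_subset (s := (finite_nE_le k).toFinset) _ fun t ht => by
      rw [Set.Finite.coe_toFinset]; exact nE_le_of_treeTerm_ne_zero Q ht, map_sum,
    ← sum_filter_add_sum_filter_not _ fun t : ReducedTree => t.out.1.nE = 0, sum_congr rfl h0,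
    filter_nE_eq_zero, sum_singleton]
  exact congrArg _ (sum_congr rfl fun t _ => hterm t)

/-- If all the variables occur, the left side of the equation is a sum over the first factors of
the factorisations of a permutation whose cycle lengths are the exponents. -/
theorem coeff_lhs_eq_sum_cuts {X : Type} [Fintype X] [DecidableEq X] {π : Perm X}
    {lab : X → Fin m} (hl : ∀ x y, lab x = lab y ↔ π.SameCycle x y)
    (hls : Function.Surjective lab) (hk : k ≠ 0) {β : Fin m →₀ ℕ}
    (hβ : ∀ i, #{x | lab x = i} = β i) : MvPowerSeries.coeff β (lhs k m Q) =
      ∑ p ∈ cuts lab k, cutCoeff Q π lab p.1 p.2 := by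
  classical
  have hβ' : (β : Fin m → ℕ) = fun i => #{x | lab x = i} := (funext hβ).symm
  rw [coeff_lhs, sum_cuts, hβ', starCoeff, ← sum_cutCoeff_one Q hl hls, ← mul_assoc,
    one_div_mul_cancel (Nat.cast_ne_zero.2 hk), one_mul, ← sum_drawings hl k]
  · congr 1
    refine sum_congr rfl fun t ht => ?_
    have hE := (mem_filter.1 ht).2
    rw [sum_coeff_treeProd Q hl hls hE]
    congr 1
    refine sum_congr (by congr!) fun ι hι => ?_
    rw [support_core (mem_filter.1 hι).2.1 t.out.2.rotW_ne]
  · intro b hb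
    refine sum_eq_zero fun Y hY => ?_
    obtain ⟨h1, -, h2⟩ := mem_leafExtensions.1 hY
    have := card_le_card h1
    omega

/-- In the monomials of `Psi (P k)`, the marker `z_i` occurs only together with `x_i`. -/
theorem coeff_Psi_P_mem_occ (i : Fin m) (j : ℕ) :
    PowerSeries.coeff j (Psi (m := m) (P k)) ∈ occ (Sum.inr i) (Sum.inl i) := by
  classical
  refine mem_occ.2 fun d hd hr hi => hd ?_
  rw [coeff_Psi]
  split_ifs
  · have hmem : i ∈ univ.filter fun i => d (Sum.inr i) ≠ 0 := mem_filter.2 ⟨mem_univ _, hr⟩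
    rw [← map_orderEmbOfFin_univ (univ.filter fun i => d (Sum.inr i) ≠ 0) rfl] at hmem
    obtain ⟨a, -, ha⟩ := mem_map.1 hmem
    rw [coeff_P_eq_zero k (i := Fin.succ a), mul_zero]
    rw [Finsupp.cons_succ]
    change d (Sum.inl _) = 0
    exact (congrArg (fun i => d (Sum.inl i)) ha).trans hi
  · rfl

/-- All the variables occur in the monomials of the left side of the equation. -/
theorem coeff_lhs_P_eq_zero (hk : k ≠ 0) {β : Fin m →₀ ℕ} {i : Fin m} (hi : β i = 0) :
    MvPowerSeries.coeff β (lhs k m (P k)) = 0 := by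
  -- `x_i` does not occur in the monomial `β`, but `z_i` does
  have hocc : ∀ {f : A m} {S : Finset (Fin m)}, f ∈ occ (Sum.inr i) (Sum.inl i) → i ∈ S →
      MvPowerSeries.coeff (ex β S) f = 0 := by
    intro f S hf hS
    by_contra h
    refine mem_occ.1 hf _ h ?_ ?_
    · rw [ex_inr, if_pos hS]
      exact one_ne_zero
    · rw [ex_inl, if_pos hS, hi]
  have hleaf : ∀ j, leafFactor (P k) m j ∈ coeffSubring (occ (Sum.inr i) (Sum.inl i)) := fun j =>
    Subring.mul_mem _ X_mem_coeffSubring (C_mem_coeffSubring (coeff_Psi_P_mem_occ i j))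
  rw [coeff_lhs, starCoeff, sum_eq_zero, mul_zero, zero_add]
  · refine sum_eq_zero fun t ht => ?_
    have hE := (mem_filter.1 ht).2
    rw [sum_eq_zero, mul_zero]
    intro lam _
    rw [coeff_treeProd (P k) lam β k (PlaneTree.degB_ne_zero hE)]
    refine sum_eq_zero fun len hlen => hocc ?_ (mem_compl.2 fun hmem => ?_)
    · have : arcSum (m := m) (P k) t.out.1 len ∈ coeffSubring (occ (Sum.inr i) (Sum.inl i)) := by
        refine Subring.sum_mem _ fun f _ => Subring.mul_mem _ (Subring.mul_mem _
          (Subring.pow_mem _ X_mem_coeffSubring _) (Subring.prod_mem _ fun w _ =>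
            C_mem_coeffSubring (coeff_Psi_P_mem_occ i _))) (Subring.prod_mem _ fun e _ =>
              chain_mem hleaf _)
      exact this k
    · obtain ⟨v, -, rfl⟩ := mem_map.1 hmem
      obtain ⟨e, rfl⟩ := PlaneTree.black_surjective hE v
      obtain ⟨h1, h2⟩ := (mem_arcLengths lam).1 hlen
      have h3 := h2 (t.out.1.black e)
      rw [hi, sum_eq_zero_iff] at h3
      have := h3 e (mem_filter.2 ⟨mem_univ _, rfl⟩)
      have := h1 e
      omega
  · intro i' _
    by_cases h : i = i'
    · rw [← h, hi, chain_zero, PowerSeries.coeff_one, if_neg hk, map_zero]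
    · exact hocc (chain_mem hleaf _ k) (mem_compl.2 fun h' => h (mem_singleton.1 h'))

end Sides

/-! ### The equation and the uniqueness of its solution -/

section Model

variable {m : ℕ} {β : Fin m → ℕ}

/-- There is a permutation with given cycle lengths. -/
theorem exists_perm_of_lengths (hβ : ∀ i, β i ≠ 0) :
    ∃ (X : Type) (_ : Fintype X) (_ : DecidableEq X) (π : Perm X) (lab : X → Fin m),
      (∀ x y, lab x = lab y ↔ π.SameCycle x y) ∧ Function.Surjective lab ∧
      (∀ i, #{x | lab x = i} = β i) ∧ Fintype.card X = ∑ i, β i := by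
  have : ∀ i, NeZero (β i) := fun i => ⟨hβ i⟩
  let π : Perm (Σ i, ZMod (β i)) := Perm.sigmaCongrRight fun i => Equiv.addRight (1 : ZMod (β i))
  have hpow : ∀ n i x, (π ^ n) ⟨i, x⟩ = ⟨i, x + n⟩ := by
    intro n i x
    induction n with
    | zero => simp
    | succ n ih =>
      rw [pow_succ', Perm.mul_apply, ih]
      simp [π, add_assoc]
  refine ⟨Σ i, ZMod (β i), inferInstance, inferInstance, π, Sigma.fst, ?_, fun i => ⟨⟨i, 0⟩, rfl⟩,
    fun i => ?_, ?_⟩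
  · rintro ⟨i, x⟩ ⟨j, y⟩
    constructor
    · rintro (rfl : i = j)
      refine ⟨((y - x).val : ℕ), ?_⟩
      rw [zpow_natCast, hpow, ZMod.natCast_zmod_val, add_sub_cancel]
    · intro h
      obtain ⟨n, -, hn⟩ := h.exists_pow_eq'
      rw [hpow] at hn
      exact (Sigma.mk.inj_iff.1 hn).1
  · rw [← ZMod.card (β i), ← card_univ]
    symm
    refine card_bij (fun x _ => ⟨i, x⟩) (fun x _ => mem_filter.2 ⟨mem_univ _, rfl⟩)
      (fun x _ y _ h => eq_of_heq (Sigma.mk.inj_iff.1 h).2) ?_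
    rintro ⟨j, x⟩ hx
    obtain rfl : j = i := (mem_filter.1 hx).2
    exact ⟨x, mem_univ _, rfl⟩
  · rw [Fintype.card_sigma]
    exact sum_congr rfl fun i _ => ZMod.card (β i)

end Model

section Equation

variable {m k : ℕ}

/-- Splitting off the first factor of a factorisation into `k`-cycles gives the equation. The number
of factors is the factor on the right. -/
theorem lhs_eq_rhs (hk : 2 ≤ k) (hm : 1 ≤ m) : lhs k m (P k) = rhs k m (P k) := by
  ext β
  rw [coeff_rhs]
  by_cases hβ : ∀ i, β i ≠ 0
  · obtain ⟨X, _, _, π, lab, hl, hls, hlab, hX⟩ := exists_perm_of_lengths hβ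
    have : Nonempty X := by
      obtain ⟨x, -⟩ := hls ⟨0, hm⟩
      exact ⟨x⟩
    have hparts : π.partition.parts = univ.val.map β := by
      rw [parts_partition_eq hls hl]
      exact Multiset.map_congr rfl fun i _ => hlab i
    have hne : ∀ i, (β i : ℚ) ≠ 0 := fun i => Nat.cast_ne_zero.2 (hβ i)
    rw [coeff_lhs_eq_sum_cuts (P k) hl hls (by omega) hlab, coeff_P hk hm hβ, ← hparts,
      ← wt_eq_wtM, ← mul_div_assoc]
    have hrec := wt_recursion (π := π) hl hls hk
    rw [hX, Fintype.card_fin, Nat.cast_sum] at hrec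
    rw [hrec, sum_div]
    refine sum_congr rfl fun p hp => ?_
    have hb := (mem_cuts.1 hp).2.support_subset
    rw [cutCoeff, coeff_cutProd hk hls hb fun _ => rfl, div_div,
      ← prod_mul_prod_compl (p.1.image lab),
      mul_comm (∏ i ∈ p.1.image lab, _)]
    simp only [hlab]
  · push Not at hβ
    obtain ⟨i, hi⟩ := hβ
    rw [coeff_lhs_P_eq_zero (by omega) hi, coeff_P_eq_zero k hi, mul_zero]

theorem chain_congr {R : Type*} [CommRing R] {u v : ℕ → R} {q : ℕ} (h : ∀ j ≤ q, u j = v j) :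
    chain u q = chain v q := by
  induction q using Nat.strong_induction_on with
  | _ q ih =>
    rcases Nat.eq_zero_or_pos q with rfl | hq
    · rw [chain_zero, chain_zero]
    · rw [chain_of_pos u hq, chain_of_pos v hq]
      refine sum_congr rfl fun j hj => ?_
      rw [mem_Icc] at hj
      rw [h j hj.2, ih (q - j) (by omega) fun i hi => h i (by omega)]

variable {Q Q' : ∀ j, MvPowerSeries (Fin j) ℚ} {I : Ideal (A m)}

theorem map_leafFactor_congr {j : ℕ}
    (h : Ideal.Quotient.mk I (PowerSeries.coeff j (Psi Q)) =
      Ideal.Quotient.mk I (PowerSeries.coeff j (Psi Q'))) :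
    PowerSeries.map (Ideal.Quotient.mk I) (leafFactor Q m j) =
      PowerSeries.map (Ideal.Quotient.mk I) (leafFactor Q' m j) := by
  rw [leafFactor, leafFactor, map_mul, map_mul, PowerSeries.map_C, PowerSeries.map_C, h]

theorem map_arcSum_congr {T : PlaneTree} (len : Fin T.nE → ℕ)
    (h : ∀ j, Ideal.Quotient.mk I (PowerSeries.coeff j (Psi Q)) =
      Ideal.Quotient.mk I (PowerSeries.coeff j (Psi Q'))) :
    PowerSeries.map (Ideal.Quotient.mk I) (arcSum Q T len) =
      PowerSeries.map (Ideal.Quotient.mk I) (arcSum Q' T len) := by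
  rw [arcSum, arcSum, map_sum, map_sum]
  refine sum_congr rfl fun f _ => ?_
  rw [whiteProd, whiteProd, map_mul, map_mul, map_mul, map_mul, map_prod, map_prod, map_prod,
    map_prod]
  refine congrArg₂ _ (congrArg _ (prod_congr rfl fun w _ => ?_)) (prod_congr rfl fun e _ => ?_)
  · rw [PowerSeries.map_C, PowerSeries.map_C, h]
  · rw [map_chain, map_chain]
    exact chain_congr fun j _ => map_leafFactor_congr (h j)

/-- The largest label of a leaf does not contribute to the coefficient of a star with at least two
edges. -/
theorem map_coeff_chain_congr (hk : 2 ≤ k) {q : ℕ}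
    (h : ∀ j < q, Ideal.Quotient.mk I (PowerSeries.coeff j (Psi Q)) =
      Ideal.Quotient.mk I (PowerSeries.coeff j (Psi Q'))) :
    Ideal.Quotient.mk I (PowerSeries.coeff k (chain (leafFactor Q m) q)) =
      Ideal.Quotient.mk I (PowerSeries.coeff k (chain (leafFactor Q' m) q)) := by
  rcases Nat.eq_zero_or_pos q with rfl | hq
  · rw [chain_zero, chain_zero]
  have hlast : ∀ Q : ∀ j, MvPowerSeries (Fin j) ℚ, PowerSeries.coeff k (leafFactor Q m q) = 0 := by
    intro Q
    rw [leafFactor, PowerSeries.coeff_mul_C, PowerSeries.coeff_X, if_neg (by omega), zero_mul]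
  have hstep : ∀ Q : ∀ j, MvPowerSeries (Fin j) ℚ,
      PowerSeries.coeff k (chain (leafFactor Q m) q) = PowerSeries.coeff k
        (∑ j ∈ Ico 1 q, leafFactor Q m j * chain (leafFactor Q m) (q - j)) := by
    intro Q
    have hI : Icc 1 q = insert q (Ico 1 q) := by
      ext j
      simp only [mem_Icc, mem_insert, mem_Ico]
      omega
    rw [chain_of_pos _ hq, hI, sum_insert (by simp), Nat.sub_self, chain_zero, mul_one, map_add,
      hlast, zero_add]
  have key : PowerSeries.map (Ideal.Quotient.mk I)
        (∑ j ∈ Ico 1 q, leafFactor Q m j * chain (leafFactor Q m) (q - j)) =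
      PowerSeries.map (Ideal.Quotient.mk I)
        (∑ j ∈ Ico 1 q, leafFactor Q' m j * chain (leafFactor Q' m) (q - j)) := by
    rw [map_sum, map_sum]
    refine sum_congr rfl fun j hj => ?_
    rw [mem_Ico] at hj
    rw [map_mul, map_mul, map_chain, map_chain]
    exact congrArg₂ _ (map_leafFactor_congr (h j hj.2))
      (chain_congr fun i hi => map_leafFactor_congr (h i (by omega)))
  rw [hstep Q, hstep Q']
  have h2 := congrArg (PowerSeries.coeff k) key
  rwa [PowerSeries.coeff_map, PowerSeries.coeff_map] at h2

/-- A coefficient of `Psi Q` depends on a single coefficient of one of the series. -/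
theorem coeff_Psi_congr {j : ℕ} {d : Fin m ⊕ Fin m →₀ ℕ} {S : Finset (Fin m)}
    (hS : ∀ i, i ∈ S ↔ d (Sum.inr i) ≠ 0)
    (h : MvPowerSeries.coeff (Finsupp.cons j (restr (fun i => d (Sum.inl i)) S)) (Q (#S + 1)) =
      MvPowerSeries.coeff (Finsupp.cons j (restr (fun i => d (Sum.inl i)) S)) (Q' (#S + 1))) :
    MvPowerSeries.coeff d (PowerSeries.coeff j (Psi Q)) =
      MvPowerSeries.coeff d (PowerSeries.coeff j (Psi Q')) := by
  classical
  obtain rfl : S = univ.filter fun i => d (Sum.inr i) ≠ 0 := by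
    ext i
    rw [mem_filter, and_iff_right (mem_univ _), hS]
  rw [coeff_Psi, coeff_Psi, h]

theorem degree_cons_restr (j : ℕ) (d : Fin m → ℕ) (S : Finset (Fin m)) :
    (Finsupp.cons j (restr d S)).degree = j + ∑ i ∈ S, d i := by
  rw [Finsupp.degree_eq_sum, Fin.sum_univ_succ, Finsupp.cons_zero]
  simp only [Finsupp.cons_succ]
  conv_rhs => rw [← map_orderEmbOfFin_univ S rfl, sum_map]
  rfl

/-- In the coefficients at the divisors of `ex β S`, only the markers with index in `S` occur. -/
theorem subset_of_le_ex {β : Fin m → ℕ} {S : Finset (Fin m)} {d : Fin m ⊕ Fin m →₀ ℕ}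
    (hd : d ≤ ex β S) : (univ.filter fun i => d (Sum.inr i) ≠ 0) ⊆ S := by
  intro i hi
  by_contra hS
  have := hd (Sum.inr i)
  rw [ex_inr, if_neg hS] at this
  exact (mem_filter.1 hi).2 (Nat.le_zero.1 this)

/-- If at most `m - 2` variables are left for the white vertices, then the series `Q m` is not used.
-/
theorem coeff_arcSum_congr (hQ : ∀ j, 1 ≤ j → j < m → Q j = Q' j) {T : PlaneTree}
    (len : Fin T.nE → ℕ) {β : Fin m → ℕ} {S : Finset (Fin m)} (hS : #S + 1 < m) :
    MvPowerSeries.coeff (ex β S) (PowerSeries.coeff k (arcSum Q T len)) =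
      MvPowerSeries.coeff (ex β S) (PowerSeries.coeff k (arcSum Q' T len)) := by
  have h1 := map_arcSum_congr (Q := Q) (Q' := Q')
    (I := lowIdeal (Set.Iic (ex β S)) (isLowerSet_Iic _)) len
    fun j => mk_eq_of_coeff_eq fun d hd => coeff_Psi_congr
      (S := univ.filter fun i => d (Sum.inr i) ≠ 0) (by simp) ?_
  · have h2 := congrArg (PowerSeries.coeff k) h1
    rw [PowerSeries.coeff_map, PowerSeries.coeff_map] at h2
    exact coeff_eq_of_mk_eq h2 (Set.mem_Iic.2 le_rfl)
  · have hc := card_le_card (subset_of_le_ex (Set.mem_Iic.1 hd))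
    rw [hQ _ (by omega) (by omega)]

/-- For a star, the series `Q m` is used at leaves only, each of which gets less than the whole
degree. -/
theorem coeff_chain_congr (hk : 2 ≤ k) {β : Fin m →₀ ℕ} (hQ : ∀ s, 1 ≤ s → s ≤ m →
      ∀ γ : Fin s →₀ ℕ, (s = m → γ.degree < β.degree) →
        MvPowerSeries.coeff γ (Q s) = MvPowerSeries.coeff γ (Q' s)) (i : Fin m) :
    MvPowerSeries.coeff (ex β {i}ᶜ) (PowerSeries.coeff k (chain (leafFactor Q m) (β i))) =
      MvPowerSeries.coeff (ex β {i}ᶜ) (PowerSeries.coeff k (chain (leafFactor Q' m) (β i))) := by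
  refine coeff_eq_of_mk_eq (hD := isLowerSet_Iic (ex β {i}ᶜ)) (map_coeff_chain_congr hk
    fun j hj => mk_eq_of_coeff_eq fun d hd => coeff_Psi_congr
      (S := univ.filter fun i => d (Sum.inr i) ≠ 0) (by simp) ?_) (Set.mem_Iic.2 le_rfl)
  have hS := subset_of_le_ex (Set.mem_Iic.1 hd)
  have hc := card_le_card hS
  rw [card_compl, card_singleton, Fintype.card_fin] at hc
  have hm := i.pos
  refine hQ _ (by omega) (by omega) _ fun _ => ?_
  have h2 : ∑ i' ∈ univ.filter (fun i => d (Sum.inr i) ≠ 0), d (Sum.inl i') ≤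
      ∑ i' ∈ {i}ᶜ, β i' := by
    refine (sum_le_sum_of_subset hS).trans (sum_le_sum fun i' hi' => ?_)
    have := hd (Sum.inl i')
    rwa [ex_inl, if_pos hi'] at this
  rw [degree_cons_restr, Finsupp.degree_eq_sum, Fintype.sum_eq_add_sum_compl i β]
  omega

/-- The coefficient of the left side of the equation at `β` only involves the given series and the
coefficients of the unknown series in degrees lower than that of `β`. -/
theorem coeff_lhs_congr (hk : 2 ≤ k) (hm : 2 ≤ m) (hQ : ∀ j, 1 ≤ j → j < m → Q j = Q' j)
    {β : Fin m →₀ ℕ} (h : ∀ γ : Fin m →₀ ℕ, γ.degree < β.degree →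
      MvPowerSeries.coeff γ (Q m) = MvPowerSeries.coeff γ (Q' m)) :
    MvPowerSeries.coeff β (lhs k m Q) = MvPowerSeries.coeff β (lhs k m Q') := by
  have hQs : ∀ s, 1 ≤ s → s ≤ m → ∀ γ : Fin s →₀ ℕ, (s = m → γ.degree < β.degree) →
      MvPowerSeries.coeff γ (Q s) = MvPowerSeries.coeff γ (Q' s) := by
    intro s hs hsm γ hγ
    rcases hsm.lt_or_eq with hlt | rfl
    · rw [hQ s hs hlt]
    · exact h γ (hγ rfl)
  rw [coeff_lhs, coeff_lhs, starCoeff, starCoeff,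
    sum_congr rfl fun i _ => coeff_chain_congr hk hQs i]
  refine congrArg _ (sum_congr rfl fun t ht => ?_)
  have hE := (mem_filter.1 ht).2
  refine congrArg _ (sum_congr rfl fun lam _ => ?_)
  rw [coeff_treeProd Q lam β k (PlaneTree.degB_ne_zero hE),
    coeff_treeProd Q' lam β k (PlaneTree.degB_ne_zero hE)]
  refine sum_congr rfl fun len _ => coeff_arcSum_congr hQ len ?_
  -- at most `m - 2` variables are left over by the black vertices
  have := t.out.2.two_le_nB hE
  rw [card_compl, card_map, card_univ, Fintype.card_fin, Fintype.card_fin]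
  omega

/-- The equation determines the series of index `m` by induction on the degree. -/
theorem eq_P_of_lhs_eq_rhs (hk : 2 ≤ k) (hm : 2 ≤ m)
    (hQ : ∀ j, 1 ≤ j → j < m → Q j = P k j) (h0 : MvPowerSeries.constantCoeff (Q m) = 0)
    (h : lhs k m Q = rhs k m Q) : Q m = P k m := by
  ext β
  induction hN : β.degree using Nat.strong_induction_on generalizing β with
  | _ N ih =>
    by_cases hβ : β = 0
    · rw [hβ, coeff_P_eq_zero k (i := ⟨0, by omega⟩) rfl,
        MvPowerSeries.coeff_zero_eq_constantCoeff_apply, h0]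
    · have h1 := coeff_lhs_congr hk hm hQ (β := β) fun γ hγ => ih _ (hN ▸ hγ) γ rfl
      rw [h, lhs_eq_rhs hk (by omega), coeff_rhs, coeff_rhs] at h1
      refine mul_left_cancel₀ (div_ne_zero ?_ ?_) h1
      · have h2 : 0 < β.degree :=
            Nat.pos_of_ne_zero fun h => hβ ((Finsupp.degree_eq_zero_iff β).1 h)
        rw [Finsupp.degree_eq_sum] at h2
        have h3 : (1 : ℚ) ≤ ∑ i, (β i : ℚ) := by exact_mod_cast h2
        have h4 : (2 : ℚ) ≤ m := by exact_mod_cast hm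
        linarith
      · have h4 : (2 : ℚ) ≤ k := by exact_mod_cast hk
        linarith

end Equation

end KCycle

end

theorem theorem3p1 (k : ℕ) (hk : 2 ≤ k) (m : ℕ) (hm : 1 ≤ m) :
    -- the sum over the reduced trees is finite
    (∀ Q : (∀ j : ℕ, MvPowerSeries (Fin j) ℚ),
      (Function.support (KCycle.treeTerm k m Q)).Finite) ∧
    -- the partial differential equation for the series of index `m`
    KCycle.lhs k m (KCycle.P k) = KCycle.rhs k m (KCycle.P k) ∧
    -- for `m ≥ 2` it determines that series from those of index `1, …, m - 1`
    (2 ≤ m → ∀ Q : (∀ j : ℕ, MvPowerSeries (Fin j) ℚ),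
      (∀ j, 1 ≤ j → j < m → Q j = KCycle.P k j) →
      MvPowerSeries.constantCoeff (Q m) = 0 →
      KCycle.lhs k m Q = KCycle.rhs k m Q →
      Q m = KCycle.P k m) := by
  refine ⟨fun Q => KCycle.finite_support_treeTerm Q, KCycle.lhs_eq_rhs hk hm,
    fun hm2 Q hQ h0 h => ?_⟩
  exact KCycle.eq_P_of_lhs_eq_rhs hk hm2 hQ h0 h
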